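/- Let $n\ge 1$ and let $(X_1,Y_1),\dots,(X_n,Y_n)$ be independent $\mathbb R^2$-valued random vectors (the two components of one vector may be dependent) with $$\mathbb E X_i=0,\qquad \mathbb E|X_i|^3<\infty,\qquad \mathbb E|Y_i|^3<\infty\quad (1\le i\le n),\qquad \sum_{i=1}^n\mathbb E X_i^2=\sum_{i=1}^n\mathbb E Y_i^2=1 .$$ Put $S_n=\sum_{i=1}^n X_i$ and $V_n=(\sum_{i=1}^n Y_i^2)^{1/2}$, and let $\Phi$ be the standard normal distribution function. For $c_0\ge 0$ and $x>0$ define $$\nu_{x,i}=\min\Big\{\frac{X_i^2}{Y_i^2+c_0\,\mathbb E Y_i^2},\;2xX_i\Big\},\qquad r_{x,i}=\mathbb E\big[e^{\nu_{x,i}}\mathbf 1(|(1+x)X_i|>1)\big],\qquad L_{3,n}=\sum_{i=1}^n\big(\mathbb E|X_i|^3+\mathbb E|Y_i|^3\big),$$ where a quotient with denominator $0$ is read as $+\infty$, and $$\begin{aligned}\delta_{x,i}={}&(1+x)^3\Big(\mathbb E\big[|X_i|^3\mathbf 1(|(1+x)X_i|>1)\big]+\mathbb E\big[|Y_i|^3\mathbf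 1(|(1+x)Y_i|>1)\big]\Big)\\&+(1+x)^4\Big(\mathbb E\big[|X_i|^4\mathbf 1(|(1+x)X_i|\le1)\big]+\mathbb E\big[|Y_i|^4\mathbf 1(|(1+x)Y_i|\le1)\big]\Big),\end{aligned}$$ $$R_x=\sum_{i=1}^n\big(\delta_{x,i}+r_{x,i}\big).$$ **Theorem.** There exist absolute constants $0<c_1\le 1/4$ and $A>0$ (depending on nothing, in particular not on $n$, $c_0$ or the distributions) such that the following holds for all such $(X_i,Y_i)_{i\le n}$, all $c_0\ge0$, all $x>0$ and all real $c$ with $|c|\le x/5$. Assume that $$\mathbb E\,e^{\nu_{x,i}}<\infty\quad (1\le i\le n),\tag{2.2}$$ $$(1+x)L_{3,n}\le c_1,\qquad x^{-2}R_x\le c_1,\tag{G1}$$ $$x\le\frac{\frac14\wedge\frac1{2\sqrt{c_0}}}{\big[\max_i(\mathbb E|X_i|^3+\mathbb E|Y_i|^3)\big]^{1/3}},\qquad \max_i r_{x,i}\le c_1,\tag{G2}$$ where $\frac1{2\sqrt{c_0}}=+\infty$ if $c_0=0$. Then $$\mathbb P(S_n\ge xV_n+c)=[1-\Phi(x+c)]\,\Psi_x^*\,e^{O_1R_x}\,\big(1+O_2(1+x)L_{3,n}\big)$$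 for some real numbers $O_1,O_2$ with $|O_1|\le A$ and $|O_2|\le A$, where $$\Psi_x^*=\exp\Big\{x^3\Big(\tfrac43\gamma^3\sum_{i=1}^n\mathbb E X_i^3-2\gamma^2\sum_{i=1}^n\mathbb E[X_iY_i^2]\Big)\Big\},\qquad \gamma=\tfrac12\Big(1+\frac cx\Big).$$ -/

import Mathlib

open MeasureTheory ProbabilityTheory

namespace SelfNorm

/-- The exponent `min {a² / (b² + c₀ m), 2 x a}`, evaluated at values `a` of `X_i`, `b` of `Y_i`
and `m = E Y_i²`. If the denominator `b² + c₀ m` vanishes, the quotient `a² / 0` is read as `+∞`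
(the minimum is then `2 x a`, also when `a = 0`), not as Lean's value `0`. -/
noncomputable def tiltExponent (c₀ x m a b : ℝ) : ℝ :=
  if b ^ 2 + c₀ * m = 0 then 2 * x * a else min (a ^ 2 / (b ^ 2 + c₀ * m)) (2 * x * a)

variable {Ω : Type*} [MeasurableSpace Ω]

/-- The random variable `exp (min {X² / (Y² + c₀ E Y²), 2 x X})`. -/
noncomputable def expTilt (μ : Measure Ω) (c₀ x : ℝ) (X Y : Ω → ℝ) (ω : Ω) : ℝ :=
  Real.exp (tiltExponent c₀ x (∫ ω', Y ω' ^ 2 ∂μ) (X ω) (Y ω))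

/-- `E |X|³ + E |Y|³`. -/
noncomputable def thirdMoment (μ : Measure Ω) (X Y : Ω → ℝ) : ℝ :=
  ∫ ω, |X ω| ^ 3 ∂μ + ∫ ω, |Y ω| ^ 3 ∂μ

/-- The truncated-moment quantity `δ_{x,i}` for one pair `(X, Y) = (X_i, Y_i)`. -/
noncomputable def deltaTerm (μ : Measure Ω) (x : ℝ) (X Y : Ω → ℝ) : ℝ :=
  (1 + x) ^ 3 * (∫ ω in {ω | 1 < |(1 + x) * X ω|}, |X ω| ^ 3 ∂μ
      + ∫ ω in {ω | 1 < |(1 + x) * Y ω|}, |Y ω| ^ 3 ∂μ)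
    + (1 + x) ^ 4 * (∫ ω in {ω | |(1 + x) * X ω| ≤ 1}, |X ω| ^ 4 ∂μ
      + ∫ ω in {ω | |(1 + x) * Y ω| ≤ 1}, |Y ω| ^ 4 ∂μ)

/-- The truncated exponential moment `r_{x,i}` for one pair `(X, Y) = (X_i, Y_i)`. -/
noncomputable def rTerm (μ : Measure Ω) (c₀ x : ℝ) (X Y : Ω → ℝ) : ℝ :=
  ∫ ω in {ω | 1 < |(1 + x) * X ω|}, expTilt μ c₀ x X Y ω ∂μ

variable {n : ℕ}

/-- `L_{3,n} = ∑ (E |X_i|³ + E |Y_i|³)`. -/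
noncomputable def L3 (μ : Measure Ω) (X Y : Fin n → Ω → ℝ) : ℝ :=
  ∑ i, thirdMoment μ (X i) (Y i)

/-- `R_x = ∑ δ_{x,i} + ∑ r_{x,i}`. -/
noncomputable def Rx (μ : Measure Ω) (c₀ x : ℝ) (X Y : Fin n → Ω → ℝ) : ℝ :=
  ∑ i, deltaTerm μ x (X i) (Y i) + ∑ i, rTerm μ c₀ x (X i) (Y i)

/-- `(1/4) ∧ (1 / (2 √c₀))`, where `1 / (2 √0) = +∞`. -/
noncomputable def rangeConst (c₀ : ℝ) : ℝ :=
  if c₀ = 0 then 1 / 4 else min (1 / 4) (1 / (2 * √c₀))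

/-- The skewness correction
`exp {x³ (4/3 γ³ ∑ E X_i³ - 2 γ² ∑ E [X_i Y_i²])}` with `γ = (1 + c / x) / 2`. -/
noncomputable def skewCorrection (μ : Measure Ω) (c x : ℝ) (X Y : Fin n → Ω → ℝ) : ℝ :=
  let γ : ℝ := (1 + c / x) / 2
  Real.exp (x ^ 3 * (4 / 3 * γ ^ 3 * ∑ i, ∫ ω, X i ω ^ 3 ∂μ
    - 2 * γ ^ 2 * ∑ i, ∫ ω, X i ω * Y i ω ^ 2 ∂μ))

/-- The numerator `S_n = ∑ X_i`. -/
def S (X : Fin n → Ω → ℝ) (ω : Ω) : ℝ := ∑ i, X i ω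

/-- The normalizer `V_n = (∑ Y_i²)^{1/2}`. -/
noncomputable def V (Y : Fin n → Ω → ℝ) (ω : Ω) : ℝ := √(∑ i, Y i ω ^ 2)

/-- The standard normal distribution function. -/
noncomputable def Phi (t : ℝ) : ℝ := cdf (gaussianReal 0 1) t

end SelfNorm

/-!
The pairs are scaled by `t = 1 + x`, and `ρ = x / t`; a pair is *good* if both scaled components are
at most one, and *large* otherwise. In these terms `R` bounds the sum of the truncated moments and
of the exponential moments `r`, and `ε = t L₃` (see `Sample`).

**Linearization.** Put `ξ = 2 x X - x² Y²`. When all pairs are good, squaring shows that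
`S ≥ x V + c` is the event `∑ ξ ≥ x² + 2 c x - x² (V - 1)²` (`mem_tailEvent_iff`). Up to the defect
`x² (V - 1)²`, which is of order `R` in the mean, this is a tail event for a sum of independent
bounded variables, and Cramér's method applies. The law of each pair is tilted by the weight
`e^{l ξ} 1_good`, with `l` the saddle point at which `∑ ξ` has tilted mean `x² + 2 c x`
(`Sample.exists_saddle`); `l` is close to `γ = (1 + c / x) / 2`. Expanding the weight to fourth order,
the Chernoff exponent `∑ log E[e^{l ξ} 1_good] - l (x² + 2 c x)` equals `-(x + c)² / 2` plus the
exponent of the skewness correction, with error `O(R)` (`Sample.abs_exponent_sub_le`). What remains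
is the tilted mean of `e^{-l s T} 1(T ≥ 0)`, where `T` is the standardized sum and `s` the standard
deviation. A Berry–Esseen bound for intervals (`berry_esseen`, by Stein's method) compares it with
the same integral for a Gaussian variable, the Mills ratio of `x + c`, up to a factor `1 + O(ε)`
(`IsTilt.abs_integral_expTail_sub_le`). Together with `one_sub_Phi_eq` this produces the factor
`1 - Φ (x + c)`.

**The defect.** It only enlarges the event, so that the lower bound is immediate
(`IsTilt.lower_bound`). For the upper bound one needs the tilted probability that `T` lies between
minus the scaled defect and `0`. The left end of this interval depends on `V`, hence on the same
variables as `T`; the randomized concentration inequality (`randomized_concentration`) bounds the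
probability by `O((ε + R) / t)`, since the defect has mean `O(R)` and changes little when one
pair is removed (`IsTilt.concentration`). A defect exceeding a bound `1 + O(R)` forces a large
deviation of `∑ Y²`, which the exponential tail bound `integral_exp_abs_tail_le` covers. Division by
the Mills ratio, which is of order `1 / t`, turns these errors into relative ones
(`IsTilt.upper_bound_allGood`).

**Large pairs.** On the tail event the exponents `ν` of the large pairs compensate for the part of
`∑ ξ` missing from the good ones. As `l` stays well below one, the weights
`e^{(49/50) ν⁺ + 1}` on large pairs, whose means are controlled by `R`, suffice
(`exponent_le_of_tail`) as long as the total exponent of the large pairs is moderate. Fixing one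
pair to be large, the remaining ones are tilted by a mixture of the two weights
(`LargeExponent.exists_isMixedTilt`); the concentration of the good part again yields the factor
`1 / t`, and the mass of the large pairs, summed over the distinguished pair, yields the factor `R`
(`IsMixedTilt.measureReal_le`). An immoderate total exponent is excluded by an exponential Markov
inequality (`LargeExponent.measureReal_compl_moderate_le`).

The two bounds of `Sample.tail_bounds` have the factors `e^{±A R} (1 ± A ε)`, and `exists_factors`
converts them into the representation with `O₁` and `O₂`.
-/

open MeasureTheory ProbabilityTheory

namespace SelfNorm

/-! ### Independence and changes of measure -/

section Independence

variable {Ω : Type*} [MeasurableSpace Ω] {ι : Type*} [Fintype ι]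

/-- Product change of measure: weighting every member of an independent family by a nonnegative
function of that member keeps the family independent, and reweights each marginal separately. -/
theorem exists_product_tilt {E : Type*} [MeasurableSpace E] {μ : Measure Ω}
    {Z : ι → Ω → E} (hZ : ∀ i, Measurable (Z i)) (hind : iIndepFun Z μ)
    {G : ι → E → ℝ} (hG : ∀ i, Measurable (G i)) (hG0 : ∀ i z, 0 ≤ G i z)
    (hpos : ∀ i, 0 < ∫ ω, G i (Z i ω) ∂μ) :
    ∃ Q : Measure Ω, IsProbabilityMeasure Q ∧ iIndepFun Z Q ∧
      (∀ i (F : E → ℝ), Measurable F →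
        ∫ ω, F (Z i ω) ∂Q = (∫ ω, F (Z i ω) * G i (Z i ω) ∂μ) / ∫ ω, G i (Z i ω) ∂μ) ∧
      (∀ F : Ω → ℝ, ∫ ω, F ω * ∏ i, G i (Z i ω) ∂μ
        = (∏ i, ∫ ω, G i (Z i ω) ∂μ) * ∫ ω, F ω ∂Q) := by
  classical
  set c : ι → ℝ := fun i => ∫ ω, G i (Z i ω) ∂μ with hc
  have hc0 : ∀ i, c i ≠ 0 := fun i => (hpos i).ne'
  set D : Ω → ℝ := fun ω => ∏ i, (G i (Z i ω) / c i) with hD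
  have hD0 : ∀ ω, 0 ≤ D ω := fun ω =>
    Finset.prod_nonneg fun i _ => div_nonneg (hG0 i _) (hpos i).le
  have hDm : Measurable D :=
    Finset.measurable_fun_prod _ fun i _ => ((hG i).comp (hZ i)).div_const _
  set Q : Measure Ω := μ.withDensity fun ω => ENNReal.ofReal (D ω) with hQ
  have hint : ∀ F : Ω → ℝ, ∫ ω, F ω ∂Q = ∫ ω, D ω * F ω ∂μ := by
    intro F
    rw [hQ, integral_withDensity_eq_integral_toReal_smul hDm.ennreal_ofReal
      (Filter.Eventually.of_forall fun ω => ENNReal.ofReal_lt_top)]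
    simp [ENNReal.toReal_ofReal (hD0 _)]
  have hprod : ∀ F : ι → E → ℝ, (∀ i, Measurable (F i)) →
      ∫ ω, ∏ i, F i (Z i ω) ∂Q = ∏ i, ((∫ ω, F i (Z i ω) * G i (Z i ω) ∂μ) / c i) := by
    intro F hF
    rw [hint]
    have : ∀ ω, D ω * ∏ i, F i (Z i ω) = ∏ i, (fun z => F i z * G i z / c i) (Z i ω) := by
      intro ω
      rw [hD, ← Finset.prod_mul_distrib]
      exact Finset.prod_congr rfl fun i _ => by ring
    rw [integral_congr_ae (Filter.Eventually.of_forall this),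
      hind.integral_fun_prod_comp (f := fun i z => F i z * G i z / c i)
      (fun i => (hZ i).aemeasurable)
      (fun i => (((hF i).mul (hG i)).div_const _).aestronglyMeasurable)]
    exact Finset.prod_congr rfl fun i _ => by rw [integral_div]
  have hmarg : ∀ i (F : E → ℝ), Measurable F →
      ∫ ω, F (Z i ω) ∂Q = (∫ ω, F (Z i ω) * G i (Z i ω) ∂μ) / c i := by
    intro i F hF
    have h := hprod (fun j => if j = i then F else fun _ => 1) (fun j => by
      by_cases h : j = i
      · simpa [h] using hF
      · simp [h])
    have h1 : ∀ ω, ∏ j, (if j = i then F else fun _ => 1) (Z j ω) = F (Z i ω) := by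
      intro ω
      rw [Finset.prod_eq_single i] <;> simp +contextual
    simp_rw [h1] at h
    rw [h, Finset.prod_eq_single i]
    · simp
    · intro j _ hj
      simp only [hj, if_false, one_mul]
      exact div_self (hc0 j)
    · simp
  have h1 : ∫ ω, D ω ∂μ = 1 := by
    have h := hprod (fun _ _ => 1) (fun _ => measurable_const)
    rw [hint] at h
    simp only [Finset.prod_const_one, mul_one, one_mul] at h
    rw [h]
    exact Finset.prod_eq_one fun i _ => div_self (hc0 i)
  have hDi : Integrable D μ := by
    by_contra hcon
    rw [integral_undef hcon] at h1
    exact zero_ne_one h1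
  have hQp : IsProbabilityMeasure Q := by
    refine ⟨?_⟩
    rw [hQ, withDensity_apply _ MeasurableSet.univ, Measure.restrict_univ,
      ← ofReal_integral_eq_lintegral_ofReal hDi (Filter.Eventually.of_forall hD0), h1]
    simp
  refine ⟨Q, hQp, ?_, hmarg, ?_⟩
  · rw [iIndepFun_iff_measure_inter_preimage_eq_mul]
    intro S sets hsets
    set F : ι → E → ℝ := fun i => if i ∈ S then (sets i).indicator 1 else fun _ => 1 with hF
    have hFm : ∀ i, Measurable (F i) := by
      intro i
      by_cases h : i ∈ S
      · simpa [hF, h] using measurable_one.indicator (hsets i h)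
      · simp [hF, h]
    have hms : ∀ i ∈ S, MeasurableSet (Z i ⁻¹' sets i) := fun i hi => hZ i (hsets i hi)
    have e1 : ∫ ω, ∏ i, F i (Z i ω) ∂Q = Q.real (⋂ i ∈ S, Z i ⁻¹' sets i) := by
      rw [← integral_indicator_one (Finset.measurableSet_biInter S hms)]
      congr 1
      ext ω
      by_cases h : ω ∈ ⋂ i ∈ S, Z i ⁻¹' sets i
      · rw [Set.indicator_of_mem h]
        simp only [Set.mem_iInter, Set.mem_preimage] at h
        refine Finset.prod_eq_one fun i _ => ?_
        by_cases hi : i ∈ S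
        · simp [hF, hi, h i hi]
        · simp [hF, hi]
      · rw [Set.indicator_of_notMem h]
        simp only [Set.mem_iInter, Set.mem_preimage, not_forall] at h
        obtain ⟨i, hi, h⟩ := h
        refine Finset.prod_eq_zero (Finset.mem_univ i) ?_
        simp [hF, hi, h]
    have e2 : ∀ i ∈ S, ∫ ω, F i (Z i ω) ∂Q = Q.real (Z i ⁻¹' sets i) := by
      intro i hi
      rw [← integral_indicator_one (hms i hi)]
      congr 1
      ext ω
      simp only [hF, hi, if_true, Set.indicator, Set.mem_preimage]
      rfl
    have e3 : ∫ ω, ∏ i, F i (Z i ω) ∂Q = ∏ i, ∫ ω, F i (Z i ω) ∂Q := by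
      rw [hprod F hFm]
      exact Finset.prod_congr rfl fun i _ => (hmarg i _ (hFm i)).symm
    have e4 : Q.real (⋂ i ∈ S, Z i ⁻¹' sets i) = ∏ i ∈ S, Q.real (Z i ⁻¹' sets i) := by
      rw [← e1, e3, ← Finset.prod_subset (Finset.subset_univ S)]
      · exact Finset.prod_congr rfl fun i hi => e2 i hi
      · intro i _ hi
        simp [hF, hi]
    rw [← ENNReal.toReal_eq_toReal_iff' (measure_ne_top _ _)
      (ENNReal.prod_ne_top fun i _ => measure_ne_top _ _), ENNReal.toReal_prod]
    exact e4
  · intro F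
    rw [hint, ← integral_const_mul]
    congr 1
    ext ω
    rw [hD]
    simp only
    rw [Finset.prod_div_distrib]
    have : ∏ i, c i ≠ 0 := Finset.prod_ne_zero_iff.2 fun i _ => hc0 i
    field_simp

/-- A member of an independent family is independent of the sum of the others. -/
lemma indepFun_sum_erase [DecidableEq ι] {E : Type*} [MeasurableSpace E] [AddCommMonoid E]
    [MeasurableAdd₂ E] {Q : Measure Ω} {U : ι → Ω → E} (hU : ∀ i, Measurable (U i))
    (hind : iIndepFun U Q) (i : ι) :
    IndepFun (U i) (fun ω => ∑ j ∈ Finset.univ.erase i, U j ω) Q := by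
  have h := (hind.indepFun_finsetSum_of_notMem hU (Finset.notMem_erase i Finset.univ)).symm
  convert h using 1
  ext ω
  simp

/-- The second moment of a sum of independent centred bounded variables. -/
lemma integral_sum_sq {Q : Measure Ω} [IsProbabilityMeasure Q] {U : ι → Ω → ℝ} {K : ℝ}
    (hU : ∀ i, Measurable (U i)) (hK : ∀ i ω, |U i ω| ≤ K) (hind : iIndepFun U Q)
    (h0 : ∀ i, ∫ ω, U i ω ∂Q = 0) :
    ∫ ω, (∑ i, U i ω) ^ 2 ∂Q = ∑ i, ∫ ω, U i ω ^ 2 ∂Q := by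
  have hm : ∀ i, MemLp (U i) 2 Q := fun i =>
    MemLp.of_bound (hU i).aestronglyMeasurable K (Filter.Eventually.of_forall (hK i))
  have h := IndepFun.variance_sum (s := Finset.univ) (fun i _ => hm i)
    (fun i _ j _ hij => hind.indepFun hij)
  rw [variance_of_integral_eq_zero] at h
  · simp only [Finset.sum_apply] at h
    rw [h]
    refine Finset.sum_congr rfl fun i _ => ?_
    rw [variance_of_integral_eq_zero (hU i).aemeasurable (h0 i)]
  · fun_prop
  · simp only [Finset.sum_apply]
    rw [integral_finsetSum _ fun i _ => (hm i).integrable (by norm_num)]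
    simp [h0]

end Independence

/-! ### The randomized concentration inequality -/

/-- The test function of the concentration inequality: the identity clipped to the
`ε`-neighbourhood of `[A, B]`, and centred at the midpoint. -/
noncomputable def clip (ε A B w : ℝ) : ℝ := max (A - ε) (min w (B + ε)) - (A + B) / 2

lemma abs_clip_le {ε A B : ℝ} (hε : 0 ≤ ε) (h : A ≤ B) (w : ℝ) :
    |clip ε A B w| ≤ (B - A) / 2 + ε := by
  unfold clip
  rw [abs_le]
  constructor
  · linarith [le_max_left (A - ε) (min w (B + ε))]
  · have : max (A - ε) (min w (B + ε)) ≤ B + ε := max_le (by linarith) (min_le_right _ _)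
    linarith

lemma clip_mono {ε A B : ℝ} : Monotone (clip ε A B) := by
  intro v w h
  unfold clip
  gcongr

lemma abs_clip_sub_clip_le (ε A B A' B' w : ℝ) :
    |clip ε A B w - clip ε A' B' w| ≤ 2 * (|A - A'| + |B - B'|) := by
  unfold clip
  have h1 := abs_max_sub_max_le_max (A - ε) (min w (B + ε)) (A' - ε) (min w (B' + ε))
  have h2 := abs_min_sub_min_le_max w (B + ε) w (B' + ε)
  have h3 : |min w (B + ε) - min w (B' + ε)| ≤ |B - B'| := by
    simpa using h2
  have h4 : |max (A - ε) (min w (B + ε)) - max (A' - ε) (min w (B' + ε))| ≤ |A - A'| + |B - B'| := by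
    refine h1.trans (max_le ?_ ?_)
    · have : A - ε - (A' - ε) = A - A' := by ring
      rw [this]
      linarith [abs_nonneg (B - B')]
    · linarith [abs_nonneg (A - A')]
  have h5 := abs_sub_abs_le_abs_sub A A'
  rw [abs_le] at h4 ⊢
  have := abs_le.1 (le_refl |A - A'|)
  have := abs_le.1 (le_refl |B - B'|)
  constructor <;> linarith

/-- The monotone test function has slope one near `[A, B]`, which makes the increment over a step
`z` at least `min ε |z|` when the end point lies in `[A, B]`. -/
lemma clip_increment {ε A B w z : ℝ} (hε : 0 ≤ ε) (h1 : A ≤ w) (h2 : w ≤ B) :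
    |z| * min ε |z| ≤ z * (clip ε A B w - clip ε A B (w - z)) := by
  unfold clip
  have e1 : max (A - ε) (min w (B + ε)) = w := by
    rw [min_eq_left (by linarith), max_eq_right (by linarith)]
  rw [e1]
  rcases le_total 0 z with hz | hz
  · rw [abs_of_nonneg hz]
    refine mul_le_mul_of_nonneg_left ?_ hz
    have : max (A - ε) (min (w - z) (B + ε)) ≤ max (w - ε) (w - z) :=
      max_le_max (by linarith) (min_le_left _ _)
    have h3 : max (w - ε) (w - z) = w - min ε z := by
      rcases le_total ε z with h | h
      · rw [max_eq_left (by linarith), min_eq_left h]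
      · rw [max_eq_right (by linarith), min_eq_right h]
    linarith
  · rw [abs_of_nonpos hz]
    have : w + min ε (-z) ≤ max (A - ε) (min (w - z) (B + ε)) := by
      refine le_trans ?_ (le_max_right _ _)
      refine le_min ?_ ?_
      · linarith [min_le_right ε (-z)]
      · linarith [min_le_left ε (-z)]
    nlinarith

lemma measurable_clip {Ω : Type*} [MeasurableSpace Ω] {ε : ℝ} {A B w : Ω → ℝ} (hA : Measurable A)
    (hB : Measurable B) (hw : Measurable w) : Measurable fun ω => clip ε (A ω) (B ω) (w ω) := by
  unfold clip
  fun_prop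

section Concentration

variable {Ω : Type*} [MeasurableSpace Ω] {ι : Type*} [Fintype ι]

lemma integrable_of_abs_le {Q : Measure Ω} [IsFiniteMeasure Q] {f : Ω → ℝ} (hf : Measurable f)
    {K : ℝ} (hK : ∀ ω, |f ω| ≤ K) : Integrable f Q :=
  Integrable.of_bound hf.aestronglyMeasurable K (Filter.Eventually.of_forall hK)

lemma abs_sum_le_card_mul {f : ι → ℝ} {K : ℝ} (h : ∀ i, |f i| ≤ K) :
    |∑ i, f i| ≤ Fintype.card ι * K := by
  calc |∑ i, f i| ≤ ∑ i, |f i| := Finset.abs_sum_le_sum_abs _ _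
    _ ≤ ∑ _i : ι, K := Finset.sum_le_sum fun i _ => h i
    _ = _ := by simp

/-- **Randomized concentration inequality.** `T = ∑ ζ_i` is a sum of independent centred variables
with total variance at most one; the end points of the interval are functions of a second sum
`H = ∑ η_i`, where the pairs `(ζ_i, η_i)` are independent. The proof tests `T` against the clipped
identity `clip`, in the manner of Stein's method. -/
theorem randomized_concentration {Q : Measure Ω} [IsProbabilityMeasure Q] {ζ η : ι → Ω → ℝ}
    (hζ : ∀ i, Measurable (ζ i)) (hη : ∀ i, Measurable (η i))
    (hind : iIndepFun (fun i ω => (ζ i ω, η i ω)) Q)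
    {K : ℝ} (hK : ∀ i ω, |ζ i ω| ≤ K) (h0 : ∀ i, ∫ ω, ζ i ω ∂Q = 0)
    (hvar : ∑ i, ∫ ω, ζ i ω ^ 2 ∂Q ≤ 1) {ε v : ℝ} (hε : 0 < ε)
    (hv : v ≤ ∑ i, ∫ ω, |ζ i ω| * min ε |ζ i ω| ∂Q)
    {a b : ℝ → ℝ} (ha : Measurable a) (hb : Measurable b) (hab : ∀ h, a h ≤ b h)
    {K' : ℝ} (hK' : ∀ h, b h - a h ≤ K')
    (hint : ∀ i, Integrable (fun ω => |ζ i ω| *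
      (|a (∑ j, η j ω) - a (∑ j, η j ω - η i ω)|
        + |b (∑ j, η j ω) - b (∑ j, η j ω - η i ω)|)) Q) :
    v * Q.real {ω | a (∑ j, η j ω) ≤ ∑ i, ζ i ω ∧ ∑ i, ζ i ω ≤ b (∑ j, η j ω)} ≤
      2 * ε + (∫ ω, |∑ i, ζ i ω| * (b (∑ j, η j ω) - a (∑ j, η j ω)) ∂Q) / 2
        + 2 * ∑ i, ∫ ω, |ζ i ω| * (|a (∑ j, η j ω) - a (∑ j, η j ω - η i ω)|
        + |b (∑ j, η j ω) - b (∑ j, η j ω - η i ω)|) ∂Q := by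
  classical
  set T : Ω → ℝ := fun ω => ∑ i, ζ i ω with hT
  set H : Ω → ℝ := fun ω => ∑ i, η i ω with hH
  have hTm : Measurable T := Finset.measurable_fun_sum _ fun i _ => hζ i
  have hHm : Measurable H := Finset.measurable_fun_sum _ fun i _ => hη i
  set D : Set Ω := {ω | a (H ω) ≤ T ω ∧ T ω ≤ b (H ω)} with hD
  have hDm : MeasurableSet D :=
    (measurableSet_le (ha.comp hHm) hTm).inter (measurableSet_le hTm (hb.comp hHm))
  have hTK : ∀ ω, |T ω| ≤ Fintype.card ι * K := fun ω => abs_sum_le_card_mul fun i => hK i ω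
  set cost : ι → Ω → ℝ := fun i ω => |ζ i ω| *
      (|a (H ω) - a (H ω - η i ω)| + |b (H ω) - b (H ω - η i ω)|) with hcost
  set M : ι → Ω → ℝ := fun i ω => |ζ i ω| * min ε |ζ i ω| with hM
  have hMm : ∀ i, Measurable (M i) := fun i => by
    have := hζ i
    simp only [hM]
    fun_prop
  have hM0 : ∀ i ω, 0 ≤ M i ω := fun i ω => mul_nonneg (abs_nonneg _) (le_min hε.le (abs_nonneg _))
  have hMle : ∀ i ω, M i ω ≤ ε * |ζ i ω| := fun i ω => by
    rw [mul_comm ε]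
    exact mul_le_mul_of_nonneg_left (min_le_left _ _) (abs_nonneg _)
  have hMK : ∀ i ω, |M i ω| ≤ ε * K := fun i ω => by
    rw [abs_of_nonneg (hM0 i ω)]
    exact (hMle i ω).trans (mul_le_mul_of_nonneg_left (hK i ω) hε.le)
  have hMi : ∀ i, Integrable (M i) Q := fun i => integrable_of_abs_le (hMm i) (hMK i)
  -- the leave-one-out test function is uncorrelated with the omitted variable
  have hloo : ∀ i, ∫ ω, ζ i ω * clip ε (a (H ω - η i ω)) (b (H ω - η i ω)) (T ω - ζ i ω) ∂Q = 0 := by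
    intro i
    have h := indepFun_sum_erase (fun i => (hζ i).prodMk (hη i)) hind i
    have hm : Measurable fun z : ℝ × ℝ => clip ε (a z.2) (b z.2) z.1 :=
      measurable_clip (ha.comp measurable_snd) (hb.comp measurable_snd) measurable_fst
    have h2 := h.comp measurable_fst hm
    have e1 : ∀ ω, (∑ j ∈ Finset.univ.erase i, ((ζ j ω, η j ω) : ℝ × ℝ)) =
        (T ω - ζ i ω, H ω - η i ω) := by
      intro ω
      have h1 := Finset.sum_erase_add Finset.univ (fun j => ((ζ j ω, η j ω) : ℝ × ℝ))
        (Finset.mem_univ i)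
      rw [eq_sub_of_add_eq h1]
      ext <;> simp [hT, hH, Prod.fst_sum, Prod.snd_sum]
    have h3 := h2.integral_mul_eq_mul_integral
      ((measurable_fst.comp ((hζ i).prodMk (hη i))).aestronglyMeasurable)
      ((hm.comp (Finset.measurable_fun_sum _ fun j _ =>
        (hζ j).prodMk (hη j))).aestronglyMeasurable)
    have h4 : ∫ ω, (Prod.fst ∘ fun ω => (ζ i ω, η i ω)) ω ∂Q = 0 := h0 i
    rw [h4, zero_mul] at h3
    rw [← h3]
    refine integral_congr_ae (Filter.Eventually.of_forall fun ω => ?_)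
    simp only [Pi.mul_apply, Function.comp_apply]
    rw [e1 ω]
  have hcm : Measurable fun ω => clip ε (a (H ω)) (b (H ω)) (T ω) :=
    measurable_clip (ha.comp hHm) (hb.comp hHm) hTm
  have hclK : ∀ h w, |clip ε (a h) (b h) w| ≤ K' / 2 + ε := fun h w =>
    (abs_clip_le hε.le (hab h) w).trans (by linarith [hK' h])
  have hK'0 : 0 ≤ K' := by linarith [hab 0, hK' 0]
  have hbd : ∀ (i : ι) ω (y : ℝ), |y| ≤ K' / 2 + ε → |ζ i ω * y| ≤ K * (K' / 2 + ε) := by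
    intro i ω y hy
    rw [abs_mul]
    exact mul_le_mul (hK i ω) hy (abs_nonneg _) ((abs_nonneg _).trans (hK i ω))
  have hi1 : ∀ i, Integrable (fun ω => ζ i ω * clip ε (a (H ω)) (b (H ω)) (T ω)) Q := fun i =>
    integrable_of_abs_le ((hζ i).mul hcm) fun ω => hbd i ω _ (hclK _ _)
  have hi2 : ∀ i, Integrable
      (fun ω => ζ i ω * clip ε (a (H ω - η i ω)) (b (H ω - η i ω)) (T ω - ζ i ω)) Q := fun i =>
    integrable_of_abs_le ((hζ i).mul (measurable_clip (ha.comp (hHm.sub (hη i)))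
      (hb.comp (hHm.sub (hη i))) (hTm.sub (hζ i)))) fun ω => hbd i ω _ (hclK _ _)
  have hi3 : ∀ i, Integrable (D.indicator (M i)) Q := fun i => (hMi i).indicator hDm
  -- the increment inequality, one variable at a time
  have hstep : ∀ i, ∫ ω, D.indicator (M i) ω ∂Q - 2 * ∫ ω, cost i ω ∂Q
      ≤ ∫ ω, ζ i ω * clip ε (a (H ω)) (b (H ω)) (T ω) ∂Q := by
    intro i
    have h1 : ∫ ω, (D.indicator (M i) ω - 2 * cost i ω
        + ζ i ω * clip ε (a (H ω - η i ω)) (b (H ω - η i ω)) (T ω - ζ i ω)) ∂Q ≤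
        ∫ ω, ζ i ω * clip ε (a (H ω)) (b (H ω)) (T ω) ∂Q := by
      refine integral_mono (((hi3 i).sub ((hint i).const_mul 2)).add (hi2 i)) (hi1 i) ?_
      intro ω
      simp only
      have g1 : D.indicator (M i) ω ≤ ζ i ω * (clip ε (a (H ω)) (b (H ω)) (T ω)
          - clip ε (a (H ω)) (b (H ω)) (T ω - ζ i ω)) := by
        by_cases hω : ω ∈ D
        · rw [Set.indicator_of_mem hω]
          exact clip_increment hε.le hω.1 hω.2
        · rw [Set.indicator_of_notMem hω]
          rcases le_total 0 (ζ i ω) with hz | hz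
          · exact mul_nonneg hz (sub_nonneg.2 (clip_mono (by linarith)))
          · exact mul_nonneg_of_nonpos_of_nonpos hz (sub_nonpos.2 (clip_mono (by linarith)))
      have g2 : |ζ i ω * (clip ε (a (H ω)) (b (H ω)) (T ω - ζ i ω)
          - clip ε (a (H ω - η i ω)) (b (H ω - η i ω)) (T ω - ζ i ω))| ≤ 2 * cost i ω := by
        rw [abs_mul]
        calc _ ≤ |ζ i ω| * (2 * (|a (H ω) - a (H ω - η i ω)| + |b (H ω) - b (H ω - η i ω)|)) :=
              mul_le_mul_of_nonneg_left (abs_clip_sub_clip_le _ _ _ _ _ _) (abs_nonneg _)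
          _ = 2 * cost i ω := by simp only [hcost]; ring
      have g3 := (abs_le.1 g2).1
      nlinarith
    have hc : Integrable (fun ω => 2 * cost i ω) Q := (hint i).const_mul 2
    have hs : Integrable (fun ω => D.indicator (M i) ω - 2 * cost i ω) Q := (hi3 i).sub hc
    rw [integral_add hs (hi2 i), hloo i, integral_sub (hi3 i) hc, integral_const_mul] at h1
    linarith
  have hsum : ∫ ω, T ω * clip ε (a (H ω)) (b (H ω)) (T ω) ∂Q
      = ∑ i, ∫ ω, ζ i ω * clip ε (a (H ω)) (b (H ω)) (T ω) ∂Q := by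
    rw [← integral_finsetSum _ fun i _ => hi1 i]
    congr 1
    ext ω
    rw [hT, Finset.sum_mul]
  -- the total increment is concentrated around its mean
  have hT2 : ∫ ω, T ω ^ 2 ∂Q ≤ 1 := by
    rw [hT, integral_sum_sq hζ hK (hind.comp (fun _ => Prod.fst) fun _ => measurable_fst) h0]
    exact hvar
  have hT2i : Integrable (fun ω => T ω ^ 2) Q :=
    integrable_of_abs_le (hTm.pow_const 2) (K := (Fintype.card ι * K) ^ 2) fun ω => by
      rw [abs_pow]
      gcongr
      exact hTK ω
  have hTi : Integrable (fun ω => |T ω|) Q :=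
    integrable_of_abs_le hTm.abs (fun ω => by rw [abs_abs]; exact hTK ω)
  have hT1 : ∫ ω, |T ω| ∂Q ≤ 1 := by
    have : ∫ ω, |T ω| ∂Q ≤ ∫ ω, (T ω ^ 2 + 1) / 2 ∂Q := by
      refine integral_mono hTi ((hT2i.add (integrable_const 1)).div_const 2) fun ω => ?_
      simp only
      nlinarith [sq_nonneg (|T ω| - 1), sq_abs (T ω)]
    rw [integral_div, integral_add hT2i (integrable_const 1)] at this
    simp only [integral_const, probReal_univ, smul_eq_mul, mul_one] at this
    linarith
  have hζ2i : ∀ i, Integrable (fun ω => ζ i ω ^ 2) Q := fun i =>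
    integrable_of_abs_le ((hζ i).pow_const 2) (K := K ^ 2) fun ω => by
      rw [abs_pow]
      gcongr
      exact hK i ω
  set m : ι → ℝ := fun i => ∫ ω, M i ω ∂Q with hm
  set N : ι → Ω → ℝ := fun i ω => M i ω - m i with hN
  have hNm : ∀ i, Measurable (N i) := fun i => (hMm i).sub_const _
  have hmK : ∀ i, |m i| ≤ ε * K := fun i => by
    refine (abs_integral_le_integral_abs).trans ?_
    calc ∫ ω, |M i ω| ∂Q ≤ ∫ _ω, ε * K ∂Q :=
          integral_mono (hMi i).abs (integrable_const _) (hMK i)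
      _ = ε * K := by simp
  have hNK : ∀ i ω, |N i ω| ≤ 2 * (ε * K) := fun i ω => by
    have := abs_sub (M i ω) (m i)
    simp only [hN]
    linarith [hMK i ω, hmK i]
  have hN2 : ∀ i, ∫ ω, N i ω ^ 2 ∂Q ≤ ε ^ 2 * ∫ ω, ζ i ω ^ 2 ∂Q := by
    intro i
    have hM2i : Integrable (fun ω => M i ω ^ 2) Q :=
      integrable_of_abs_le ((hMm i).pow_const 2) (K := (ε * K) ^ 2) fun ω => by
        rw [abs_pow]
        gcongr
        exact hMK i ω
    have e : ∫ ω, N i ω ^ 2 ∂Q = ∫ ω, M i ω ^ 2 ∂Q - m i ^ 2 := by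
      have : ∀ ω, N i ω ^ 2 = M i ω ^ 2 - 2 * m i * M i ω + m i ^ 2 := fun ω => by
        simp only [hN]; ring
      simp_rw [this]
      have hs : Integrable (fun ω => M i ω ^ 2 - 2 * m i * M i ω) Q :=
        hM2i.sub ((hMi i).const_mul _)
      rw [integral_add hs (integrable_const _), integral_sub hM2i ((hMi i).const_mul _), integral_const_mul]
      simp only [integral_const, probReal_univ, smul_eq_mul, one_mul]
      change _ - 2 * m i * m i + _ = _
      ring
    rw [e, ← integral_const_mul]
    have : ∫ ω, M i ω ^ 2 ∂Q ≤ ∫ ω, ε ^ 2 * ζ i ω ^ 2 ∂Q := by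
      refine integral_mono hM2i ((hζ2i i).const_mul _) fun ω => ?_
      have h1 := hMle i ω
      calc M i ω ^ 2 ≤ (ε * |ζ i ω|) ^ 2 := pow_le_pow_left₀ (hM0 i ω) h1 2
        _ = ε ^ 2 * ζ i ω ^ 2 := by rw [mul_pow, sq_abs]
    nlinarith [sq_nonneg (m i)]
  have hNsq : ∫ ω, (∑ i, N i ω) ^ 2 ∂Q ≤ ε ^ 2 := by
    have hNind : iIndepFun N Q := by
      have := hind.comp (fun i (z : ℝ × ℝ) => |z.1| * min ε |z.1| - m i) fun i => by fun_prop
      exact this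
    rw [integral_sum_sq hNm hNK hNind fun i => by
      simp only [hN]
      rw [integral_sub (hMi i) (integrable_const _)]
      simp [hm]]
    calc ∑ i, ∫ ω, N i ω ^ 2 ∂Q ≤ ∑ i, ε ^ 2 * ∫ ω, ζ i ω ^ 2 ∂Q :=
          Finset.sum_le_sum fun i _ => hN2 i
      _ = ε ^ 2 * ∑ i, ∫ ω, ζ i ω ^ 2 ∂Q := by rw [Finset.mul_sum]
      _ ≤ ε ^ 2 * 1 := by gcongr
      _ = ε ^ 2 := mul_one _
  have hSNm : Measurable fun ω => ∑ i, N i ω := Finset.measurable_fun_sum _ fun i _ => hNm i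
  have hSNK : ∀ ω, |∑ i, N i ω| ≤ Fintype.card ι * (2 * (ε * K)) := fun ω =>
    abs_sum_le_card_mul fun i => hNK i ω
  have hSNi : Integrable (fun ω => |∑ i, N i ω|) Q :=
    integrable_of_abs_le hSNm.abs fun ω => by rw [abs_abs]; exact hSNK ω
  have hSN2i : Integrable (fun ω => (∑ i, N i ω) ^ 2) Q :=
    integrable_of_abs_le (hSNm.pow_const 2) (K := (Fintype.card ι * (2 * (ε * K))) ^ 2) fun ω => by
      rw [abs_pow]
      gcongr
      exact hSNK ω
  have hNabs : ∫ ω, |∑ i, N i ω| ∂Q ≤ ε := by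
    have : ∫ ω, |∑ i, N i ω| ∂Q ≤ ∫ ω, ((∑ i, N i ω) ^ 2 / ε + ε) / 2 ∂Q := by
      refine integral_mono hSNi (((hSN2i.div_const ε).add (integrable_const ε)).div_const 2)
        fun ω => ?_
      simp only
      rw [le_div_iff₀ (by norm_num), ← sub_nonneg]
      have : (∑ i, N i ω) ^ 2 / ε + ε - |∑ i, N i ω| * 2 = (|∑ i, N i ω| - ε) ^ 2 / ε := by
        field_simp
        rw [← sq_abs (∑ i, N i ω)]
        ring
      rw [this]
      positivity
    rw [integral_div, integral_add (hSN2i.div_const ε) (integrable_const ε), integral_div] at this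
    simp only [integral_const, probReal_univ, smul_eq_mul, one_mul] at this
    have h2 : (∫ ω, (∑ i, N i ω) ^ 2 ∂Q) / ε ≤ ε := by
      rw [div_le_iff₀ hε]
      nlinarith
    linarith
  have hlow : v * Q.real D - ε ≤ ∑ i, ∫ ω, D.indicator (M i) ω ∂Q := by
    rw [← integral_finsetSum _ fun i _ => hi3 i]
    have h1 : ∫ ω, (D.indicator (fun _ => ∑ i, m i) ω - |∑ i, N i ω|) ∂Q ≤
        ∫ ω, ∑ i, D.indicator (M i) ω ∂Q := by
      refine integral_mono (((integrable_const _).indicator hDm).sub hSNi)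
        (integrable_finsetSum _ fun i _ => hi3 i) fun ω => ?_
      by_cases hω : ω ∈ D
      · simp only [Set.indicator_of_mem hω]
        have : ∑ i, M i ω = ∑ i, m i + ∑ i, N i ω := by
          rw [← Finset.sum_add_distrib]
          exact Finset.sum_congr rfl fun i _ => by simp [hN]
        rw [this]
        linarith [neg_abs_le (∑ i, N i ω)]
      · simp only [Set.indicator_of_notMem hω]
        simp
    rw [integral_sub ((integrable_const _).indicator hDm) hSNi, integral_indicator_const _ hDm,
      smul_eq_mul] at h1
    have h2 : v * Q.real D ≤ Q.real D * ∑ i, m i := by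
      rw [mul_comm]
      exact mul_le_mul_of_nonneg_left hv measureReal_nonneg
    linarith
  have hup : ∫ ω, T ω * clip ε (a (H ω)) (b (H ω)) (T ω) ∂Q ≤
      (∫ ω, |T ω| * (b (H ω) - a (H ω)) ∂Q) / 2 + ε := by
    have hbai : Integrable (fun ω => |T ω| * (b (H ω) - a (H ω))) Q :=
      integrable_of_abs_le (hTm.abs.mul ((hb.comp hHm).sub (ha.comp hHm)))
        (K := Fintype.card ι * K * K') fun ω => by
          rw [abs_mul, abs_abs, abs_of_nonneg (sub_nonneg.2 (hab (H ω)))]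
          exact mul_le_mul (hTK ω) (hK' _) (sub_nonneg.2 (hab _)) ((abs_nonneg _).trans (hTK ω))
    have h1 : ∫ ω, T ω * clip ε (a (H ω)) (b (H ω)) (T ω) ∂Q ≤
        ∫ ω, (|T ω| * (b (H ω) - a (H ω)) / 2 + ε * |T ω|) ∂Q := by
      refine integral_mono ?_ ((hbai.div_const 2).add (hTi.const_mul ε)) fun ω => ?_
      · refine integrable_of_abs_le (hTm.mul hcm) (K := Fintype.card ι * K * (K' / 2 + ε))
          fun ω => ?_
        rw [abs_mul]
        exact mul_le_mul (hTK ω) (hclK _ _) (abs_nonneg _) ((abs_nonneg _).trans (hTK ω))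
      · calc T ω * clip ε (a (H ω)) (b (H ω)) (T ω) ≤ |T ω * clip ε (a (H ω)) (b (H ω)) (T ω)| :=
              le_abs_self _
          _ = |T ω| * |clip ε (a (H ω)) (b (H ω)) (T ω)| := abs_mul _ _
          _ ≤ |T ω| * ((b (H ω) - a (H ω)) / 2 + ε) :=
              mul_le_mul_of_nonneg_left (abs_clip_le hε.le (hab _) _) (abs_nonneg _)
          _ = _ := by ring
    rw [integral_add (hbai.div_const 2) (hTi.const_mul ε), integral_div, integral_const_mul] at h1
    nlinarith
  have hfin := Finset.sum_le_sum fun i (_ : i ∈ Finset.univ) => hstep i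
  rw [Finset.sum_sub_distrib, ← Finset.mul_sum, ← hsum] at hfin
  linarith

/-- The mass `|z| min {ε, |z|}` recovers the variance up to a third-moment term. -/
lemma sq_sub_cube_le_abs_mul_min {ε : ℝ} (hε : 0 < ε) (z : ℝ) :
    z ^ 2 - |z| ^ 3 / (4 * ε) ≤ |z| * min ε |z| := by
  rw [← sq_abs]
  have hz := abs_nonneg z
  set y := |z|
  rcases le_total ε y with h | h
  · rw [min_eq_left h]
    rw [sub_le_iff_le_add, ← sub_le_iff_le_add', le_div_iff₀ (by positivity)]
    nlinarith [mul_nonneg hz (sq_nonneg (y - 2 * ε))]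
  · rw [min_eq_right h]
    have : 0 ≤ y ^ 3 / (4 * ε) := by positivity
    nlinarith

end Concentration

/-! ### The Stein equation of an interval -/

section Stein

lemma integrable_exp_neg_sq_half : Integrable fun v : ℝ => Real.exp (-v ^ 2 / 2) := by
  have := integrable_exp_neg_mul_sq (b := 1 / 2) (by norm_num)
  refine this.congr (Filter.Eventually.of_forall fun v => ?_)
  simp only
  congr 1
  ring

lemma integral_exp_neg_sq_half : ∫ v : ℝ, Real.exp (-v ^ 2 / 2) = √(2 * Real.pi) := by
  have := integral_gaussian (1 / 2)
  rw [show Real.pi / (1 / 2) = 2 * Real.pi by ring] at this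
  rw [← this]
  congr 1
  ext v
  congr 1
  ring

lemma sqrt_two_pi_le_three : √(2 * Real.pi) ≤ 3 := by
  rw [Real.sqrt_le_left (by norm_num)]
  nlinarith [Real.pi_lt_four, Real.pi_lt_d2]

lemma integral_Ioi_exp_neg_sq_half_le {w : ℝ} (hw : 0 ≤ w) :
    ∫ v in Set.Ioi w, Real.exp (-v ^ 2 / 2) ≤ 3 * Real.exp (-w ^ 2 / 2) := by
  have hsh : Integrable fun v : ℝ => Real.exp (-w ^ 2 / 2) * Real.exp (-(v - w) ^ 2 / 2) :=
    (integrable_exp_neg_sq_half.comp_sub_right w).const_mul _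
  calc ∫ v in Set.Ioi w, Real.exp (-v ^ 2 / 2)
      ≤ ∫ v in Set.Ioi w, Real.exp (-w ^ 2 / 2) * Real.exp (-(v - w) ^ 2 / 2) := by
        refine setIntegral_mono_on integrable_exp_neg_sq_half.integrableOn hsh.integrableOn
          measurableSet_Ioi fun v hv => ?_
        rw [← Real.exp_add]
        refine Real.exp_le_exp.2 ?_
        have : w < v := hv
        nlinarith [mul_nonneg hw (sub_nonneg.2 this.le)]
    _ ≤ ∫ v, Real.exp (-w ^ 2 / 2) * Real.exp (-(v - w) ^ 2 / 2) :=
        setIntegral_le_integral hsh (Filter.Eventually.of_forall fun v => by positivity)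
    _ = Real.exp (-w ^ 2 / 2) * √(2 * Real.pi) := by
        rw [integral_const_mul,
          integral_sub_right_eq_self (fun v : ℝ => Real.exp (-v ^ 2 / 2)) w,
          integral_exp_neg_sq_half]
    _ ≤ 3 * Real.exp (-w ^ 2 / 2) := by
        nlinarith [sqrt_two_pi_le_three, Real.exp_pos (-w ^ 2 / 2)]

lemma mul_integral_Ioi_exp_neg_sq_half_le (w : ℝ) :
    w * ∫ v in Set.Ioi w, Real.exp (-v ^ 2 / 2) ≤ Real.exp (-w ^ 2 / 2) := by
  have hi : Integrable fun v : ℝ => v * Real.exp (-v ^ 2 / 2) := by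
    refine (integrable_mul_exp_neg_mul_sq (b := 1 / 2) (by norm_num)).congr
      (Filter.Eventually.of_forall fun v => ?_)
    simp only
    congr 2
    ring
  have hlim : Filter.Tendsto (fun v : ℝ => -Real.exp (-v ^ 2 / 2)) Filter.atTop (nhds (-0)) := by
    refine Filter.Tendsto.neg (Real.tendsto_exp_atBot.comp ?_)
    have h1 : Filter.Tendsto (fun v : ℝ => v ^ 2) Filter.atTop Filter.atTop :=
      Filter.tendsto_pow_atTop (by norm_num)
    have h2 := Filter.tendsto_neg_atTop_atBot.comp (h1.atTop_div_const (r := 2) (by norm_num))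
    refine h2.congr fun v => ?_
    simp only [Function.comp_apply]
    ring
  have hval : ∫ v in Set.Ioi w, v * Real.exp (-v ^ 2 / 2) = Real.exp (-w ^ 2 / 2) := by
    rw [integral_Ioi_of_hasDerivAt_of_tendsto' (f := fun v : ℝ => -Real.exp (-v ^ 2 / 2))
      (m := -0) (fun v _ => ?_) hi.integrableOn hlim]
    · ring
    · have h1 : HasDerivAt (fun v : ℝ => -v ^ 2 / 2) (-v) v := by
        have := ((hasDerivAt_pow 2 v).neg).div_const 2
        refine this.congr_deriv ?_
        simp
        ring
      refine h1.exp.neg.congr_deriv ?_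
      ring
  rw [← integral_const_mul, ← hval]
  refine setIntegral_mono_on (integrable_exp_neg_sq_half.const_mul w).integrableOn
    hi.integrableOn measurableSet_Ioi fun v hv => ?_
  exact mul_le_mul_of_nonneg_right (le_of_lt hv) (Real.exp_pos _).le

/-- The standard normal probability of the interval `[a, b]`. -/
noncomputable def gaussIcc (a b : ℝ) : ℝ := (gaussianReal 0 1).real (Set.Icc a b)

lemma gaussIcc_nonneg (a b : ℝ) : 0 ≤ gaussIcc a b := measureReal_nonneg

lemma gaussIcc_le_one (a b : ℝ) : gaussIcc a b ≤ 1 := measureReal_le_one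

/-- The indicator of `[a, b]`, centred under the standard normal law. -/
noncomputable def centredIcc (a b v : ℝ) : ℝ := (Set.Icc a b).indicator 1 v - gaussIcc a b

lemma measurable_centredIcc (a b : ℝ) : Measurable (centredIcc a b) :=
  (measurable_one.indicator measurableSet_Icc).sub_const _

lemma abs_centredIcc_le (a b v : ℝ) : |centredIcc a b v| ≤ 1 := by
  unfold centredIcc
  have h1 := gaussIcc_nonneg a b
  have h2 := gaussIcc_le_one a b
  by_cases hv : v ∈ Set.Icc a b
  · rw [Set.indicator_of_mem hv, Pi.one_apply, abs_le]
    constructor <;> linarith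
  · rw [Set.indicator_of_notMem hv, abs_le]
    constructor <;> linarith

lemma integrable_centredIcc_mul (a b : ℝ) :
    Integrable fun v => centredIcc a b v * Real.exp (-v ^ 2 / 2) := by
  refine integrable_exp_neg_sq_half.mono'
    ((measurable_centredIcc a b).mul (by fun_prop)).aestronglyMeasurable
    (Filter.Eventually.of_forall fun v => ?_)
  rw [Real.norm_eq_abs, abs_mul, abs_of_pos (Real.exp_pos _)]
  nlinarith [abs_centredIcc_le a b v, Real.exp_pos (-v ^ 2 / 2)]

lemma integral_centredIcc_mul (a b : ℝ) :
    ∫ v, centredIcc a b v * Real.exp (-v ^ 2 / 2) = 0 := by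
  have h : ∫ v, centredIcc a b v ∂(gaussianReal 0 1) = 0 := by
    unfold centredIcc
    have hi : Integrable ((Set.Icc a b).indicator (1 : ℝ → ℝ)) (gaussianReal 0 1) :=
      (integrable_const (1 : ℝ)).indicator measurableSet_Icc
    rw [integral_sub hi (integrable_const _), integral_indicator_one measurableSet_Icc]
    simp [gaussIcc]
  rw [integral_gaussianReal_eq_integral_smul (by norm_num)] at h
  simp only [gaussianPDFReal, NNReal.coe_one, mul_one, sub_zero, smul_eq_mul] at h
  have h2 : ∀ v : ℝ, (√(2 * Real.pi))⁻¹ * Real.exp (-v ^ 2 / 2) * centredIcc a b v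
      = (√(2 * Real.pi))⁻¹ * (centredIcc a b v * Real.exp (-v ^ 2 / 2)) := fun v => by ring
  simp_rw [h2] at h
  rw [integral_const_mul] at h
  exact (mul_eq_zero.1 h).resolve_left (by positivity)

/-- The bounded solution of the Stein equation `f' - w f = 1_[a,b] - N[a,b]`. -/
noncomputable def steinSol (a b w : ℝ) : ℝ :=
  Real.exp (w ^ 2 / 2) * ∫ v in Set.Iic w, centredIcc a b v * Real.exp (-v ^ 2 / 2)

/-- The derivative of `steinSol` away from the end points of the interval. -/
noncomputable def steinDeriv (a b w : ℝ) : ℝ := w * steinSol a b w + centredIcc a b w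

lemma abs_steinSol_le_tail (a b w : ℝ) :
    |steinSol a b w| ≤ Real.exp (w ^ 2 / 2) * ∫ v in Set.Ioi |w|, Real.exp (-v ^ 2 / 2) := by
  unfold steinSol
  rw [abs_mul, abs_of_pos (Real.exp_pos _)]
  refine mul_le_mul_of_nonneg_left ?_ (Real.exp_pos _).le
  have hpt : ∀ v, |centredIcc a b v * Real.exp (-v ^ 2 / 2)| ≤ Real.exp (-v ^ 2 / 2) := fun v => by
    rw [abs_mul, abs_of_pos (Real.exp_pos _)]
    nlinarith [abs_centredIcc_le a b v, Real.exp_pos (-v ^ 2 / 2)]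
  have hset : ∀ s : Set ℝ, |∫ v in s, centredIcc a b v * Real.exp (-v ^ 2 / 2)|
      ≤ ∫ v in s, Real.exp (-v ^ 2 / 2) := fun s => by
    refine (abs_integral_le_integral_abs).trans ?_
    exact integral_mono (integrable_centredIcc_mul a b).abs.integrableOn
      integrable_exp_neg_sq_half.integrableOn hpt
  rcases le_total 0 w with hw | hw
  · rw [abs_of_nonneg hw]
    have h1 := intervalIntegral.integral_Iic_add_Ioi (μ := volume) (b := w)
      (integrable_centredIcc_mul a b).integrableOn (integrable_centredIcc_mul a b).integrableOn
    rw [integral_centredIcc_mul] at h1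
    rw [eq_neg_of_add_eq_zero_left h1, abs_neg]
    exact hset _
  · rw [abs_of_nonpos hw]
    refine (hset _).trans (le_of_eq ?_)
    have := integral_comp_neg_Iic w (fun v : ℝ => Real.exp (-v ^ 2 / 2))
    simp only [neg_sq] at this
    exact this

lemma abs_steinSol_le (a b w : ℝ) : |steinSol a b w| ≤ 3 := by
  refine (abs_steinSol_le_tail a b w).trans ?_
  have h := integral_Ioi_exp_neg_sq_half_le (abs_nonneg w)
  rw [sq_abs] at h
  calc _ ≤ Real.exp (w ^ 2 / 2) * (3 * Real.exp (-w ^ 2 / 2)) :=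
        mul_le_mul_of_nonneg_left h (Real.exp_pos _).le
    _ = 3 * (Real.exp (w ^ 2 / 2) * Real.exp (-w ^ 2 / 2)) := by ring
    _ = 3 := by rw [← Real.exp_add]; ring_nf; simp

lemma abs_mul_steinSol_le (a b w : ℝ) : |w * steinSol a b w| ≤ 1 := by
  rw [abs_mul]
  have h := mul_integral_Ioi_exp_neg_sq_half_le |w|
  rw [sq_abs] at h
  calc _ ≤ |w| * (Real.exp (w ^ 2 / 2) * ∫ v in Set.Ioi |w|, Real.exp (-v ^ 2 / 2)) :=
        mul_le_mul_of_nonneg_left (abs_steinSol_le_tail a b w) (abs_nonneg w)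
    _ = Real.exp (w ^ 2 / 2) * (|w| * ∫ v in Set.Ioi |w|, Real.exp (-v ^ 2 / 2)) := by ring
    _ ≤ Real.exp (w ^ 2 / 2) * Real.exp (-w ^ 2 / 2) :=
        mul_le_mul_of_nonneg_left h (Real.exp_pos _).le
    _ = 1 := by rw [← Real.exp_add]; ring_nf; simp

lemma abs_steinDeriv_le (a b w : ℝ) : |steinDeriv a b w| ≤ 2 := by
  unfold steinDeriv
  linarith [abs_add_le (w * steinSol a b w) (centredIcc a b w), abs_mul_steinSol_le a b w,
    abs_centredIcc_le a b w]

lemma integral_Iic_centredIcc_eq (a b w : ℝ) :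
    ∫ v in Set.Iic w, centredIcc a b v * Real.exp (-v ^ 2 / 2)
      = (∫ v in Set.Iic 0, centredIcc a b v * Real.exp (-v ^ 2 / 2))
        + ∫ v in (0 : ℝ)..w, centredIcc a b v * Real.exp (-v ^ 2 / 2) := by
  rw [← intervalIntegral.integral_Iic_sub_Iic (integrable_centredIcc_mul a b).integrableOn
    (integrable_centredIcc_mul a b).integrableOn]
  ring

lemma continuous_steinSol (a b : ℝ) : Continuous (steinSol a b) := by
  unfold steinSol
  refine Continuous.mul (by fun_prop) ?_
  refine Continuous.congr ?_ fun w => (integral_Iic_centredIcc_eq a b w).symm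
  exact continuous_const.add (intervalIntegral.continuous_primitive
    (fun _ _ => (integrable_centredIcc_mul a b).intervalIntegrable) 0)

lemma measurable_steinDeriv (a b : ℝ) : Measurable (steinDeriv a b) :=
  (measurable_id.mul (continuous_steinSol a b).measurable).add (measurable_centredIcc a b)

lemma continuousAt_centredIcc {a b w : ℝ} (h : w ∉ ({a, b} : Set ℝ)) :
    ContinuousAt (centredIcc a b) w := by
  refine ContinuousAt.sub ?_ continuousAt_const
  simp only [Set.mem_insert_iff, Set.mem_singleton_iff, not_or] at h
  have hout : ∀ U : Set ℝ, IsOpen U → w ∈ U → Disjoint U (Set.Icc a b) →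
      ContinuousAt ((Set.Icc a b).indicator (1 : ℝ → ℝ)) w := by
    intro U hU hw hd
    refine ContinuousAt.congr (f := fun _ => (0 : ℝ)) continuousAt_const ?_
    filter_upwards [hU.mem_nhds hw] with v hv
    exact (Set.indicator_of_notMem (Set.disjoint_left.1 hd hv) _).symm
  rcases lt_or_gt_of_ne h.1 with h1 | h1
  · exact hout (Set.Iio a) isOpen_Iio h1 (Set.disjoint_left.2 fun v hv hv' =>
      absurd hv'.1 (not_le.2 hv))
  rcases lt_or_gt_of_ne h.2 with h2 | h2
  · refine ContinuousAt.congr (f := fun _ => (1 : ℝ)) continuousAt_const ?_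
    filter_upwards [Ioo_mem_nhds h1 h2] with v hv
    exact (Set.indicator_of_mem (Set.Ioo_subset_Icc_self hv) (1 : ℝ → ℝ)).symm
  · exact hout (Set.Ioi b) isOpen_Ioi h2 (Set.disjoint_left.2 fun v hv hv' =>
      absurd hv'.2 (not_le.2 hv))

lemma hasDerivAt_steinSol {a b w : ℝ} (h : w ∉ ({a, b} : Set ℝ)) :
    HasDerivAt (steinSol a b) (steinDeriv a b w) w := by
  have h1 : HasDerivAt (fun w : ℝ => Real.exp (w ^ 2 / 2)) (Real.exp (w ^ 2 / 2) * w) w := by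
    have : HasDerivAt (fun v : ℝ => v ^ 2 / 2) w w := by
      refine ((hasDerivAt_pow 2 w).div_const 2).congr_deriv ?_
      simp
    exact this.exp
  have h2 : HasDerivAt (fun w => ∫ v in Set.Iic w, centredIcc a b v * Real.exp (-v ^ 2 / 2))
      (centredIcc a b w * Real.exp (-w ^ 2 / 2)) w := by
    refine HasDerivAt.congr_of_eventuallyEq ?_
      (Filter.Eventually.of_forall (integral_Iic_centredIcc_eq a b))
    refine HasDerivAt.const_add _ ?_
    refine intervalIntegral.integral_hasDerivAt_right
      (integrable_centredIcc_mul a b).intervalIntegrable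
      ((integrable_centredIcc_mul a b).aestronglyMeasurable.stronglyMeasurableAtFilter) ?_
    exact (continuousAt_centredIcc h).mul (by fun_prop)
  refine (h1.mul h2).congr_deriv ?_
  unfold steinDeriv steinSol
  have : Real.exp (w ^ 2 / 2) * Real.exp (-w ^ 2 / 2) = 1 := by
    rw [← Real.exp_add]; ring_nf; simp
  linear_combination centredIcc a b w * this

lemma intervalIntegrable_steinDeriv (a b v w : ℝ) :
    IntervalIntegrable (steinDeriv a b) volume v w := by
  rw [intervalIntegrable_iff]
  have : IsFiniteMeasure (volume.restrict (Set.uIoc v w)) := ⟨by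
    rw [Measure.restrict_apply_univ]
    exact measure_Ioc_lt_top⟩
  refine Integrable.of_bound (measurable_steinDeriv a b).aestronglyMeasurable 2
    (Filter.Eventually.of_forall fun y => abs_steinDeriv_le a b y)

lemma steinSol_sub_eq_integral (a b v w : ℝ) :
    steinSol a b w - steinSol a b v = ∫ y in v..w, steinDeriv a b y :=
  (integral_eq_of_hasDerivAt_off_countable _ _ (Set.toFinite {a, b}).countable
    (continuous_steinSol a b).continuousOn (fun _ hx => hasDerivAt_steinSol hx.2)
    (intervalIntegrable_steinDeriv a b v w)).symm

lemma abs_steinSol_sub_le (a b v w : ℝ) : |steinSol a b w - steinSol a b v| ≤ 2 * |w - v| := by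
  rw [steinSol_sub_eq_integral]
  exact intervalIntegral.norm_integral_le_of_norm_le_const (f := steinDeriv a b)
    fun y _ => abs_steinDeriv_le a b y

/-- Counts the end points of `[a, b]` within distance `r` of `w`. -/
noncomputable def nearEnds (a b w r : ℝ) : ℝ :=
  (if |w - a| ≤ r then 1 else 0) + (if |w - b| ≤ r then 1 else 0)

lemma nearEnds_nonneg (a b w r : ℝ) : 0 ≤ nearEnds a b w r := by
  unfold nearEnds
  positivity

lemma nearEnds_le_two (a b w r : ℝ) : nearEnds a b w r ≤ 2 := by
  unfold nearEnds
  split_ifs <;> norm_num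

lemma abs_indicator_Icc_sub_le {a b v w r : ℝ} (h : |v - w| ≤ r) :
    |(Set.Icc a b).indicator (1 : ℝ → ℝ) v - (Set.Icc a b).indicator 1 w| ≤ nearEnds a b w r := by
  have h' := abs_le.1 h
  unfold nearEnds
  by_cases ha : |w - a| ≤ r
  · rw [if_pos ha]
    have : (0 : ℝ) ≤ if |w - b| ≤ r then 1 else 0 := by split_ifs <;> norm_num
    by_cases h1 : v ∈ Set.Icc a b <;> by_cases h2 : w ∈ Set.Icc a b <;> simp [h1, h2] <;> linarith
  · by_cases hb : |w - b| ≤ r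
    · rw [if_pos hb, if_neg ha]
      by_cases h1 : v ∈ Set.Icc a b <;> by_cases h2 : w ∈ Set.Icc a b <;> simp [h1, h2]
    · rw [if_neg ha, if_neg hb]
      have hiff : v ∈ Set.Icc a b ↔ w ∈ Set.Icc a b := by
        rw [abs_le] at ha hb
        push Not at ha hb
        simp only [Set.mem_Icc]
        constructor
        · rintro ⟨h1, h2⟩
          constructor
          · by_contra hc
            linarith [ha (by linarith)]
          · by_contra hc
            linarith [hb (by linarith)]
        · rintro ⟨h1, h2⟩
          constructor
          · linarith [ha (by linarith)]
          · by_contra hc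
            linarith [hb (by linarith)]
      by_cases h2 : w ∈ Set.Icc a b
      · simp [h2, hiff.2 h2]
      · simp [h2, mt hiff.1 h2]

lemma abs_steinDeriv_sub_le {a b v w r : ℝ} (h : |v - w| ≤ r) :
    |steinDeriv a b v - steinDeriv a b w| ≤ (2 * |w| + 3) * r + nearEnds a b w r := by
  have e : steinDeriv a b v - steinDeriv a b w = w * (steinSol a b v - steinSol a b w)
      + (v - w) * steinSol a b v
      + ((Set.Icc a b).indicator (1 : ℝ → ℝ) v - (Set.Icc a b).indicator 1 w) := by
    unfold steinDeriv centredIcc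
    ring
  have h1 : |w * (steinSol a b v - steinSol a b w)| ≤ |w| * (2 * r) := by
    rw [abs_mul]
    refine mul_le_mul_of_nonneg_left ?_ (abs_nonneg w)
    linarith [abs_steinSol_sub_le a b w v]
  have h2 : |(v - w) * steinSol a b v| ≤ r * 3 := by
    rw [abs_mul]
    exact mul_le_mul h (abs_steinSol_le a b v) (abs_nonneg _) ((abs_nonneg _).trans h)
  rw [e]
  refine (abs_add_three _ _ _).trans ?_
  linarith [abs_indicator_Icc_sub_le (a := a) (b := b) h]

/-- The first-order remainder of the Stein solution: the term `nearEnds`, due to the jumps of the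
derivative, is controlled by the concentration inequality, the other one by moments. -/
lemma abs_steinSol_taylor (a b w z : ℝ) :
    |steinSol a b (w + z) - steinSol a b w - z * steinDeriv a b w|
      ≤ |z| * ((2 * |w| + 3) * |z| + nearEnds a b w |z|) := by
  have e : steinSol a b (w + z) - steinSol a b w - z * steinDeriv a b w
      = ∫ y in w..(w + z), (steinDeriv a b y - steinDeriv a b w) := by
    rw [intervalIntegral.integral_sub (intervalIntegrable_steinDeriv a b _ _) (by simp),
      ← steinSol_sub_eq_integral]
    simp
  rw [e]
  have := intervalIntegral.norm_integral_le_of_norm_le_const (a := w) (b := w + z)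
    (f := fun y => steinDeriv a b y - steinDeriv a b w)
    (C := (2 * |w| + 3) * |z| + nearEnds a b w |z|) fun y hy => by
      refine abs_steinDeriv_sub_le ?_
      have h1 := Set.abs_sub_left_of_mem_uIcc (Set.uIoc_subset_uIcc hy)
      simpa using h1
  rw [Real.norm_eq_abs, add_sub_cancel_left] at this
  linarith

end Stein

/-! ### The Berry–Esseen bound -/

section BerryEsseen

variable {Ω : Type*} [MeasurableSpace Ω] {ι : Type*} [Fintype ι]

/-- Integrate out one of two independent variables under an inequality. -/
lemma integral_le_of_indepFun {Q : Measure Ω} [IsProbabilityMeasure Q] {U V : Ω → ℝ}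
    (hU : Measurable U) (hV : Measurable V) (h : IndepFun U V Q) {F : ℝ × ℝ → ℝ}
    (hF : Measurable F) {K : ℝ} (hK : ∀ ω, |F (U ω, V ω)| ≤ K) {G : ℝ → ℝ}
    (hG : Integrable (fun ω => G (U ω)) Q) (hGm : Measurable G)
    (hle : ∀ u, ∫ ω, F (u, V ω) ∂Q ≤ G u) :
    ∫ ω, F (U ω, V ω) ∂Q ≤ ∫ ω, G (U ω) ∂Q := by
  have hmap := (indepFun_iff_map_prod_eq_prod_map_map hU.aemeasurable hV.aemeasurable).1 h
  have e1 : ∫ ω, F (U ω, V ω) ∂Q = ∫ z, F z ∂((Q.map U).prod (Q.map V)) := by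
    rw [← hmap, integral_map (hU.prodMk hV).aemeasurable hF.aestronglyMeasurable]
  have := Measure.isProbabilityMeasure_map (μ := Q) hU.aemeasurable
  have := Measure.isProbabilityMeasure_map (μ := Q) hV.aemeasurable
  have hi : Integrable F ((Q.map U).prod (Q.map V)) := by
    rw [← hmap, integrable_map_measure hF.aestronglyMeasurable (hU.prodMk hV).aemeasurable]
    exact integrable_of_abs_le (hF.comp (hU.prodMk hV)) hK
  rw [e1, integral_prod _ hi]
  have e2 : ∫ ω, G (U ω) ∂Q = ∫ u, G u ∂(Q.map U) := by
    rw [integral_map hU.aemeasurable hGm.aestronglyMeasurable]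
  rw [e2]
  refine integral_mono hi.integral_prod_left
    ((integrable_map_measure hGm.aestronglyMeasurable hU.aemeasurable).2 hG) fun u => ?_
  have hFu : Measurable fun y => F (u, y) := hF.comp (measurable_const.prodMk measurable_id)
  rw [integral_map hV.aemeasurable hFu.aestronglyMeasurable]
  exact hle u

lemma integrable_abs_of_abs_le {Q : Measure Ω} [IsFiniteMeasure Q] {f : Ω → ℝ} (hf : Measurable f)
    {K : ℝ} (hK : ∀ ω, |f ω| ≤ K) (m : ℕ) : Integrable (fun ω => |f ω| ^ m) Q :=
  integrable_of_abs_le (hf.abs.pow_const m) (K := K ^ m) fun ω => by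
    rw [abs_pow, abs_abs]
    exact pow_le_pow_left₀ (abs_nonneg _) (hK ω) m

lemma integrable_sq_of_abs_le {Q : Measure Ω} [IsFiniteMeasure Q] {f : Ω → ℝ} (hf : Measurable f)
    {K : ℝ} (hK : ∀ ω, |f ω| ≤ K) : Integrable (fun ω => f ω ^ 2) Q := by
  simpa using integrable_abs_of_abs_le (Q := Q) hf hK 2

/-- The first absolute moment of a variable with second moment at most one. -/
lemma integral_abs_le_one {Q : Measure Ω} [IsProbabilityMeasure Q] {f : Ω → ℝ} (hf : Measurable f)
    {K : ℝ} (hK : ∀ ω, |f ω| ≤ K) (h : ∫ ω, f ω ^ 2 ∂Q ≤ 1) : ∫ ω, |f ω| ∂Q ≤ 1 := by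
  have h2 := integrable_sq_of_abs_le (Q := Q) hf hK
  have : ∫ ω, |f ω| ∂Q ≤ ∫ ω, (f ω ^ 2 + 1) / 2 ∂Q := by
    refine integral_mono (integrable_of_abs_le hf hK).abs
      ((h2.add (integrable_const 1)).div_const 2) fun ω => ?_
    simp only
    nlinarith [sq_nonneg (|f ω| - 1), sq_abs (f ω)]
  rw [integral_div, integral_add h2 (integrable_const 1)] at this
  simp only [integral_const, probReal_univ, smul_eq_mul, mul_one] at this
  linarith

/-- Chebyshev's association inequality for the first and second absolute moments. -/
lemma integral_sq_mul_integral_abs_le {Q : Measure Ω} [IsProbabilityMeasure Q] {f : Ω → ℝ}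
    (hf : Measurable f) {K : ℝ} (hK : ∀ ω, |f ω| ≤ K) :
    (∫ ω, f ω ^ 2 ∂Q) * ∫ ω, |f ω| ∂Q ≤ ∫ ω, |f ω| ^ 3 ∂Q := by
  set m := ∫ ω, |f ω| ∂Q with hm
  have h1 := (integrable_of_abs_le (Q := Q) hf hK).abs
  have h2 := integrable_sq_of_abs_le (Q := Q) hf hK
  have h3 := integrable_abs_of_abs_le (Q := Q) hf hK 3
  have hm0 : 0 ≤ m := integral_nonneg fun ω => abs_nonneg _
  have : ∫ ω, (m * f ω ^ 2 + m ^ 2 * |f ω| - m ^ 3) ∂Q ≤ ∫ ω, |f ω| ^ 3 ∂Q := by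
    refine integral_mono (((h2.const_mul m).add (h1.const_mul _)).sub (integrable_const _)) h3
      fun ω => ?_
    simp only
    rw [← sq_abs (f ω)]
    nlinarith [mul_nonneg (sq_nonneg (|f ω| - m)) (add_nonneg (abs_nonneg (f ω)) hm0)]
  have ha : Integrable (fun ω => m * f ω ^ 2 + m ^ 2 * |f ω|) Q :=
    (h2.const_mul m).add (h1.const_mul _)
  rw [integral_sub ha (integrable_const _), integral_add (h2.const_mul m) (h1.const_mul _),
    integral_const_mul, integral_const_mul, ← hm] at this
  simp only [integral_const, probReal_univ, smul_eq_mul, one_mul] at this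
  nlinarith

variable {Q : Measure Ω} [IsProbabilityMeasure Q] {U : ι → Ω → ℝ} {K : ℝ}

/-- Removing one summand from a normalized sum with small third moments leaves a sum that puts
little mass on short intervals. -/
lemma concentration_leave_one_out (hU : ∀ i, Measurable (U i)) (hK : ∀ i ω, |U i ω| ≤ K)
    (hind : iIndepFun U Q) (h0 : ∀ i, ∫ ω, U i ω ∂Q = 0)
    (h1 : ∑ i, ∫ ω, U i ω ^ 2 ∂Q = 1) {β : ℝ} (hβ0 : 0 < β) (hβ : ∑ i, ∫ ω, |U i ω| ^ 3 ∂Q ≤ β)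
    (hβ1 : β ≤ 1 / 16) (i : ι) (a : ℝ) {r : ℝ} (hr : 0 ≤ r) :
    (∫ ω, |∑ j, U j ω - U i ω| ∂Q ≤ 1) ∧
    Q.real {ω | |(∑ j, U j ω - U i ω) - a| ≤ r} ≤ 8 * β + 4 * r := by
  classical
  set ζ : ι → Ω → ℝ := fun j => if j = i then fun _ => 0 else U j with hζ
  have hζm : ∀ j, Measurable (ζ j) := fun j => by
    by_cases h : j = i
    · simp [hζ, h]
    · simpa [hζ, h] using hU j
  have hK0 : ∀ ω, 0 ≤ K := fun ω => (abs_nonneg _).trans (hK i ω)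
  have hζK : ∀ j ω, |ζ j ω| ≤ K := fun j ω => by
    by_cases h : j = i
    · simpa [hζ, h] using hK0 ω
    · simpa [hζ, h] using hK j ω
  have hζind : iIndepFun ζ Q := by
    have := hind.comp (fun j (z : ℝ) => if j = i then 0 else z) fun j => by
      by_cases h : j = i
      · simp [h]
      · simpa [h] using measurable_id'
    convert this using 1
    ext j ω
    by_cases h : j = i <;> simp [hζ, h]
  have hζ0 : ∀ j, ∫ ω, ζ j ω ∂Q = 0 := fun j => by
    by_cases h : j = i
    · simp [hζ, h]
    · simpa [hζ, h] using h0 j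
  have hsum : ∀ ω, ∑ j, ζ j ω = ∑ j, U j ω - U i ω := fun ω => by
    rw [← Finset.sum_erase_eq_sub (Finset.mem_univ i),
      ← Finset.add_sum_erase _ _ (Finset.mem_univ i)]
    simp only [hζ, if_true, zero_add]
    exact Finset.sum_congr rfl fun j hj => by rw [if_neg (Finset.ne_of_mem_erase hj)]
  have hζ2 : ∀ j, ∫ ω, ζ j ω ^ 2 ∂Q = ∫ ω, U j ω ^ 2 ∂Q - if j = i then ∫ ω, U i ω ^ 2 ∂Q else 0 := by
    intro j
    by_cases h : j = i
    · simp [hζ, h]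
    · simp [hζ, h]
  have hvar : ∑ j, ∫ ω, ζ j ω ^ 2 ∂Q = 1 - ∫ ω, U i ω ^ 2 ∂Q := by
    simp_rw [hζ2]
    rw [Finset.sum_sub_distrib, h1]
    simp
  have hUi : 0 ≤ ∫ ω, U i ω ^ 2 ∂Q := integral_nonneg fun ω => sq_nonneg _
  have hcube : ∀ j, ∫ ω, |ζ j ω| ^ 3 ∂Q ≤ ∫ ω, |U j ω| ^ 3 ∂Q := fun j => by
    by_cases h : j = i
    · simp only [hζ, h, if_true]
      simp only [abs_zero, ne_eq, OfNat.ofNat_ne_zero, not_false_eq_true, zero_pow, integral_zero]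
      exact integral_nonneg fun ω => by positivity
    · simp [hζ, h]
  have hi3 : ∫ ω, |U i ω| ^ 3 ∂Q ≤ β := le_trans
    (Finset.single_le_sum (f := fun j => ∫ ω, |U j ω| ^ 3 ∂Q)
      (fun j _ => integral_nonneg fun ω => by positivity) (Finset.mem_univ i)) hβ
  have hUi2 : ∫ ω, U i ω ^ 2 ∂Q ≤ 5 / 16 := by
    have : ∫ ω, U i ω ^ 2 ∂Q ≤ ∫ ω, (1 / 16 + 4 * |U i ω| ^ 3) ∂Q := by
      refine integral_mono (integrable_sq_of_abs_le (hU i) (hK i)) ((integrable_const _).add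
        ((integrable_abs_of_abs_le (hU i) (hK i) 3).const_mul 4)) fun ω => ?_
      simp only
      rw [← sq_abs]
      have hy := abs_nonneg (U i ω)
      set y := |U i ω|
      rcases le_total y (1 / 4) with h | h
      · nlinarith [pow_nonneg hy 3]
      · nlinarith [mul_nonneg (sq_nonneg y) (sub_nonneg.2 h)]
    rw [integral_add (integrable_const _)
      ((integrable_abs_of_abs_le (hU i) (hK i) 3).const_mul 4), integral_const_mul] at this
    simp only [integral_const, probReal_univ, smul_eq_mul, one_mul] at this
    linarith
  have hv : (1 / 4 : ℝ) ≤ ∑ j, ∫ ω, |ζ j ω| * min β |ζ j ω| ∂Q := by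
    have hj : ∀ j, ∫ ω, ζ j ω ^ 2 ∂Q - (∫ ω, |ζ j ω| ^ 3 ∂Q) / (4 * β)
        ≤ ∫ ω, |ζ j ω| * min β |ζ j ω| ∂Q := fun j => by
      rw [← integral_div, ← integral_sub (integrable_sq_of_abs_le (hζm j) (hζK j))
        ((integrable_abs_of_abs_le (hζm j) (hζK j) 3).div_const _)]
      refine integral_mono ((integrable_sq_of_abs_le (hζm j) (hζK j)).sub
        ((integrable_abs_of_abs_le (hζm j) (hζK j) 3).div_const _)) ?_
        fun ω => sq_sub_cube_le_abs_mul_min hβ0 _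
      refine integrable_of_abs_le (K := K * β) ?_ fun ω => ?_
      · have := hζm j
        fun_prop
      · rw [abs_mul, abs_abs, abs_of_nonneg (le_min hβ0.le (abs_nonneg _))]
        exact mul_le_mul (hζK j ω) (min_le_left _ _) (le_min hβ0.le (abs_nonneg _)) (hK0 ω)
    refine le_trans ?_ (Finset.sum_le_sum fun j _ => hj j)
    rw [Finset.sum_sub_distrib, hvar, ← Finset.sum_div]
    have h3 : (∑ j, ∫ ω, |ζ j ω| ^ 3 ∂Q) / (4 * β) ≤ 1 / 4 := by
      rw [div_le_iff₀ (by positivity)]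
      linarith [Finset.sum_le_sum fun j (_ : j ∈ Finset.univ) => hcube j]
    linarith
  have hT2 : ∫ ω, (∑ j, ζ j ω) ^ 2 ∂Q ≤ 1 := by
    rw [integral_sum_sq hζm hζK hζind hζ0, hvar]
    linarith
  have hTabs : ∫ ω, |∑ j, ζ j ω| ∂Q ≤ 1 :=
    integral_abs_le_one (Finset.measurable_fun_sum _ fun j _ => hζm j)
      (fun ω => abs_sum_le_card_mul fun j => hζK j ω) hT2
  have hpair : iIndepFun (fun j ω => (ζ j ω, (0 : ℝ))) Q :=
    hζind.comp (fun _ z => (z, (0 : ℝ))) fun _ => by fun_prop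
  have hmain := randomized_concentration (η := fun _ _ => 0) hζm (fun _ => measurable_const) hpair
    hζK hζ0 (by rw [hvar]; linarith) hβ0 hv (a := fun _ => a - r) (b := fun _ => a + r)
    measurable_const measurable_const (fun _ => by linarith) (K' := 2 * r)
    (fun _ => by linarith) (fun j => by simp)
  simp only [sub_self, abs_zero, add_zero, mul_zero, integral_zero, Finset.sum_const_zero] at hmain
  have e : ∀ ω, |∑ j, ζ j ω| * (a + r - (a - r)) = 2 * r * |∑ j, ζ j ω| := fun ω => by ring
  simp_rw [e] at hmain
  rw [integral_const_mul] at hmain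
  refine ⟨by simpa only [hsum] using hTabs, ?_⟩
  have hset : {ω | |(∑ j, U j ω - U i ω) - a| ≤ r}
      = {ω | a - r ≤ ∑ j, ζ j ω ∧ ∑ j, ζ j ω ≤ a + r} := by
    ext ω
    simp only [Set.mem_ofPred_eq, hsum, abs_le]
    constructor <;> rintro ⟨h1, h2⟩ <;> constructor <;> linarith
  rw [hset]
  nlinarith

/-- **Berry–Esseen bound** for intervals, for bounded independent summands. -/
theorem berry_esseen (hU : ∀ i, Measurable (U i)) (hK : ∀ i ω, |U i ω| ≤ K)
    (hind : iIndepFun U Q) (h0 : ∀ i, ∫ ω, U i ω ∂Q = 0)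
    (h1 : ∑ i, ∫ ω, U i ω ^ 2 ∂Q = 1) {β : ℝ} (hβ0 : 0 < β) (hβ : ∑ i, ∫ ω, |U i ω| ^ 3 ∂Q ≤ β)
    (a b : ℝ) :
    |Q.real {ω | a ≤ ∑ i, U i ω ∧ ∑ i, U i ω ≤ b} - gaussIcc a b| ≤ 60 * β := by
  classical
  rcases lt_or_ge (1 / 16) β with hbig | hβ1
  · have g1 : Q.real {ω | a ≤ ∑ i, U i ω ∧ ∑ i, U i ω ≤ b} ≤ 1 := measureReal_le_one
    have g2 : 0 ≤ Q.real {ω | a ≤ ∑ i, U i ω ∧ ∑ i, U i ω ≤ b} := measureReal_nonneg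
    have g3 := gaussIcc_nonneg a b
    have g4 := gaussIcc_le_one a b
    rw [abs_le]
    constructor <;> linarith
  set T : Ω → ℝ := fun ω => ∑ i, U i ω with hT
  have hTm : Measurable T := Finset.measurable_fun_sum _ fun i _ => hU i
  have hTK : ∀ ω, |T ω| ≤ Fintype.card ι * K := fun ω => abs_sum_le_card_mul fun i => hK i ω
  set f := steinSol a b with hf
  set f' := steinDeriv a b with hf'
  have hfm : Measurable f := (continuous_steinSol a b).measurable
  have hfm' : Measurable f' := measurable_steinDeriv a b
  have hfi' : ∀ V : Ω → ℝ, Measurable V → Integrable (fun ω => f' (V ω)) Q := fun V hV =>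
    integrable_of_abs_le (hfm'.comp hV) fun ω => abs_steinDeriv_le a b _
  have hUf : ∀ i (V : Ω → ℝ), Measurable V → Integrable (fun ω => U i ω * f (V ω)) Q :=
    fun i V hV => integrable_of_abs_le ((hU i).mul (hfm.comp hV)) (K := K * 3) fun ω => by
      rw [abs_mul]
      exact mul_le_mul (hK i ω) (abs_steinSol_le a b _) (abs_nonneg _)
        ((abs_nonneg _).trans (hK i ω))
  have hQ : Q.real {ω | a ≤ T ω ∧ T ω ≤ b} - gaussIcc a b
      = ∫ ω, f' (T ω) ∂Q - ∑ i, ∫ ω, U i ω * f (T ω) ∂Q := by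
    rw [← integral_finsetSum _ fun i _ => hUf i T hTm]
    have e1 : ∀ ω, f' (T ω) = ∑ i, U i ω * f (T ω) + centredIcc a b (T ω) := fun ω => by
      rw [hf', steinDeriv, ← Finset.sum_mul]
    have hci : Integrable (fun ω => centredIcc a b (T ω)) Q :=
      integrable_of_abs_le ((measurable_centredIcc a b).comp hTm) fun ω => abs_centredIcc_le a b _
    have e2 : ∫ ω, f' (T ω) ∂Q
        = ∫ ω, ∑ i, U i ω * f (T ω) ∂Q + ∫ ω, centredIcc a b (T ω) ∂Q := by
      rw [← integral_add (integrable_finsetSum _ fun i _ => hUf i T hTm) hci]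
      exact integral_congr_ae (Filter.Eventually.of_forall e1)
    rw [e2, add_sub_cancel_left]
    unfold centredIcc
    have hset : MeasurableSet {ω | a ≤ T ω ∧ T ω ≤ b} :=
      (measurableSet_le measurable_const hTm).inter (measurableSet_le hTm measurable_const)
    have e3 : ∀ ω, (Set.Icc a b).indicator (1 : ℝ → ℝ) (T ω)
        = ({ω | a ≤ T ω ∧ T ω ≤ b}.indicator 1 ω : ℝ) := fun ω => rfl
    simp_rw [e3]
    have hi : Integrable ({ω | a ≤ T ω ∧ T ω ≤ b}.indicator (1 : Ω → ℝ)) Q :=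
      (integrable_const (1 : ℝ)).indicator hset
    rw [integral_sub hi (integrable_const _), integral_indicator_one hset]
    simp
  have key : ∀ i, |(∫ ω, U i ω ^ 2 ∂Q) * ∫ ω, f' (T ω) ∂Q - ∫ ω, U i ω * f (T ω) ∂Q|
      ≤ 26 * ∫ ω, |U i ω| ^ 3 ∂Q + 32 * β * ∫ ω, U i ω ^ 2 ∂Q := by
    intro i
    set V : Ω → ℝ := fun ω => T ω - U i ω with hV
    have hVm : Measurable V := hTm.sub (hU i)
    have hVK : ∀ ω, |V ω| ≤ Fintype.card ι * K + K := fun ω =>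
      (abs_sub _ _).trans (add_le_add (hTK ω) (hK i ω))
    have hloo := fun c {r : ℝ} (hr : 0 ≤ r) =>
      concentration_leave_one_out hU hK hind h0 h1 hβ0 hβ hβ1 i c hr
    have hV1 : ∫ ω, |V ω| ∂Q ≤ 1 := (hloo 0 le_rfl).1
    have hindV : IndepFun (U i) V Q := by
      have := indepFun_sum_erase hU hind i
      convert this using 1
      ext ω
      rw [hV, hT]
      simp only
      rw [Finset.sum_erase_eq_sub (Finset.mem_univ i)]
    have hU2 := integrable_sq_of_abs_le (Q := Q) (hU i) (hK i)
    have hU3 := integrable_abs_of_abs_le (Q := Q) (hU i) (hK i) 3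
    have hU1 := (integrable_of_abs_le (Q := Q) (hU i) (hK i)).abs
    set n : Ω → ℝ := fun ω => nearEnds a b (V ω) |U i ω| with hn
    have hnearm : Measurable fun z : ℝ × ℝ => nearEnds a b z.2 |z.1| := by
      unfold nearEnds
      refine Measurable.add ?_ ?_ <;>
      exact Measurable.ite (measurableSet_le (by fun_prop) (by fun_prop)) measurable_const
        measurable_const
    have hnm : Measurable n := hnearm.comp ((hU i).prodMk hVm)
    have hn2 : ∀ ω, |n ω| ≤ 2 := fun ω => by
      rw [abs_of_nonneg (nearEnds_nonneg _ _ _ _)]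
      exact nearEnds_le_two _ _ _ _
    have hnear : ∀ r : ℝ, 0 ≤ r → ∫ ω, nearEnds a b (V ω) r ∂Q ≤ 16 * β + 8 * r := by
      intro r hr
      have hm : ∀ c, MeasurableSet {ω | |V ω - c| ≤ r} := fun c =>
        measurableSet_le (hVm.sub_const c).abs measurable_const
      have e : ∀ ω, nearEnds a b (V ω) r = {ω | |V ω - a| ≤ r}.indicator (1 : Ω → ℝ) ω
          + {ω | |V ω - b| ≤ r}.indicator 1 ω := fun ω => by
        simp [nearEnds, Set.indicator]
      simp_rw [e]
      have hi : ∀ c, Integrable ({ω | |V ω - c| ≤ r}.indicator (1 : Ω → ℝ)) Q := fun c =>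
        (integrable_const (1 : ℝ)).indicator (hm c)
      rw [integral_add (hi a) (hi b), integral_indicator_one (hm a), integral_indicator_one (hm b)]
      linarith [(hloo a hr).2, (hloo b hr).2]
    -- the two error terms, with the near-end contributions integrated by independence
    have t1 : ∫ ω, U i ω ^ 2 * n ω ∂Q ≤ 16 * β * ∫ ω, U i ω ^ 2 ∂Q + 8 * ∫ ω, |U i ω| ^ 3 ∂Q := by
      have := integral_le_of_indepFun (hU i) hVm hindV
        (F := fun z => z.1 ^ 2 * nearEnds a b z.2 |z.1|) ((measurable_fst.pow_const 2).mul hnearm)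
        (K := K ^ 2 * 2) (fun ω => by
          rw [abs_mul, abs_pow]
          exact mul_le_mul (pow_le_pow_left₀ (abs_nonneg _) (hK i ω) 2) (hn2 ω) (abs_nonneg _)
            (sq_nonneg _))
        (G := fun u => 16 * β * u ^ 2 + 8 * |u| ^ 3)
        ((hU2.const_mul _).add (hU3.const_mul _)) (by fun_prop) (fun u => by
          simp only
          rw [integral_const_mul]
          have := mul_le_mul_of_nonneg_left (hnear |u| (abs_nonneg u)) (sq_nonneg u)
          have e : u ^ 2 * |u| = |u| ^ 3 := by rw [← sq_abs]; ring
          nlinarith)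
      rw [integral_add (hU2.const_mul _) (hU3.const_mul _), integral_const_mul,
        integral_const_mul] at this
      exact this
    have t2 : ∫ ω, n ω ∂Q ≤ 16 * β + 8 * ∫ ω, |U i ω| ∂Q := by
      have := integral_le_of_indepFun (hU i) hVm hindV
        (F := fun z => nearEnds a b z.2 |z.1|) hnearm hn2
        (G := fun u => 16 * β + 8 * |u|)
        ((integrable_const _).add (hU1.const_mul _)) (by fun_prop) (fun u => hnear _ (abs_nonneg u))
      rw [integral_add (integrable_const _) (hU1.const_mul 8), integral_const_mul] at this
      simpa [integral_const_mul] using this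
    have hVi := (integrable_of_abs_le (Q := Q) hVm hVK).abs
    have hgi : Integrable (fun ω => 2 * |V ω| + 3) Q := (hVi.const_mul 2).add (integrable_const 3)
    have hg5 : ∫ ω, (2 * |V ω| + 3) ∂Q ≤ 5 := by
      rw [integral_add (hVi.const_mul 2) (integrable_const 3), integral_const_mul]
      simp only [integral_const, probReal_univ, smul_eq_mul, one_mul]
      linarith
    have hprod : ∀ p : ℕ, ∫ ω, |U i ω| ^ p * (2 * |V ω| + 3) ∂Q
        ≤ 5 * ∫ ω, |U i ω| ^ p ∂Q := fun p => by
      have h := (hindV.comp (φ := fun u => |u| ^ p) (ψ := fun v => 2 * |v| + 3) (by fun_prop)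
        (by fun_prop)).integral_mul_eq_mul_integral
        (((hU i).abs.pow_const p).aestronglyMeasurable)
        (((hVm.abs.const_mul 2).add_const 3).aestronglyMeasurable)
      have h' : ∫ ω, |U i ω| ^ p * (2 * |V ω| + 3) ∂Q
          = (∫ ω, |U i ω| ^ p ∂Q) * ∫ ω, (2 * |V ω| + 3) ∂Q := h
      rw [h', mul_comm]
      exact mul_le_mul_of_nonneg_right hg5 (integral_nonneg fun ω => by positivity)
    have hpi : ∀ p : ℕ, Integrable (fun ω => |U i ω| ^ p * (2 * |V ω| + 3)) Q := fun p =>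
      integrable_of_abs_le (((hU i).abs.pow_const p).mul ((hVm.abs.const_mul 2).add_const 3))
        (K := K ^ p * (2 * (Fintype.card ι * K + K) + 3)) fun ω => by
          rw [abs_mul, abs_pow, abs_abs]
          refine mul_le_mul (pow_le_pow_left₀ (abs_nonneg _) (hK i ω) p) ?_ (abs_nonneg _)
            (pow_nonneg ((abs_nonneg _).trans (hK i ω)) p)
          rw [abs_of_nonneg (by positivity)]
          linarith [hVK ω]
    have hUn : Integrable (fun ω => U i ω ^ 2 * n ω) Q :=
      integrable_of_abs_le (((hU i).pow_const 2).mul hnm) (K := K ^ 2 * 2) fun ω => by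
        rw [abs_mul, abs_pow]
        exact mul_le_mul (pow_le_pow_left₀ (abs_nonneg _) (hK i ω) 2) (hn2 ω) (abs_nonneg _)
          (sq_nonneg _)
    have hni : Integrable n Q := integrable_of_abs_le hnm hn2
    have s1 : |∫ ω, U i ω * f (T ω) ∂Q - ∫ ω, U i ω ^ 2 * f' (V ω) ∂Q|
        ≤ 5 * ∫ ω, |U i ω| ^ 3 ∂Q + ∫ ω, U i ω ^ 2 * n ω ∂Q := by
      have hz : ∫ ω, U i ω * f (V ω) ∂Q = 0 := by
        have h := (hindV.comp measurable_id hfm).integral_mul_eq_mul_integral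
          (hU i).aestronglyMeasurable (hfm.comp hVm).aestronglyMeasurable
        have h' : ∫ ω, U i ω * f (V ω) ∂Q = (∫ ω, U i ω ∂Q) * ∫ ω, f (V ω) ∂Q := h
        rw [h', h0 i, zero_mul]
      have hi2 : Integrable (fun ω => U i ω ^ 2 * f' (V ω)) Q :=
        integrable_of_abs_le (((hU i).pow_const 2).mul (hfm'.comp hVm)) (K := K ^ 2 * 2) fun ω => by
          rw [abs_mul, abs_pow]
          exact mul_le_mul (pow_le_pow_left₀ (abs_nonneg _) (hK i ω) 2) (abs_steinDeriv_le a b _)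
            (abs_nonneg _) (sq_nonneg _)
      have hd : Integrable (fun ω => U i ω * f (T ω) - U i ω * f (V ω)) Q :=
        (hUf i T hTm).sub (hUf i V hVm)
      have e : ∫ ω, U i ω * f (T ω) ∂Q - ∫ ω, U i ω ^ 2 * f' (V ω) ∂Q
          = ∫ ω, (U i ω * f (T ω) - U i ω * f (V ω) - U i ω ^ 2 * f' (V ω)) ∂Q := by
        rw [integral_sub hd hi2, integral_sub (hUf i T hTm) (hUf i V hVm), hz, sub_zero]
      rw [e]
      refine (abs_integral_le_integral_abs).trans ?_
      have hle : ∫ ω, |U i ω * f (T ω) - U i ω * f (V ω) - U i ω ^ 2 * f' (V ω)| ∂Q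
          ≤ ∫ ω, (|U i ω| ^ 3 * (2 * |V ω| + 3) + U i ω ^ 2 * n ω) ∂Q := by
        refine integral_mono (hd.sub hi2).abs ((hpi 3).add hUn) fun ω => ?_
        have hTV : T ω = V ω + U i ω := by simp [hV]
        have h := abs_steinSol_taylor a b (V ω) (U i ω)
        simp only
        have e2 : U i ω * f (T ω) - U i ω * f (V ω) - U i ω ^ 2 * f' (V ω)
            = U i ω * (f (V ω + U i ω) - f (V ω) - U i ω * f' (V ω)) := by rw [hTV]; ring
        rw [e2, abs_mul]
        refine (mul_le_mul_of_nonneg_left h (abs_nonneg _)).trans (le_of_eq ?_)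
        rw [← sq_abs (U i ω)]
        ring
      rw [integral_add (hpi 3) hUn] at hle
      linarith [hprod 3]
    have s2 : |∫ ω, f' (T ω) ∂Q - ∫ ω, f' (V ω) ∂Q|
        ≤ 5 * ∫ ω, |U i ω| ∂Q + ∫ ω, n ω ∂Q := by
      rw [← integral_sub (hfi' T hTm) (hfi' V hVm)]
      refine (abs_integral_le_integral_abs).trans ?_
      have hle : ∫ ω, |f' (T ω) - f' (V ω)| ∂Q
          ≤ ∫ ω, (|U i ω| ^ 1 * (2 * |V ω| + 3) + n ω) ∂Q := by
        refine integral_mono ((hfi' T hTm).sub (hfi' V hVm)).abs ((hpi 1).add hni) fun ω => ?_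
        have h := abs_steinDeriv_sub_le (a := a) (b := b) (v := T ω) (w := V ω) (r := |U i ω|)
          (by simp [hV])
        simp only
        rw [pow_one, mul_comm]
        exact h
      rw [integral_add (hpi 1) hni] at hle
      have := hprod 1
      simp only [pow_one] at this hle
      linarith
    have s3 : ∫ ω, U i ω ^ 2 * f' (V ω) ∂Q = (∫ ω, U i ω ^ 2 ∂Q) * ∫ ω, f' (V ω) ∂Q := by
      have h := (hindV.comp (φ := fun u => u ^ 2) (by fun_prop) hfm').integral_mul_eq_mul_integral
        ((hU i).pow_const 2).aestronglyMeasurable (hfm'.comp hVm).aestronglyMeasurable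
      exact h
    have hassoc := integral_sq_mul_integral_abs_le (Q := Q) (hU i) (hK i)
    have hU2nn : 0 ≤ ∫ ω, U i ω ^ 2 ∂Q := integral_nonneg fun ω => sq_nonneg _
    have e : (∫ ω, U i ω ^ 2 ∂Q) * ∫ ω, f' (T ω) ∂Q - ∫ ω, U i ω * f (T ω) ∂Q
        = (∫ ω, U i ω ^ 2 ∂Q) * (∫ ω, f' (T ω) ∂Q - ∫ ω, f' (V ω) ∂Q)
          - (∫ ω, U i ω * f (T ω) ∂Q - ∫ ω, U i ω ^ 2 * f' (V ω) ∂Q) := by rw [s3]; ring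
    rw [e]
    refine (abs_sub _ _).trans ?_
    rw [abs_mul, abs_of_nonneg hU2nn]
    have s4 := mul_le_mul_of_nonneg_left
      (s2.trans (add_le_add_right t2 (5 * ∫ ω, |U i ω| ∂Q))) hU2nn
    nlinarith
  rw [hQ]
  have e : ∫ ω, f' (T ω) ∂Q - ∑ i, ∫ ω, U i ω * f (T ω) ∂Q
      = ∑ i, ((∫ ω, U i ω ^ 2 ∂Q) * ∫ ω, f' (T ω) ∂Q - ∫ ω, U i ω * f (T ω) ∂Q) := by
    rw [Finset.sum_sub_distrib, ← Finset.sum_mul, h1, one_mul]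
  rw [e]
  refine (Finset.abs_sum_le_sum_abs _ _).trans ?_
  refine (Finset.sum_le_sum fun i _ => key i).trans ?_
  rw [Finset.sum_add_distrib, ← Finset.mul_sum, ← Finset.mul_sum, h1]
  linarith

end BerryEsseen

/-! ### Exponentially weighted half lines -/

section Mills

/-- The weight `e^{-y w}` on the half line `w ≥ 0`. -/
noncomputable def expTail (y w : ℝ) : ℝ := (Set.Ici 0).indicator (fun w => Real.exp (-y * w)) w

lemma measurable_expTail (y : ℝ) : Measurable (expTail y) :=
  Measurable.indicator (by fun_prop) measurableSet_Ici

lemma expTail_nonneg (y w : ℝ) : 0 ≤ expTail y w :=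
  Set.indicator_nonneg (fun _ _ => (Real.exp_pos _).le) _

lemma expTail_le_one {y : ℝ} (hy : 0 ≤ y) (w : ℝ) : expTail y w ≤ 1 := by
  unfold expTail
  by_cases hw : w ∈ Set.Ici (0 : ℝ)
  · rw [Set.indicator_of_mem hw]
    have : (0 : ℝ) ≤ w := hw
    exact Real.exp_le_one_iff.2 (by nlinarith)
  · rw [Set.indicator_of_notMem hw]
    exact zero_le_one

lemma abs_expTail_le_one {y : ℝ} (hy : 0 ≤ y) (w : ℝ) : |expTail y w| ≤ 1 := by
  rw [abs_of_nonneg (expTail_nonneg y w)]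
  exact expTail_le_one hy w

lemma expTail_of_nonneg {y w : ℝ} (hw : 0 ≤ w) : expTail y w = Real.exp (-y * w) :=
  Set.indicator_of_mem (s := Set.Ici (0 : ℝ)) hw _

lemma expTail_of_neg {y w : ℝ} (hw : w < 0) : expTail y w = 0 :=
  Set.indicator_of_notMem (s := Set.Ici (0 : ℝ)) (fun h => absurd h (not_le.2 hw)) _

/-- The quantity `e^{y²/2} (1 - Φ y)`, which is the Mills ratio divided by `√(2π)`, written as an
exponential moment of the standard normal law restricted to the half line. -/
noncomputable def mills (y : ℝ) : ℝ := ∫ w, expTail y w ∂(gaussianReal 0 1)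

lemma le_expTail_iff {y w r : ℝ} (hy : 0 < y) (hr : 0 < r) :
    r ≤ expTail y w ↔ 0 ≤ w ∧ w ≤ -Real.log r / y := by
  rcases lt_or_ge w 0 with hw | hw
  · rw [expTail_of_neg hw]
    constructor
    · intro h
      linarith
    · rintro ⟨h, -⟩
      linarith
  · rw [expTail_of_nonneg hw, ← Real.log_le_iff_le_exp hr, le_div_iff₀ hy]
    constructor
    · intro h
      exact ⟨hw, by linarith⟩
    · rintro ⟨-, h⟩
      linarith

lemma layer_cake_expTail {Ω : Type*} [MeasurableSpace Ω] (P : Measure Ω) [IsProbabilityMeasure P]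
    {V : Ω → ℝ} (hV : Measurable V) {y : ℝ} (hy : 0 ≤ y) :
    ∫ ω, expTail y (V ω) ∂P = ∫ r in Set.Ioc (0 : ℝ) 1, P.real {ω | r ≤ expTail y (V ω)} ∧
      IntegrableOn (fun r => P.real {ω | r ≤ expTail y (V ω)}) (Set.Ioc 0 1) := by
  have hi : Integrable (fun ω => expTail y (V ω)) P :=
    integrable_of_abs_le ((measurable_expTail y).comp hV) fun ω => abs_expTail_le_one hy _
  constructor
  · rw [hi.integral_eq_integral_meas_le (Filter.Eventually.of_forall fun ω => expTail_nonneg y _)]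
    refine setIntegral_eq_of_subset_of_forall_sdiff_eq_zero measurableSet_Ioi
      Set.Ioc_subset_Ioi_self fun r hr => ?_
    have hr1 : 1 < r := by
      by_contra hc
      exact hr.2 ⟨hr.1, not_lt.1 hc⟩
    have : {ω | r ≤ expTail y (V ω)} = ∅ := by
      ext ω
      simp only [Set.mem_ofPred_eq, Set.mem_empty_iff_false, iff_false, not_le]
      exact (expTail_le_one hy _).trans_lt hr1
    rw [this, measureReal_empty]
  · have hanti : Antitone fun r => P.real {ω | r ≤ expTail y (V ω)} := fun r s hrs =>
      measureReal_mono (fun ω (hω : s ≤ expTail y (V ω)) => hrs.trans hω)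
    refine Integrable.of_bound hanti.measurable.aestronglyMeasurable 1
      (Filter.Eventually.of_forall fun r => ?_)
    rw [Real.norm_eq_abs, abs_of_nonneg measureReal_nonneg]
    exact measureReal_le_one

/-- By the layer-cake formula, closeness to the normal law on intervals carries over to
exponentially weighted half lines. -/
lemma abs_integral_expTail_sub_mills_le {Ω : Type*} [MeasurableSpace Ω] {Q : Measure Ω}
    [IsProbabilityMeasure Q] {T : Ω → ℝ} (hT : Measurable T) {y η : ℝ} (hy : 0 < y)
    (h : ∀ b, |Q.real {ω | 0 ≤ T ω ∧ T ω ≤ b} - gaussIcc 0 b| ≤ η) :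
    |∫ ω, expTail y (T ω) ∂Q - mills y| ≤ η := by
  obtain ⟨e1, i1⟩ := layer_cake_expTail Q hT hy.le
  obtain ⟨e2, i2⟩ := layer_cake_expTail (gaussianReal 0 1) measurable_id' hy.le
  rw [mills, e1, e2, ← integral_sub i1 i2]
  refine (abs_integral_le_integral_abs).trans ?_
  calc ∫ r in Set.Ioc (0 : ℝ) 1, |Q.real {ω | r ≤ expTail y (T ω)}
        - (gaussianReal 0 1).real {w | r ≤ expTail y w}|
      ≤ ∫ _r in Set.Ioc (0 : ℝ) 1, η := by
        refine setIntegral_mono_on (i1.sub i2).abs (integrable_const _) measurableSet_Ioc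
          fun r hr => ?_
        have := h (-Real.log r / y)
        rw [gaussIcc] at this
        have s1 : {ω | r ≤ expTail y (T ω)} = {ω | 0 ≤ T ω ∧ T ω ≤ -Real.log r / y} := by
          ext ω
          exact le_expTail_iff hy hr.1
        have s2 : {w | r ≤ expTail y w} = Set.Icc 0 (-Real.log r / y) := by
          ext ω
          exact le_expTail_iff hy hr.1
        rw [s1, s2]
        exact this
    _ = η := by simp

/-- A variable that puts mass at most `p` on every unit interval `[k, k + 1]` has exponentially
weighted mass at most `2 p` on the half line. -/
lemma integral_expTail_le_of_unit_intervals {Ω : Type*} [MeasurableSpace Ω] {Q : Measure Ω}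
    [IsProbabilityMeasure Q] {T : Ω → ℝ} (hT : Measurable T) {p : ℝ}
    (h : ∀ k : ℕ, Q.real {ω | (k : ℝ) ≤ T ω ∧ T ω ≤ k + 1} ≤ p) :
    ∫ ω, expTail 1 (T ω) ∂Q ≤ 2 * p := by
  have hp : 0 ≤ p := measureReal_nonneg.trans (h 0)
  set D : ℕ → Set Ω := fun k => {ω | (k : ℝ) ≤ T ω ∧ T ω ≤ k + 1} with hD
  have hDm : ∀ k, MeasurableSet (D k) := fun k =>
    (measurableSet_le measurable_const hT).inter (measurableSet_le hT measurable_const)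
  set q : ℝ := Real.exp (-1) with hq
  have hq0 : 0 < q := Real.exp_pos _
  have hq1 : q ≤ 1 / 2 := by
    have := Real.add_one_le_exp (1 : ℝ)
    rw [hq, Real.exp_neg]
    rw [inv_le_comm₀ (Real.exp_pos _) (by norm_num)]
    linarith
  have hqk : ∀ k : ℕ, Real.exp (-(k : ℝ)) = q ^ k := fun k => by
    rw [hq, ← Real.exp_nat_mul]
    ring_nf
  have hm : ∀ m : ℕ, ∫ ω, expTail 1 (T ω) ∂Q ≤ 2 * p + q ^ m := by
    intro m
    have hi : ∀ k, Integrable ((D k).indicator fun _ => q ^ k) Q := fun k =>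
      (integrable_const _).indicator (hDm k)
    have h1 : ∫ ω, expTail 1 (T ω) ∂Q
        ≤ ∫ ω, (∑ k ∈ Finset.range m, (D k).indicator (fun _ => q ^ k) ω + q ^ m) ∂Q := by
      refine integral_mono (integrable_of_abs_le ((measurable_expTail 1).comp hT) fun ω =>
        abs_expTail_le_one zero_le_one _) ((integrable_finsetSum _ fun k _ => hi k).add
        (integrable_const _)) fun ω => ?_
      have hnn : ∀ k, 0 ≤ (D k).indicator (fun _ => q ^ k) ω := fun k =>
        Set.indicator_nonneg (fun _ _ => by positivity) _
      have hs : 0 ≤ ∑ k ∈ Finset.range m, (D k).indicator (fun _ => q ^ k) ω :=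
        Finset.sum_nonneg fun k _ => hnn k
      simp only
      rcases lt_or_ge (T ω) 0 with hneg | hpos
      · rw [expTail_of_neg hneg]
        positivity
      rw [expTail_of_nonneg hpos]
      rcases lt_or_ge (T ω) m with hlt | hge
      · have hk : ⌊T ω⌋₊ < m := (Nat.floor_lt hpos).2 hlt
        have hmem : ω ∈ D ⌊T ω⌋₊ := ⟨Nat.floor_le hpos, (Nat.lt_floor_add_one _).le⟩
        have := Finset.single_le_sum (f := fun k => (D k).indicator (fun _ => q ^ k) ω)
          (fun k _ => hnn k) (Finset.mem_range.2 hk)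
        simp only [Set.indicator_of_mem hmem] at this
        have h2 : Real.exp (-1 * T ω) ≤ q ^ ⌊T ω⌋₊ := by
          rw [← hqk]
          exact Real.exp_le_exp.2 (by linarith [Nat.floor_le hpos])
        have : 0 ≤ q ^ m := by positivity
        linarith
      · have : Real.exp (-1 * T ω) ≤ q ^ m := by
          rw [← hqk]
          exact Real.exp_le_exp.2 (by linarith)
        linarith
    rw [integral_add (integrable_finsetSum _ fun k _ => hi k) (integrable_const _),
      integral_finsetSum _ fun k _ => hi k] at h1
    simp only [integral_const, probReal_univ, smul_eq_mul, one_mul] at h1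
    refine h1.trans (add_le_add_left ?_ _)
    calc ∑ k ∈ Finset.range m, ∫ ω, (D k).indicator (fun _ => q ^ k) ω ∂Q
        ≤ ∑ k ∈ Finset.range m, p * q ^ k := by
          refine Finset.sum_le_sum fun k _ => ?_
          rw [integral_indicator_const _ (hDm k), smul_eq_mul]
          exact mul_le_mul_of_nonneg_right (h k) (by positivity)
      _ = p * ∑ k ∈ Finset.range m, q ^ k := by rw [Finset.mul_sum]
      _ ≤ p * 2 := by
          refine mul_le_mul_of_nonneg_left ?_ hp
          have hg := geom_sum_eq (x := q) (by linarith) m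
          rw [hg, div_le_iff_of_neg (by linarith)]
          have : 0 ≤ q ^ m := by positivity
          linarith
      _ = 2 * p := mul_comm _ _
  have hlim : Filter.Tendsto (fun m : ℕ => 2 * p + q ^ m) Filter.atTop (nhds (2 * p + 0)) :=
    tendsto_const_nhds.add (tendsto_pow_atTop_nhds_zero_of_lt_one hq0.le (by linarith))
  rw [add_zero] at hlim
  exact ge_of_tendsto' hlim hm

lemma gaussianPDFReal_std (w : ℝ) :
    gaussianPDFReal 0 1 w = (√(2 * Real.pi))⁻¹ * Real.exp (-w ^ 2 / 2) := by
  simp [gaussianPDFReal]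

lemma inv_sqrt_two_pi_le_half : (√(2 * Real.pi))⁻¹ ≤ 1 / 2 := by
  rw [inv_le_comm₀ (by positivity) (by norm_num)]
  refine Real.le_sqrt_of_sq_le ?_
  nlinarith [Real.pi_gt_three]

lemma third_le_inv_sqrt_two_pi : 1 / 3 ≤ (√(2 * Real.pi))⁻¹ := by
  rw [le_inv_comm₀ (by norm_num) (by positivity)]
  linarith [sqrt_two_pi_le_three]

lemma one_sub_Phi_eq (y : ℝ) : 1 - Phi y = Real.exp (-y ^ 2 / 2) * mills y := by
  have e1 : 1 - Phi y = ∫ w in Set.Ici y, gaussianPDFReal 0 1 w := by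
    unfold Phi
    rw [cdf_eq_real]
    have h := probReal_compl_eq_one_sub (μ := gaussianReal 0 1) (measurableSet_Iic (a := y))
    rw [← h, Set.compl_Iic, measureReal_def, gaussianReal_apply_eq_integral _ (by norm_num),
      ENNReal.toReal_ofReal (integral_nonneg fun w => gaussianPDFReal_nonneg _ _ _),
      integral_Ici_eq_integral_Ioi]
  have e2 : mills y = ∫ w in Set.Ici (0 : ℝ), Real.exp (y ^ 2 / 2) * gaussianPDFReal 0 1 (w + y) := by
    unfold mills
    rw [integral_gaussianReal_eq_integral_smul (by norm_num), ← integral_indicator measurableSet_Ici]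
    congr 1
    ext w
    by_cases hw : w ∈ Set.Ici (0 : ℝ)
    · have hw' : (0 : ℝ) ≤ w := hw
      rw [Set.indicator_of_mem hw, expTail_of_nonneg hw', smul_eq_mul, gaussianPDFReal_std,
        gaussianPDFReal_std]
      have : Real.exp (-w ^ 2 / 2) * Real.exp (-y * w)
          = Real.exp (y ^ 2 / 2) * Real.exp (-(w + y) ^ 2 / 2) := by
        rw [← Real.exp_add, ← Real.exp_add]
        congr 1
        ring
      linear_combination (√(2 * Real.pi))⁻¹ * this
    · rw [Set.indicator_of_notMem hw, expTail_of_neg (not_le.1 hw), smul_zero]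
  have e3 : ∫ w in Set.Ici (0 : ℝ), gaussianPDFReal 0 1 (w + y)
      = ∫ w in Set.Ici y, gaussianPDFReal 0 1 w := by
    rw [← integral_indicator measurableSet_Ici, ← integral_indicator measurableSet_Ici,
      ← integral_add_right_eq_self ((Set.Ici y).indicator (gaussianPDFReal 0 1)) y]
    congr 1
    ext w
    simp [Set.indicator]
  rw [e1, e2, integral_const_mul, e3, ← mul_assoc, ← Real.exp_add]
  ring_nf
  simp

lemma le_gaussIcc {r : ℝ} (hr0 : 0 ≤ r) (hr1 : r ≤ 1) : r / 6 ≤ gaussIcc 0 r := by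
  unfold gaussIcc
  rw [measureReal_def, gaussianReal_apply_eq_integral _ (by norm_num),
    ENNReal.toReal_ofReal (integral_nonneg fun w => gaussianPDFReal_nonneg _ _ _)]
  calc r / 6 = ∫ _w in Set.Icc 0 r, (1 / 6 : ℝ) := by simp [hr0]; ring
    _ ≤ ∫ w in Set.Icc 0 r, gaussianPDFReal 0 1 w := by
      refine setIntegral_mono_on (by simp) (integrable_gaussianPDFReal 0 1).integrableOn
        measurableSet_Icc fun w hw => ?_
      rw [gaussianPDFReal_std]
      have h1 : (1 / 2 : ℝ) ≤ Real.exp (-w ^ 2 / 2) := by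
        have := Real.add_one_le_exp (-w ^ 2 / 2)
        nlinarith [hw.1, hw.2]
      nlinarith [third_le_inv_sqrt_two_pi, Real.exp_pos (-w ^ 2 / 2)]

lemma integrable_expTail_gauss {y : ℝ} (hy : 0 ≤ y) :
    Integrable (expTail y) (gaussianReal 0 1) :=
  integrable_of_abs_le (measurable_expTail y) (abs_expTail_le_one hy)

lemma le_mills {y : ℝ} (hy : 0 ≤ y) : 1 / (20 * (1 + y)) ≤ mills y := by
  set r := 1 / (1 + y) with hr
  have hr0 : 0 ≤ r := by positivity
  have hr1 : r ≤ 1 := by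
    rw [hr, div_le_one (by positivity)]
    linarith
  have hyr : y * r ≤ 1 := by
    rw [hr, mul_one_div, div_le_one (by positivity)]
    linarith
  have he : (1 / 3 : ℝ) ≤ Real.exp (-1) := by
    rw [Real.exp_neg, le_inv_comm₀ (by norm_num) (Real.exp_pos _)]
    linarith [Real.exp_one_lt_d9]
  have h1 : ∫ w, (Set.Icc 0 r).indicator (fun _ => (1 / 3 : ℝ)) w ∂(gaussianReal 0 1) ≤ mills y := by
    refine integral_mono ((integrable_const _).indicator measurableSet_Icc)
      (integrable_expTail_gauss hy) fun w => ?_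
    by_cases hw : w ∈ Set.Icc 0 r
    · rw [Set.indicator_of_mem hw, expTail_of_nonneg hw.1]
      refine he.trans (Real.exp_le_exp.2 ?_)
      nlinarith [hw.2]
    · rw [Set.indicator_of_notMem hw]
      exact expTail_nonneg _ _
  rw [integral_indicator_const _ measurableSet_Icc, smul_eq_mul] at h1
  have h2 := le_gaussIcc hr0 hr1
  unfold gaussIcc at h2
  have : 1 / (20 * (1 + y)) = r / 20 := by rw [hr]; field_simp
  rw [this]
  linarith

lemma mills_pos {y : ℝ} (hy : 0 ≤ y) : 0 < mills y :=
  lt_of_lt_of_le (by positivity) (le_mills hy)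

lemma mul_exp_neg_le {m w : ℝ} (hm : 0 < m) :
    w * Real.exp (-m * w) ≤ 1 / m * Real.exp (-(m / 2) * w) := by
  have h1 : Real.exp (-m * w) = Real.exp (-(m / 2) * w) * Real.exp (-(m / 2) * w) := by
    rw [← Real.exp_add]; ring_nf
  have h2 : m * w * Real.exp (-(m / 2) * w) ≤ 1 := by
    have h3 := Real.add_one_le_exp (m / 2 * w - 1)
    have h4 : Real.exp (-(m / 2) * w) * Real.exp (m / 2 * w - 1) = Real.exp (-1) := by
      rw [← Real.exp_add]; ring_nf
    have h5 : Real.exp (-1) ≤ 1 / 2 := by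
      have := Real.add_one_le_exp (1 : ℝ)
      rw [Real.exp_neg, inv_le_comm₀ (Real.exp_pos _) (by norm_num)]
      linarith
    nlinarith [Real.exp_pos (-(m / 2) * w)]
  rw [h1, ← mul_assoc]
  refine mul_le_mul_of_nonneg_right ?_ (Real.exp_pos _).le
  rw [le_div_iff₀ hm]
  linarith

/-- The derivative of the Mills ratio in `m` is, up to sign, this integral. -/
lemma integral_mul_expTail_le {m : ℝ} (hm : 0 ≤ m) :
    Integrable (fun w => w * expTail m w) (gaussianReal 0 1) ∧
    ∫ w, w * expTail m w ∂(gaussianReal 0 1) ≤ 4 / (1 + m) ^ 2 := by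
  have hL2 : MemLp (fun w : ℝ => w) 2 (gaussianReal 0 1) := memLp_id_gaussianReal 2
  have hid : Integrable (fun w : ℝ => w) (gaussianReal 0 1) := hL2.integrable (by norm_num)
  have hsq : Integrable (fun w : ℝ => w ^ 2) (gaussianReal 0 1) := hL2.integrable_sq
  have hi : Integrable (fun w => w * expTail m w) (gaussianReal 0 1) := by
    refine hid.mono (measurable_id.mul (measurable_expTail m)).aestronglyMeasurable
      (Filter.Eventually.of_forall fun w => ?_)
    rw [norm_mul]
    exact mul_le_of_le_one_right (norm_nonneg _) (abs_expTail_le_one hm w)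
  refine ⟨hi, ?_⟩
  rcases le_total m 1 with h | h
  · have h1 : ∫ w, w * expTail m w ∂(gaussianReal 0 1) ≤ 1 := by
      have hv := variance_of_integral_eq_zero (X := fun w : ℝ => w) (μ := gaussianReal 0 1)
        measurable_id.aemeasurable integral_id_gaussianReal
      rw [variance_fun_id_gaussianReal] at hv
      calc ∫ w, w * expTail m w ∂(gaussianReal 0 1)
          ≤ ∫ w : ℝ, (w ^ 2 + 1) / 2 ∂(gaussianReal 0 1) := by
            refine integral_mono hi ((hsq.add (integrable_const 1)).div_const 2) fun w => ?_
            simp only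
            have := expTail_le_one hm w
            have := expTail_nonneg m w
            rcases le_total 0 w with hw | hw
            · nlinarith [sq_nonneg (w - 1)]
            · nlinarith [sq_nonneg (w - 1)]
        _ = 1 := by
            rw [integral_div, integral_add hsq (integrable_const 1), ← hv]
            simp
    refine h1.trans ?_
    rw [le_div_iff₀ (by positivity)]
    nlinarith
  · have hm0 : 0 < m := by linarith
    have hexp : IntegrableOn (fun w : ℝ => Real.exp (-(m / 2) * w)) (Set.Ioi 0) :=
      exp_neg_integrableOn_Ioi 0 (by linarith)
    have hi' : Integrable (fun w => gaussianPDFReal 0 1 w * (w * expTail m w)) := by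
      refine (Integrable.mono' (g := fun w => |w| * gaussianPDFReal 0 1 w) ?_ ?_ ?_)
      · have := (integrable_mul_exp_neg_mul_sq (b := 1 / 2) (by norm_num)).abs
        refine (this.const_mul (√(2 * Real.pi))⁻¹).congr (Filter.Eventually.of_forall fun w => ?_)
        simp only [gaussianPDFReal_std]
        rw [abs_mul, abs_of_pos (Real.exp_pos _), show -(1 / 2) * w ^ 2 = -w ^ 2 / 2 by ring]
        ring
      · exact ((measurable_gaussianPDFReal 0 1).mul
          (measurable_id.mul (measurable_expTail m))).aestronglyMeasurable
      · refine Filter.Eventually.of_forall fun w => ?_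
        rw [Real.norm_eq_abs, abs_mul, abs_mul, abs_of_nonneg (gaussianPDFReal_nonneg 0 1 w),
          mul_comm]
        refine mul_le_mul_of_nonneg_right ?_ (gaussianPDFReal_nonneg 0 1 w)
        exact mul_le_of_le_one_right (abs_nonneg _) (abs_expTail_le_one hm w)
    rw [integral_gaussianReal_eq_integral_smul (by norm_num)]
    calc ∫ w, gaussianPDFReal 0 1 w • (w * expTail m w)
        ≤ ∫ w, (Set.Ioi 0).indicator (fun w => 1 / 2 * (1 / m) * Real.exp (-(m / 2) * w)) w := by
          refine integral_mono hi' ((integrable_indicator_iff measurableSet_Ioi).2 (hexp.const_mul _))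
            fun w => ?_
          rcases le_or_gt w 0 with hw | hw
          · rw [Set.indicator_of_notMem (s := Set.Ioi (0 : ℝ)) (not_lt.2 hw), smul_eq_mul]
            exact mul_nonpos_of_nonneg_of_nonpos (gaussianPDFReal_nonneg 0 1 w)
              (mul_nonpos_of_nonpos_of_nonneg hw (expTail_nonneg m w))
          · rw [Set.indicator_of_mem (s := Set.Ioi (0 : ℝ)) hw, smul_eq_mul, gaussianPDFReal_std,
              expTail_of_nonneg hw.le]
            have h1 := mul_exp_neg_le (w := w) hm0
            have h2 : (√(2 * Real.pi))⁻¹ * Real.exp (-w ^ 2 / 2) ≤ 1 / 2 := by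
              have : Real.exp (-w ^ 2 / 2) ≤ 1 := Real.exp_le_one_iff.2 (by nlinarith [sq_nonneg w])
              have h0 : 0 < (√(2 * Real.pi))⁻¹ := by positivity
              nlinarith [inv_sqrt_two_pi_le_half]
            rw [mul_assoc (1 / 2 : ℝ)]
            exact mul_le_mul h2 h1 (mul_nonneg hw.le (Real.exp_pos _).le) (by norm_num)
      _ = 1 / m ^ 2 := by
          rw [integral_indicator measurableSet_Ioi, integral_const_mul,
            integral_exp_mul_Ioi (by linarith)]
          simp
          field_simp
      _ ≤ 4 / (1 + m) ^ 2 := by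
          rw [div_le_div_iff₀ (by positivity) (by positivity)]
          nlinarith

/-- The Mills ratio is relatively Lipschitz with constant `O (1 / (1 + m))`, since it is itself of
order `1 / (1 + m)`. -/
lemma abs_mills_sub_le {m y z : ℝ} (hm : 0 ≤ m) (hy : m ≤ y) (hz : m ≤ z) :
    |mills y - mills z| ≤ 4 / (1 + m) ^ 2 * |y - z| := by
  obtain ⟨hi, hle⟩ := integral_mul_expTail_le hm
  unfold mills
  rw [← integral_sub (integrable_expTail_gauss (hm.trans hy)) (integrable_expTail_gauss (hm.trans hz))]
  refine (abs_integral_le_integral_abs).trans ?_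
  have hpt : ∀ w, |expTail y w - expTail z w| ≤ |y - z| * (w * expTail m w) := by
    have key : ∀ {y z : ℝ}, m ≤ y → y ≤ z → ∀ w,
        |expTail y w - expTail z w| ≤ |y - z| * (w * expTail m w) := by
      intro y z hy hyz w
      rcases lt_or_ge w 0 with hw | hw
      · simp [expTail_of_neg hw]
      rw [expTail_of_nonneg hw, expTail_of_nonneg hw, expTail_of_nonneg hw,
        abs_of_nonneg (sub_nonneg.2 (Real.exp_le_exp.2 (by nlinarith))), abs_sub_comm,
        abs_of_nonneg (sub_nonneg.2 hyz)]
      have h1 : Real.exp (-z * w) = Real.exp (-y * w) * Real.exp (-((z - y) * w)) := by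
        rw [← Real.exp_add]; ring_nf
      have h2 := Real.add_one_le_exp (-((z - y) * w))
      have h3 : Real.exp (-y * w) ≤ Real.exp (-m * w) := Real.exp_le_exp.2 (by nlinarith)
      have h4 := Real.exp_pos (-y * w)
      have h5 : 0 ≤ (z - y) * w := mul_nonneg (sub_nonneg.2 hyz) hw
      rw [h1]
      nlinarith
    intro w
    rcases le_total y z with h | h
    · exact key hy h w
    · rw [abs_sub_comm, abs_sub_comm y z]
      exact key hz h w
  calc ∫ w, |expTail y w - expTail z w| ∂(gaussianReal 0 1)
      ≤ ∫ w, |y - z| * (w * expTail m w) ∂(gaussianReal 0 1) :=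
        integral_mono ((integrable_expTail_gauss (hm.trans hy)).sub
          (integrable_expTail_gauss (hm.trans hz))).abs (hi.const_mul _) hpt
    _ = |y - z| * ∫ w, w * expTail m w ∂(gaussianReal 0 1) := integral_const_mul _ _
    _ ≤ |y - z| * (4 / (1 + m) ^ 2) := mul_le_mul_of_nonneg_left hle (abs_nonneg _)
    _ = _ := mul_comm _ _

end Mills

/-! ### Pointwise expansions of the tilted pair -/

section Pointwise

/-- The exponent `2 x X - x² Y²` in terms of the scaled pair `z = ((1 + x) X, (1 + x) Y)` and
`ρ = x / (1 + x)`. -/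
noncomputable def xi (ρ : ℝ) (z : ℝ × ℝ) : ℝ := 2 * ρ * z.1 - ρ ^ 2 * z.2 ^ 2

/-- The scaled pairs with both components at most one. -/
def good : Set (ℝ × ℝ) := {z | |z.1| ≤ 1 ∧ |z.2| ≤ 1}

/-- The exponential weight `e^{l ξ}`, truncated to the good set. -/
noncomputable def wt (ρ l : ℝ) (z : ℝ × ℝ) : ℝ := good.indicator (fun z => Real.exp (l * xi ρ z)) z

/-- The function equal to `r ^ 4` for `|r| ≤ 1` and `|r| ^ 3` otherwise, that is, the minimum of
the two. -/
noncomputable def trunc (r : ℝ) : ℝ := if |r| ≤ 1 then r ^ 4 else |r| ^ 3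

/-- The integrand of `δ_{x,i}` in terms of the scaled pair. -/
noncomputable def dd (z : ℝ × ℝ) : ℝ := trunc z.1 + trunc z.2

/-- The sum of the absolute cubes of the components. -/
noncomputable def cube (z : ℝ × ℝ) : ℝ := |z.1| ^ 3 + |z.2| ^ 3

lemma measurableSet_good : MeasurableSet good :=
  (measurableSet_le measurable_fst.abs measurable_const).inter
    (measurableSet_le measurable_snd.abs measurable_const)

lemma measurable_xi (ρ : ℝ) : Measurable (xi ρ) := by
  unfold xi
  fun_prop

lemma measurable_wt (ρ l : ℝ) : Measurable (wt ρ l) :=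
  ((measurable_xi ρ).const_mul l).exp.indicator measurableSet_good

lemma measurable_trunc : Measurable trunc :=
  Measurable.ite (measurableSet_le measurable_id.abs measurable_const) (by fun_prop) (by fun_prop)

lemma measurable_dd : Measurable dd :=
  (measurable_trunc.comp measurable_fst).add (measurable_trunc.comp measurable_snd)

lemma trunc_nonneg (r : ℝ) : 0 ≤ trunc r := by
  unfold trunc
  split_ifs <;> positivity

lemma dd_nonneg (z : ℝ × ℝ) : 0 ≤ dd z := add_nonneg (trunc_nonneg _) (trunc_nonneg _)

lemma cube_nonneg (z : ℝ × ℝ) : 0 ≤ cube z := by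
  unfold cube
  positivity

lemma trunc_le_cube (r : ℝ) : trunc r ≤ |r| ^ 3 := by
  unfold trunc
  split_ifs with h
  · have : r ^ 4 = |r| ^ 3 * |r| := by
      rw [← Even.pow_abs (by decide : Even 4)]
      ring
    rw [this]
    exact mul_le_of_le_one_right (by positivity) h
  · exact le_rfl

lemma dd_le_cube (z : ℝ × ℝ) : dd z ≤ cube z := add_le_add (trunc_le_cube _) (trunc_le_cube _)

lemma wt_nonneg (ρ l : ℝ) (z : ℝ × ℝ) : 0 ≤ wt ρ l z :=
  Set.indicator_nonneg (fun _ _ => (Real.exp_pos _).le) _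

lemma wt_of_mem {ρ l : ℝ} {z : ℝ × ℝ} (hz : z ∈ good) : wt ρ l z = Real.exp (l * xi ρ z) :=
  Set.indicator_of_mem hz _

lemma wt_of_notMem {ρ l : ℝ} {z : ℝ × ℝ} (hz : z ∉ good) : wt ρ l z = 0 :=
  Set.indicator_of_notMem hz _

lemma dd_of_mem {z : ℝ × ℝ} (hz : z ∈ good) : dd z = z.1 ^ 4 + z.2 ^ 4 := by
  simp [dd, trunc, hz.1, hz.2]

lemma abs_le_pow_of_one_le {r : ℝ} (h : 1 ≤ |r|) : |r| ≤ |r| ^ 3 ∧ r ^ 2 ≤ |r| ^ 3 ∧ 1 ≤ |r| ^ 3 := by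
  have h2 : r ^ 2 = |r| ^ 2 := (sq_abs r).symm
  rw [h2]
  refine ⟨?_, ?_, ?_⟩
  · nlinarith [sq_nonneg (|r| - 1)]
  · nlinarith [sq_nonneg |r|]
  · exact one_le_pow₀ h

/-- Off the good set `dd` dominates all monomials of degree at most three. -/
lemma bounds_of_notMem_good {z : ℝ × ℝ} (hz : z ∉ good) :
    1 ≤ dd z ∧ |z.1| ≤ dd z ∧ z.1 ^ 2 ≤ dd z ∧ |z.1| ^ 3 ≤ dd z ∧ |z.2| ≤ dd z ∧ z.2 ^ 2 ≤ dd z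
      ∧ |z.2| ^ 3 ≤ dd z ∧ 1 ≤ z.1 ^ 2 + z.2 ^ 2 ∧ |z.1| ≤ z.1 ^ 2 + z.2 ^ 2 := by
  have hone : 1 ≤ dd z ∧ 1 ≤ z.1 ^ 2 + z.2 ^ 2 := by
    have : 1 < |z.1| ∨ 1 < |z.2| := by
      by_contra hc
      push Not at hc
      exact hz hc
    rcases this with h | h
    · have h1 : trunc z.1 = |z.1| ^ 3 := if_neg (not_le.2 h)
      have h2 := abs_le_pow_of_one_le h.le
      have h3 := trunc_nonneg z.2
      refine ⟨by unfold dd; linarith, ?_⟩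
      rw [← sq_abs z.1]
      nlinarith [sq_nonneg z.2]
    · have h1 : trunc z.2 = |z.2| ^ 3 := if_neg (not_le.2 h)
      have h2 := abs_le_pow_of_one_le h.le
      have h3 := trunc_nonneg z.1
      refine ⟨by unfold dd; linarith, ?_⟩
      rw [← sq_abs z.2]
      nlinarith [sq_nonneg z.1]
  have hcomp : ∀ r : ℝ, trunc r ≤ dd z → |r| ≤ dd z ∧ r ^ 2 ≤ dd z ∧ |r| ^ 3 ≤ dd z := by
    intro r hr
    rcases le_or_gt |r| 1 with h | h
    · have h0 := abs_nonneg r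
      refine ⟨by linarith, ?_, ?_⟩
      · rw [← sq_abs]; nlinarith
      · exact (pow_le_one₀ h0 h).trans hone.1
    · have h1 : trunc r = |r| ^ 3 := if_neg (not_le.2 h)
      have h2 := abs_le_pow_of_one_le h.le
      exact ⟨by linarith, by linarith, by linarith⟩
  obtain ⟨a1, a2, a3⟩ := hcomp z.1 (by unfold dd; linarith [trunc_nonneg z.2])
  obtain ⟨b1, b2, b3⟩ := hcomp z.2 (by unfold dd; linarith [trunc_nonneg z.1])
  refine ⟨hone.1, a1, a2, a3, b1, b2, b3, hone.2, ?_⟩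
  rcases le_or_gt |z.1| 1 with h | h
  · linarith [hone.2]
  · rw [← sq_abs z.1]
    nlinarith [sq_nonneg z.2]

lemma mul_le_weighted {s : ℝ} (hs : 0 < s) (a b : ℝ) : a * b ≤ s * a ^ 2 + b ^ 2 / s := by
  have h : 0 ≤ (s * a - b) ^ 2 / s + s * a ^ 2 + b ^ 2 / s := by positivity
  have e : (s * a - b) ^ 2 / s = s * a ^ 2 - 2 * (a * b) + b ^ 2 / s := by
    field_simp
    ring
  rw [e] at h
  linarith

lemma abs_exp_sub_taylor_le (n : ℕ) {y : ℝ} (hy : |y| ≤ 3) :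
    |Real.exp y - ∑ m ∈ Finset.range n, y ^ m / m.factorial| ≤ 21 * |y| ^ n := by
  have h := Complex.norm_exp_sub_sum_le_norm_mul_exp (y : ℂ) n
  have e : Complex.exp (y : ℂ) - ∑ m ∈ Finset.range n, (y : ℂ) ^ m / m.factorial
      = ((Real.exp y - ∑ m ∈ Finset.range n, y ^ m / m.factorial : ℝ) : ℂ) := by
    push_cast
    rfl
  rw [e, Complex.norm_real, Complex.norm_real, Real.norm_eq_abs, Real.norm_eq_abs] at h
  refine h.trans ?_
  have h3 : Real.exp |y| ≤ 21 := by
    calc Real.exp |y| ≤ Real.exp 3 := Real.exp_le_exp.2 hy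
      _ = Real.exp 1 ^ 3 := by rw [← Real.exp_nat_mul]; norm_num
      _ ≤ 2.7182818286 ^ 3 := pow_le_pow_left₀ (Real.exp_pos _).le Real.exp_one_lt_d9.le 3
      _ ≤ 21 := by norm_num
  rw [mul_comm]
  exact mul_le_mul_of_nonneg_right h3 (by positivity)

section Scaled

variable {l u w : ℝ}

lemma abs_xi_le (hw : |w| ≤ 1) : |2 * u - w ^ 2| ≤ 2 * |u| + |w| := by
  have h1 : |2 * u - w ^ 2| ≤ |2 * u| + |w ^ 2| := abs_sub _ _
  rw [abs_mul, abs_two, abs_pow] at h1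
  nlinarith [abs_nonneg w]

lemma abs_mul_xi_le_three (hl0 : 0 ≤ l) (hl1 : l ≤ 1) (hu : |u| ≤ 1) (hw : |w| ≤ 1) :
    |l * (2 * u - w ^ 2)| ≤ |2 * u - w ^ 2| ∧ |l * (2 * u - w ^ 2)| ≤ 3 := by
  have h1 := abs_xi_le (u := u) hw
  rw [abs_mul, abs_of_nonneg hl0]
  have h2 := abs_nonneg (2 * u - w ^ 2)
  constructor <;> nlinarith

lemma xi_sq_le (hw : |w| ≤ 1) : (2 * u - w ^ 2) ^ 2 ≤ 8 * (u ^ 2 + w ^ 2) := by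
  have h1 := abs_xi_le (u := u) hw
  calc (2 * u - w ^ 2) ^ 2 = |2 * u - w ^ 2| ^ 2 := (sq_abs _).symm
    _ ≤ (2 * |u| + |w|) ^ 2 := pow_le_pow_left₀ (abs_nonneg _) h1 2
    _ ≤ 8 * (|u| ^ 2 + |w| ^ 2) := by nlinarith [sq_nonneg (2 * |u| - |w|), sq_nonneg |w|]
    _ = 8 * (u ^ 2 + w ^ 2) := by rw [sq_abs, sq_abs]

lemma xi_cube_le (hw : |w| ≤ 1) : |2 * u - w ^ 2| ^ 3 ≤ 32 * (|u| ^ 3 + |w| ^ 3) := by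
  have h1 := abs_xi_le (u := u) hw
  have hu := abs_nonneg u
  have hw' := abs_nonneg w
  calc |2 * u - w ^ 2| ^ 3 ≤ (2 * |u| + |w|) ^ 3 := pow_le_pow_left₀ (abs_nonneg _) h1 3
    _ ≤ 32 * (|u| ^ 3 + |w| ^ 3) := by
      nlinarith [mul_nonneg (add_nonneg hu hw') (sq_nonneg (|u| - |w|)),
        mul_nonneg hu (sq_nonneg (|u| - |w|)), mul_nonneg hw' (sq_nonneg (|u| - |w|)),
        pow_nonneg hu 3, pow_nonneg hw' 3]

lemma xi_fourth_le (hw : |w| ≤ 1) : |2 * u - w ^ 2| ^ 4 ≤ 128 * (u ^ 4 + w ^ 4) := by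
  have h := xi_sq_le (u := u) hw
  have e : |2 * u - w ^ 2| ^ 4 = ((2 * u - w ^ 2) ^ 2) ^ 2 := by
    rw [Even.pow_abs (by decide : Even 4)]
    ring
  rw [e]
  calc _ ≤ (8 * (u ^ 2 + w ^ 2)) ^ 2 := pow_le_pow_left₀ (sq_nonneg _) h 2
    _ ≤ 128 * (u ^ 4 + w ^ 4) := by nlinarith [sq_nonneg (u ^ 2 - w ^ 2)]

lemma abs_mul_sq_le (hw : |w| ≤ 1) :
    |u * w ^ 2| ≤ |u| ^ 3 + |w| ^ 3 ∧ w ^ 4 ≤ |w| ^ 3 := by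
  have hu := abs_nonneg u
  have hw' := abs_nonneg w
  have e : w ^ 4 = |w| ^ 4 := (Even.pow_abs (by decide) w).symm
  rw [e, abs_mul, abs_pow]
  constructor
  · rcases le_total |u| |w| with h | h
    · have : |u| * |w| ^ 2 ≤ |w| * |w| ^ 2 := mul_le_mul_of_nonneg_right h (by positivity)
      nlinarith [pow_nonneg hu 3]
    · have : |w| ^ 2 ≤ |u| ^ 2 := pow_le_pow_left₀ hw' h 2
      nlinarith [pow_nonneg hw' 3]
  · have : |w| ^ 3 * |w| ≤ |w| ^ 3 * 1 := mul_le_mul_of_nonneg_left hw (by positivity)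
    nlinarith

/-- In this and the following expansions `u` and `w` stand for `ρ z.1` and `ρ z.2` at a good
pair `z`. -/
lemma abs_exp_xi_sub_quartic (hl0 : 0 ≤ l) (hl1 : l ≤ 1) (hu : |u| ≤ 1) (hw : |w| ≤ 1) :
    |Real.exp (l * (2 * u - w ^ 2)) - (1 + 2 * l * u - l * w ^ 2 + 2 * l ^ 2 * u ^ 2
      + (4 / 3 * l ^ 3 * u ^ 3 - 2 * l ^ 2 * (u * w ^ 2)))| ≤ 2700 * (u ^ 4 + w ^ 4) := by
  obtain ⟨h1, h3⟩ := abs_mul_xi_le_three hl0 hl1 hu hw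
  have h4 := abs_exp_sub_taylor_le 4 h3
  have h5 : |l * (2 * u - w ^ 2)| ^ 4 ≤ 128 * (u ^ 4 + w ^ 4) :=
    (pow_le_pow_left₀ (abs_nonneg _) h1 4).trans (xi_fourth_le hw)
  simp only [Finset.sum_range_succ, Finset.sum_range_zero, Nat.factorial] at h4
  push_cast at h4
  have hw2 : w ^ 2 ≤ 1 := (sq_le_one_iff_abs_le_one w).2 hw
  have hl2 : l ^ 2 ≤ 1 := pow_le_one₀ hl0 hl1
  have hl3 : l ^ 3 ≤ 1 := pow_le_one₀ hl0 hl1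
  have hw4 : 0 ≤ w ^ 4 := by positivity
  have r1 : |l ^ 2 * w ^ 4 / 2| ≤ w ^ 4 := by
    rw [abs_of_nonneg (by positivity)]
    nlinarith
  have r2 : |2 * l ^ 3 * (u ^ 2 * w ^ 2)| ≤ u ^ 4 + w ^ 4 := by
    rw [abs_of_nonneg (by positivity)]
    nlinarith [sq_nonneg (u ^ 2 - w ^ 2), mul_nonneg (sq_nonneg u) (sq_nonneg w)]
  have r3 : |l ^ 3 * u * w ^ 4| ≤ w ^ 4 := by
    rw [abs_mul, abs_mul, abs_of_nonneg hw4, abs_of_nonneg (by positivity : 0 ≤ l ^ 3)]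
    refine mul_le_of_le_one_left hw4 ?_
    exact mul_le_one₀ hl3 (abs_nonneg _) hu
  have r4 : |l ^ 3 * w ^ 6 / 6| ≤ w ^ 4 := by
    rw [abs_of_nonneg (by positivity)]
    have : w ^ 6 ≤ w ^ 4 := by nlinarith
    have h6 : 0 ≤ w ^ 6 := by positivity
    nlinarith
  rw [abs_le] at *
  constructor <;> nlinarith

lemma abs_exp_sub_one_le (hl0 : 0 ≤ l) (hl1 : l ≤ 1) (hu : |u| ≤ 1) (hw : |w| ≤ 1) :
    |Real.exp (l * (2 * u - w ^ 2)) - 1| ≤ 21 * |2 * u - w ^ 2| ∧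
    |Real.exp (l * (2 * u - w ^ 2)) - 1 - l * (2 * u - w ^ 2)| ≤ 21 * |2 * u - w ^ 2| ^ 2 ∧
    Real.exp (l * (2 * u - w ^ 2)) ≤ 21 := by
  obtain ⟨h1, h3⟩ := abs_mul_xi_le_three hl0 hl1 hu hw
  have e0 := abs_exp_sub_taylor_le 0 h3
  have e1 := abs_exp_sub_taylor_le 1 h3
  have e2 := abs_exp_sub_taylor_le 2 h3
  simp only [Finset.sum_range_succ, Finset.sum_range_zero, Nat.factorial] at e0 e1 e2
  push_cast at e0 e1 e2
  have h2 := pow_le_pow_left₀ (abs_nonneg _) h1 2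
  refine ⟨?_, ?_, ?_⟩
  · ring_nf at e1 ⊢
    ring_nf at h1
    linarith
  · have : Real.exp (l * (2 * u - w ^ 2)) - 1 - l * (2 * u - w ^ 2)
        = Real.exp (l * (2 * u - w ^ 2)) - (0 + (l * (2 * u - w ^ 2)) ^ 0 / 1
          + (l * (2 * u - w ^ 2)) ^ 1 / ((0 + 1) * 1)) := by ring
    rw [this]
    linarith
  · rw [sub_zero, abs_of_pos (Real.exp_pos _)] at e0
    simpa using e0

lemma abs_exp_xi_sub_linear (hl0 : 0 ≤ l) (hl1 : l ≤ 1) (hu : |u| ≤ 1) (hw : |w| ≤ 1) :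
    |Real.exp (l * (2 * u - w ^ 2)) - 1 - 2 * l * u| ≤ 170 * (u ^ 2 + w ^ 2) := by
  obtain ⟨-, h2, -⟩ := abs_exp_sub_one_le hl0 hl1 hu hw
  have h := xi_sq_le (u := u) hw
  rw [sq_abs] at h2
  have : 0 ≤ l * w ^ 2 := by positivity
  have : l * w ^ 2 ≤ w ^ 2 := mul_le_of_le_one_left (sq_nonneg _) hl1
  rw [abs_le] at *
  constructor <;> nlinarith [sq_nonneg u]

lemma abs_xi_mul_exp_sub_linear (hl0 : 0 ≤ l) (hl1 : l ≤ 1) (hu : |u| ≤ 1) (hw : |w| ≤ 1) :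
    |(2 * u - w ^ 2) * Real.exp (l * (2 * u - w ^ 2)) - 2 * u| ≤ 170 * (u ^ 2 + w ^ 2) := by
  obtain ⟨h1, -, -⟩ := abs_exp_sub_one_le hl0 hl1 hu hw
  have h := xi_sq_le (u := u) hw
  have h2 : |(2 * u - w ^ 2) * (Real.exp (l * (2 * u - w ^ 2)) - 1)| ≤ 168 * (u ^ 2 + w ^ 2) := by
    rw [abs_mul]
    calc _ ≤ |2 * u - w ^ 2| * (21 * |2 * u - w ^ 2|) :=
          mul_le_mul_of_nonneg_left h1 (abs_nonneg _)
      _ = 21 * (2 * u - w ^ 2) ^ 2 := by rw [← sq_abs (2 * u - w ^ 2)]; ring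
      _ ≤ _ := by linarith
  rw [abs_le] at *
  constructor <;> nlinarith [sq_nonneg u, sq_nonneg w]

lemma abs_xi_mul_exp_sub_quadratic (hl0 : 0 ≤ l) (hl1 : l ≤ 1) (hu : |u| ≤ 1) (hw : |w| ≤ 1) :
    |(2 * u - w ^ 2) * Real.exp (l * (2 * u - w ^ 2)) - (2 * u - w ^ 2 + 4 * l * u ^ 2)|
      ≤ 700 * (|u| ^ 3 + |w| ^ 3) := by
  obtain ⟨-, h1, -⟩ := abs_exp_sub_one_le hl0 hl1 hu hw
  have h := xi_cube_le (u := u) hw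
  obtain ⟨h3, h4⟩ := abs_mul_sq_le (u := u) hw
  have h2 : |(2 * u - w ^ 2) * (Real.exp (l * (2 * u - w ^ 2)) - 1 - l * (2 * u - w ^ 2))|
      ≤ 672 * (|u| ^ 3 + |w| ^ 3) := by
    rw [abs_mul]
    calc _ ≤ |2 * u - w ^ 2| * (21 * |2 * u - w ^ 2| ^ 2) :=
          mul_le_mul_of_nonneg_left h1 (abs_nonneg _)
      _ = 21 * |2 * u - w ^ 2| ^ 3 := by ring
      _ ≤ _ := by linarith
  have h5 : |l * (u * w ^ 2)| ≤ |u| ^ 3 + |w| ^ 3 := by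
    rw [abs_mul, abs_of_nonneg hl0]
    exact (mul_le_of_le_one_left (abs_nonneg _) hl1).trans h3
  have h6 : 0 ≤ l * w ^ 4 := by positivity
  have h7 : l * w ^ 4 ≤ w ^ 4 := mul_le_of_le_one_left (by positivity) hl1
  have h8 : 0 ≤ |u| ^ 3 := by positivity
  rw [abs_le] at *
  constructor <;> nlinarith

lemma abs_xi_sq_mul_exp_sub (hl0 : 0 ≤ l) (hl1 : l ≤ 1) (hu : |u| ≤ 1) (hw : |w| ≤ 1) :
    |(2 * u - w ^ 2) ^ 2 * Real.exp (l * (2 * u - w ^ 2)) - 4 * u ^ 2|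
      ≤ 700 * (|u| ^ 3 + |w| ^ 3) := by
  obtain ⟨h1, -, -⟩ := abs_exp_sub_one_le hl0 hl1 hu hw
  have h := xi_cube_le (u := u) hw
  obtain ⟨h3, h4⟩ := abs_mul_sq_le (u := u) hw
  have h2 : |(2 * u - w ^ 2) ^ 2 * (Real.exp (l * (2 * u - w ^ 2)) - 1)|
      ≤ 672 * (|u| ^ 3 + |w| ^ 3) := by
    rw [abs_mul, abs_pow]
    calc _ ≤ |2 * u - w ^ 2| ^ 2 * (21 * |2 * u - w ^ 2|) :=
          mul_le_mul_of_nonneg_left h1 (by positivity)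
      _ = 21 * |2 * u - w ^ 2| ^ 3 := by ring
      _ ≤ _ := by linarith
  have h6 : 0 ≤ w ^ 4 := by positivity
  have h8 : 0 ≤ |u| ^ 3 := by positivity
  rw [abs_le] at *
  constructor <;> nlinarith

lemma abs_xi_cube_mul_exp_le (hl0 : 0 ≤ l) (hl1 : l ≤ 1) (hu : |u| ≤ 1) (hw : |w| ≤ 1) :
    |2 * u - w ^ 2| ^ 3 * Real.exp (l * (2 * u - w ^ 2)) ≤ 672 * (|u| ^ 3 + |w| ^ 3) := by
  obtain ⟨-, -, h1⟩ := abs_exp_sub_one_le hl0 hl1 hu hw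
  have h := xi_cube_le (u := u) hw
  calc _ ≤ |2 * u - w ^ 2| ^ 3 * 21 := mul_le_mul_of_nonneg_left h1 (by positivity)
    _ ≤ _ := by linarith

end Scaled

variable {ρ l s : ℝ} {z : ℝ × ℝ}

lemma xi_eq (ρ : ℝ) (z : ℝ × ℝ) : xi ρ z = 2 * (ρ * z.1) - (ρ * z.2) ^ 2 := by
  unfold xi
  ring

lemma abs_scaled_le_one (h0 : 0 ≤ ρ) (h1 : ρ ≤ 1) {r : ℝ} (hr : |r| ≤ 1) : |ρ * r| ≤ 1 := by
  rw [abs_mul, abs_of_nonneg h0]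
  exact mul_le_one₀ h1 (abs_nonneg _) hr

lemma scaled_cube (h0 : 0 ≤ ρ) (z : ℝ × ℝ) :
    |ρ * z.1| ^ 3 + |ρ * z.2| ^ 3 = ρ ^ 3 * cube z := by
  unfold cube
  rw [abs_mul, abs_mul, abs_of_nonneg h0]
  ring

/-- The product bound `|p| q² ≤ |p|³ + |q|³`. -/
lemma abs_fst_mul_sq_le (z : ℝ × ℝ) : |z.1| * z.2 ^ 2 ≤ |z.1| ^ 3 + |z.2| ^ 3 := by
  have hu := abs_nonneg z.1
  have hw' := abs_nonneg z.2
  rw [← sq_abs z.2]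
  rcases le_total |z.1| |z.2| with h | h
  · have : |z.1| * |z.2| ^ 2 ≤ |z.2| * |z.2| ^ 2 := mul_le_mul_of_nonneg_right h (by positivity)
    nlinarith [pow_nonneg hu 3]
  · have : |z.2| ^ 2 ≤ |z.1| ^ 2 := pow_le_pow_left₀ hw' h 2
    nlinarith [pow_nonneg hw' 3]

/-- The expansion of the weight behind the expansion of the log-Laplace transform: its cubic part is
the source of the skewness correction. -/
lemma abs_wt_sub_quartic_le (h0 : 0 ≤ ρ) (h1 : ρ ≤ 1) (hl0 : 0 ≤ l) (hl1 : l ≤ 1) :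
    |wt ρ l z - (1 + 2 * l * ρ * z.1 - l * ρ ^ 2 * z.2 ^ 2 + 2 * l ^ 2 * ρ ^ 2 * z.1 ^ 2
      + ρ ^ 3 * (4 / 3 * l ^ 3 * z.1 ^ 3 - 2 * l ^ 2 * (z.1 * z.2 ^ 2)))| ≤ 3000 * dd z := by
  by_cases hz : z ∈ good
  · have h := abs_exp_xi_sub_quartic hl0 hl1 (abs_scaled_le_one h0 h1 hz.1)
      (abs_scaled_le_one h0 h1 hz.2)
    rw [wt_of_mem hz, xi_eq, dd_of_mem hz]
    have e : 1 + 2 * l * ρ * z.1 - l * ρ ^ 2 * z.2 ^ 2 + 2 * l ^ 2 * ρ ^ 2 * z.1 ^ 2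
      + ρ ^ 3 * (4 / 3 * l ^ 3 * z.1 ^ 3 - 2 * l ^ 2 * (z.1 * z.2 ^ 2))
      = 1 + 2 * l * (ρ * z.1) - l * (ρ * z.2) ^ 2 + 2 * l ^ 2 * (ρ * z.1) ^ 2
      + (4 / 3 * l ^ 3 * (ρ * z.1) ^ 3 - 2 * l ^ 2 * ((ρ * z.1) * (ρ * z.2) ^ 2)) := by ring
    rw [e]
    refine h.trans ?_
    have h4 : ρ ^ 4 ≤ 1 := pow_le_one₀ h0 h1
    have h5 : 0 ≤ z.1 ^ 4 + z.2 ^ 4 := by positivity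
    have h6 : (ρ * z.1) ^ 4 + (ρ * z.2) ^ 4 = ρ ^ 4 * (z.1 ^ 4 + z.2 ^ 4) := by ring
    rw [h6]
    nlinarith
  · obtain ⟨b1, b2, b3, b4, b5, b6, b7, -, -⟩ := bounds_of_notMem_good hz
    have b8 := abs_fst_mul_sq_le z
    rw [wt_of_notMem hz]
    have hd := dd_nonneg z
    have m : ∀ c r D : ℝ, 0 ≤ c → c ≤ 1 → |r| ≤ D → |c * r| ≤ D := fun c r D hc hc1 hr => by
      rw [abs_mul, abs_of_nonneg hc]
      exact (mul_le_of_le_one_left (abs_nonneg _) hc1).trans hr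
    have hp : ∀ i j : ℕ, 0 ≤ l ^ i * ρ ^ j ∧ l ^ i * ρ ^ j ≤ 1 := fun i j =>
      ⟨by positivity, mul_le_one₀ (pow_le_one₀ hl0 hl1) (by positivity) (pow_le_one₀ h0 h1)⟩
    have m1 := m _ z.1 _ (hp 1 1).1 (hp 1 1).2 b2
    have m2 := m _ (z.2 ^ 2) (dd z) (hp 1 2).1 (hp 1 2).2 (by rwa [abs_of_nonneg (sq_nonneg _)])
    have m3 := m _ (z.1 ^ 2) (dd z) (hp 2 2).1 (hp 2 2).2 (by rwa [abs_of_nonneg (sq_nonneg _)])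
    have m4 := m _ (z.1 ^ 3) (dd z) (hp 3 3).1 (hp 3 3).2 (by rwa [abs_pow])
    have m5 := m _ (z.1 * z.2 ^ 2) (2 * dd z) (hp 2 3).1 (hp 2 3).2
      (by rw [abs_mul, abs_of_nonneg (sq_nonneg z.2)]; linarith)
    rw [abs_le] at *
    constructor <;> nlinarith

lemma abs_wt_sub_linear_le (h0 : 0 ≤ ρ) (h1 : ρ ≤ 1) (hl0 : 0 ≤ l) (hl1 : l ≤ 1) :
    |wt ρ l z - 1 - 2 * l * ρ * z.1| ≤ 170 * (z.1 ^ 2 + z.2 ^ 2) := by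
  by_cases hz : z ∈ good
  · have h := abs_exp_xi_sub_linear hl0 hl1 (abs_scaled_le_one h0 h1 hz.1)
      (abs_scaled_le_one h0 h1 hz.2)
    rw [wt_of_mem hz, xi_eq, show 2 * l * ρ * z.1 = 2 * l * (ρ * z.1) by ring]
    refine h.trans ?_
    have h4 : ρ ^ 2 ≤ 1 := pow_le_one₀ h0 h1
    have h6 : (ρ * z.1) ^ 2 + (ρ * z.2) ^ 2 = ρ ^ 2 * (z.1 ^ 2 + z.2 ^ 2) := by ring
    rw [h6]
    nlinarith [sq_nonneg z.1, sq_nonneg z.2]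
  · obtain ⟨-, -, -, -, -, -, -, b8, b9⟩ := bounds_of_notMem_good hz
    rw [wt_of_notMem hz]
    have hl : 0 ≤ l * ρ ∧ l * ρ ≤ 1 := ⟨by positivity, mul_le_one₀ hl1 h0 h1⟩
    have : |l * ρ * z.1| ≤ z.1 ^ 2 + z.2 ^ 2 := by
      rw [abs_mul, abs_of_nonneg hl.1]
      exact (mul_le_of_le_one_left (abs_nonneg _) hl.2).trans b9
    rw [abs_le] at *
    constructor <;> nlinarith

lemma le_wt (h0 : 0 ≤ ρ) (h1 : ρ ≤ 1) (hl0 : 0 ≤ l) (hl1 : l ≤ 1) :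
    1 + 2 * l * ρ * z.1 - l * ρ ^ 2 * z.2 ^ 2 - 3 * cube z ≤ wt ρ l z := by
  by_cases hz : z ∈ good
  · have h := Real.add_one_le_exp (l * (2 * (ρ * z.1) - (ρ * z.2) ^ 2))
    rw [wt_of_mem hz, xi_eq]
    nlinarith [cube_nonneg z]
  · obtain ⟨b1, b2, -, -, -, -, -, -, -⟩ := bounds_of_notMem_good hz
    rw [wt_of_notMem hz]
    have hd := dd_le_cube z
    have hl : 0 ≤ l * ρ ∧ l * ρ ≤ 1 := ⟨by positivity, mul_le_one₀ hl1 h0 h1⟩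
    have : |l * ρ * z.1| ≤ dd z := by
      rw [abs_mul, abs_of_nonneg hl.1]
      exact (mul_le_of_le_one_left (abs_nonneg _) hl.2).trans b2
    have := le_abs_self (l * ρ * z.1)
    have : 0 ≤ l * ρ ^ 2 * z.2 ^ 2 := by positivity
    nlinarith

lemma abs_xi_mul_wt_sub_linear_le (h0 : 0 ≤ ρ) (h1 : ρ ≤ 1) (hl0 : 0 ≤ l) (hl1 : l ≤ 1) :
    |xi ρ z * wt ρ l z - 2 * ρ * z.1| ≤ 170 * ρ * (z.1 ^ 2 + z.2 ^ 2) := by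
  by_cases hz : z ∈ good
  · have h := abs_xi_mul_exp_sub_linear hl0 hl1 (abs_scaled_le_one h0 h1 hz.1)
      (abs_scaled_le_one h0 h1 hz.2)
    rw [wt_of_mem hz, xi_eq, show 2 * ρ * z.1 = 2 * (ρ * z.1) by ring]
    refine h.trans ?_
    have h4 : ρ ^ 2 ≤ ρ := by nlinarith
    have h6 : (ρ * z.1) ^ 2 + (ρ * z.2) ^ 2 = ρ ^ 2 * (z.1 ^ 2 + z.2 ^ 2) := by ring
    rw [h6, mul_assoc]
    exact mul_le_mul_of_nonneg_left (mul_le_mul_of_nonneg_right h4 (by positivity)) (by norm_num)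
  · obtain ⟨-, -, -, -, -, -, -, b8, b9⟩ := bounds_of_notMem_good hz
    rw [wt_of_notMem hz, mul_zero, zero_sub, abs_neg, abs_mul, abs_of_nonneg (by positivity)]
    have : ρ * |z.1| ≤ ρ * (z.1 ^ 2 + z.2 ^ 2) := mul_le_mul_of_nonneg_left b9 h0
    have : 0 ≤ ρ * |z.1| := by positivity
    nlinarith

lemma abs_quadratic_le_of_notMem (h0 : 0 ≤ ρ) (h1 : ρ ≤ 1) (hl0 : 0 ≤ l) (hl1 : l ≤ 1)
    (hz : z ∉ good) :
    |2 * ρ * z.1 - ρ ^ 2 * z.2 ^ 2 + 4 * l * ρ ^ 2 * z.1 ^ 2| ≤ 7 * (ρ * dd z) := by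
  obtain ⟨b1, b2, b3, -, -, b6, -, -, -⟩ := bounds_of_notMem_good hz
  have m : ∀ c r : ℝ, 0 ≤ c → c ≤ ρ → |r| ≤ dd z → |c * r| ≤ ρ * dd z := fun c r hc hc1 hr => by
    rw [abs_mul, abs_of_nonneg hc]
    exact mul_le_mul hc1 hr (abs_nonneg _) h0
  have hr2 : ρ ^ 2 ≤ ρ := by nlinarith
  have m1 := m ρ z.1 h0 le_rfl b2
  have m2 := m (ρ ^ 2) (z.2 ^ 2) (by positivity) hr2 (by rwa [abs_of_nonneg (sq_nonneg _)])
  have m3 := m (l * ρ ^ 2) (z.1 ^ 2) (by positivity)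
    ((mul_le_of_le_one_left (by positivity) hl1).trans hr2) (by rwa [abs_of_nonneg (sq_nonneg _)])
  rw [abs_le] at *
  constructor <;> linarith

lemma abs_xi_mul_wt_sub_quadratic_le (h0 : 0 ≤ ρ) (h1 : ρ ≤ 1) (hl0 : 0 ≤ l) (hl1 : l ≤ 1) :
    |xi ρ z * wt ρ l z - (2 * ρ * z.1 - ρ ^ 2 * z.2 ^ 2 + 4 * l * ρ ^ 2 * z.1 ^ 2)|
      ≤ 700 * ρ * cube z := by
  by_cases hz : z ∈ good
  · have h := abs_xi_mul_exp_sub_quadratic hl0 hl1 (abs_scaled_le_one h0 h1 hz.1)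
      (abs_scaled_le_one h0 h1 hz.2)
    rw [scaled_cube h0] at h
    rw [wt_of_mem hz, xi_eq, show 2 * ρ * z.1 - ρ ^ 2 * z.2 ^ 2 + 4 * l * ρ ^ 2 * z.1 ^ 2
      = 2 * (ρ * z.1) - (ρ * z.2) ^ 2 + 4 * l * (ρ * z.1) ^ 2 by ring]
    refine h.trans ?_
    have h4 : ρ ^ 3 ≤ ρ := by
      have : ρ ^ 2 ≤ 1 := pow_le_one₀ h0 h1
      nlinarith
    rw [mul_assoc]
    exact mul_le_mul_of_nonneg_left (mul_le_mul_of_nonneg_right h4 (cube_nonneg z)) (by norm_num)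
  · have h := abs_quadratic_le_of_notMem h0 h1 hl0 hl1 hz
    rw [wt_of_notMem hz, mul_zero, zero_sub, abs_neg]
    have : ρ * dd z ≤ ρ * cube z := mul_le_mul_of_nonneg_left (dd_le_cube z) h0
    have : 0 ≤ ρ * dd z := mul_nonneg h0 (dd_nonneg z)
    linarith

/-- On the good set the third moments interpolate between second and fourth moments, with a free
weight `s`. -/
lemma cube_le_of_mem (hs : 0 < s) (hz : z ∈ good) :
    cube z ≤ s * (z.1 ^ 2 + z.2 ^ 2) + dd z / s := by
  have h1 := mul_le_weighted hs |z.1| (z.1 ^ 2)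
  have h2 := mul_le_weighted hs |z.2| (z.2 ^ 2)
  rw [dd_of_mem hz, add_div]
  rw [sq_abs] at h1 h2
  have e1 : |z.1| * z.1 ^ 2 = |z.1| ^ 3 := by rw [← sq_abs]; ring
  have e2 : |z.2| * z.2 ^ 2 = |z.2| ^ 3 := by rw [← sq_abs]; ring
  rw [e1, ← pow_mul] at h1
  rw [e2, ← pow_mul] at h2
  unfold cube
  norm_num at h1 h2
  linarith

/-- The error with the cubic moments interpolated, for the bound of the saddle point in terms
of `√R`. -/
lemma abs_xi_mul_wt_sub_quadratic_le_weighted (h0 : 0 ≤ ρ) (h1 : ρ ≤ 1) (hl0 : 0 ≤ l)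
    (hl1 : l ≤ 1) (hs : 0 < s) :
    |xi ρ z * wt ρ l z - (2 * ρ * z.1 - ρ ^ 2 * z.2 ^ 2 + 4 * l * ρ ^ 2 * z.1 ^ 2)|
      ≤ 700 * (ρ ^ 3 * (s * (z.1 ^ 2 + z.2 ^ 2) + dd z / s) + dd z) := by
  have hd := dd_nonneg z
  have hr : 0 ≤ ρ ^ 3 * (s * (z.1 ^ 2 + z.2 ^ 2) + dd z / s) := by positivity
  by_cases hz : z ∈ good
  · have h := abs_xi_mul_exp_sub_quadratic hl0 hl1 (abs_scaled_le_one h0 h1 hz.1)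
      (abs_scaled_le_one h0 h1 hz.2)
    rw [scaled_cube h0] at h
    rw [wt_of_mem hz, xi_eq, show 2 * ρ * z.1 - ρ ^ 2 * z.2 ^ 2 + 4 * l * ρ ^ 2 * z.1 ^ 2
      = 2 * (ρ * z.1) - (ρ * z.2) ^ 2 + 4 * l * (ρ * z.1) ^ 2 by ring]
    refine h.trans ?_
    have := mul_le_mul_of_nonneg_left (cube_le_of_mem hs hz) (by positivity : 0 ≤ ρ ^ 3)
    linarith
  · have h := abs_quadratic_le_of_notMem h0 h1 hl0 hl1 hz
    rw [wt_of_notMem hz, mul_zero, zero_sub, abs_neg]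
    nlinarith

lemma abs_xi_sq_mul_wt_sub_le (h0 : 0 ≤ ρ) (h1 : ρ ≤ 1) (hl0 : 0 ≤ l) (hl1 : l ≤ 1) :
    |xi ρ z ^ 2 * wt ρ l z - 4 * ρ ^ 2 * z.1 ^ 2| ≤ 700 * ρ ^ 2 * cube z := by
  by_cases hz : z ∈ good
  · have h := abs_xi_sq_mul_exp_sub hl0 hl1 (abs_scaled_le_one h0 h1 hz.1)
      (abs_scaled_le_one h0 h1 hz.2)
    rw [scaled_cube h0] at h
    rw [wt_of_mem hz, xi_eq, show 4 * ρ ^ 2 * z.1 ^ 2 = 4 * (ρ * z.1) ^ 2 by ring]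
    refine h.trans ?_
    have h4 : ρ ^ 3 ≤ ρ ^ 2 := by nlinarith [sq_nonneg ρ]
    rw [mul_assoc]
    exact mul_le_mul_of_nonneg_left (mul_le_mul_of_nonneg_right h4 (cube_nonneg z)) (by norm_num)
  · obtain ⟨b1, b2, b3, -, -, b6, -, -, -⟩ := bounds_of_notMem_good hz
    rw [wt_of_notMem hz, mul_zero, zero_sub, abs_neg, abs_of_nonneg (by positivity)]
    have := mul_le_mul_of_nonneg_left (b3.trans (dd_le_cube z)) (sq_nonneg ρ)
    nlinarith [mul_nonneg (sq_nonneg ρ) (cube_nonneg z)]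

lemma abs_xi_cube_mul_wt_le (h0 : 0 ≤ ρ) (h1 : ρ ≤ 1) (hl0 : 0 ≤ l) (hl1 : l ≤ 1) :
    |xi ρ z| ^ 3 * wt ρ l z ≤ 672 * ρ ^ 3 * cube z := by
  by_cases hz : z ∈ good
  · have h := abs_xi_cube_mul_exp_le hl0 hl1 (abs_scaled_le_one h0 h1 hz.1)
      (abs_scaled_le_one h0 h1 hz.2)
    rw [scaled_cube h0] at h
    rw [wt_of_mem hz, xi_eq]
    linarith
  · rw [wt_of_notMem hz, mul_zero]
    exact mul_nonneg (by positivity) (cube_nonneg z)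

/-- The weighted interpolation of the mixed third moment. -/
lemma abs_fst_mul_sq_le_weighted (hs : 0 < s) (hz : z ∈ good) :
    |z.1| * z.2 ^ 2 ≤ s * (z.1 ^ 2 + z.2 ^ 2) + dd z / s := by
  have h1 := mul_le_weighted hs |z.2| (|z.1| * |z.2|)
  rw [dd_of_mem hz]
  have e1 : |z.2| * (|z.1| * |z.2|) = |z.1| * z.2 ^ 2 := by rw [← sq_abs]; ring
  have e2 : (|z.1| * |z.2|) ^ 2 = z.1 ^ 2 * z.2 ^ 2 := by rw [mul_pow, sq_abs, sq_abs]
  rw [e1, e2, sq_abs] at h1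
  have h2 : z.1 ^ 2 * z.2 ^ 2 / s ≤ (z.1 ^ 4 + z.2 ^ 4) / s := by
    gcongr
    nlinarith [sq_nonneg (z.1 ^ 2 - z.2 ^ 2), sq_nonneg (z.1 ^ 2), sq_nonneg (z.2 ^ 2)]
  have h3 : 0 ≤ s * z.1 ^ 2 := by positivity
  linarith

/-- Interpolation of third moments between second moments and `dd`. The free weight `s` is chosen
after integration. -/
lemma third_moments_le_weighted (hs : 0 < s) :
    |z.1| ^ 3 + |z.1| * z.2 ^ 2 ≤ 2 * (s * (z.1 ^ 2 + z.2 ^ 2) + dd z / s) + 3 * dd z := by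
  have hd := dd_nonneg z
  by_cases hz : z ∈ good
  · have h1 := cube_le_of_mem hs hz
    have h2 := abs_fst_mul_sq_le_weighted hs hz
    have h3 : 0 ≤ |z.2| ^ 3 := by positivity
    unfold cube at h1
    linarith
  · obtain ⟨b1, b2, b3, b4, -, b6, b7, -, -⟩ := bounds_of_notMem_good hz
    have h4 := abs_fst_mul_sq_le z
    have : 0 ≤ s * (z.1 ^ 2 + z.2 ^ 2) + dd z / s := by positivity
    linarith

lemma abs_sq_mul_wt_sub_le (h0 : 0 ≤ ρ) (h1 : ρ ≤ 1) (hl0 : 0 ≤ l) (hl1 : l ≤ 1) (hs : 0 < s) :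
    |z.2 ^ 2 * wt ρ l z - z.2 ^ 2|
      ≤ 100 * (ρ * (s * (z.1 ^ 2 + z.2 ^ 2) + dd z / s) + dd z) := by
  have hd := dd_nonneg z
  have hr : 0 ≤ ρ * (s * (z.1 ^ 2 + z.2 ^ 2) + dd z / s) := by positivity
  by_cases hz : z ∈ good
  · have hw := abs_scaled_le_one h0 h1 hz.2
    obtain ⟨h, -, -⟩ := abs_exp_sub_one_le hl0 hl1 (abs_scaled_le_one h0 h1 hz.1) hw
    have h2 := abs_xi_le (u := ρ * z.1) hw
    rw [wt_of_mem hz, xi_eq, show ∀ a b : ℝ, a * b - a = a * (b - 1) by intros; ring, abs_mul,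
      abs_of_nonneg (sq_nonneg _)]
    have c1 := cube_le_of_mem hs hz
    have c2 := abs_fst_mul_sq_le_weighted hs hz
    have e2 : |z.2| * z.2 ^ 2 = |z.2| ^ 3 := by rw [← sq_abs]; ring
    calc _ ≤ z.2 ^ 2 * (21 * (2 * |ρ * z.1| + |ρ * z.2|)) :=
          mul_le_mul_of_nonneg_left (h.trans (by linarith)) (sq_nonneg _)
      _ = ρ * (42 * (|z.1| * z.2 ^ 2) + 21 * |z.2| ^ 3) := by
          rw [abs_mul, abs_mul, abs_of_nonneg h0, ← e2]
          ring
      _ ≤ ρ * (63 * (s * (z.1 ^ 2 + z.2 ^ 2) + dd z / s)) := by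
          refine mul_le_mul_of_nonneg_left ?_ h0
          have : 0 ≤ |z.1| ^ 3 := by positivity
          unfold cube at c1
          linarith
      _ ≤ _ := by nlinarith
  · obtain ⟨b1, b2, b3, -, -, b6, -, -, -⟩ := bounds_of_notMem_good hz
    rw [wt_of_notMem hz, mul_zero, zero_sub, abs_neg, abs_of_nonneg (sq_nonneg _)]
    linarith

lemma fourth_mul_wt_le (h0 : 0 ≤ ρ) (h1 : ρ ≤ 1) (hl0 : 0 ≤ l) (hl1 : l ≤ 1) :
    z.2 ^ 4 * wt ρ l z ≤ 21 * dd z := by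
  by_cases hz : z ∈ good
  · obtain ⟨-, -, h⟩ := abs_exp_sub_one_le hl0 hl1 (abs_scaled_le_one h0 h1 hz.1)
      (abs_scaled_le_one h0 h1 hz.2)
    rw [wt_of_mem hz, xi_eq, dd_of_mem hz]
    have h4 : 0 ≤ z.2 ^ 4 := by positivity
    have h5 : 0 ≤ z.1 ^ 4 := by positivity
    nlinarith
  · rw [wt_of_notMem hz, mul_zero]
    exact mul_nonneg (by norm_num) (dd_nonneg z)

lemma sq_le_weighted_trunc (hs : 0 < s) (hs1 : s ≤ 1) (r : ℝ) : r ^ 2 ≤ s + trunc r / s := by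
  unfold trunc
  split_ifs with h
  · have := mul_le_weighted hs 1 (r ^ 2)
    rw [← pow_mul] at this
    norm_num at this
    exact this
  · have h2 := (abs_le_pow_of_one_le (not_le.1 h).le).2.1
    have h3 : |r| ^ 3 ≤ |r| ^ 3 / s := by
      rw [le_div_iff₀ hs]
      exact mul_le_of_le_one_right (by positivity) hs1
    linarith

end Pointwise

/-! ### Moments of one tilted pair -/

section PairLaw

variable {Ω : Type*} [MeasurableSpace Ω] {μ : Measure Ω} {Z : Ω → ℝ × ℝ} {ρ l s : ℝ}

lemma abs_integral_sub_le {f g h : Ω → ℝ} (hf : AEStronglyMeasurable f μ) (hg : Integrable g μ)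
    (hh : Integrable h μ) (hb : ∀ ω, |f ω - g ω| ≤ h ω) :
    Integrable f μ ∧ |∫ ω, f ω ∂μ - ∫ ω, g ω ∂μ| ≤ ∫ ω, h ω ∂μ := by
  have hd : Integrable (fun ω => f ω - g ω) μ :=
    hh.mono' (hf.sub hg.1) (Filter.Eventually.of_forall fun ω => by simpa using hb ω)
  have hi : Integrable f μ := by
    have := hd.add hg
    refine this.congr (Filter.Eventually.of_forall fun ω => ?_)
    simp
  refine ⟨hi, ?_⟩
  rw [← integral_sub hi hg]
  exact (abs_integral_le_integral_abs).trans (integral_mono hd.abs hh hb)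

/-- The hypotheses on one scaled pair `Z = ((1 + x) X, (1 + x) Y)` used in the expansions, with
`ρ = x / (1 + x)`. -/
structure PairLaw (μ : Measure Ω) (ρ : ℝ) (Z : Ω → ℝ × ℝ) : Prop where
  meas : Measurable Z
  int_cube : Integrable (fun ω => cube (Z ω)) μ
  mean : ∫ ω, (Z ω).1 ∂μ = 0
  cube_le : ∫ ω, cube (Z ω) ∂μ ≤ 1 / 8
  sq_le : ρ ^ 2 * ∫ ω, (Z ω).2 ^ 2 ∂μ ≤ 1 / 16
  rho_nonneg : 0 ≤ ρ
  rho_le : ρ ≤ 1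

/-- The total mass `E e^{l ξ} 1_good` of the exponential tilt. -/
noncomputable def tiltMass (μ : Measure Ω) (ρ l : ℝ) (Z : Ω → ℝ × ℝ) : ℝ := ∫ ω, wt ρ l (Z ω) ∂μ

/-- The expectation of `F Z` under the normalized exponential tilt. -/
noncomputable def tiltMean (μ : Measure Ω) (ρ l : ℝ) (Z : Ω → ℝ × ℝ) (F : ℝ × ℝ → ℝ) : ℝ :=
  (∫ ω, F (Z ω) * wt ρ l (Z ω) ∂μ) / tiltMass μ ρ l Z

lemma abs_pow_le_one_add_cube (r : ℝ) : |r| ≤ 1 + |r| ^ 3 ∧ r ^ 2 ≤ 1 + |r| ^ 3 := by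
  have h := abs_nonneg r
  rcases le_total |r| 1 with h1 | h1
  · have : 0 ≤ |r| ^ 3 := by positivity
    refine ⟨by linarith, ?_⟩
    rw [← sq_abs]
    nlinarith
  · obtain ⟨a, b, -⟩ := abs_le_pow_of_one_le h1
    constructor <;> linarith

lemma integral_dd_nonneg : 0 ≤ ∫ ω, dd (Z ω) ∂μ := integral_nonneg fun ω => dd_nonneg (Z ω)

variable [IsProbabilityMeasure μ]

namespace PairLaw

lemma integrable_comp (hZ : PairLaw μ ρ Z) {F : ℝ × ℝ → ℝ} (hF : Measurable F)
    (hb : ∀ z, |F z| ≤ 3 * (1 + cube z)) : Integrable (fun ω => F (Z ω)) μ :=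
  (((integrable_const (1 : ℝ)).add hZ.int_cube).const_mul 3).mono'
    (hF.comp hZ.meas).aestronglyMeasurable
    (Filter.Eventually.of_forall fun ω => by simpa using hb (Z ω))

lemma int_fst (hZ : PairLaw μ ρ Z) : Integrable (fun ω => (Z ω).1) μ :=
  hZ.integrable_comp measurable_fst fun z => by
    have := (abs_pow_le_one_add_cube z.1).1
    have h2 : 0 ≤ |z.2| ^ 3 := by positivity
    have h1 : 0 ≤ |z.1| ^ 3 := by positivity
    unfold cube
    linarith

lemma int_fst_sq (hZ : PairLaw μ ρ Z) : Integrable (fun ω => (Z ω).1 ^ 2) μ :=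
  hZ.integrable_comp (F := fun z => z.1 ^ 2) (by fun_prop) fun z => by
    have := (abs_pow_le_one_add_cube z.1).2
    have h2 : 0 ≤ |z.2| ^ 3 := by positivity
    have h1 : 0 ≤ |z.1| ^ 3 := by positivity
    rw [abs_of_nonneg (sq_nonneg _)]
    unfold cube
    linarith

lemma int_snd_sq (hZ : PairLaw μ ρ Z) : Integrable (fun ω => (Z ω).2 ^ 2) μ :=
  hZ.integrable_comp (F := fun z => z.2 ^ 2) (by fun_prop) fun z => by
    have := (abs_pow_le_one_add_cube z.2).2
    have h2 : 0 ≤ |z.2| ^ 3 := by positivity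
    have h1 : 0 ≤ |z.1| ^ 3 := by positivity
    rw [abs_of_nonneg (sq_nonneg _)]
    unfold cube
    linarith

lemma int_fst_cube (hZ : PairLaw μ ρ Z) : Integrable (fun ω => (Z ω).1 ^ 3) μ :=
  hZ.integrable_comp (F := fun z => z.1 ^ 3) (by fun_prop) fun z => by
    have h2 : 0 ≤ |z.2| ^ 3 := by positivity
    have h1 : 0 ≤ |z.1| ^ 3 := by positivity
    rw [abs_pow]
    unfold cube
    linarith

lemma int_fst_mul_sq (hZ : PairLaw μ ρ Z) : Integrable (fun ω => (Z ω).1 * (Z ω).2 ^ 2) μ :=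
  hZ.integrable_comp (F := fun z => z.1 * z.2 ^ 2) (by fun_prop) fun z => by
    have h2 : 0 ≤ cube z := cube_nonneg z
    have h1 := abs_fst_mul_sq_le z
    rw [abs_mul, abs_of_nonneg (sq_nonneg z.2)]
    unfold cube at *
    linarith

lemma int_dd (hZ : PairLaw μ ρ Z) : Integrable (fun ω => dd (Z ω)) μ :=
  hZ.integrable_comp measurable_dd fun z => by
    rw [abs_of_nonneg (dd_nonneg z)]
    linarith [dd_le_cube z, cube_nonneg z]

lemma int_weighted (hZ : PairLaw μ ρ Z) (s : ℝ) :
    Integrable (fun ω => s * ((Z ω).1 ^ 2 + (Z ω).2 ^ 2) + dd (Z ω) / s) μ :=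
  ((hZ.int_fst_sq.add hZ.int_snd_sq).const_mul s).add (hZ.int_dd.div_const s)

lemma integral_weighted (hZ : PairLaw μ ρ Z) (s : ℝ) :
    ∫ ω, (s * ((Z ω).1 ^ 2 + (Z ω).2 ^ 2) + dd (Z ω) / s) ∂μ
      = s * (∫ ω, (Z ω).1 ^ 2 ∂μ + ∫ ω, (Z ω).2 ^ 2 ∂μ) + (∫ ω, dd (Z ω) ∂μ) / s := by
  have h1 : Integrable (fun ω => (Z ω).1 ^ 2 + (Z ω).2 ^ 2) μ := hZ.int_fst_sq.add hZ.int_snd_sq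
  rw [integral_add (h1.const_mul s) (hZ.int_dd.div_const s), integral_const_mul,
    integral_add hZ.int_fst_sq hZ.int_snd_sq, integral_div]

lemma dd_le (hZ : PairLaw μ ρ Z) : ∫ ω, dd (Z ω) ∂μ ≤ ∫ ω, cube (Z ω) ∂μ :=
  integral_mono hZ.int_dd hZ.int_cube fun ω => dd_le_cube (Z ω)

lemma integral_sq_le_trunc (hZ : PairLaw μ ρ Z) {g : ℝ × ℝ → ℝ}
    (hgd : ∀ z, trunc (g z) ≤ dd z) (hint : Integrable (fun ω => g (Z ω) ^ 2) μ) :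
    (∫ ω, g (Z ω) ^ 2 ∂μ) ^ 2 ≤ 4 * ∫ ω, dd (Z ω) ∂μ := by
  have he := hZ.dd_le.trans hZ.cube_le
  have he0 := integral_dd_nonneg (μ := μ) (Z := Z)
  have key : ∀ s : ℝ, 0 < s → s ≤ 1 → ∫ ω, g (Z ω) ^ 2 ∂μ ≤ s + (∫ ω, dd (Z ω) ∂μ) / s := by
    intro s hs hs1
    have h : ∫ ω, g (Z ω) ^ 2 ∂μ ≤ ∫ ω, (s + dd (Z ω) / s) ∂μ := by
      refine integral_mono hint ((integrable_const s).add (hZ.int_dd.div_const s)) fun ω => ?_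
      exact (sq_le_weighted_trunc hs hs1 _).trans (by gcongr; exact hgd _)
    rw [integral_add (integrable_const s) (hZ.int_dd.div_const s), integral_div] at h
    simpa using h
  set A := ∫ ω, g (Z ω) ^ 2 ∂μ with hA
  have hA0 : 0 ≤ A := integral_nonneg fun ω => sq_nonneg _
  rcases hA0.eq_or_lt with h0 | h0
  · rw [← h0]
    linarith
  · have h1 := key 1 one_pos le_rfl
    have h2 := key (A / 2) (by linarith) (by linarith)
    have h3 : A / 2 ≤ (∫ ω, dd (Z ω) ∂μ) / (A / 2) := by linarith
    rw [le_div_iff₀ (by linarith)] at h3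
    linarith

lemma fst_sq_sq_le (hZ : PairLaw μ ρ Z) : (∫ ω, (Z ω).1 ^ 2 ∂μ) ^ 2 ≤ 4 * ∫ ω, dd (Z ω) ∂μ :=
  hZ.integral_sq_le_trunc (g := Prod.fst)
    (fun z => by unfold dd; linarith [trunc_nonneg z.2]) hZ.int_fst_sq

lemma snd_sq_sq_le (hZ : PairLaw μ ρ Z) : (∫ ω, (Z ω).2 ^ 2 ∂μ) ^ 2 ≤ 4 * ∫ ω, dd (Z ω) ∂μ :=
  hZ.integral_sq_le_trunc (g := Prod.snd)
    (fun z => by unfold dd; linarith [trunc_nonneg z.1]) hZ.int_snd_sq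

lemma sum_sq_sq_le (hZ : PairLaw μ ρ Z) :
    (∫ ω, (Z ω).1 ^ 2 ∂μ + ∫ ω, (Z ω).2 ^ 2 ∂μ) ^ 2 ≤ 16 * ∫ ω, dd (Z ω) ∂μ := by
  nlinarith [hZ.fst_sq_sq_le, hZ.snd_sq_sq_le,
    sq_nonneg (∫ ω, (Z ω).1 ^ 2 ∂μ - ∫ ω, (Z ω).2 ^ 2 ∂μ)]

lemma int_wt (hZ : PairLaw μ ρ Z) (hl0 : 0 ≤ l) (hl1 : l ≤ 1) :
    Integrable (fun ω => wt ρ l (Z ω)) μ ∧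
      |tiltMass μ ρ l Z - 1| ≤ 170 * (∫ ω, (Z ω).1 ^ 2 ∂μ + ∫ ω, (Z ω).2 ^ 2 ∂μ) := by
  have h1 : Integrable (fun ω => 1 + 2 * l * ρ * (Z ω).1) μ :=
    (integrable_const 1).add (hZ.int_fst.const_mul _)
  have h2 : Integrable (fun ω => (Z ω).1 ^ 2 + (Z ω).2 ^ 2) μ := hZ.int_fst_sq.add hZ.int_snd_sq
  obtain ⟨a, b⟩ := abs_integral_sub_le (((measurable_wt ρ l).comp hZ.meas).aestronglyMeasurable)
    h1 (h2.const_mul 170) fun ω => by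
      have := abs_wt_sub_linear_le (z := Z ω) hZ.rho_nonneg hZ.rho_le hl0 hl1
      rwa [sub_sub] at this
  refine ⟨a, ?_⟩
  unfold tiltMass
  rw [integral_add (integrable_const 1) (hZ.int_fst.const_mul _), integral_const_mul, hZ.mean,
    integral_const_mul, integral_add hZ.int_fst_sq hZ.int_snd_sq] at b
  simpa using b

lemma half_le_tiltMass (hZ : PairLaw μ ρ Z) (hl0 : 0 ≤ l) (hl1 : l ≤ 1) :
    1 / 2 ≤ tiltMass μ ρ l Z := by
  have h1 : Integrable (fun ω => 1 + 2 * l * ρ * (Z ω).1) μ :=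
    (integrable_const 1).add (hZ.int_fst.const_mul _)
  have h2 : Integrable (fun ω => 1 + 2 * l * ρ * (Z ω).1 - l * ρ ^ 2 * (Z ω).2 ^ 2) μ :=
    h1.sub (hZ.int_snd_sq.const_mul _)
  have h := integral_mono (h2.sub (hZ.int_cube.const_mul 3)) (hZ.int_wt hl0 hl1).1
    fun ω => le_wt (z := Z ω) hZ.rho_nonneg hZ.rho_le hl0 hl1
  simp only [Pi.sub_apply] at h
  rw [integral_sub h2 (hZ.int_cube.const_mul 3), integral_sub h1 (hZ.int_snd_sq.const_mul _),
    integral_add (integrable_const 1) (hZ.int_fst.const_mul _), integral_const_mul, hZ.mean,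
    integral_const_mul, integral_const_mul] at h
  simp only [integral_const, probReal_univ, smul_eq_mul, mul_one, mul_zero, add_zero] at h
  have hk := hZ.cube_le
  have hs := hZ.sq_le
  have h0 : 0 ≤ ρ ^ 2 * ∫ ω, (Z ω).2 ^ 2 ∂μ :=
    mul_nonneg (sq_nonneg _) (integral_nonneg fun ω => sq_nonneg _)
  have : l * ρ ^ 2 * ∫ ω, (Z ω).2 ^ 2 ∂μ ≤ ρ ^ 2 * ∫ ω, (Z ω).2 ^ 2 ∂μ := by
    rw [mul_assoc]
    exact mul_le_of_le_one_left h0 hl1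
  unfold tiltMass
  linarith

lemma abs_tiltMass_sub_le (hZ : PairLaw μ ρ Z) (hl0 : 0 ≤ l) (hl1 : l ≤ 1) :
    |tiltMass μ ρ l Z - (1 - l * ρ ^ 2 * ∫ ω, (Z ω).2 ^ 2 ∂μ + 2 * l ^ 2 * ρ ^ 2 * ∫ ω, (Z ω).1 ^ 2 ∂μ
      + ρ ^ 3 * (4 / 3 * l ^ 3 * ∫ ω, (Z ω).1 ^ 3 ∂μ - 2 * l ^ 2 * ∫ ω, (Z ω).1 * (Z ω).2 ^ 2 ∂μ))|
      ≤ 3000 * ∫ ω, dd (Z ω) ∂μ := by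
  have h1 : Integrable (fun ω => 1 + 2 * l * ρ * (Z ω).1) μ :=
    (integrable_const 1).add (hZ.int_fst.const_mul _)
  have h2 : Integrable (fun ω => 1 + 2 * l * ρ * (Z ω).1 - l * ρ ^ 2 * (Z ω).2 ^ 2) μ :=
    h1.sub (hZ.int_snd_sq.const_mul _)
  have h3 : Integrable (fun ω => 1 + 2 * l * ρ * (Z ω).1 - l * ρ ^ 2 * (Z ω).2 ^ 2
      + 2 * l ^ 2 * ρ ^ 2 * (Z ω).1 ^ 2) μ := h2.add (hZ.int_fst_sq.const_mul _)
  have h4 : Integrable (fun ω => 4 / 3 * l ^ 3 * (Z ω).1 ^ 3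
      - 2 * l ^ 2 * ((Z ω).1 * (Z ω).2 ^ 2)) μ :=
    (hZ.int_fst_cube.const_mul _).sub (hZ.int_fst_mul_sq.const_mul _)
  obtain ⟨-, b⟩ := abs_integral_sub_le (((measurable_wt ρ l).comp hZ.meas).aestronglyMeasurable)
    (h3.add (h4.const_mul (ρ ^ 3))) (hZ.int_dd.const_mul 3000) fun ω => by
      exact abs_wt_sub_quartic_le (z := Z ω) hZ.rho_nonneg hZ.rho_le hl0 hl1
  simp only [Pi.add_apply] at b
  rw [integral_add h3 (h4.const_mul _), integral_add h2 (hZ.int_fst_sq.const_mul _),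
    integral_sub h1 (hZ.int_snd_sq.const_mul _), integral_const_mul, integral_const_mul (ρ ^ 3),
    integral_sub (hZ.int_fst_cube.const_mul _) (hZ.int_fst_mul_sq.const_mul _),
    integral_add (integrable_const 1) (hZ.int_fst.const_mul _), integral_const_mul, hZ.mean,
    integral_const_mul, integral_const_mul, integral_const_mul, integral_const_mul] at b
  simp only [integral_const, probReal_univ, smul_eq_mul, mul_one, mul_zero, add_zero] at b
  exact b

lemma abs_log_tiltMass_sub_le (hZ : PairLaw μ ρ Z) (hl0 : 0 ≤ l) (hl1 : l ≤ 1) :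
    |Real.log (tiltMass μ ρ l Z) - (- l * ρ ^ 2 * ∫ ω, (Z ω).2 ^ 2 ∂μ
      + 2 * l ^ 2 * ρ ^ 2 * ∫ ω, (Z ω).1 ^ 2 ∂μ
      + ρ ^ 3 * (4 / 3 * l ^ 3 * ∫ ω, (Z ω).1 ^ 3 ∂μ - 2 * l ^ 2 * ∫ ω, (Z ω).1 * (Z ω).2 ^ 2 ∂μ))|
      ≤ 10 ^ 6 * ∫ ω, dd (Z ω) ∂μ := by
  have h1 := hZ.abs_tiltMass_sub_le hl0 hl1
  have h2 := (hZ.int_wt hl0 hl1).2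
  have h3 := hZ.half_le_tiltMass hl0 hl1
  have h4 := hZ.sum_sq_sq_le
  set M := tiltMass μ ρ l Z with hM
  have hM0 : 0 < M := by linarith
  have h5 := Real.log_le_sub_one_of_pos hM0
  have h6 := Real.one_sub_inv_le_log_of_pos hM0
  have h7 : M - 1 - 2 * (M - 1) ^ 2 ≤ 1 - M⁻¹ := by
    have : 1 - M⁻¹ - (M - 1 - 2 * (M - 1) ^ 2) = (M - 1) ^ 2 * (2 * M - 1) / M := by
      field_simp
      ring
    have : 0 ≤ (M - 1) ^ 2 * (2 * M - 1) / M :=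
      div_nonneg (mul_nonneg (sq_nonneg _) (by linarith)) hM0.le
    linarith
  have h8 : (M - 1) ^ 2 ≤ 170 ^ 2 * (16 * ∫ ω, dd (Z ω) ∂μ) := by
    rw [← sq_abs (M - 1)]
    have := pow_le_pow_left₀ (abs_nonneg _) h2 2
    rw [mul_pow] at this
    linarith
  have he0 := integral_dd_nonneg (μ := μ) (Z := Z)
  rw [abs_le] at h1 ⊢
  constructor <;> linarith [h1.1, h1.2]

/-- The numerator of the tilted mean of `ξ`: a crude bound, and the expansion with the error in terms
of third moments or of interpolated moments. -/
lemma int_mul_wt (hZ : PairLaw μ ρ Z) (hl0 : 0 ≤ l) (hl1 : l ≤ 1) :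
    |∫ ω, xi ρ (Z ω) * wt ρ l (Z ω) ∂μ|
        ≤ 170 * ρ * (∫ ω, (Z ω).1 ^ 2 ∂μ + ∫ ω, (Z ω).2 ^ 2 ∂μ) ∧
    |∫ ω, xi ρ (Z ω) * wt ρ l (Z ω) ∂μ
      - (-(ρ ^ 2 * ∫ ω, (Z ω).2 ^ 2 ∂μ) + 4 * l * ρ ^ 2 * ∫ ω, (Z ω).1 ^ 2 ∂μ)|
        ≤ 700 * ρ * ∫ ω, cube (Z ω) ∂μ ∧
    ∀ s : ℝ, 0 < s → |∫ ω, xi ρ (Z ω) * wt ρ l (Z ω) ∂μ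
      - (-(ρ ^ 2 * ∫ ω, (Z ω).2 ^ 2 ∂μ) + 4 * l * ρ ^ 2 * ∫ ω, (Z ω).1 ^ 2 ∂μ)|
        ≤ 700 * (ρ ^ 3 * (s * (∫ ω, (Z ω).1 ^ 2 ∂μ + ∫ ω, (Z ω).2 ^ 2 ∂μ)
          + (∫ ω, dd (Z ω) ∂μ) / s) + ∫ ω, dd (Z ω) ∂μ) := by
  have hm : AEStronglyMeasurable (fun ω => xi ρ (Z ω) * wt ρ l (Z ω)) μ :=
    (((measurable_xi ρ).comp hZ.meas).mul ((measurable_wt ρ l).comp hZ.meas)).aestronglyMeasurable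
  have h2 : Integrable (fun ω => (Z ω).1 ^ 2 + (Z ω).2 ^ 2) μ := hZ.int_fst_sq.add hZ.int_snd_sq
  have h3 : Integrable (fun ω => 2 * ρ * (Z ω).1 - ρ ^ 2 * (Z ω).2 ^ 2) μ :=
    (hZ.int_fst.const_mul _).sub (hZ.int_snd_sq.const_mul _)
  have h4 : Integrable (fun ω => 2 * ρ * (Z ω).1 - ρ ^ 2 * (Z ω).2 ^ 2
      + 4 * l * ρ ^ 2 * (Z ω).1 ^ 2) μ := h3.add (hZ.int_fst_sq.const_mul _)
  have e4 : ∫ ω, (2 * ρ * (Z ω).1 - ρ ^ 2 * (Z ω).2 ^ 2 + 4 * l * ρ ^ 2 * (Z ω).1 ^ 2) ∂μ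
      = -(ρ ^ 2 * ∫ ω, (Z ω).2 ^ 2 ∂μ) + 4 * l * ρ ^ 2 * ∫ ω, (Z ω).1 ^ 2 ∂μ := by
    rw [integral_add h3 (hZ.int_fst_sq.const_mul _),
      integral_sub (hZ.int_fst.const_mul _) (hZ.int_snd_sq.const_mul _), integral_const_mul,
      integral_const_mul, integral_const_mul, hZ.mean]
    ring
  refine ⟨?_, ?_, fun s hs => ?_⟩
  · obtain ⟨-, b⟩ := abs_integral_sub_le hm (hZ.int_fst.const_mul (2 * ρ))
      (h2.const_mul (170 * ρ)) fun ω =>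
        abs_xi_mul_wt_sub_linear_le (z := Z ω) hZ.rho_nonneg hZ.rho_le hl0 hl1
    rw [integral_const_mul, hZ.mean, integral_const_mul,
      integral_add hZ.int_fst_sq hZ.int_snd_sq] at b
    simpa using b
  · obtain ⟨-, b⟩ := abs_integral_sub_le hm h4 (hZ.int_cube.const_mul (700 * ρ)) fun ω =>
        abs_xi_mul_wt_sub_quadratic_le (z := Z ω) hZ.rho_nonneg hZ.rho_le hl0 hl1
    rwa [e4, integral_const_mul] at b
  · have h5 := (hZ.int_weighted s).const_mul (ρ ^ 3)
    have h6 : Integrable (fun ω => ρ ^ 3 * (s * ((Z ω).1 ^ 2 + (Z ω).2 ^ 2) + dd (Z ω) / s)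
      + dd (Z ω)) μ := h5.add hZ.int_dd
    obtain ⟨-, b⟩ := abs_integral_sub_le hm h4 (h6.const_mul 700) fun ω =>
        abs_xi_mul_wt_sub_quadratic_le_weighted (z := Z ω) hZ.rho_nonneg hZ.rho_le hl0 hl1 hs
    rwa [e4, integral_const_mul, integral_add h5 hZ.int_dd, integral_const_mul,
      hZ.integral_weighted] at b

/-- Dividing by the mass `M` changes an integral by at most `|M - 1|` times twice its size. -/
lemma abs_div_sub_self_le {M A : ℝ} (hM : 1 / 2 ≤ M) : |A / M - A| ≤ 2 * (|A| * |M - 1|) := by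
  have hM0 : 0 < M := by linarith
  have : A / M - A = -(A * (M - 1)) / M := by
    field_simp
    ring
  rw [this, abs_div, abs_neg, abs_mul, abs_of_pos hM0, div_le_iff₀ hM0]
  nlinarith [mul_nonneg (abs_nonneg A) (abs_nonneg (M - 1))]

lemma abs_div_le {M A : ℝ} (hM : 1 / 2 ≤ M) : |A / M| ≤ 2 * |A| := by
  have hM0 : 0 < M := by linarith
  rw [abs_div, abs_of_pos hM0, div_le_iff₀ hM0]
  nlinarith [abs_nonneg A]

lemma abs_tiltMean_xi_le (hZ : PairLaw μ ρ Z) (hl0 : 0 ≤ l) (hl1 : l ≤ 1) :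
    |tiltMean μ ρ l Z (xi ρ)| ≤ 340 * ρ * (∫ ω, (Z ω).1 ^ 2 ∂μ + ∫ ω, (Z ω).2 ^ 2 ∂μ) := by
  have h := abs_div_le (A := ∫ ω, xi ρ (Z ω) * wt ρ l (Z ω) ∂μ) (hZ.half_le_tiltMass hl0 hl1)
  have := (hZ.int_mul_wt hl0 hl1).1
  unfold tiltMean
  linarith

lemma tiltMean_xi_sq_le (hZ : PairLaw μ ρ Z) (hl0 : 0 ≤ l) (hl1 : l ≤ 1) :
    (tiltMean μ ρ l Z (xi ρ)) ^ 2 ≤ 2 * 10 ^ 6 * (ρ ^ 2 * ∫ ω, dd (Z ω) ∂μ) := by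
  have h := pow_le_pow_left₀ (abs_nonneg _) (hZ.abs_tiltMean_xi_le hl0 hl1) 2
  rw [sq_abs, mul_pow, mul_pow] at h
  have h2 := mul_le_mul_of_nonneg_left hZ.sum_sq_sq_le (sq_nonneg ρ)
  have := mul_nonneg (sq_nonneg ρ) (integral_dd_nonneg (μ := μ) (Z := Z))
  nlinarith

lemma abs_tiltMean_xi_sub_aux (hZ : PairLaw μ ρ Z) (hl0 : 0 ≤ l) (hl1 : l ≤ 1) :
    |tiltMean μ ρ l Z (xi ρ) - ∫ ω, xi ρ (Z ω) * wt ρ l (Z ω) ∂μ|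
      ≤ 924800 * (ρ * ∫ ω, dd (Z ω) ∂μ) := by
  have h := abs_div_sub_self_le (A := ∫ ω, xi ρ (Z ω) * wt ρ l (Z ω) ∂μ)
    (hZ.half_le_tiltMass hl0 hl1)
  have h1 := (hZ.int_mul_wt hl0 hl1).1
  have h2 := (hZ.int_wt hl0 hl1).2
  have h3 := mul_le_mul h1 h2 (abs_nonneg _) ((abs_nonneg _).trans h1)
  have h4 := mul_le_mul_of_nonneg_left hZ.sum_sq_sq_le hZ.rho_nonneg
  unfold tiltMean
  nlinarith

lemma abs_tiltMean_xi_sub_le (hZ : PairLaw μ ρ Z) (hl0 : 0 ≤ l) (hl1 : l ≤ 1) :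
    |tiltMean μ ρ l Z (xi ρ)
      - (-(ρ ^ 2 * ∫ ω, (Z ω).2 ^ 2 ∂μ) + 4 * l * ρ ^ 2 * ∫ ω, (Z ω).1 ^ 2 ∂μ)|
        ≤ 10 ^ 6 * (ρ * ∫ ω, cube (Z ω) ∂μ) := by
  have h := hZ.abs_tiltMean_xi_sub_aux hl0 hl1
  have h1 := (hZ.int_mul_wt hl0 hl1).2.1
  have h2 := mul_le_mul_of_nonneg_left hZ.dd_le hZ.rho_nonneg
  have h3 := mul_nonneg hZ.rho_nonneg (integral_dd_nonneg (μ := μ) (Z := Z))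
  have h4 := abs_sub_le (tiltMean μ ρ l Z (xi ρ)) (∫ ω, xi ρ (Z ω) * wt ρ l (Z ω) ∂μ)
    (-(ρ ^ 2 * ∫ ω, (Z ω).2 ^ 2 ∂μ) + 4 * l * ρ ^ 2 * ∫ ω, (Z ω).1 ^ 2 ∂μ)
  linarith

lemma abs_tiltMean_xi_sub_le_weighted (hZ : PairLaw μ ρ Z) (hl0 : 0 ≤ l) (hl1 : l ≤ 1)
    (hs : 0 < s) :
    |tiltMean μ ρ l Z (xi ρ)
      - (-(ρ ^ 2 * ∫ ω, (Z ω).2 ^ 2 ∂μ) + 4 * l * ρ ^ 2 * ∫ ω, (Z ω).1 ^ 2 ∂μ)|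
        ≤ 10 ^ 6 * (ρ ^ 3 * (s * (∫ ω, (Z ω).1 ^ 2 ∂μ + ∫ ω, (Z ω).2 ^ 2 ∂μ)
          + (∫ ω, dd (Z ω) ∂μ) / s) + ∫ ω, dd (Z ω) ∂μ) := by
  have h := hZ.abs_tiltMean_xi_sub_aux hl0 hl1
  have h1 := (hZ.int_mul_wt hl0 hl1).2.2 s hs
  have h3 := mul_le_of_le_one_left (integral_dd_nonneg (μ := μ) (Z := Z)) hZ.rho_le
  have h5 := integral_dd_nonneg (μ := μ) (Z := Z)
  have h4 := abs_sub_le (tiltMean μ ρ l Z (xi ρ)) (∫ ω, xi ρ (Z ω) * wt ρ l (Z ω) ∂μ)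
    (-(ρ ^ 2 * ∫ ω, (Z ω).2 ^ 2 ∂μ) + 4 * l * ρ ^ 2 * ∫ ω, (Z ω).1 ^ 2 ∂μ)
  have h6 : 0 ≤ ρ ^ 3 * (s * (∫ ω, (Z ω).1 ^ 2 ∂μ + ∫ ω, (Z ω).2 ^ 2 ∂μ)
          + (∫ ω, dd (Z ω) ∂μ) / s) := by
    have a0 : 0 ≤ ∫ ω, (Z ω).1 ^ 2 ∂μ := integral_nonneg fun ω => sq_nonneg _
    have b0 : 0 ≤ ∫ ω, (Z ω).2 ^ 2 ∂μ := integral_nonneg fun ω => sq_nonneg _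
    have := hZ.rho_nonneg
    positivity
  linarith

lemma abs_tiltVar_sub_le (hZ : PairLaw μ ρ Z) (hl0 : 0 ≤ l) (hl1 : l ≤ 1) :
    |tiltMean μ ρ l Z (fun z => xi ρ z ^ 2) - tiltMean μ ρ l Z (xi ρ) ^ 2
      - 4 * ρ ^ 2 * ∫ ω, (Z ω).1 ^ 2 ∂μ| ≤ 3 * 10 ^ 6 * (ρ ^ 2 * ∫ ω, cube (Z ω) ∂μ) := by
  have hm : AEStronglyMeasurable (fun ω => xi ρ (Z ω) ^ 2 * wt ρ l (Z ω)) μ :=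
    ((((measurable_xi ρ).comp hZ.meas).pow_const 2).mul
      ((measurable_wt ρ l).comp hZ.meas)).aestronglyMeasurable
  obtain ⟨-, b⟩ := abs_integral_sub_le hm (hZ.int_fst_sq.const_mul (4 * ρ ^ 2))
    (hZ.int_cube.const_mul (700 * ρ ^ 2)) fun ω =>
      abs_xi_sq_mul_wt_sub_le (z := Z ω) hZ.rho_nonneg hZ.rho_le hl0 hl1
  rw [integral_const_mul, integral_const_mul] at b
  have hM := hZ.half_le_tiltMass hl0 hl1
  have h1 := abs_div_le (A := ∫ ω, xi ρ (Z ω) ^ 2 * wt ρ l (Z ω) ∂μ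
    - 4 * ρ ^ 2 * ∫ ω, (Z ω).1 ^ 2 ∂μ) hM
  have h2 := abs_div_sub_self_le (A := 4 * ρ ^ 2 * ∫ ω, (Z ω).1 ^ 2 ∂μ) hM
  rw [sub_div] at h1
  have h3 := (hZ.int_wt hl0 hl1).2
  have a0 : 0 ≤ ∫ ω, (Z ω).1 ^ 2 ∂μ := integral_nonneg fun ω => sq_nonneg _
  have b0 : 0 ≤ ∫ ω, (Z ω).2 ^ 2 ∂μ := integral_nonneg fun ω => sq_nonneg _
  have h4 : |4 * ρ ^ 2 * ∫ ω, (Z ω).1 ^ 2 ∂μ| * |tiltMass μ ρ l Z - 1|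
      ≤ 680 * (ρ ^ 2 * (16 * ∫ ω, dd (Z ω) ∂μ)) := by
    rw [abs_of_nonneg (by positivity)]
    calc _ ≤ 4 * ρ ^ 2 * (∫ ω, (Z ω).1 ^ 2 ∂μ + ∫ ω, (Z ω).2 ^ 2 ∂μ)
          * (170 * (∫ ω, (Z ω).1 ^ 2 ∂μ + ∫ ω, (Z ω).2 ^ 2 ∂μ)) := by
          gcongr
          linarith
      _ = 680 * (ρ ^ 2 * (∫ ω, (Z ω).1 ^ 2 ∂μ + ∫ ω, (Z ω).2 ^ 2 ∂μ) ^ 2) := by ring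
      _ ≤ _ := by
          gcongr
          exact hZ.sum_sq_sq_le
  have h5 := hZ.tiltMean_xi_sq_le hl0 hl1
  have h6 := mul_le_mul_of_nonneg_left hZ.dd_le (sq_nonneg ρ)
  have h7 := sq_nonneg (tiltMean μ ρ l Z (xi ρ))
  have h8 := mul_nonneg (sq_nonneg ρ) (integral_dd_nonneg (μ := μ) (Z := Z))
  unfold tiltMean at *
  beta_reduce
  rw [abs_le] at h1 h2 ⊢
  constructor <;> linarith [h1.1, h1.2, h2.1, h2.2]

lemma tiltMean_xi_cube_le (hZ : PairLaw μ ρ Z) (hl0 : 0 ≤ l) (hl1 : l ≤ 1) :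
    tiltMean μ ρ l Z (fun z => |xi ρ z| ^ 3) ≤ 1344 * (ρ ^ 3 * ∫ ω, cube (Z ω) ∂μ) := by
  have hM := hZ.half_le_tiltMass hl0 hl1
  have hp : ∀ ω, 0 ≤ |xi ρ (Z ω)| ^ 3 * wt ρ l (Z ω) := fun ω =>
    mul_nonneg (by positivity) (wt_nonneg _ _ _)
  have h1 : ∫ ω, |xi ρ (Z ω)| ^ 3 * wt ρ l (Z ω) ∂μ ≤ 672 * ρ ^ 3 * ∫ ω, cube (Z ω) ∂μ := by
    rw [← integral_const_mul]
    exact integral_mono_of_nonneg (Filter.Eventually.of_forall hp) (hZ.int_cube.const_mul _)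
      (Filter.Eventually.of_forall fun ω =>
        abs_xi_cube_mul_wt_le (z := Z ω) hZ.rho_nonneg hZ.rho_le hl0 hl1)
  have h2 := abs_div_le (A := ∫ ω, |xi ρ (Z ω)| ^ 3 * wt ρ l (Z ω) ∂μ) hM
  rw [abs_of_nonneg (integral_nonneg hp)] at h2
  unfold tiltMean
  linarith [le_abs_self ((∫ ω, |xi ρ (Z ω)| ^ 3 * wt ρ l (Z ω) ∂μ) / tiltMass μ ρ l Z)]

lemma tiltMean_snd_fourth_le (hZ : PairLaw μ ρ Z) (hl0 : 0 ≤ l) (hl1 : l ≤ 1) :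
    tiltMean μ ρ l Z (fun z => z.2 ^ 4) ≤ 42 * ∫ ω, dd (Z ω) ∂μ := by
  have hM := hZ.half_le_tiltMass hl0 hl1
  have hp : ∀ ω, 0 ≤ (Z ω).2 ^ 4 * wt ρ l (Z ω) := fun ω =>
    mul_nonneg (by positivity) (wt_nonneg _ _ _)
  have h1 : ∫ ω, (Z ω).2 ^ 4 * wt ρ l (Z ω) ∂μ ≤ 21 * ∫ ω, dd (Z ω) ∂μ := by
    rw [← integral_const_mul]
    exact integral_mono_of_nonneg (Filter.Eventually.of_forall hp) (hZ.int_dd.const_mul _)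
      (Filter.Eventually.of_forall fun ω =>
        fourth_mul_wt_le (z := Z ω) hZ.rho_nonneg hZ.rho_le hl0 hl1)
  have h2 := abs_div_le (A := ∫ ω, (Z ω).2 ^ 4 * wt ρ l (Z ω) ∂μ) hM
  rw [abs_of_nonneg (integral_nonneg hp)] at h2
  unfold tiltMean
  linarith [le_abs_self ((∫ ω, (Z ω).2 ^ 4 * wt ρ l (Z ω) ∂μ) / tiltMass μ ρ l Z)]

lemma abs_tiltMean_snd_sq_sub_le (hZ : PairLaw μ ρ Z) (hl0 : 0 ≤ l) (hl1 : l ≤ 1) (hs : 0 < s) :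
    |tiltMean μ ρ l Z (fun z => z.2 ^ 2) - ∫ ω, (Z ω).2 ^ 2 ∂μ|
      ≤ 10 ^ 4 * (ρ * (s * (∫ ω, (Z ω).1 ^ 2 ∂μ + ∫ ω, (Z ω).2 ^ 2 ∂μ)
          + (∫ ω, dd (Z ω) ∂μ) / s) + ∫ ω, dd (Z ω) ∂μ) := by
  have hm : AEStronglyMeasurable (fun ω => (Z ω).2 ^ 2 * wt ρ l (Z ω)) μ :=
    ((hZ.meas.snd.pow_const 2).mul ((measurable_wt ρ l).comp hZ.meas)).aestronglyMeasurable
  have h5 := (hZ.int_weighted s).const_mul ρ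
  have h6 : Integrable (fun ω => ρ * (s * ((Z ω).1 ^ 2 + (Z ω).2 ^ 2) + dd (Z ω) / s)
      + dd (Z ω)) μ := h5.add hZ.int_dd
  obtain ⟨-, b⟩ := abs_integral_sub_le hm hZ.int_snd_sq (h6.const_mul 100) fun ω =>
        abs_sq_mul_wt_sub_le (z := Z ω) hZ.rho_nonneg hZ.rho_le hl0 hl1 hs
  rw [integral_const_mul, integral_add h5 hZ.int_dd, integral_const_mul,
      hZ.integral_weighted] at b
  have hM := hZ.half_le_tiltMass hl0 hl1
  have h1 := abs_div_le (A := ∫ ω, (Z ω).2 ^ 2 * wt ρ l (Z ω) ∂μ - ∫ ω, (Z ω).2 ^ 2 ∂μ) hM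
  have h2 := abs_div_sub_self_le (A := ∫ ω, (Z ω).2 ^ 2 ∂μ) hM
  rw [sub_div] at h1
  have h3 := (hZ.int_wt hl0 hl1).2
  have a0 : 0 ≤ ∫ ω, (Z ω).1 ^ 2 ∂μ := integral_nonneg fun ω => sq_nonneg _
  have b0 : 0 ≤ ∫ ω, (Z ω).2 ^ 2 ∂μ := integral_nonneg fun ω => sq_nonneg _
  have e0 := integral_dd_nonneg (μ := μ) (Z := Z)
  have h4 : |∫ ω, (Z ω).2 ^ 2 ∂μ| * |tiltMass μ ρ l Z - 1| ≤ 170 * (16 * ∫ ω, dd (Z ω) ∂μ) := by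
    rw [abs_of_nonneg b0]
    have := mul_le_mul_of_nonneg_left h3 b0
    nlinarith [hZ.sum_sq_sq_le]
  have h7 : 0 ≤ ρ * (s * (∫ ω, (Z ω).1 ^ 2 ∂μ + ∫ ω, (Z ω).2 ^ 2 ∂μ)
          + (∫ ω, dd (Z ω) ∂μ) / s) := by
    have := hZ.rho_nonneg
    positivity
  unfold tiltMean
  beta_reduce
  rw [abs_le] at h1 h2 ⊢
  constructor <;> linarith [h1.1, h1.2, h2.1, h2.2]

end PairLaw
end PairLaw

/-! ### The saddle point -/

section Saddle

variable {Ω : Type*} [MeasurableSpace Ω] {μ : Measure Ω}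
  {ι : Type*} [Fintype ι]

lemma wt_le (ρ l : ℝ) (z : ℝ × ℝ) (h0 : 0 ≤ ρ) (h1 : ρ ≤ 1) (hl0 : 0 ≤ l) (hl1 : l ≤ 1) :
    wt ρ l z ≤ 21 ∧ |xi ρ z| * wt ρ l z ≤ 63 := by
  by_cases hz : z ∈ good
  · have hu := abs_scaled_le_one h0 h1 hz.1
    have hw := abs_scaled_le_one h0 h1 hz.2
    obtain ⟨-, -, h⟩ := abs_exp_sub_one_le hl0 hl1 hu hw
    have h2 := abs_xi_le (u := ρ * z.1) hw
    rw [wt_of_mem hz, xi_eq]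
    refine ⟨h, ?_⟩
    nlinarith [Real.exp_pos (l * (2 * (ρ * z.1) - (ρ * z.2) ^ 2)),
      abs_nonneg (2 * (ρ * z.1) - (ρ * z.2) ^ 2)]
  · simp [wt_of_notMem hz]

/-- The tilted mean depends continuously on the tilting parameter. -/
lemma continuousOn_tiltMean_xi [IsProbabilityMeasure μ] {ρ : ℝ} {Z : Ω → ℝ × ℝ} (hZ : PairLaw μ ρ Z) :
    ContinuousOn (fun l => tiltMean μ ρ l Z (xi ρ)) (Set.Icc 0 1) := by
  have hc : ∀ z, Continuous fun l => wt ρ l z := by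
    intro z
    by_cases hz : z ∈ good
    · simp only [wt_of_mem hz]
      fun_prop
    · simp only [wt_of_notMem hz]
      fun_prop
  refine ContinuousOn.div ?_ ?_ fun l hl => ?_
  · refine continuousOn_of_dominated (bound := fun _ => 63) (fun l hl => ?_)
      (fun l hl => Filter.Eventually.of_forall fun ω => ?_) (integrable_const _)
      (Filter.Eventually.of_forall fun ω => ((hc (Z ω)).const_mul _).continuousOn)
    · exact (((measurable_xi ρ).comp hZ.meas).mul
        ((measurable_wt ρ l).comp hZ.meas)).aestronglyMeasurable
    · rw [Real.norm_eq_abs, abs_mul, abs_of_nonneg (wt_nonneg _ _ _)]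
      exact (wt_le ρ l _ hZ.rho_nonneg hZ.rho_le hl.1 hl.2).2
  · refine continuousOn_of_dominated (bound := fun _ => 21) (fun l hl => ?_)
      (fun l hl => Filter.Eventually.of_forall fun ω => ?_) (integrable_const _)
      (Filter.Eventually.of_forall fun ω => (hc (Z ω)).continuousOn)
    · exact ((measurable_wt ρ l).comp hZ.meas).aestronglyMeasurable
    · rw [Real.norm_eq_abs, abs_of_nonneg (wt_nonneg _ _ _)]
      exact (wt_le ρ l _ hZ.rho_nonneg hZ.rho_le hl.1 hl.2).1
  · have := hZ.half_le_tiltMass hl.1 hl.2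
    linarith

lemma abs_sum_sub_sum_le {f g h : ι → ℝ} (H : ∀ i, |f i - g i| ≤ h i) :
    |∑ i, f i - ∑ i, g i| ≤ ∑ i, h i := by
  rw [← Finset.sum_sub_distrib]
  exact (Finset.abs_sum_le_sum_abs _ _).trans (Finset.sum_le_sum fun i _ => H i)

/-- An independent sample of scaled pairs `Z i = t • (X i, Y i)`, where `t = 1 + x` and
`ρ = x / t`, with total truncated moments at most `R` and total third moments at most
`ε t ^ 2`. -/
structure Sample (μ : Measure Ω) (x t ρ c R ε : ℝ) (Z : ι → Ω → ℝ × ℝ) : Prop where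
  law : ∀ i, PairLaw μ ρ (Z i)
  ind : iIndepFun Z μ
  x_pos : 0 < x
  t_eq : t = 1 + x
  rho_mul : ρ * t = x
  abs_c_le : |c| ≤ x / 5
  sum_fst : ∑ i, ∫ ω, (Z i ω).1 ^ 2 ∂μ = t ^ 2
  sum_snd : ∑ i, ∫ ω, (Z i ω).2 ^ 2 ∂μ = t ^ 2
  R_pos : 0 < R
  sum_dd : ∑ i, ∫ ω, dd (Z i ω) ∂μ ≤ R
  R_le : R ≤ 10⁻¹ ^ 30 * x ^ 2
  sum_cube : ∑ i, ∫ ω, cube (Z i ω) ∂μ ≤ ε * t ^ 2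
  eps_pos : 0 < ε
  eps_le : ε ≤ 10⁻¹ ^ 30

/-- The skewness term of the log-moment generating function. -/
noncomputable def skew (μ : Measure Ω) (ρ l : ℝ) (Z : ι → Ω → ℝ × ℝ) : ℝ :=
  ρ ^ 3 * (4 / 3 * l ^ 3 * ∑ i, ∫ ω, (Z i ω).1 ^ 3 ∂μ
    - 2 * l ^ 2 * ∑ i, ∫ ω, (Z i ω).1 * (Z i ω).2 ^ 2 ∂μ)

namespace Sample

variable {x t ρ c R ε l : ℝ} {Z : ι → Ω → ℝ × ℝ}

lemma t_pos (h : Sample μ x t ρ c R ε Z) : 0 < t := by linarith [h.t_eq, h.x_pos]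

lemma one_le_t (h : Sample μ x t ρ c R ε Z) : 1 ≤ t := by linarith [h.t_eq, h.x_pos]

lemma x_le_t (h : Sample μ x t ρ c R ε Z) : x ≤ t := by linarith [h.t_eq]

lemma rho_pos (h : Sample μ x t ρ c R ε Z) : 0 < ρ := by
  by_contra hc
  have := mul_nonpos_of_nonpos_of_nonneg (not_lt.1 hc) h.t_pos.le
  linarith [h.x_pos, h.rho_mul]

lemma rho_le (h : Sample μ x t ρ c R ε Z) : ρ ≤ 1 := by
  by_contra hc
  have := mul_lt_mul_of_pos_right (not_le.1 hc) h.t_pos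
  linarith [h.x_le_t, h.rho_mul]

lemma eps_nonneg (h : Sample μ x t ρ c R ε Z) : 0 ≤ ε := h.eps_pos.le

lemma sqrt_R_le (h : Sample μ x t ρ c R ε Z) : √R ≤ 10⁻¹ ^ 15 * x := by
  rw [Real.sqrt_le_left (mul_nonneg (by norm_num) h.x_pos.le)]
  refine h.R_le.trans (le_of_eq ?_)
  ring

lemma sqrt_R_pos (h : Sample μ x t ρ c R ε Z) : 0 < √R := Real.sqrt_pos.2 h.R_pos

lemma sq_sqrt_R (h : Sample μ x t ρ c R ε Z) : √R * √R = R := Real.mul_self_sqrt h.R_pos.le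

lemma R_le_mul_sqrt (h : Sample μ x t ρ c R ε Z) : R ≤ x * √R := by
  have h1 := h.sqrt_R_le
  have h2 := h.sqrt_R_pos
  have h3 := h.x_pos
  have : √R ≤ x := by
    refine h1.trans ?_
    exact mul_le_of_le_one_left h3.le (by norm_num)
  calc R = √R * √R := h.sq_sqrt_R.symm
    _ ≤ x * √R := mul_le_mul_of_nonneg_right this h2.le

lemma rho_sq_mul (h : Sample μ x t ρ c R ε Z) : ρ ^ 2 * t ^ 2 = x ^ 2 := by
  rw [← h.rho_mul]
  ring

/-- The approximate saddle point `γ = (1 + c / x) / 2`. -/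
lemma gamma_mem (h : Sample μ x t ρ c R ε Z) :
    2 / 5 ≤ (1 + c / x) / 2 ∧ (1 + c / x) / 2 ≤ 3 / 5 ∧ 2 * ((1 + c / x) / 2) * x = x + c := by
  have hx := h.x_pos
  have h1 := abs_le.1 h.abs_c_le
  have h2 : -(1 / 5) ≤ c / x := by
    rw [le_div_iff₀ hx]
    linarith
  have h3 : c / x ≤ 1 / 5 := by
    rw [div_le_iff₀ hx]
    linarith
  refine ⟨by linarith, by linarith, ?_⟩
  field_simp

lemma weight_pos (h : Sample μ x t ρ c R ε Z) : 0 < √R / t := div_pos h.sqrt_R_pos h.t_pos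

/-- Summing the weighted interpolation bounds with the weight `√R / t`. -/
lemma sum_weighted_le (h : Sample μ x t ρ c R ε Z) :
    ∑ i, ((√R / t) * (∫ ω, (Z i ω).1 ^ 2 ∂μ + ∫ ω, (Z i ω).2 ^ 2 ∂μ)
      + (∫ ω, dd (Z i ω) ∂μ) / (√R / t)) ≤ 3 * (t * √R) := by
  have ht := h.t_pos
  have hR := h.sqrt_R_pos
  rw [Finset.sum_add_distrib, ← Finset.mul_sum, Finset.sum_add_distrib, h.sum_fst, h.sum_snd,
    ← Finset.sum_div]
  have h1 : (∑ i, ∫ ω, dd (Z i ω) ∂μ) / (√R / t) ≤ R / (√R / t) := by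
    gcongr
    exact h.sum_dd
  have h2 : R / (√R / t) = t * √R := by
    rw [div_div_eq_mul_div, div_eq_iff hR.ne', mul_assoc, h.sq_sqrt_R, mul_comm]
  have h3 : √R / t * (t ^ 2 + t ^ 2) = 2 * (t * √R) := by
    field_simp
    ring
  linarith

lemma rho_cube_mul_le (h : Sample μ x t ρ c R ε Z) : ρ ^ 3 * (t * √R) ≤ x * √R := by
  have h1 : ρ ^ 3 * (t * √R) = ρ ^ 2 * (x * √R) := by rw [← h.rho_mul]; ring
  rw [h1]
  exact mul_le_of_le_one_left (mul_nonneg h.x_pos.le h.sqrt_R_pos.le)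
    (pow_le_one₀ h.rho_pos.le h.rho_le)

variable [IsProbabilityMeasure μ]

lemma sum_third_le (h : Sample μ x t ρ c R ε Z) :
    ∑ i, (|∫ ω, (Z i ω).1 ^ 3 ∂μ| + |∫ ω, (Z i ω).1 * (Z i ω).2 ^ 2 ∂μ|) ≤ 9 * (t * √R) := by
  have h1 : ∀ i, |∫ ω, (Z i ω).1 ^ 3 ∂μ| + |∫ ω, (Z i ω).1 * (Z i ω).2 ^ 2 ∂μ|
      ≤ 2 * ((√R / t) * (∫ ω, (Z i ω).1 ^ 2 ∂μ + ∫ ω, (Z i ω).2 ^ 2 ∂μ)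
      + (∫ ω, dd (Z i ω) ∂μ) / (√R / t)) + 3 * ∫ ω, dd (Z i ω) ∂μ := by
    intro i
    have hZ := h.law i
    have a1 : |∫ ω, (Z i ω).1 ^ 3 ∂μ| ≤ ∫ ω, |(Z i ω).1| ^ 3 ∂μ := by
      refine abs_integral_le_integral_abs.trans (le_of_eq ?_)
      simp only [abs_pow]
    have a2 : |∫ ω, (Z i ω).1 * (Z i ω).2 ^ 2 ∂μ| ≤ ∫ ω, |(Z i ω).1| * (Z i ω).2 ^ 2 ∂μ := by
      refine abs_integral_le_integral_abs.trans (le_of_eq ?_)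
      simp only [abs_mul, abs_pow, sq_abs]
    have i1 : Integrable (fun ω => |(Z i ω).1| ^ 3) μ := by
      refine hZ.int_fst_cube.abs.congr (Filter.Eventually.of_forall fun ω => ?_)
      simp only [abs_pow]
    have i2 : Integrable (fun ω => |(Z i ω).1| * (Z i ω).2 ^ 2) μ := by
      refine hZ.int_fst_mul_sq.abs.congr (Filter.Eventually.of_forall fun ω => ?_)
      simp only [abs_mul, abs_pow, sq_abs]
    have hw := (hZ.int_weighted (√R / t)).const_mul 2
    have a3 := integral_mono (i1.add i2) (hw.add (hZ.int_dd.const_mul 3))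
      fun ω => third_moments_le_weighted (z := Z i ω) h.weight_pos
    simp only [Pi.add_apply] at a3
    rw [integral_add i1 i2, integral_add hw (hZ.int_dd.const_mul 3), integral_const_mul,
      hZ.integral_weighted, integral_const_mul] at a3
    linarith
  have h2 := Finset.sum_le_sum fun i (_ : i ∈ Finset.univ) => h1 i
  have h3 := h.sum_weighted_le
  have h4 := h.R_le_mul_sqrt
  have h5 := mul_le_mul_of_nonneg_right h.x_le_t h.sqrt_R_pos.le
  have h6 := h.sum_dd
  rw [Finset.sum_add_distrib (f := fun i => 2 * _), ← Finset.mul_sum, ← Finset.mul_sum] at h2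
  linarith

lemma abs_skew_sub_le (h : Sample μ x t ρ c R ε Z) {l' : ℝ} (hl0 : 0 ≤ l) (hl1 : l ≤ 1)
    (hl0' : 0 ≤ l') (hl1' : l' ≤ 1) :
    |skew μ ρ l Z - skew μ ρ l' Z| ≤ 36 * |l - l'| * (x * √R) := by
  set T := ∑ i, ∫ ω, (Z i ω).1 ^ 3 ∂μ with hT
  set U := ∑ i, ∫ ω, (Z i ω).1 * (Z i ω).2 ^ 2 ∂μ with hU
  have h1 : |T| + |U| ≤ 9 * (t * √R) := by
    have := h.sum_third_le
    rw [Finset.sum_add_distrib] at this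
    have a := Finset.abs_sum_le_sum_abs (fun i => ∫ ω, (Z i ω).1 ^ 3 ∂μ) Finset.univ
    have b := Finset.abs_sum_le_sum_abs (fun i => ∫ ω, (Z i ω).1 * (Z i ω).2 ^ 2 ∂μ) Finset.univ
    linarith
  have e : skew μ ρ l Z - skew μ ρ l' Z
      = ρ ^ 3 * ((l - l') * (4 / 3 * (l ^ 2 + l * l' + l' ^ 2) * T - 2 * (l + l') * U)) := by
    unfold skew
    rw [← hT, ← hU]
    ring
  have h2 : |4 / 3 * (l ^ 2 + l * l' + l' ^ 2) * T - 2 * (l + l') * U| ≤ 4 * (|T| + |U|) := by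
    have b1 : l ^ 2 + l * l' + l' ^ 2 ≤ 3 := by nlinarith
    have b0 : 0 ≤ l ^ 2 + l * l' + l' ^ 2 := by positivity
    calc _ ≤ |4 / 3 * (l ^ 2 + l * l' + l' ^ 2) * T| + |2 * (l + l') * U| := abs_sub _ _
      _ = 4 / 3 * (l ^ 2 + l * l' + l' ^ 2) * |T| + 2 * (l + l') * |U| := by
          rw [abs_mul, abs_mul (2 * (l + l')), abs_of_nonneg (mul_nonneg (by norm_num) b0),
            abs_of_nonneg (by positivity : 0 ≤ 2 * (l + l'))]
      _ ≤ 4 * |T| + 4 * |U| := by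
          gcongr <;> linarith
      _ = _ := by ring
  have h3 : 0 ≤ ρ ^ 3 := pow_nonneg h.rho_pos.le 3
  rw [e, abs_mul, abs_mul, abs_of_nonneg h3]
  calc ρ ^ 3 * (|l - l'| * |4 / 3 * (l ^ 2 + l * l' + l' ^ 2) * T - 2 * (l + l') * U|)
      ≤ ρ ^ 3 * (|l - l'| * (4 * (9 * (t * √R)))) := by
        gcongr
        linarith
    _ = 36 * |l - l'| * (ρ ^ 3 * (t * √R)) := by ring
    _ ≤ _ := mul_le_mul_of_nonneg_left h.rho_cube_mul_le (by positivity)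

lemma abs_skew_le (h : Sample μ x t ρ c R ε Z) (hl0 : 0 ≤ l) (hl1 : l ≤ 1) :
    |skew μ ρ l Z| ≤ 36 * (x * √R) := by
  have h1 := h.abs_skew_sub_le hl0 hl1 le_rfl zero_le_one
  have h0 : skew μ ρ 0 Z = 0 := by simp [skew]
  rw [h0, sub_zero, sub_zero, abs_of_nonneg hl0] at h1
  have := mul_nonneg h.x_pos.le h.sqrt_R_pos.le
  nlinarith

/-- The expansion of the log-moment generating function. -/
lemma abs_sum_log_sub_le (h : Sample μ x t ρ c R ε Z) (hl0 : 0 ≤ l) (hl1 : l ≤ 1) :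
    |∑ i, Real.log (tiltMass μ ρ l (Z i)) - ((2 * l ^ 2 - l) * x ^ 2 + skew μ ρ l Z)|
      ≤ 10 ^ 6 * R := by
  have h1 := abs_sum_sub_sum_le fun i => (h.law i).abs_log_tiltMass_sub_le hl0 hl1
  rw [Finset.sum_add_distrib, Finset.sum_add_distrib, ← Finset.mul_sum, ← Finset.mul_sum,
    ← Finset.mul_sum, Finset.sum_sub_distrib, ← Finset.mul_sum, ← Finset.mul_sum, h.sum_fst,
    h.sum_snd, ← Finset.mul_sum] at h1
  have e : -l * ρ ^ 2 * t ^ 2 + 2 * l ^ 2 * ρ ^ 2 * t ^ 2 = (2 * l ^ 2 - l) * x ^ 2 := by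
    rw [← h.rho_sq_mul]
    ring
  rw [e] at h1
  unfold skew
  have := h.sum_dd
  linarith

lemma abs_sum_tiltMean_sub_le (h : Sample μ x t ρ c R ε Z) (hl0 : 0 ≤ l) (hl1 : l ≤ 1) :
    |∑ i, tiltMean μ ρ l (Z i) (xi ρ) - (4 * l - 1) * x ^ 2| ≤ 4 * 10 ^ 6 * (x * √R) ∧
    |∑ i, tiltMean μ ρ l (Z i) (xi ρ) - (4 * l - 1) * x ^ 2| ≤ 10 ^ 6 * (x * t * ε) := by
  have h1 := abs_sum_sub_sum_le fun i => (h.law i).abs_tiltMean_xi_sub_le hl0 hl1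
  have h2 := abs_sum_sub_sum_le fun i =>
    (h.law i).abs_tiltMean_xi_sub_le_weighted hl0 hl1 h.weight_pos
  have e : ∑ i, (-(ρ ^ 2 * ∫ ω, (Z i ω).2 ^ 2 ∂μ) + 4 * l * ρ ^ 2 * ∫ ω, (Z i ω).1 ^ 2 ∂μ)
      = (4 * l - 1) * x ^ 2 := by
    rw [Finset.sum_add_distrib, Finset.sum_neg_distrib, ← Finset.mul_sum, ← Finset.mul_sum,
      h.sum_fst, h.sum_snd, ← h.rho_sq_mul]
    ring
  rw [e] at h1 h2
  constructor
  · refine h2.trans ?_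
    rw [← Finset.mul_sum, Finset.sum_add_distrib, ← Finset.mul_sum]
    have a := mul_le_mul_of_nonneg_left h.sum_weighted_le (pow_nonneg h.rho_pos.le 3)
    have b := h.rho_cube_mul_le
    have d := h.R_le_mul_sqrt
    have f := h.sum_dd
    linarith
  · refine h1.trans ?_
    rw [← Finset.mul_sum, ← Finset.mul_sum]
    have a := mul_le_mul_of_nonneg_left h.sum_cube h.rho_pos.le
    have b : ρ * (ε * t ^ 2) = x * t * ε := by
      rw [← h.rho_mul]
      ring
    linarith

/-- Existence of the saddle point `l`, at which the tilted mean of `∑ (2 x X - x² Y²)` is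
`x² + 2 c x`, and its distance to `γ`. -/
lemma exists_saddle (h : Sample μ x t ρ c R ε Z) :
    ∃ l : ℝ, 39 / 100 ≤ l ∧ l ≤ 61 / 100 ∧
      ∑ i, tiltMean μ ρ l (Z i) (xi ρ) = x ^ 2 + 2 * c * x ∧
      x * |l - (1 + c / x) / 2| ≤ 10 ^ 6 * √R ∧
      x * |l - (1 + c / x) / 2| ≤ 10 ^ 6 * (t * ε) := by
  obtain ⟨g1, g2, g3⟩ := h.gamma_mem
  set γ := (1 + c / x) / 2 with hγ
  have hx := h.x_pos
  have hb : x ^ 2 + 2 * c * x = (4 * γ - 1) * x ^ 2 := by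
    have : c = 2 * γ * x - x := by linarith
    rw [this]
    ring
  have hR := mul_le_mul_of_nonneg_left h.sqrt_R_le hx.le
  have hsmall : 4 * 10 ^ 6 * (x * √R) ≤ 4 / 100 * x ^ 2 := by
    have : x * (10⁻¹ ^ 15 * x) = 10⁻¹ ^ 15 * x ^ 2 := by ring
    rw [this] at hR
    norm_num at hR ⊢
    nlinarith [sq_nonneg x]
  have hcont : ContinuousOn (fun l => ∑ i, tiltMean μ ρ l (Z i) (xi ρ))
      (Set.Icc (γ - 1 / 100) (γ + 1 / 100)) := by
    refine continuousOn_finsetSum _ fun i _ => ?_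
    exact (continuousOn_tiltMean_xi (h.law i)).mono
      (Set.Icc_subset_Icc (by linarith) (by linarith))
  have hlow := (abs_le.1 (h.abs_sum_tiltMean_sub_le (l := γ - 1 / 100)
    (by linarith) (by linarith)).1).2
  have hupp := (abs_le.1 (h.abs_sum_tiltMean_sub_le (l := γ + 1 / 100)
    (by linarith) (by linarith)).1).1
  obtain ⟨l, hl, hl2⟩ := intermediate_value_Icc (by linarith) hcont
    (show x ^ 2 + 2 * c * x ∈ Set.Icc _ _ from ⟨by
      rw [hb]; linarith, by rw [hb]; linarith⟩)
  have hl0 : 0 ≤ l := by linarith [hl.1]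
  have hl1 : l ≤ 1 := by linarith [hl.2]
  obtain ⟨h1, h2⟩ := h.abs_sum_tiltMean_sub_le hl0 hl1
  have hl2' : ∑ i, tiltMean μ ρ l (Z i) (xi ρ) = x ^ 2 + 2 * c * x := hl2
  have e : |∑ i, tiltMean μ ρ l (Z i) (xi ρ) - (4 * l - 1) * x ^ 2| = 4 * x * (x * |l - γ|) := by
    rw [hl2', hb, show (4 * γ - 1) * x ^ 2 - (4 * l - 1) * x ^ 2 = -(4 * x * x * (l - γ)) by ring,
      abs_neg, abs_mul, abs_of_nonneg (by positivity)]
    ring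
  rw [e] at h1 h2
  refine ⟨l, by linarith [hl.1], by linarith [hl.2], hl2', ?_, ?_⟩
  · refine le_of_mul_le_mul_left ?_ (by positivity : 0 < 4 * x)
    linarith
  · refine le_of_mul_le_mul_left ?_ (by positivity : 0 < 4 * x)
    have : 0 ≤ x * t * ε := mul_nonneg (mul_nonneg hx.le h.t_pos.le) h.eps_nonneg
    linarith

/-- The Chernoff exponent at the saddle point. -/
lemma abs_exponent_sub_le (h : Sample μ x t ρ c R ε Z) (hl0 : 39 / 100 ≤ l) (hl1 : l ≤ 61 / 100)
    (hl : x * |l - (1 + c / x) / 2| ≤ 10 ^ 6 * √R) :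
    |∑ i, Real.log (tiltMass μ ρ l (Z i)) - l * (x ^ 2 + 2 * c * x)
      - (-(x + c) ^ 2 / 2 + skew μ ρ ((1 + c / x) / 2) Z)| ≤ 3 * 10 ^ 12 * R := by
  obtain ⟨g1, g2, g3⟩ := h.gamma_mem
  set γ := (1 + c / x) / 2 with hγ
  have h1 := h.abs_sum_log_sub_le (l := l) (by linarith) (by linarith)
  have h2 := h.abs_skew_sub_le (l := l) (l' := γ) (by linarith) (by linarith) (by linarith)
    (by linarith)
  have h3 : 36 * |l - γ| * (x * √R) ≤ 36 * 10 ^ 6 * R := by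
    have := mul_le_mul_of_nonneg_right hl h.sqrt_R_pos.le
    have e : 10 ^ 6 * √R * √R = 10 ^ 6 * R := by rw [mul_assoc, h.sq_sqrt_R]
    nlinarith
  have h4 : 2 * (x * (l - γ)) ^ 2 ≤ 2 * 10 ^ 12 * R := by
    have := pow_le_pow_left₀ (mul_nonneg h.x_pos.le (abs_nonneg _)) hl 2
    rw [mul_pow, mul_pow, sq_abs, sq √R, h.sq_sqrt_R] at this
    rw [mul_pow]
    linarith
  have h5 := sq_nonneg (x * (l - γ))
  have e : (2 * l ^ 2 - l) * x ^ 2 - l * (x ^ 2 + 2 * c * x) + (x + c) ^ 2 / 2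
      = 2 * (x * (l - γ)) ^ 2 := by
    have : c = 2 * γ * x - x := by linarith
    rw [this]
    ring
  have hR := h.R_pos
  have h6 := h2.trans h3
  rw [abs_le] at h1 h6 ⊢
  constructor <;> linarith [h1.1, h1.2, h6.1, h6.2]

lemma abs_sum_tiltVar_sub_le (h : Sample μ x t ρ c R ε Z) (hl0 : 0 ≤ l) (hl1 : l ≤ 1) :
    |∑ i, (tiltMean μ ρ l (Z i) (fun z => xi ρ z ^ 2) - tiltMean μ ρ l (Z i) (xi ρ) ^ 2)
      - 4 * x ^ 2| ≤ 3 * 10 ^ 6 * (x ^ 2 * ε) := by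
  have h1 := abs_sum_sub_sum_le fun i => (h.law i).abs_tiltVar_sub_le hl0 hl1
  rw [← Finset.mul_sum, h.sum_fst, ← Finset.mul_sum, ← Finset.mul_sum, mul_assoc,
    h.rho_sq_mul] at h1
  have a := mul_le_mul_of_nonneg_left h.sum_cube (sq_nonneg ρ)
  have b : ρ ^ 2 * (ε * t ^ 2) = x ^ 2 * ε := by
    rw [← h.rho_sq_mul]
    ring
  linarith

/-- The tilted mean of `∑ Y²`, scaled, is close to its mean. -/
lemma abs_sum_tiltMean_snd_sq_sub_le (h : Sample μ x t ρ c R ε Z) (hl0 : 0 ≤ l) (hl1 : l ≤ 1) :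
    |∑ i, tiltMean μ ρ l (Z i) (fun z => z.2 ^ 2) - t ^ 2| ≤ 4 * 10 ^ 4 * (x * √R) := by
  have h1 := abs_sum_sub_sum_le fun i =>
    (h.law i).abs_tiltMean_snd_sq_sub_le hl0 hl1 h.weight_pos
  rw [h.sum_snd, ← Finset.mul_sum, Finset.sum_add_distrib, ← Finset.mul_sum] at h1
  have a := mul_le_mul_of_nonneg_left h.sum_weighted_le h.rho_pos.le
  have b : ρ * (3 * (t * √R)) = 3 * (x * √R) := by rw [← h.rho_mul]; ring
  have d := h.R_le_mul_sqrt
  have f := h.sum_dd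
  linarith

lemma sum_tiltMean_snd_fourth_le (h : Sample μ x t ρ c R ε Z) (hl0 : 0 ≤ l) (hl1 : l ≤ 1) :
    ∑ i, tiltMean μ ρ l (Z i) (fun z => z.2 ^ 4) ≤ 42 * R := by
  have h1 := Finset.sum_le_sum fun i (_ : i ∈ Finset.univ) =>
    (h.law i).tiltMean_snd_fourth_le hl0 hl1
  rw [← Finset.mul_sum] at h1
  linarith [h.sum_dd]

end Sample
end Saddle

/-! ### The tilted measure and the main term -/

section Tilt

variable {Ω : Type*} [MeasurableSpace Ω] {μ Q : Measure Ω} {ι : Type*} [Fintype ι]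
  {x t ρ c R ε l : ℝ} {Z : ι → Ω → ℝ × ℝ}

/-- The exponent `ξ` truncated to the good set. -/
noncomputable def xiGood (ρ : ℝ) (z : ℝ × ℝ) : ℝ := good.indicator (xi ρ) z

lemma measurable_xiGood (ρ : ℝ) : Measurable (xiGood ρ) :=
  (measurable_xi ρ).indicator measurableSet_good

lemma xiGood_of_mem {z : ℝ × ℝ} (hz : z ∈ good) : xiGood ρ z = xi ρ z := Set.indicator_of_mem hz _

lemma xiGood_of_notMem {z : ℝ × ℝ} (hz : z ∉ good) : xiGood ρ z = 0 :=
  Set.indicator_of_notMem hz _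

lemma abs_xiGood_le (h0 : 0 ≤ ρ) (h1 : ρ ≤ 1) (z : ℝ × ℝ) : |xiGood ρ z| ≤ 3 * ρ := by
  by_cases hz : z ∈ good
  · rw [xiGood_of_mem hz]
    have a := abs_le.1 hz.1
    have b : z.2 ^ 2 ≤ 1 := (sq_le_one_iff_abs_le_one _).2 hz.2
    have hr : ρ ^ 2 ≤ ρ := by nlinarith
    have b1 : ρ ^ 2 * z.2 ^ 2 ≤ ρ := by nlinarith [sq_nonneg z.2, sq_nonneg ρ]
    have b0 : 0 ≤ ρ ^ 2 * z.2 ^ 2 := by positivity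
    unfold xi
    rw [abs_le]
    constructor <;> nlinarith [a.1, a.2]
  · rw [xiGood_of_notMem hz, abs_zero]
    linarith

lemma tiltMean_congr {Y : Ω → ℝ × ℝ} {F F' : ℝ × ℝ → ℝ} (h : ∀ z ∈ good, F z = F' z) :
    tiltMean μ ρ l Y F = tiltMean μ ρ l Y F' := by
  unfold tiltMean
  congr 2
  ext ω
  by_cases hz : Y ω ∈ good
  · rw [h _ hz]
  · rw [wt_of_notMem hz, mul_zero, mul_zero]

/-- `Q` is the product tilt of `μ` by the truncated weights `e^{l ξ(Z i)} 1_good`. -/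
structure IsTilt (μ Q : Measure Ω) (ρ l : ℝ) (Z : ι → Ω → ℝ × ℝ) : Prop where
  ind : iIndepFun Z Q
  integral_comp : ∀ i (F : ℝ × ℝ → ℝ), Measurable F →
    ∫ ω, F (Z i ω) ∂Q = tiltMean μ ρ l (Z i) F
  change : ∀ F : Ω → ℝ, ∫ ω, F ω * ∏ i, wt ρ l (Z i ω) ∂μ
    = Real.exp (∑ i, Real.log (tiltMass μ ρ l (Z i))) * ∫ ω, F ω ∂Q

/-- `l` is the saddle point: the tilted mean of `∑ ξ` equals `x² + 2 c x`. -/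
structure IsSaddle (μ : Measure Ω) (x t ρ c R ε l : ℝ) (Z : ι → Ω → ℝ × ℝ) : Prop where
  le : 39 / 100 ≤ l
  ge : l ≤ 61 / 100
  mean : ∑ i, tiltMean μ ρ l (Z i) (xi ρ) = x ^ 2 + 2 * c * x
  near : x * |l - (1 + c / x) / 2| ≤ 10 ^ 6 * √R
  near' : x * |l - (1 + c / x) / 2| ≤ 10 ^ 6 * (t * ε)

namespace IsSaddle

lemma zero_le (hl : IsSaddle μ x t ρ c R ε l Z) : 0 ≤ l := by linarith [hl.le]

lemma le_one (hl : IsSaddle μ x t ρ c R ε l Z) : l ≤ 1 := by linarith [hl.ge]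

end IsSaddle

lemma Sample.exists_isTilt [IsProbabilityMeasure μ] (h : Sample μ x t ρ c R ε Z) (hl0 : 0 ≤ l)
    (hl1 : l ≤ 1) :
    ∃ Q : Measure Ω, IsProbabilityMeasure Q ∧ IsTilt μ Q ρ l Z := by
  have hpos : ∀ i, 0 < ∫ ω, wt ρ l (Z i ω) ∂μ := fun i => by
    have := (h.law i).half_le_tiltMass hl0 hl1
    unfold tiltMass at this
    linarith
  obtain ⟨Q, hQ, hi, hm, hc⟩ := exists_product_tilt (fun i => (h.law i).meas) h.ind
    (fun _ => measurable_wt ρ l) (fun _ z => wt_nonneg ρ l z) hpos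
  refine ⟨Q, hQ, hi, hm, fun F => ?_⟩
  rw [hc F, Real.exp_sum]
  congr 1
  refine Finset.prod_congr rfl fun i _ => ?_
  exact (Real.exp_log (hpos i)).symm

/-- The tilted standard deviation of `∑ ξ`. -/
noncomputable def tiltSd (μ : Measure Ω) (ρ l : ℝ) (Z : ι → Ω → ℝ × ℝ) : ℝ :=
  √(∑ i, (tiltMean μ ρ l (Z i) (fun z => xi ρ z ^ 2) - tiltMean μ ρ l (Z i) (xi ρ) ^ 2))

lemma Sample.tiltSd_bounds [IsProbabilityMeasure μ] (h : Sample μ x t ρ c R ε Z) (hl0 : 0 ≤ l)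
    (hl1 : l ≤ 1) :
    tiltSd μ ρ l Z ^ 2 = ∑ i, (tiltMean μ ρ l (Z i) (fun z => xi ρ z ^ 2)
      - tiltMean μ ρ l (Z i) (xi ρ) ^ 2) ∧
    19 / 10 * x ≤ tiltSd μ ρ l Z ∧ tiltSd μ ρ l Z ≤ 21 / 10 * x ∧
      |tiltSd μ ρ l Z - 2 * x| ≤ 2 * 10 ^ 6 * (x * ε) := by
  have h1 := h.abs_sum_tiltVar_sub_le hl0 hl1
  have hx := h.x_pos
  set S2 := ∑ i, (tiltMean μ ρ l (Z i) (fun z => xi ρ z ^ 2) - tiltMean μ ρ l (Z i) (xi ρ) ^ 2)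
    with hS2
  have hs : tiltSd μ ρ l Z = √S2 := rfl
  have he := mul_le_mul_of_nonneg_left h.eps_le (sq_nonneg x)
  have hx2 : 0 < x ^ 2 := by positivity
  have h2 := abs_le.1 h1
  have hlow : (19 / 10 * x) ^ 2 ≤ S2 := by
    norm_num at he
    nlinarith [h2.1]
  have hupp : S2 ≤ (21 / 10 * x) ^ 2 := by
    norm_num at he
    nlinarith [h2.2]
  have hS0 : 0 ≤ S2 := (sq_nonneg _).trans hlow
  have hsq : tiltSd μ ρ l Z ^ 2 = S2 := by rw [hs, Real.sq_sqrt hS0]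
  have b1 : 19 / 10 * x ≤ tiltSd μ ρ l Z := by
    rw [hs]
    exact Real.le_sqrt_of_sq_le hlow
  refine ⟨hsq, b1, ?_, ?_⟩
  · rw [hs]
    exact (Real.sqrt_le_left (by positivity)).2 hupp
  · have e : S2 - 4 * x ^ 2 = (tiltSd μ ρ l Z - 2 * x) * (tiltSd μ ρ l Z + 2 * x) := by
      rw [← hsq]
      ring
    rw [e, abs_mul, abs_of_pos (by linarith : 0 < tiltSd μ ρ l Z + 2 * x)] at h1
    have h3 := mul_le_mul_of_nonneg_left (by linarith : 2 * x ≤ tiltSd μ ρ l Z + 2 * x)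
      (abs_nonneg (tiltSd μ ρ l Z - 2 * x))
    refine le_of_mul_le_mul_right ?_ (by positivity : 0 < 2 * x)
    have : 0 ≤ x ^ 2 * ε := mul_nonneg (sq_nonneg _) h.eps_nonneg
    linarith

/-- The standardized summand `(ξ 1_good - m) / s`. -/
noncomputable def stdXi (μ : Measure Ω) (ρ l : ℝ) (Z : ι → Ω → ℝ × ℝ) (i : ι) (z : ℝ × ℝ) : ℝ :=
  (xiGood ρ z - tiltMean μ ρ l (Z i) (xi ρ)) / tiltSd μ ρ l Z

lemma measurable_stdXi (i : ι) : Measurable (stdXi μ ρ l Z i) :=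
  ((measurable_xiGood ρ).sub_const _).div_const _

lemma sum_stdXi (hl : IsSaddle μ x t ρ c R ε l Z) (hs : tiltSd μ ρ l Z ≠ 0) (ω : Ω) :
    tiltSd μ ρ l Z * ∑ i, stdXi μ ρ l Z i (Z i ω)
      = ∑ i, xiGood ρ (Z i ω) - (x ^ 2 + 2 * c * x) := by
  unfold stdXi
  rw [← Finset.sum_div, mul_div_cancel₀ _ hs, Finset.sum_sub_distrib, hl.mean]

namespace IsTilt

lemma iIndepFun_comp (hQ : IsTilt μ Q ρ l Z) {E : Type*} [MeasurableSpace E]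
    {F : ι → ℝ × ℝ → E} (hF : ∀ i, Measurable (F i)) : iIndepFun (fun i ω => F i (Z i ω)) Q :=
  hQ.ind.comp F hF

lemma integral_xiGood (hQ : IsTilt μ Q ρ l Z) (i : ι) :
    ∫ ω, xiGood ρ (Z i ω) ∂Q = tiltMean μ ρ l (Z i) (xi ρ) := by
  rw [hQ.integral_comp i _ (measurable_xiGood ρ)]
  exact tiltMean_congr fun z hz => xiGood_of_mem hz

variable [IsProbabilityMeasure Q]

lemma abs_tiltMean_xi_le (hQ : IsTilt μ Q ρ l Z) (h : Sample μ x t ρ c R ε Z) (i : ι) :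
    |tiltMean μ ρ l (Z i) (xi ρ)| ≤ 3 * ρ := by
  rw [← hQ.integral_xiGood i]
  refine abs_integral_le_integral_abs.trans ?_
  have hm : Measurable fun ω => xiGood ρ (Z i ω) := (measurable_xiGood ρ).comp (h.law i).meas
  have hb := fun ω => abs_xiGood_le h.rho_pos.le h.rho_le (Z i ω)
  have := integral_mono (integrable_of_abs_le (Q := Q) hm hb).abs (integrable_const (3 * ρ)) hb
  simpa using this

lemma integral_stdXi (hQ : IsTilt μ Q ρ l Z) (h : Sample μ x t ρ c R ε Z) (i : ι) :
    ∫ ω, stdXi μ ρ l Z i (Z i ω) ∂Q = 0 := by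
  have hm : Measurable fun ω => xiGood ρ (Z i ω) := (measurable_xiGood ρ).comp (h.law i).meas
  have hb := fun ω => abs_xiGood_le h.rho_pos.le h.rho_le (Z i ω)
  unfold stdXi
  rw [integral_div, integral_sub (integrable_of_abs_le hm hb) (integrable_const _),
    hQ.integral_xiGood]
  simp

variable [IsProbabilityMeasure μ]

lemma abs_stdXi_le (hQ : IsTilt μ Q ρ l Z) (h : Sample μ x t ρ c R ε Z) (hl0 : 0 ≤ l)
    (hl1 : l ≤ 1) (i : ι) (z : ℝ × ℝ) : |stdXi μ ρ l Z i z| ≤ 4 / t := by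
  obtain ⟨-, hs, -, -⟩ := h.tiltSd_bounds hl0 hl1
  have h1 := hQ.abs_tiltMean_xi_le h i
  have h2 := abs_xiGood_le h.rho_pos.le h.rho_le z
  have h3 : |xiGood ρ z - tiltMean μ ρ l (Z i) (xi ρ)| ≤ 6 * ρ :=
    (abs_sub _ _).trans (by linarith)
  have hs0 : 0 < tiltSd μ ρ l Z := lt_of_lt_of_le (by linarith [h.x_pos]) hs
  have ht := h.t_pos
  unfold stdXi
  rw [abs_div, abs_of_pos hs0, div_le_div_iff₀ hs0 ht]
  calc |xiGood ρ z - tiltMean μ ρ l (Z i) (xi ρ)| * t ≤ 6 * ρ * t := by gcongr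
    _ = 6 * x := by rw [mul_assoc, h.rho_mul]
    _ ≤ 4 * tiltSd μ ρ l Z := by linarith

lemma sum_integral_stdXi_sq (hQ : IsTilt μ Q ρ l Z) (h : Sample μ x t ρ c R ε Z) (hl0 : 0 ≤ l)
    (hl1 : l ≤ 1) : ∑ i, ∫ ω, stdXi μ ρ l Z i (Z i ω) ^ 2 ∂Q = 1 := by
  obtain ⟨hs2, hs, -, -⟩ := h.tiltSd_bounds hl0 hl1
  have hs0 : 0 < tiltSd μ ρ l Z := lt_of_lt_of_le (by linarith [h.x_pos]) hs
  have key : ∀ i, ∫ ω, stdXi μ ρ l Z i (Z i ω) ^ 2 ∂Q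
      = (tiltMean μ ρ l (Z i) (fun z => xi ρ z ^ 2) - tiltMean μ ρ l (Z i) (xi ρ) ^ 2)
        / tiltSd μ ρ l Z ^ 2 := by
    intro i
    have hm : Measurable fun ω => xiGood ρ (Z i ω) := (measurable_xiGood ρ).comp (h.law i).meas
    have hb := fun ω => abs_xiGood_le h.rho_pos.le h.rho_le (Z i ω)
    have i1 := integrable_of_abs_le (Q := Q) hm hb
    have i2 := integrable_sq_of_abs_le (Q := Q) hm hb
    set m := tiltMean μ ρ l (Z i) (xi ρ) with hmdef
    have e2 : ∫ ω, xiGood ρ (Z i ω) ^ 2 ∂Q = tiltMean μ ρ l (Z i) (fun z => xi ρ z ^ 2) := by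
      rw [hQ.integral_comp i (fun z => xiGood ρ z ^ 2) ((measurable_xiGood ρ).pow_const 2)]
      exact tiltMean_congr fun z hz => by rw [xiGood_of_mem hz]
    have e : ∀ ω, stdXi μ ρ l Z i (Z i ω) ^ 2
        = (xiGood ρ (Z i ω) ^ 2 - (2 * m) * xiGood ρ (Z i ω) + m ^ 2) / tiltSd μ ρ l Z ^ 2 := by
      intro ω
      unfold stdXi
      rw [div_pow]
      congr 1
      ring
    simp only [e]
    have i3 : Integrable (fun ω => xiGood ρ (Z i ω) ^ 2 - (2 * m) * xiGood ρ (Z i ω)) Q :=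
      i2.sub (i1.const_mul _)
    rw [integral_div, integral_add i3 (integrable_const _), integral_sub i2 (i1.const_mul _),
      integral_const_mul, hQ.integral_xiGood, e2, ← hmdef]
    simp only [integral_const, probReal_univ, smul_eq_mul]
    congr 1
    ring
  rw [Finset.sum_congr rfl fun i _ => key i, ← Finset.sum_div, ← hs2, div_self (by positivity)]

lemma abs_sub_cube_le (a b : ℝ) : |a - b| ^ 3 ≤ 4 * (|a| ^ 3 + |b| ^ 3) := by
  have ha := abs_nonneg a
  have hb := abs_nonneg b
  calc |a - b| ^ 3 ≤ (|a| + |b|) ^ 3 := pow_le_pow_left₀ (abs_nonneg _) (abs_sub _ _) 3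
    _ ≤ _ := by nlinarith [mul_nonneg (add_nonneg ha hb) (sq_nonneg (|a| - |b|))]

/-- The Lyapunov ratio under the tilted measure. -/
lemma sum_integral_stdXi_cube_le (hQ : IsTilt μ Q ρ l Z) (h : Sample μ x t ρ c R ε Z)
    (hl0 : 0 ≤ l) (hl1 : l ≤ 1) :
    ∑ i, ∫ ω, |stdXi μ ρ l Z i (Z i ω)| ^ 3 ∂Q ≤ 4 * 10 ^ 6 * (ε / t) := by
  obtain ⟨-, hs, -, -⟩ := h.tiltSd_bounds hl0 hl1
  have hx := h.x_pos
  have ht := h.t_pos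
  have hs0 : 0 < tiltSd μ ρ l Z := lt_of_lt_of_le (by linarith) hs
  have hρ := h.rho_pos
  have key : ∀ i, ∫ ω, |stdXi μ ρ l Z i (Z i ω)| ^ 3 ∂Q
      ≤ (25 * 10 ^ 6 * ρ ^ 3 * ∫ ω, cube (Z i ω) ∂μ) / tiltSd μ ρ l Z ^ 3 := by
    intro i
    have hm : Measurable fun ω => xiGood ρ (Z i ω) := (measurable_xiGood ρ).comp (h.law i).meas
    have hb := fun ω => abs_xiGood_le hρ.le h.rho_le (Z i ω)
    have hm1 := hQ.abs_tiltMean_xi_le h i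
    have hm2 := (h.law i).tiltMean_xi_sq_le hl0 hl1
    set m := tiltMean μ ρ l (Z i) (xi ρ) with hmdef
    have hm3 : |m| ^ 3 ≤ 6 * 10 ^ 6 * (ρ ^ 3 * ∫ ω, cube (Z i ω) ∂μ) := by
      have hd := mul_le_mul_of_nonneg_left (h.law i).dd_le (sq_nonneg ρ)
      calc |m| ^ 3 = |m| * m ^ 2 := by rw [← sq_abs]; ring
        _ ≤ (3 * ρ) * (2 * 10 ^ 6 * (ρ ^ 2 * ∫ ω, cube (Z i ω) ∂μ)) :=
          mul_le_mul hm1 (by linarith) (sq_nonneg _) (by positivity)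
        _ = _ := by ring
    have i3 : Integrable (fun ω => |xiGood ρ (Z i ω)| ^ 3) Q := by
      refine integrable_of_abs_le (K := (3 * ρ) ^ 3) (by fun_prop) fun ω => ?_
      rw [abs_pow, abs_abs]
      exact pow_le_pow_left₀ (abs_nonneg _) (hb ω) 3
    have e3 : ∫ ω, |xiGood ρ (Z i ω)| ^ 3 ∂Q ≤ 1344 * (ρ ^ 3 * ∫ ω, cube (Z i ω) ∂μ) := by
      rw [hQ.integral_comp i (fun z => |xiGood ρ z| ^ 3)
        ((measurable_xiGood ρ).abs.pow_const 3)]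
      rw [tiltMean_congr (F' := fun z => |xi ρ z| ^ 3) fun z hz => by rw [xiGood_of_mem hz]]
      exact (h.law i).tiltMean_xi_cube_le hl0 hl1
    have i4 : Integrable (fun ω => 4 * (|xiGood ρ (Z i ω)| ^ 3 + |m| ^ 3) / tiltSd μ ρ l Z ^ 3) Q :=
      ((i3.add (integrable_const _)).const_mul 4).div_const _
    have h1 : ∫ ω, |stdXi μ ρ l Z i (Z i ω)| ^ 3 ∂Q
        ≤ ∫ ω, 4 * (|xiGood ρ (Z i ω)| ^ 3 + |m| ^ 3) / tiltSd μ ρ l Z ^ 3 ∂Q := by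
      refine integral_mono_of_nonneg (Filter.Eventually.of_forall fun ω => by positivity) i4
        (Filter.Eventually.of_forall fun ω => ?_)
      unfold stdXi
      beta_reduce
      rw [abs_div, abs_of_pos hs0, div_pow]
      gcongr
      exact abs_sub_cube_le _ _
    refine h1.trans ?_
    rw [integral_div, integral_const_mul, integral_add i3 (integrable_const _)]
    simp only [integral_const, probReal_univ, smul_eq_mul, one_mul]
    have hk : 0 ≤ ρ ^ 3 * ∫ ω, cube (Z i ω) ∂μ :=
      mul_nonneg (by positivity) (integral_nonneg fun ω => cube_nonneg _)
    refine div_le_div_of_nonneg_right ?_ (by positivity)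
    linarith
  refine (Finset.sum_le_sum fun i _ => key i).trans ?_
  rw [← Finset.sum_div, ← Finset.mul_sum, div_le_iff₀ (by positivity)]
  have h1 : ρ ^ 3 * ∑ i, ∫ ω, cube (Z i ω) ∂μ ≤ x ^ 3 * (ε / t) := by
    have := mul_le_mul_of_nonneg_left h.sum_cube (by positivity : 0 ≤ ρ ^ 3)
    have e : ρ ^ 3 * (ε * t ^ 2) = x ^ 3 * (ε / t) := by
      rw [← h.rho_mul]
      field_simp
    linarith
  have h2 : (19 / 10 * x) ^ 3 ≤ tiltSd μ ρ l Z ^ 3 := pow_le_pow_left₀ (by positivity) hs 3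
  have h3 : 0 ≤ ε / t := div_nonneg h.eps_nonneg ht.le
  have h4 := mul_le_mul_of_nonneg_left h2 h3
  have h5 : 0 ≤ ε / t * x ^ 3 := by positivity
  nlinarith

/-- The integral giving the tail probability under the tilted measure is close to the Mills
ratio. -/
lemma abs_integral_expTail_sub_le (hQ : IsTilt μ Q ρ l Z) (h : Sample μ x t ρ c R ε Z)
    (hl : IsSaddle μ x t ρ c R ε l Z) :
    |∫ ω, expTail (l * tiltSd μ ρ l Z) (∑ i, stdXi μ ρ l Z i (Z i ω)) ∂Q - mills (x + c)|
      ≤ 10 ^ 11 * ε * mills (x + c) := by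
  obtain ⟨-, hs, hs', hs2⟩ := h.tiltSd_bounds hl.zero_le hl.le_one
  have hx := h.x_pos
  have ht := h.t_pos
  have hε := h.eps_pos
  have hs0 : 0 < tiltSd μ ρ l Z := lt_of_lt_of_le (by linarith) hs
  have hm : ∀ i, Measurable fun ω => stdXi μ ρ l Z i (Z i ω) := fun i =>
    (measurable_stdXi i).comp (h.law i).meas
  have hbe : ∀ a b, |Q.real {ω | a ≤ ∑ i, stdXi μ ρ l Z i (Z i ω) ∧
      ∑ i, stdXi μ ρ l Z i (Z i ω) ≤ b} - gaussIcc a b| ≤ 60 * (4 * 10 ^ 6 * (ε / t)) :=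
    berry_esseen hm (fun i ω => hQ.abs_stdXi_le h hl.zero_le hl.le_one i (Z i ω))
      (hQ.iIndepFun_comp fun i => measurable_stdXi i) (fun i => hQ.integral_stdXi h i)
      (hQ.sum_integral_stdXi_sq h hl.zero_le hl.le_one) (by positivity)
      (hQ.sum_integral_stdXi_cube_le h hl.zero_le hl.le_one)
  have hy : 0 < l * tiltSd μ ρ l Z := mul_pos (by linarith [hl.le]) hs0
  have h1 := abs_integral_expTail_sub_mills_le (Finset.measurable_fun_sum _ fun i _ => hm i) hy
    (hbe 0)
  obtain ⟨g1, g2, g3⟩ := h.gamma_mem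
  have hn := hl.near'
  set γ := (1 + c / x) / 2 with hγ
  have hdist : |l * tiltSd μ ρ l Z - (x + c)| ≤ 6 * 10 ^ 6 * (t * ε) := by
    have e : l * tiltSd μ ρ l Z - (x + c) = (l - γ) * tiltSd μ ρ l Z
        + γ * (tiltSd μ ρ l Z - 2 * x) := by
      rw [← g3]
      ring
    rw [e]
    have hxt : x * ε ≤ t * ε := mul_le_mul_of_nonneg_right h.x_le_t hε.le
    calc _ ≤ |(l - γ) * tiltSd μ ρ l Z| + |γ * (tiltSd μ ρ l Z - 2 * x)| := abs_add_le _ _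
      _ = |l - γ| * tiltSd μ ρ l Z + γ * |tiltSd μ ρ l Z - 2 * x| := by
          rw [abs_mul, abs_mul, abs_of_pos hs0, abs_of_pos (by linarith : 0 < γ)]
      _ ≤ |l - γ| * (21 / 10 * x) + 1 * (2 * 10 ^ 6 * (x * ε)) := by
          gcongr
          linarith
      _ ≤ _ := by nlinarith
  have hlow1 : 7 / 10 * x ≤ l * tiltSd μ ρ l Z := by nlinarith [hl.le]
  have hlow2 : 7 / 10 * x ≤ x + c := by linarith [(abs_le.1 h.abs_c_le).1]
  have h2 := abs_mills_sub_le (by positivity) hlow1 hlow2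
  have h3 : 4 / (1 + 7 / 10 * x) ^ 2 * |l * tiltSd μ ρ l Z - (x + c)| ≤ 6 * 10 ^ 7 * (ε / t) := by
    have a : (7 / 10 * t) ^ 2 ≤ (1 + 7 / 10 * x) ^ 2 :=
      pow_le_pow_left₀ (by positivity) (by linarith [h.t_eq]) 2
    calc _ ≤ 4 / (7 / 10 * t) ^ 2 * (6 * 10 ^ 6 * (t * ε)) := by gcongr
      _ = 4 * 6 * 10 ^ 6 * 100 / 49 * (ε / t) := by
          field_simp
          norm_num
      _ ≤ _ := by
          have : 0 ≤ ε / t := by positivity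
          nlinarith
  have h4 : 1 / (24 * t) ≤ mills (x + c) := by
    refine le_trans ?_ (le_mills (by linarith))
    rw [div_le_div_iff₀ (by positivity) (by linarith)]
    linarith [(abs_le.1 h.abs_c_le).2, h.t_eq]
  have h5 : ε / t = 24 * ε * (1 / (24 * t)) := by
    field_simp
  have h6 : ε / t ≤ 24 * (ε * mills (x + c)) := by
    rw [h5, mul_assoc]
    exact mul_le_mul_of_nonneg_left (mul_le_mul_of_nonneg_left h4 hε.le) (by norm_num)
  have h8 : 0 ≤ ε / t := by positivity
  have h7 := abs_sub_le (∫ ω, expTail (l * tiltSd μ ρ l Z) (∑ i, stdXi μ ρ l Z i (Z i ω)) ∂Q)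
    (mills (l * tiltSd μ ρ l Z)) (mills (x + c))
  linarith

end IsTilt
end Tilt

/-! ### Joint moments and exponential tails of sums of bounded variables -/

section Sums

variable {Ω : Type*} [MeasurableSpace Ω] {Q : Measure Ω} [IsProbabilityMeasure Q]
  {ι : Type*} [Fintype ι]

/-- The induction step for the mixed moments of a pair of sums. -/
lemma integral_sq_mul_sq_add {T H X Y : Ω → ℝ} (hT : Measurable T) (hH : Measurable H)
    (hX : Measurable X) (hY : Measurable Y) {K : ℝ} (bT : ∀ ω, |T ω| ≤ K) (bH : ∀ ω, |H ω| ≤ K)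
    (bX : ∀ ω, |X ω| ≤ K) (bY : ∀ ω, |Y ω| ≤ K)
    (hind : IndepFun (fun ω => (T ω, H ω)) (fun ω => (X ω, Y ω)) Q)
    (eT : ∫ ω, T ω ∂Q = 0) (eH : ∫ ω, H ω ∂Q = 0) (eX : ∫ ω, X ω ∂Q = 0)
    (eY : ∫ ω, Y ω ∂Q = 0) :
    ∫ ω, (T ω + X ω) * (H ω + Y ω) ∂Q = ∫ ω, T ω * H ω ∂Q + ∫ ω, X ω * Y ω ∂Q ∧
    ∫ ω, (T ω + X ω) ^ 2 ∂Q = ∫ ω, T ω ^ 2 ∂Q + ∫ ω, X ω ^ 2 ∂Q ∧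
    ∫ ω, (H ω + Y ω) ^ 2 ∂Q = ∫ ω, H ω ^ 2 ∂Q + ∫ ω, Y ω ^ 2 ∂Q ∧
    ∫ ω, (T ω + X ω) ^ 2 * (H ω + Y ω) ^ 2 ∂Q = ∫ ω, T ω ^ 2 * H ω ^ 2 ∂Q
      + (∫ ω, T ω ^ 2 ∂Q) * (∫ ω, Y ω ^ 2 ∂Q) + (∫ ω, X ω ^ 2 ∂Q) * (∫ ω, H ω ^ 2 ∂Q)
      + 4 * ((∫ ω, T ω * H ω ∂Q) * (∫ ω, X ω * Y ω ∂Q)) + ∫ ω, X ω ^ 2 * Y ω ^ 2 ∂Q := by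
  have I : ∀ a b c d : ℕ, Integrable (fun ω => (T ω ^ a * H ω ^ b) * (X ω ^ c * Y ω ^ d)) Q := by
    intro a b c d
    refine integrable_of_abs_le (K := K ^ a * K ^ b * (K ^ c * K ^ d)) (by fun_prop) fun ω => ?_
    have hK : 0 ≤ K := (abs_nonneg _).trans (bT ω)
    rw [abs_mul, abs_mul, abs_mul, abs_pow, abs_pow, abs_pow, abs_pow]
    have := bT ω
    have := bH ω
    have := bX ω
    have := bY ω
    gcongr
  have M : ∀ a b c d : ℕ, ∫ ω, (T ω ^ a * H ω ^ b) * (X ω ^ c * Y ω ^ d) ∂Q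
      = (∫ ω, T ω ^ a * H ω ^ b ∂Q) * ∫ ω, X ω ^ c * Y ω ^ d ∂Q := by
    intro a b c d
    have h := hind.comp (φ := fun z : ℝ × ℝ => z.1 ^ a * z.2 ^ b)
      (ψ := fun z : ℝ × ℝ => z.1 ^ c * z.2 ^ d) (by fun_prop) (by fun_prop)
    exact h.integral_fun_mul_eq_mul_integral
      (Measurable.aestronglyMeasurable (by simp only [Function.comp_def]; fun_prop))
      (Measurable.aestronglyMeasurable (by simp only [Function.comp_def]; fun_prop))
  have S : ∀ (J : List (ℝ × ℕ × ℕ × ℕ × ℕ)),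
      Integrable (fun ω => (J.map fun j => j.1 * ((T ω ^ j.2.1 * H ω ^ j.2.2.1) *
        (X ω ^ j.2.2.2.1 * Y ω ^ j.2.2.2.2))).sum) Q ∧
      ∫ ω, (J.map fun j => j.1 * ((T ω ^ j.2.1 * H ω ^ j.2.2.1) *
        (X ω ^ j.2.2.2.1 * Y ω ^ j.2.2.2.2))).sum ∂Q
      = (J.map fun j => j.1 * ((∫ ω, T ω ^ j.2.1 * H ω ^ j.2.2.1 ∂Q) *
        ∫ ω, X ω ^ j.2.2.2.1 * Y ω ^ j.2.2.2.2 ∂Q)).sum := by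
    intro J
    induction J with
    | nil => simp
    | cons j J ih =>
      simp only [List.map_cons, List.sum_cons]
      have i1 := (I j.2.1 j.2.2.1 j.2.2.2.1 j.2.2.2.2).const_mul j.1
      refine ⟨i1.add ih.1, ?_⟩
      rw [integral_add i1 ih.1, ih.2, integral_const_mul, M]
  refine ⟨?_, ?_, ?_, ?_⟩
  · have h := (S [(1, 1, 1, 0, 0), (1, 1, 0, 0, 1), (1, 0, 1, 1, 0), (1, 0, 0, 1, 1)]).2
    simp only [List.map_cons, List.map_nil, List.sum_cons, List.sum_nil, pow_zero, pow_one,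
      mul_one, one_mul, add_zero, integral_const, probReal_univ, smul_eq_mul, eT, eH, eX, eY,
      mul_zero, zero_add] at h
    rw [← h]
    refine integral_congr_ae (Filter.Eventually.of_forall fun ω => ?_)
    ring
  · have h := (S [(1, 2, 0, 0, 0), (2, 1, 0, 1, 0), (1, 0, 0, 2, 0)]).2
    simp only [List.map_cons, List.map_nil, List.sum_cons, List.sum_nil, pow_zero, pow_one,
      mul_one, one_mul, add_zero, integral_const, probReal_univ, smul_eq_mul, eT, eX,
      mul_zero, zero_add] at h
    rw [← h]
    refine integral_congr_ae (Filter.Eventually.of_forall fun ω => ?_)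
    ring
  · have h := (S [(1, 0, 2, 0, 0), (2, 0, 1, 0, 1), (1, 0, 0, 0, 2)]).2
    simp only [List.map_cons, List.map_nil, List.sum_cons, List.sum_nil, pow_zero, pow_one,
      mul_one, one_mul, add_zero, integral_const, probReal_univ, smul_eq_mul, eH, eY,
      mul_zero, zero_add] at h
    rw [← h]
    refine integral_congr_ae (Filter.Eventually.of_forall fun ω => ?_)
    ring
  · have h := (S [(1, 2, 2, 0, 0), (1, 2, 0, 0, 2), (1, 0, 2, 2, 0), (4, 1, 1, 1, 1),
      (1, 0, 0, 2, 2), (2, 2, 1, 0, 1), (2, 1, 2, 1, 0), (2, 1, 0, 1, 2), (2, 0, 1, 2, 1)]).2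
    simp only [List.map_cons, List.map_nil, List.sum_cons, List.sum_nil, pow_zero, pow_one,
      mul_one, one_mul, add_zero, integral_const, probReal_univ, smul_eq_mul, eT, eH, eX, eY,
      mul_zero, zero_mul] at h
    rw [mul_comm (∫ ω, X ω ^ 2 ∂Q), add_assoc, add_assoc, add_assoc, ← h]
    refine integral_congr_ae (Filter.Eventually.of_forall fun ω => ?_)
    ring

/-- The joint fourth moment `E T² H²` of two sums over the same independent family. -/
lemma integral_sum_sq_mul_sum_sq_le {X Y : ι → Ω → ℝ} (hX : ∀ i, Measurable (X i))
    (hY : ∀ i, Measurable (Y i)) (hind : iIndepFun (fun i ω => (X i ω, Y i ω)) Q) {K : ℝ}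
    (bX : ∀ i ω, |X i ω| ≤ K) (bY : ∀ i ω, |Y i ω| ≤ K) (eX : ∀ i, ∫ ω, X i ω ∂Q = 0)
    (eY : ∀ i, ∫ ω, Y i ω ∂Q = 0) :
    ∫ ω, (∑ i, X i ω) ^ 2 * (∑ i, Y i ω) ^ 2 ∂Q
      ≤ 3 * ((∑ i, ∫ ω, X i ω ^ 2 ∂Q) * ∑ i, ∫ ω, Y i ω ^ 2 ∂Q)
        + ∑ i, ∫ ω, X i ω ^ 2 * Y i ω ^ 2 ∂Q := by
  classical
  have key : ∀ s : Finset ι,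
      ∫ ω, (∑ i ∈ s, X i ω) * (∑ i ∈ s, Y i ω) ∂Q = ∑ i ∈ s, ∫ ω, X i ω * Y i ω ∂Q ∧
      ∫ ω, (∑ i ∈ s, X i ω) ^ 2 ∂Q = ∑ i ∈ s, ∫ ω, X i ω ^ 2 ∂Q ∧
      ∫ ω, (∑ i ∈ s, Y i ω) ^ 2 ∂Q = ∑ i ∈ s, ∫ ω, Y i ω ^ 2 ∂Q ∧
      ∫ ω, (∑ i ∈ s, X i ω) ^ 2 * (∑ i ∈ s, Y i ω) ^ 2 ∂Q
        ≤ (∑ i ∈ s, ∫ ω, X i ω ^ 2 ∂Q) * (∑ i ∈ s, ∫ ω, Y i ω ^ 2 ∂Q)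
          + 2 * (∑ i ∈ s, ∫ ω, X i ω * Y i ω ∂Q) ^ 2
          + ∑ i ∈ s, ∫ ω, X i ω ^ 2 * Y i ω ^ 2 ∂Q := by
    intro s
    induction s using Finset.induction_on with
    | empty => simp
    | insert j s hj ih =>
      obtain ⟨h1, h2, h3, h4⟩ := ih
      have hK : 0 ≤ |K| := abs_nonneg K
      have bs : ∀ {U : ι → Ω → ℝ}, (∀ i ω, |U i ω| ≤ K) → ∀ ω,
          |∑ i ∈ s, U i ω| ≤ s.card * |K| + |K| := fun {U} hU ω => by
        refine (Finset.abs_sum_le_sum_abs _ _).trans ?_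
        have := Finset.sum_le_card_nsmul s (fun i => |U i ω|) |K|
          fun i _ => (hU i ω).trans (le_abs_self K)
        rw [nsmul_eq_mul] at this
        linarith
      have b1 : ∀ {U : ι → Ω → ℝ}, (∀ i ω, |U i ω| ≤ K) → ∀ ω,
          |U j ω| ≤ s.card * |K| + |K| := fun {U} hU ω => by
        have : 0 ≤ (s.card : ℝ) * |K| := by positivity
        linarith [hU j ω, le_abs_self K]
      have hi : IndepFun (fun ω => (∑ i ∈ s, X i ω, ∑ i ∈ s, Y i ω))
          (fun ω => (X j ω, Y j ω)) Q := by
        have h := hind.indepFun_finsetSum_of_notMem (fun i => (hX i).prodMk (hY i)) hj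
        convert h using 1
        ext ω
        · simp [Prod.fst_sum]
        · simp [Prod.snd_sum]
      have z : ∀ {U : ι → Ω → ℝ}, (∀ i, Measurable (U i)) → (∀ i ω, |U i ω| ≤ K) →
          (∀ i, ∫ ω, U i ω ∂Q = 0) → ∫ ω, ∑ i ∈ s, U i ω ∂Q = 0 := fun {U} hU hb h0 => by
        rw [integral_finsetSum _ fun i _ => integrable_of_abs_le (hU i) (hb i)]
        exact Finset.sum_eq_zero fun i _ => h0 i
      obtain ⟨r1, r2, r3, r4⟩ := integral_sq_mul_sq_add
        (Finset.measurable_fun_sum s fun i _ => hX i) (Finset.measurable_fun_sum s fun i _ => hY i)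
        (hX j) (hY j) (bs bX) (bs bY) (b1 bX) (b1 bY) hi (z hX bX eX) (z hY bY eY) (eX j) (eY j)
      simp only [Finset.sum_insert hj, add_comm (X j _), add_comm (Y j _)]
      simp only [r1, r2, r3, r4, h1, h2, h3]
      refine ⟨add_comm _ _, add_comm _ _, add_comm _ _, ?_⟩
      have p1 : 0 ≤ ∫ ω, X j ω ^ 2 ∂Q := integral_nonneg fun ω => sq_nonneg _
      have p2 : 0 ≤ ∫ ω, Y j ω ^ 2 ∂Q := integral_nonneg fun ω => sq_nonneg _
      nlinarith [mul_nonneg p1 p2, sq_nonneg (∫ ω, X j ω * Y j ω ∂Q)]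
  obtain ⟨-, -, -, h4⟩ := key Finset.univ
  have hcs : (∑ i, ∫ ω, X i ω * Y i ω ∂Q) ^ 2
      ≤ (∑ i, ∫ ω, X i ω ^ 2 ∂Q) * ∑ i, ∫ ω, Y i ω ^ 2 ∂Q := by
    refine Finset.sum_sq_le_sum_mul_sum_of_sq_le_mul _ (fun i _ => integral_nonneg fun ω =>
      sq_nonneg _) (fun i _ => integral_nonneg fun ω => sq_nonneg _) fun i _ => ?_
    have iX := integrable_sq_of_abs_le (Q := Q) (hX i) (bX i)
    have iY := integrable_sq_of_abs_le (Q := Q) (hY i) (bY i)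
    have iXY : Integrable (fun ω => X i ω * Y i ω) Q := by
      refine integrable_of_abs_le (K := K * K) ((hX i).mul (hY i)) fun ω => ?_
      rw [abs_mul]
      exact mul_le_mul (bX i ω) (bY i ω) (abs_nonneg _) ((abs_nonneg _).trans (bX i ω))
    have hq : ∀ r : ℝ, 0 ≤ (∫ ω, X i ω ^ 2 ∂Q) * (r * r) + (2 * ∫ ω, X i ω * Y i ω ∂Q) * r
        + ∫ ω, Y i ω ^ 2 ∂Q := by
      intro r
      have e : ∫ ω, (r * X i ω + Y i ω) ^ 2 ∂Q = (∫ ω, X i ω ^ 2 ∂Q) * (r * r)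
          + (2 * ∫ ω, X i ω * Y i ω ∂Q) * r + ∫ ω, Y i ω ^ 2 ∂Q := by
        have e1 : ∀ ω, (r * X i ω + Y i ω) ^ 2
            = (r * r) * X i ω ^ 2 + (2 * r) * (X i ω * Y i ω) + Y i ω ^ 2 := fun ω => by ring
        have i1 : Integrable (fun ω => (r * r) * X i ω ^ 2 + (2 * r) * (X i ω * Y i ω)) Q :=
          (iX.const_mul _).add (iXY.const_mul _)
        simp only [e1]
        rw [integral_add i1 iY, integral_add (iX.const_mul _) (iXY.const_mul _),
          integral_const_mul, integral_const_mul]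
        ring
      rw [← e]
      exact integral_nonneg fun ω => sq_nonneg _
    have := discrim_le_zero hq
    unfold discrim at this
    linarith
  linarith

lemma exp_le_one_add_sq (y : ℝ) : Real.exp y ≤ 1 + y + y ^ 2 * Real.exp |y| := by
  have h := Complex.norm_exp_sub_sum_le_norm_mul_exp (y : ℂ) 2
  have e : Complex.exp (y : ℂ) - ∑ m ∈ Finset.range 2, (y : ℂ) ^ m / m.factorial
      = ((Real.exp y - 1 - y : ℝ) : ℂ) := by
    simp [Finset.sum_range_succ]
    ring
  rw [e, Complex.norm_real, Complex.norm_real, Real.norm_eq_abs, Real.norm_eq_abs, sq_abs] at h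
  linarith [le_abs_self (Real.exp y - 1 - y)]

/-- A Bennett-type bound on the Laplace transform of a centred sum. -/
lemma integral_exp_mul_sum_le {Y : ι → Ω → ℝ} (hY : ∀ i, Measurable (Y i)) (hind : iIndepFun Y Q)
    (bY : ∀ i ω, |Y i ω| ≤ 1) (eY : ∀ i, ∫ ω, Y i ω ∂Q = 0) {B : ℝ}
    (hB : ∑ i, ∫ ω, Y i ω ^ 2 ∂Q ≤ B) {a β : ℝ} (ha : |a| = β) :
    ∫ ω, Real.exp (a * ∑ i, Y i ω) ∂Q ≤ Real.exp (β ^ 2 * Real.exp β * B) := by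
  have hβ : 0 ≤ β := ha ▸ abs_nonneg a
  have h1 : ∀ ω, Real.exp (a * ∑ i, Y i ω) = ∏ i, Real.exp (a * Y i ω) := fun ω => by
    rw [Finset.mul_sum, Real.exp_sum]
  simp only [h1]
  rw [hind.integral_fun_prod_comp (f := fun _ y => Real.exp (a * y)) (fun i => (hY i).aemeasurable)
    (fun i => (by fun_prop : Measurable fun y : ℝ => Real.exp (a * y)).aestronglyMeasurable)]
  calc ∏ i, ∫ ω, Real.exp (a * Y i ω) ∂Q
      ≤ ∏ i, Real.exp (β ^ 2 * Real.exp β * ∫ ω, Y i ω ^ 2 ∂Q) := by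
        refine Finset.prod_le_prod (fun i _ => integral_nonneg fun ω => (Real.exp_pos _).le)
          fun i _ => ?_
        have i1 := integrable_of_abs_le (Q := Q) (hY i) (bY i)
        have i2 := integrable_sq_of_abs_le (Q := Q) (hY i) (bY i)
        have i3 : Integrable (fun ω => 1 + a * Y i ω) Q :=
          (integrable_const 1).add (i1.const_mul a)
        have h2 : ∫ ω, Real.exp (a * Y i ω) ∂Q
            ≤ ∫ ω, (1 + a * Y i ω + β ^ 2 * Real.exp β * Y i ω ^ 2) ∂Q := by
          refine integral_mono_of_nonneg (Filter.Eventually.of_forall fun ω => (Real.exp_pos _).le)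
            (i3.add (i2.const_mul _)) (Filter.Eventually.of_forall fun ω => ?_)
          refine (exp_le_one_add_sq _).trans ?_
          have h3 : |a * Y i ω| ≤ β := by
            rw [abs_mul, ha]
            exact mul_le_of_le_one_right hβ (bY i ω)
          have h4 : (a * Y i ω) ^ 2 = β ^ 2 * Y i ω ^ 2 := by rw [mul_pow, ← ha, sq_abs]
          rw [h4]
          have h5 := mul_le_mul_of_nonneg_left (Real.exp_le_exp.2 h3)
            (by positivity : 0 ≤ β ^ 2 * Y i ω ^ 2)
          beta_reduce
          linarith
        rw [integral_add i3 (i2.const_mul _), integral_add (integrable_const 1) (i1.const_mul a),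
          integral_const_mul, integral_const_mul, eY i] at h2
        simp only [integral_const, probReal_univ, smul_eq_mul, mul_one, mul_zero, add_zero] at h2
        refine h2.trans ?_
        linarith [Real.add_one_le_exp (β ^ 2 * Real.exp β * ∫ ω, Y i ω ^ 2 ∂Q)]
    _ = Real.exp (β ^ 2 * Real.exp β * ∑ i, ∫ ω, Y i ω ^ 2 ∂Q) := by
        rw [Finset.mul_sum, Real.exp_sum]
    _ ≤ _ := Real.exp_le_exp.2 (mul_le_mul_of_nonneg_left hB (by positivity))

lemma exp_le_cosh_sub_one {y : ℝ} (hy : 1 / 2 ≤ y) :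
    Real.exp y ≤ 9 * (Real.exp y + Real.exp (-y) - 2) := by
  have e1 : Real.exp y = Real.exp (y / 2) ^ 2 := by rw [← Real.exp_nat_mul]; ring_nf
  have e2 : Real.exp (-y) = Real.exp (-(y / 2)) ^ 2 := by rw [← Real.exp_nat_mul]; ring_nf
  have e3 : Real.exp (y / 2) * Real.exp (-(y / 2)) = 1 := by rw [← Real.exp_add]; simp
  have h1 : y + 1 ≤ Real.exp y := Real.add_one_le_exp y
  have h2 : 3 * Real.exp (-(y / 2)) ≤ 2 * Real.exp (y / 2) := by
    have h3 := Real.exp_pos (-(y / 2))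
    have h4 : Real.exp (y / 2) = Real.exp y * Real.exp (-(y / 2)) := by
      rw [← Real.exp_add]
      ring_nf
    rw [h4]
    nlinarith
  have h5 : 9 * (Real.exp y + Real.exp (-y) - 2)
      = (3 * (Real.exp (y / 2) - Real.exp (-(y / 2)))) ^ 2 := by
    rw [e1, e2]
    nlinarith
  rw [h5, e1]
  exact pow_le_pow_left₀ (Real.exp_pos _).le (by linarith) 2

/-- Exponential moments of a centred sum on the event that it is large: they vanish with the
variance, and decay exponentially in the threshold. -/
lemma integral_exp_abs_tail_le {Y : ι → Ω → ℝ} (hY : ∀ i, Measurable (Y i))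
    (hind : iIndepFun Y Q) (bY : ∀ i ω, |Y i ω| ≤ 1) (eY : ∀ i, ∫ ω, Y i ω ∂Q = 0) {B : ℝ}
    (hB : ∑ i, ∫ ω, Y i ω ^ 2 ∂Q ≤ B) {a τ : ℝ} (ha : 0 ≤ a) (hτ : 1 / 2 ≤ τ) :
    ∫ ω, {ω | τ ≤ |∑ i, Y i ω|}.indicator (fun ω => Real.exp (a * |∑ i, Y i ω|)) ω ∂Q
      ≤ 18 * Real.exp (-τ) * (Real.exp ((a + 1) ^ 2 * Real.exp (a + 1) * B) - 1) := by
  have hm : Measurable fun ω => ∑ i, Y i ω := Finset.measurable_fun_sum _ fun i _ => hY i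
  have hbd : ∀ ω, |∑ i, Y i ω| ≤ Fintype.card ι * 1 := fun ω => abs_sum_le_card_mul fun i => bY i ω
  have hint : ∀ r : ℝ, Integrable (fun ω => Real.exp (r * ∑ i, Y i ω)) Q := fun r => by
    refine integrable_of_abs_le (K := Real.exp (|r| * (Fintype.card ι * 1))) (by fun_prop)
      fun ω => ?_
    rw [abs_of_pos (Real.exp_pos _)]
    refine Real.exp_le_exp.2 ((le_abs_self _).trans ?_)
    rw [abs_mul]
    exact mul_le_mul_of_nonneg_left (hbd ω) (abs_nonneg _)
  have h1 := integral_exp_mul_sum_le hY hind bY eY hB (abs_of_nonneg (by linarith : 0 ≤ a + 1))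
  have h2 := integral_exp_mul_sum_le hY hind bY eY hB (a := -(a + 1)) (β := a + 1)
    (by rw [abs_neg, abs_of_nonneg (by linarith)])
  have i0 : Integrable (fun ω => Real.exp ((a + 1) * ∑ i, Y i ω)
      + Real.exp (-(a + 1) * ∑ i, Y i ω)) Q := (hint _).add (hint _)
  have i1 : Integrable (fun ω => Real.exp ((a + 1) * ∑ i, Y i ω)
      + Real.exp (-(a + 1) * ∑ i, Y i ω) - 2) Q := i0.sub (integrable_const 2)
  have h3 : ∫ ω, {ω | τ ≤ |∑ i, Y i ω|}.indicator (fun ω => Real.exp (a * |∑ i, Y i ω|)) ω ∂Q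
      ≤ ∫ ω, 9 * Real.exp (-τ) * (Real.exp ((a + 1) * ∑ i, Y i ω)
      + Real.exp (-(a + 1) * ∑ i, Y i ω) - 2) ∂Q := by
    refine integral_mono_of_nonneg (Filter.Eventually.of_forall fun ω =>
      Set.indicator_nonneg (fun _ _ => (Real.exp_pos _).le) _) (i1.const_mul _)
      (Filter.Eventually.of_forall fun ω => ?_)
    beta_reduce
    set θ := ∑ i, Y i ω with hθ
    have hsym : Real.exp ((a + 1) * θ) + Real.exp (-(a + 1) * θ)
        = Real.exp ((a + 1) * |θ|) + Real.exp (-((a + 1) * |θ|)) := by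
      rcases abs_cases θ with ⟨h, -⟩ | ⟨h, -⟩
      · rw [h, neg_mul]
      · rw [h, mul_neg, neg_neg, neg_mul, add_comm]
    have hnn : 0 ≤ Real.exp ((a + 1) * |θ|) + Real.exp (-((a + 1) * |θ|)) - 2 := by
      have e3 : Real.exp ((a + 1) * |θ|) * Real.exp (-((a + 1) * |θ|)) = 1 := by
        rw [← Real.exp_add]; simp
      nlinarith [sq_nonneg (Real.exp ((a + 1) * |θ|) - Real.exp (-((a + 1) * |θ|))),
        Real.exp_pos ((a + 1) * |θ|), Real.exp_pos (-((a + 1) * |θ|))]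
    rw [hsym]
    by_cases hc : τ ≤ |θ|
    · rw [Set.indicator_of_mem (by exact hc)]
      have h4 := exp_le_cosh_sub_one (y := (a + 1) * |θ|) (by nlinarith [abs_nonneg θ])
      have h5 : Real.exp (a * |θ|) ≤ Real.exp (-τ) * Real.exp ((a + 1) * |θ|) := by
        rw [← Real.exp_add]
        exact Real.exp_le_exp.2 (by linarith)
      refine h5.trans ?_
      rw [mul_comm (9 : ℝ), mul_assoc]
      exact mul_le_mul_of_nonneg_left h4 (Real.exp_pos _).le
    · rw [Set.indicator_of_notMem (by exact hc)]
      exact mul_nonneg (mul_nonneg (by norm_num) (Real.exp_pos _).le) hnn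
  refine h3.trans ?_
  rw [integral_const_mul, integral_sub i0 (integrable_const 2), integral_add (hint _) (hint _)]
  simp only [integral_const, probReal_univ, smul_eq_mul, one_mul]
  have := mul_le_mul_of_nonneg_left (add_le_add h1 h2)
    (by positivity : 0 ≤ 9 * Real.exp (-τ))
  linarith

end Sums

/-! ### The lower bound and the bound on the event of good pairs -/

section Pointwise

variable {Ω ι : Type*} [Fintype ι] {x t ρ c l : ℝ} {Z : ι → Ω → ℝ × ℝ}

/-- The event `S ≥ x V + c` in terms of the scaled pairs. -/
def tailEvent (x t c : ℝ) (Z : ι → Ω → ℝ × ℝ) : Set Ω :=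
  {ω | x * √(∑ i, (Z i ω).2 ^ 2) + c * t ≤ ∑ i, (Z i ω).1}

/-- The event that all pairs are good. -/
def allGood (Z : ι → Ω → ℝ × ℝ) : Set Ω := {ω | ∀ i, Z i ω ∈ good}

/-- The square `Y² 1_good` of the scaled second component. -/
noncomputable def sqGood (z : ℝ × ℝ) : ℝ := good.indicator (fun z => z.2 ^ 2) z

lemma measurable_sqGood : Measurable sqGood :=
  (measurable_snd.pow_const 2).indicator measurableSet_good

lemma sqGood_of_mem {z : ℝ × ℝ} (hz : z ∈ good) : sqGood z = z.2 ^ 2 := Set.indicator_of_mem hz _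

lemma sqGood_of_notMem {z : ℝ × ℝ} (hz : z ∉ good) : sqGood z = 0 :=
  Set.indicator_of_notMem hz _

lemma sqGood_nonneg (z : ℝ × ℝ) : 0 ≤ sqGood z := Set.indicator_nonneg (fun _ _ => sq_nonneg _) _

lemma sqGood_le_one (z : ℝ × ℝ) : sqGood z ≤ 1 := by
  by_cases hz : z ∈ good
  · rw [sqGood_of_mem hz]
    exact (sq_le_one_iff_abs_le_one _).2 hz.2
  · rw [sqGood_of_notMem hz]
    exact zero_le_one

lemma abs_sqGood_le_one (z : ℝ × ℝ) : |sqGood z| ≤ 1 := by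
  rw [abs_of_nonneg (sqGood_nonneg z)]
  exact sqGood_le_one z

lemma prod_wt_of_mem {ω : Ω} (h : ω ∈ allGood Z) :
    ∏ i, wt ρ l (Z i ω) = Real.exp (l * ∑ i, xiGood ρ (Z i ω)) := by
  rw [Finset.mul_sum, Real.exp_sum]
  refine Finset.prod_congr rfl fun i _ => ?_
  rw [wt_of_mem (h i), xiGood_of_mem (h i)]

lemma prod_wt_of_notMem {ω : Ω} (h : ω ∉ allGood Z) : ∏ i, wt ρ l (Z i ω) = 0 := by
  have : ∃ i, Z i ω ∉ good := by
    by_contra hc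
    push Not at hc
    exact h hc
  obtain ⟨i, hi⟩ := this
  exact Finset.prod_eq_zero (Finset.mem_univ i) (wt_of_notMem hi)

/-- On the good event `∑ ξ = 2 x S - x² V²`. -/
lemma sum_xiGood_of_mem {ω : Ω} (h : ω ∈ allGood Z) :
    ∑ i, xiGood ρ (Z i ω) = 2 * ρ * ∑ i, (Z i ω).1 - ρ ^ 2 * ∑ i, (Z i ω).2 ^ 2 := by
  rw [Finset.mul_sum, Finset.mul_sum, ← Finset.sum_sub_distrib]
  exact Finset.sum_congr rfl fun i _ => by rw [xiGood_of_mem (h i)]; rfl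

/-- On the good event, `S ≥ x V + c` means that `∑ ξ` exceeds `x² + 2 c x - x² (V - 1)²`. -/
lemma mem_tailEvent_iff {ω : Ω} (hρ : 0 < ρ) (hx : ρ * t = x) (h : ω ∈ allGood Z) :
    ω ∈ tailEvent x t c Z ↔
      x ^ 2 + 2 * c * x - (x - ρ * √(∑ i, (Z i ω).2 ^ 2)) ^ 2 ≤ ∑ i, xiGood ρ (Z i ω) := by
  rw [sum_xiGood_of_mem h]
  unfold tailEvent
  rw [Set.mem_ofPred_eq]
  set q := √(∑ i, (Z i ω).2 ^ 2) with hq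
  have hq2 : ∑ i, (Z i ω).2 ^ 2 = q ^ 2 :=
    (Real.sq_sqrt (Finset.sum_nonneg fun i _ => sq_nonneg _)).symm
  rw [hq2, ← mul_le_mul_iff_right₀ (by linarith : 0 < 2 * ρ), ← hx]
  constructor <;> intro h1 <;> nlinarith

/-- The defect `x² (V - 1)²` in terms of `u = V² - 1`. -/
lemma defect_le {q u : ℝ} (ht : 0 < t) (hx : ρ * t = x) (hq : 0 ≤ q)
    (hu : q ^ 2 = t ^ 2 * (1 + u)) :
    (x - ρ * q) ^ 2 ≤ x ^ 2 * u ^ 2 ∧ (x - ρ * q) ^ 2 ≤ x ^ 2 * |u| := by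
  obtain ⟨V, rfl⟩ : ∃ V, q = t * V := ⟨q / t, by field_simp⟩
  have hV : 0 ≤ V := nonneg_of_mul_nonneg_right hq ht
  have hV2 : V ^ 2 = 1 + u := by
    have : t ^ 2 * V ^ 2 = t ^ 2 * (1 + u) := by rw [← hu]; ring
    exact mul_left_cancel₀ (by positivity) this
  have hu' : u = (V - 1) * (V + 1) := by linear_combination -hV2
  have e : (x - ρ * (t * V)) ^ 2 = x ^ 2 * (V - 1) ^ 2 := by
    rw [← hx]
    ring
  have h1 : (V - 1) ^ 2 ≤ u ^ 2 := by
    rw [hu', mul_pow]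
    exact le_mul_of_one_le_right (sq_nonneg _) (one_le_pow₀ (by linarith))
  have h2 : (V - 1) ^ 2 ≤ |u| := by
    rw [hu', abs_mul, abs_of_nonneg (by linarith : 0 ≤ V + 1), ← sq_abs, sq]
    refine mul_le_mul_of_nonneg_left ?_ (abs_nonneg _)
    rw [abs_le]
    constructor <;> linarith
  rw [e]
  exact ⟨mul_le_mul_of_nonneg_left h1 (sq_nonneg _), mul_le_mul_of_nonneg_left h2 (sq_nonneg _)⟩

end Pointwise

section GoodEvent

variable {Ω : Type*} [MeasurableSpace Ω] {μ Q : Measure Ω} {ι : Type*} [Fintype ι]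
  {x t ρ c R ε l : ℝ} {Z : ι → Ω → ℝ × ℝ}

lemma measurableSet_tailEvent (hZ : ∀ i, Measurable (Z i)) :
    MeasurableSet (tailEvent x t c Z) :=
  measurableSet_le (by fun_prop) (by fun_prop)

lemma measurableSet_allGood (hZ : ∀ i, Measurable (Z i)) : MeasurableSet (allGood Z) := by
  have : allGood Z = ⋂ i, (Z i) ⁻¹' good := by
    ext ω
    simp [allGood]
  rw [this]
  exact MeasurableSet.iInter fun i => (hZ i) measurableSet_good

/-- The centred summand of `∑ Y² 1_good`. -/
noncomputable def sqDev (μ : Measure Ω) (ρ l : ℝ) (Z : ι → Ω → ℝ × ℝ) (i : ι) (z : ℝ × ℝ) : ℝ :=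
  sqGood z - tiltMean μ ρ l (Z i) (fun z => z.2 ^ 2)

lemma measurable_sqDev {ι : Type*} {Z : ι → Ω → ℝ × ℝ} (i : ι) : Measurable (sqDev μ ρ l Z i) := measurable_sqGood.sub_const _

namespace IsTilt

lemma integral_sqGood (hQ : IsTilt μ Q ρ l Z) (i : ι) :
    ∫ ω, sqGood (Z i ω) ∂Q = tiltMean μ ρ l (Z i) (fun z => z.2 ^ 2) := by
  rw [hQ.integral_comp i _ measurable_sqGood]
  exact tiltMean_congr fun z hz => sqGood_of_mem hz

end IsTilt

/-- The defect `x² (V - 1)²` is nonnegative, so the tail event contains the event that all pairs are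
good and `∑ ξ` exceeds its tilted mean. -/
lemma IsTilt.lower_bound [IsProbabilityMeasure μ] (hQ : IsTilt μ Q ρ l Z) (h : Sample μ x t ρ c R ε Z)
    (hl : IsSaddle μ x t ρ c R ε l Z) :
    Real.exp (∑ i, Real.log (tiltMass μ ρ l (Z i)) - l * (x ^ 2 + 2 * c * x))
      * ∫ ω, expTail (l * tiltSd μ ρ l Z) (∑ i, stdXi μ ρ l Z i (Z i ω)) ∂Q
      ≤ μ.real (tailEvent x t c Z) := by
  obtain ⟨-, hs, -, -⟩ := h.tiltSd_bounds hl.zero_le hl.le_one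
  have hx := h.x_pos
  have ht := h.t_pos
  have hs0 : 0 < tiltSd μ ρ l Z := lt_of_lt_of_le (by linarith) hs
  have hE := measurableSet_tailEvent (x := x) (t := t) (c := c) fun i => (h.law i).meas
  set b := x ^ 2 + 2 * c * x with hb
  set T : Ω → ℝ := fun ω => ∑ i, stdXi μ ρ l Z i (Z i ω) with hT
  rw [sub_eq_add_neg, Real.exp_add, mul_assoc, ← integral_const_mul, ← hQ.change,
    ← integral_indicator_one hE]
  refine integral_mono_of_nonneg (Filter.Eventually.of_forall fun ω => ?_)
    ((integrable_const (1 : ℝ)).indicator hE) (Filter.Eventually.of_forall fun ω => ?_)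
  · exact mul_nonneg (mul_nonneg (Real.exp_pos _).le (expTail_nonneg _ _))
      (Finset.prod_nonneg fun i _ => wt_nonneg _ _ _)
  beta_reduce
  by_cases hN : ω ∈ allGood Z
  swap
  · rw [prod_wt_of_notMem hN, mul_zero]
    exact Set.indicator_nonneg (fun _ _ => zero_le_one) _
  have hW : tiltSd μ ρ l Z * T ω = ∑ i, xiGood ρ (Z i ω) - b := sum_stdXi hl hs0.ne' ω
  rw [prod_wt_of_mem hN]
  rcases lt_or_ge (T ω) 0 with hneg | hpos
  · rw [expTail_of_neg hneg, mul_zero, zero_mul]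
    exact Set.indicator_nonneg (fun _ _ => zero_le_one) _
  · rw [expTail_of_nonneg hpos, ← Real.exp_add, ← Real.exp_add]
    have e : -(l * b) + -(l * tiltSd μ ρ l Z) * T ω + l * ∑ i, xiGood ρ (Z i ω) = 0 := by
      rw [neg_mul, mul_assoc, hW]
      ring
    rw [e, Real.exp_zero]
    have hmem : ω ∈ tailEvent x t c Z := by
      have hWb : b ≤ ∑ i, xiGood ρ (Z i ω) := by
        have := mul_nonneg hs0.le hpos
        linarith
      rw [mem_tailEvent_iff h.rho_pos h.rho_mul hN]
      linarith [sq_nonneg (x - ρ * √(∑ i, (Z i ω).2 ^ 2))]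
    rw [Set.indicator_of_mem hmem]
    exact le_rfl

namespace IsTilt

variable [IsProbabilityMeasure Q]

lemma abs_sqDev_le (hQ : IsTilt μ Q ρ l Z) (h : Sample μ x t ρ c R ε Z) (i : ι) (z : ℝ × ℝ) :
    |sqDev μ ρ l Z i z| ≤ 1 := by
  have hm : Measurable fun ω => sqGood (Z i ω) := measurable_sqGood.comp (h.law i).meas
  have hi := integrable_of_abs_le (Q := Q) hm fun ω => abs_sqGood_le_one (Z i ω)
  have h0 : 0 ≤ ∫ ω, sqGood (Z i ω) ∂Q := integral_nonneg fun ω => sqGood_nonneg _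
  have h1 : ∫ ω, sqGood (Z i ω) ∂Q ≤ 1 := by
    have := integral_mono hi (integrable_const 1) fun ω => sqGood_le_one (Z i ω)
    simpa using this
  rw [hQ.integral_sqGood] at h0 h1
  have := sqGood_nonneg z
  have := sqGood_le_one z
  unfold sqDev
  rw [abs_le]
  constructor <;> linarith

lemma integral_sqDev (hQ : IsTilt μ Q ρ l Z) (h : Sample μ x t ρ c R ε Z) (i : ι) :
    ∫ ω, sqDev μ ρ l Z i (Z i ω) ∂Q = 0 := by
  have hm : Measurable fun ω => sqGood (Z i ω) := measurable_sqGood.comp (h.law i).meas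
  have hi := integrable_of_abs_le (Q := Q) hm fun ω => abs_sqGood_le_one (Z i ω)
  unfold sqDev
  rw [integral_sub hi (integrable_const _), hQ.integral_sqGood]
  simp

lemma integral_sqDev_sq_le (hQ : IsTilt μ Q ρ l Z) (h : Sample μ x t ρ c R ε Z) (i : ι) :
    ∫ ω, sqDev μ ρ l Z i (Z i ω) ^ 2 ∂Q ≤ tiltMean μ ρ l (Z i) (fun z => z.2 ^ 4) := by
  have hm : Measurable fun ω => sqGood (Z i ω) := measurable_sqGood.comp (h.law i).meas
  have hi := integrable_of_abs_le (Q := Q) hm fun ω => abs_sqGood_le_one (Z i ω)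
  have hi2 := integrable_sq_of_abs_le (Q := Q) hm fun ω => abs_sqGood_le_one (Z i ω)
  set v := tiltMean μ ρ l (Z i) (fun z => z.2 ^ 2) with hv
  have e : ∀ ω, sqDev μ ρ l Z i (Z i ω) ^ 2
      = sqGood (Z i ω) ^ 2 - 2 * v * sqGood (Z i ω) + v ^ 2 := fun ω => by
    unfold sqDev
    rw [← hv]
    ring
  have e4 : ∫ ω, sqGood (Z i ω) ^ 2 ∂Q = tiltMean μ ρ l (Z i) (fun z => z.2 ^ 4) := by
    rw [hQ.integral_comp i (fun z => sqGood z ^ 2) (measurable_sqGood.pow_const 2)]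
    refine tiltMean_congr fun z hz => ?_
    rw [sqGood_of_mem hz]
    ring
  have i3 : Integrable (fun ω => sqGood (Z i ω) ^ 2 - 2 * v * sqGood (Z i ω)) Q :=
    hi2.sub (hi.const_mul _)
  simp only [e]
  rw [integral_add i3 (integrable_const _), integral_sub hi2 (hi.const_mul _), integral_const_mul,
    hQ.integral_sqGood, e4, ← hv]
  simp only [integral_const, probReal_univ, smul_eq_mul, one_mul]
  nlinarith [sq_nonneg v]

lemma sum_integral_sqDev_sq_le [IsProbabilityMeasure μ] (hQ : IsTilt μ Q ρ l Z) (h : Sample μ x t ρ c R ε Z) (hl0 : 0 ≤ l)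
    (hl1 : l ≤ 1) : ∑ i, ∫ ω, sqDev μ ρ l Z i (Z i ω) ^ 2 ∂Q ≤ 42 * R :=
  (Finset.sum_le_sum fun i _ => hQ.integral_sqDev_sq_le h i).trans
    (h.sum_tiltMean_snd_fourth_le hl0 hl1)

end IsTilt

end GoodEvent

/-! ### Concentration with a random left end -/

section Concentration

variable {Ω : Type*} [MeasurableSpace Ω] {μ Q : Measure Ω} {ι : Type*} [Fintype ι]
  {x t ρ c R ε l : ℝ} {Z : ι → Ω → ℝ × ℝ}

/-- The defect `min (x² u²) κ / s` as a function of the centred sum `h = ∑ Y² - E ∑ Y²`, where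
`u = (h + m) / t²`. -/
noncomputable def defect (x t s m κ h : ℝ) : ℝ := min (x ^ 2 * ((h + m) / t ^ 2) ^ 2) κ / s

lemma measurable_defect (x t s m κ : ℝ) : Measurable (defect x t s m κ) := by
  unfold defect
  fun_prop

lemma defect_nonneg {s m κ : ℝ} (hs : 0 < s) (hκ : 0 ≤ κ) (h : ℝ) : 0 ≤ defect x t s m κ h :=
  div_nonneg (le_min (by positivity) hκ) hs.le

lemma defect_le_cap {s m κ : ℝ} (hs : 0 < s) (h : ℝ) : defect x t s m κ h ≤ κ / s :=
  div_le_div_of_nonneg_right (min_le_right _ _) hs.le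

lemma defect_le_sq {s m κ : ℝ} (hs : 0 < s) (h : ℝ) :
    defect x t s m κ h ≤ x ^ 2 / (s * t ^ 4) * (2 * h ^ 2 + 2 * m ^ 2) := by
  have h1 : defect x t s m κ h ≤ x ^ 2 * ((h + m) / t ^ 2) ^ 2 / s :=
    div_le_div_of_nonneg_right (min_le_left _ _) hs.le
  have e : x ^ 2 * ((h + m) / t ^ 2) ^ 2 / s = x ^ 2 / (s * t ^ 4) * (h + m) ^ 2 := by
    rw [div_pow, ← pow_mul]
    field_simp
  rw [e] at h1
  refine h1.trans (mul_le_mul_of_nonneg_left ?_ (by positivity))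
  nlinarith [sq_nonneg (h - m)]

lemma abs_defect_sub_le {s m κ : ℝ} (hs : 0 < s) (h y : ℝ) :
    |defect x t s m κ h - defect x t s m κ (h - y)|
      ≤ x ^ 2 / (s * t ^ 4) * (2 * (|y| * |h - y|) + 2 * (|m| * |y|) + y ^ 2) := by
  have h1 : |defect x t s m κ h - defect x t s m κ (h - y)|
      ≤ |x ^ 2 * ((h + m) / t ^ 2) ^ 2 - x ^ 2 * ((h - y + m) / t ^ 2) ^ 2| / s := by
    unfold defect
    rw [← sub_div, abs_div, abs_of_pos hs]
    refine div_le_div_of_nonneg_right ?_ hs.le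
    refine (abs_min_sub_min_le_max _ _ _ _).trans ?_
    simp
  have e : |x ^ 2 * ((h + m) / t ^ 2) ^ 2 - x ^ 2 * ((h - y + m) / t ^ 2) ^ 2| / s
      = x ^ 2 / (s * t ^ 4) * |y * (2 * (h - y) + 2 * m + y)| := by
    have : x ^ 2 * ((h + m) / t ^ 2) ^ 2 - x ^ 2 * ((h - y + m) / t ^ 2) ^ 2
        = x ^ 2 / t ^ 4 * (y * (2 * (h - y) + 2 * m + y)) := by
      rw [div_pow, div_pow, ← pow_mul]
      ring
    rw [this, abs_mul, abs_of_nonneg (by positivity : 0 ≤ x ^ 2 / t ^ 4)]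
    field_simp
  rw [e] at h1
  refine h1.trans (mul_le_mul_of_nonneg_left ?_ (by positivity))
  rw [abs_mul]
  have h2 : |2 * (h - y) + 2 * m + y| ≤ 2 * |h - y| + 2 * |m| + |y| := by
    refine (abs_add_le _ _).trans ?_
    have := abs_add_le (2 * (h - y)) (2 * m)
    rw [abs_mul, abs_mul, abs_two] at this
    linarith
  have h3 := mul_le_mul_of_nonneg_left h2 (abs_nonneg y)
  have h4 : |y| * |y| = y ^ 2 := by rw [← sq, sq_abs]
  nlinarith

lemma abs_mul_le_half {r : ℝ} (hr : 0 < r) (a b : ℝ) :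
    |a| * |b| ≤ (r * a ^ 2 + b ^ 2 / r) / 2 := by
  have h : 0 ≤ (r * |a| - |b|) ^ 2 / r := by positivity
  have e : (r * |a| - |b|) ^ 2 / r = r * a ^ 2 - 2 * (|a| * |b|) + b ^ 2 / r := by
    rw [← sq_abs a, ← sq_abs b]
    field_simp
    ring
  linarith

lemma concentration_arith (h : Sample μ x t ρ c R ε Z) {s m : ℝ} (hs : 19 / 10 * x ≤ s)
    (hm : |m| ≤ 4 * 10 ^ 4 * (x * √R)) :
    (x ^ 2 / (s * t ^ 4) * (2 * (420 * R) + 2 * m ^ 2)) / 2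
        + 2 * (x ^ 2 / (s * t ^ 4) * (2 * (22 * √R * (44 * √R)) + 2 * |m| * (22 * √R)
          + 4 * (42 * R))) ≤ 19 * 10 ^ 8 * (R / t) := by
  have hx := h.x_pos
  have ht := h.t_pos
  have ht1 := h.one_le_t
  have hR := h.R_pos
  have hsR := h.sqrt_R_pos
  have hs0 : 0 < s := lt_of_lt_of_le (by linarith) hs
  set k := x ^ 2 / (s * t ^ 4) with hk
  have hk0 : 0 ≤ k := by positivity
  have hkt : k * t ^ 2 ≤ 1 / t := by
    have e : k * t ^ 2 = x ^ 2 / (s * t ^ 2) := by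
      rw [hk]
      field_simp
    rw [e, div_le_div_iff₀ (by positivity) ht]
    have : x ^ 2 * t ≤ x * t * t := by nlinarith [h.x_le_t, mul_pos hx ht]
    nlinarith [mul_pos ht ht]
  have hsq : √R * √R = R := h.sq_sqrt_R
  have hm2 : m ^ 2 ≤ 16 * 10 ^ 8 * (x ^ 2 * R) := by
    rw [← sq_abs, ← hsq]
    refine (pow_le_pow_left₀ (abs_nonneg _) hm 2).trans (le_of_eq ?_)
    ring
  have hm1 : |m| * √R ≤ 4 * 10 ^ 4 * (x * R) := by
    have := mul_le_mul_of_nonneg_right hm hsR.le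
    have e : 4 * 10 ^ 4 * (x * √R) * √R = 4 * 10 ^ 4 * (x * (√R * √R)) := by ring
    rw [e, hsq] at this
    exact this
  have hxt2 : x ^ 2 ≤ t ^ 2 := pow_le_pow_left₀ hx.le h.x_le_t 2
  have ht2 : 1 ≤ t ^ 2 := one_le_pow₀ ht1
  have hxt1 : x ≤ t ^ 2 := by nlinarith [h.x_le_t]
  have b1 : R ≤ t ^ 2 * R := le_mul_of_one_le_left hR.le ht2
  have b2 : x ^ 2 * R ≤ t ^ 2 * R := mul_le_mul_of_nonneg_right hxt2 hR.le
  have b3 : x * R ≤ t ^ 2 * R := mul_le_mul_of_nonneg_right hxt1 hR.le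
  have e : (k * (2 * (420 * R) + 2 * m ^ 2)) / 2
        + 2 * (k * (2 * (22 * √R * (44 * √R)) + 2 * |m| * (22 * √R) + 4 * (42 * R)))
        = k * (420 * R + m ^ 2 + 2 * (2 * 22 * 44 * (√R * √R) + 44 * (|m| * √R) + 168 * R)) := by
      ring
  rw [e, hsq]
  have tot := mul_le_mul_of_nonneg_left (by linarith : 420 * R + m ^ 2 + 2 * (2 * 22 * 44 * R
    + 44 * (|m| * √R) + 168 * R) ≤ 19 * 10 ^ 8 * (t ^ 2 * R)) hk0
  have tot2 := mul_le_mul_of_nonneg_right hkt hR.le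
  have e2 : 1 / t * R = R / t := by ring
  rw [e2] at tot2
  linarith

variable [IsProbabilityMeasure μ] [IsProbabilityMeasure Q]

set_option maxHeartbeats 400000 in
/-- The tilted probability that the standardized sum falls between the random level
`-min (x² u²) κ / s` and `0`, where `u = V² - 1`. -/
lemma IsTilt.concentration (hQ : IsTilt μ Q ρ l Z) (h : Sample μ x t ρ c R ε Z)
    (hl : IsSaddle μ x t ρ c R ε l Z) {κ : ℝ} (hκ : 0 ≤ κ) :
    Q.real {ω | -defect x t (tiltSd μ ρ l Z)
        (∑ i, tiltMean μ ρ l (Z i) (fun z => z.2 ^ 2) - t ^ 2) κ (∑ i, sqDev μ ρ l Z i (Z i ω))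
          ≤ ∑ i, stdXi μ ρ l Z i (Z i ω) ∧ ∑ i, stdXi μ ρ l Z i (Z i ω) ≤ 0}
      ≤ 10 ^ 7 * (ε / t) + 4 * 10 ^ 9 * (R / t) := by
  classical
  obtain ⟨-, hs, -, -⟩ := h.tiltSd_bounds hl.zero_le hl.le_one
  have hm' := h.abs_sum_tiltMean_snd_sq_sub_le hl.zero_le hl.le_one
  have hx := h.x_pos
  have ht := h.t_pos
  have ht1 := h.one_le_t
  have hε := h.eps_pos
  have hR := h.R_pos
  have hsR := h.sqrt_R_pos
  set s := tiltSd μ ρ l Z with hsdef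
  set m := ∑ i, tiltMean μ ρ l (Z i) (fun z => z.2 ^ 2) - t ^ 2 with hmdef
  have hs0 : 0 < s := lt_of_lt_of_le (by linarith) hs
  set ζ : ι → Ω → ℝ := fun i ω => stdXi μ ρ l Z i (Z i ω) with hζdef
  set η : ι → Ω → ℝ := fun i ω => sqDev μ ρ l Z i (Z i ω) with hηdef
  have hζ : ∀ i, Measurable (ζ i) := fun i => (measurable_stdXi i).comp (h.law i).meas
  have hη : ∀ i, Measurable (η i) := fun i => (measurable_sqDev i).comp (h.law i).meas
  have h4t : 4 / t ≤ 4 := div_le_self (by norm_num) ht1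
  have bζ : ∀ i ω, |ζ i ω| ≤ 4 := fun i ω =>
    (hQ.abs_stdXi_le h hl.zero_le hl.le_one i _).trans h4t
  have bη : ∀ i ω, |η i ω| ≤ 1 := fun i ω => hQ.abs_sqDev_le h i _
  have eζ : ∀ i, ∫ ω, ζ i ω ∂Q = 0 := fun i => hQ.integral_stdXi h i
  have eη : ∀ i, ∫ ω, η i ω ∂Q = 0 := fun i => hQ.integral_sqDev h i
  have vζ : ∑ i, ∫ ω, ζ i ω ^ 2 ∂Q = 1 := hQ.sum_integral_stdXi_sq h hl.zero_le hl.le_one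
  have vη : ∑ i, ∫ ω, η i ω ^ 2 ∂Q ≤ 42 * R := hQ.sum_integral_sqDev_sq_le h hl.zero_le hl.le_one
  have hind : iIndepFun (fun i ω => (ζ i ω, η i ω)) Q :=
    hQ.iIndepFun_comp fun i => (measurable_stdXi i).prodMk (measurable_sqDev i)
  have hindζ : iIndepFun ζ Q := hQ.iIndepFun_comp fun i => measurable_stdXi i
  have hindη : iIndepFun η Q := hQ.iIndepFun_comp fun i => measurable_sqDev i
  set T : Ω → ℝ := fun ω => ∑ i, ζ i ω with hT
  set H : Ω → ℝ := fun ω => ∑ i, η i ω with hH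
  have hTm : Measurable T := Finset.measurable_fun_sum _ fun i _ => hζ i
  have hHm : Measurable H := Finset.measurable_fun_sum _ fun i _ => hη i
  have bT : ∀ ω, |T ω| ≤ Fintype.card ι * 4 := fun ω => abs_sum_le_card_mul fun i => bζ i ω
  have bH : ∀ ω, |H ω| ≤ Fintype.card ι * 1 := fun ω => abs_sum_le_card_mul fun i => bη i ω
  have iT := integrable_of_abs_le (Q := Q) hTm bT
  have iH := integrable_of_abs_le (Q := Q) hHm bH
  have iζ := fun i => integrable_of_abs_le (Q := Q) (hζ i) (bζ i)
  have iη := fun i => integrable_of_abs_le (Q := Q) (hη i) (bη i)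
  have iζ2 := fun i => integrable_sq_of_abs_le (Q := Q) (hζ i) (bζ i)
  have iη2 := fun i => integrable_sq_of_abs_le (Q := Q) (hη i) (bη i)
  have iT2 := integrable_sq_of_abs_le (Q := Q) hTm bT
  have iH2 := integrable_sq_of_abs_le (Q := Q) hHm bH
  have eT2 : ∫ ω, T ω ^ 2 ∂Q = 1 := by
    rw [← vζ]
    exact integral_sum_sq hζ bζ hindζ eζ
  have eH2 : ∫ ω, H ω ^ 2 ∂Q ≤ 42 * R := by
    rw [show ∫ ω, H ω ^ 2 ∂Q = ∑ i, ∫ ω, η i ω ^ 2 ∂Q from integral_sum_sq hη bη hindη eη]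
    exact vη
  have eT1 : ∫ ω, |T ω| ∂Q ≤ 1 := integral_abs_le_one hTm bT eT2.le
  have bprod : ∀ {a b : Ω → ℝ} {A B : ℝ}, (∀ ω, |a ω| ≤ A) → (∀ ω, |b ω| ≤ B) →
      ∀ ω, |a ω * b ω| ≤ A * B := fun {a b A B} ha hb ω => by
    rw [abs_mul]
    exact mul_le_mul (ha ω) (hb ω) (abs_nonneg _) ((abs_nonneg _).trans (ha ω))
  -- joint moments of the standardized sum and the deviation of `V²`
  have eTH : ∫ ω, T ω ^ 2 * H ω ^ 2 ∂Q ≤ 798 * R := by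
    have h1 := integral_sum_sq_mul_sum_sq_le hζ hη hind bζ
      (fun i ω => (bη i ω).trans (by norm_num)) eζ eη
    have h2 : ∑ i, ∫ ω, ζ i ω ^ 2 * η i ω ^ 2 ∂Q ≤ ∑ i, 16 * ∫ ω, η i ω ^ 2 ∂Q := by
      refine Finset.sum_le_sum fun i _ => ?_
      rw [← integral_const_mul]
      refine integral_mono_of_nonneg (Filter.Eventually.of_forall fun ω => by positivity)
        ((iη2 i).const_mul 16) (Filter.Eventually.of_forall fun ω => ?_)
      have : ζ i ω ^ 2 ≤ 16 := by
        rw [← sq_abs]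
        have := pow_le_pow_left₀ (abs_nonneg _) (bζ i ω) 2
        linarith
      exact mul_le_mul_of_nonneg_right this (sq_nonneg _)
    rw [vζ, one_mul] at h1
    rw [← Finset.mul_sum] at h2
    linarith
  have iTH : Integrable (fun ω => |T ω| * H ω ^ 2) Q := by
    refine integrable_of_abs_le (by fun_prop)
      (bprod (a := fun ω => |T ω|) (A := Fintype.card ι * 4) (B := (Fintype.card ι * 1) ^ 2)
        (fun ω => by rw [abs_abs]; exact bT ω) fun ω => ?_)
    rw [abs_pow]
    exact pow_le_pow_left₀ (abs_nonneg _) (bH ω) 2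
  have eTH1 : ∫ ω, |T ω| * H ω ^ 2 ∂Q ≤ 420 * R := by
    have iTH2 : Integrable (fun ω => T ω ^ 2 * H ω ^ 2) Q := by
      refine integrable_of_abs_le (K := (Fintype.card ι * 4) ^ 2 * (Fintype.card ι * 1) ^ 2)
        (by fun_prop) (bprod (a := fun ω => T ω ^ 2) (b := fun ω => H ω ^ 2) (fun ω => ?_)
          fun ω => ?_)
      · rw [abs_pow]
        exact pow_le_pow_left₀ (abs_nonneg _) (bT ω) 2
      · rw [abs_pow]
        exact pow_le_pow_left₀ (abs_nonneg _) (bH ω) 2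
    have h1 : ∫ ω, |T ω| * H ω ^ 2 ∂Q ≤ ∫ ω, (T ω ^ 2 * H ω ^ 2 + H ω ^ 2) / 2 ∂Q := by
      refine integral_mono iTH ((iTH2.add iH2).div_const 2) fun ω => ?_
      beta_reduce
      rw [← sq_abs (T ω)]
      nlinarith [mul_nonneg (sq_nonneg (|T ω| - 1)) (sq_nonneg (H ω))]
    rw [integral_div, integral_add iTH2 iH2] at h1
    linarith
  have hζη : ∀ i, ∫ ω, |ζ i ω| * |η i ω| ∂Q
      ≤ (√R * ∫ ω, ζ i ω ^ 2 ∂Q + (∫ ω, η i ω ^ 2 ∂Q) / √R) / 2 := by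
    intro i
    have i1 := (iζ2 i).const_mul √R
    have i2 := (iη2 i).div_const √R
    rw [← integral_const_mul, ← integral_div, ← integral_add i1 i2, ← integral_div]
    refine integral_mono_of_nonneg (Filter.Eventually.of_forall fun ω => by positivity)
      ((i1.add i2).div_const 2) (Filter.Eventually.of_forall fun ω => abs_mul_le_half hsR _ _)
  have h42 : 42 * R / √R = 42 * √R := by
    rw [div_eq_iff hsR.ne', mul_assoc, h.sq_sqrt_R]
  have sζη : ∑ i, ∫ ω, |ζ i ω| * |η i ω| ∂Q ≤ 22 * √R := by
    refine (Finset.sum_le_sum fun i _ => hζη i).trans ?_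
    rw [← Finset.sum_div, Finset.sum_add_distrib, ← Finset.mul_sum, vζ, ← Finset.sum_div]
    have : (∑ i, ∫ ω, η i ω ^ 2 ∂Q) / √R ≤ 42 * R / √R := by gcongr
    linarith
  have absle : ∀ {f : Ω → ℝ} {K : ℝ}, Measurable f → (∀ ω, |f ω| ≤ K) → ∫ ω, f ω ^ 2 ∂Q ≤ 42 * R →
      ∫ ω, |f ω| ∂Q ≤ 22 * √R := fun {f K} hf hb h2 => by
    have i1 : Integrable (fun ω => √R * (1 : ℝ) ^ 2 + f ω ^ 2 / √R) Q :=
      (integrable_const _).add ((integrable_sq_of_abs_le (Q := Q) hf hb).div_const √R)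
    have h1 : ∫ ω, |f ω| ∂Q ≤ ∫ ω, (√R * (1 : ℝ) ^ 2 + f ω ^ 2 / √R) / 2 ∂Q := by
      refine integral_mono (integrable_of_abs_le (Q := Q) hf hb).abs (i1.div_const 2) fun ω => ?_
      have := abs_mul_le_half hsR 1 (f ω)
      rwa [abs_one, one_mul] at this
    rw [integral_div, integral_add (integrable_const _)
      ((integrable_sq_of_abs_le (Q := Q) hf hb).div_const √R), integral_div] at h1
    simp only [integral_const, probReal_univ, smul_eq_mul, one_mul, one_pow, mul_one] at h1
    have : (∫ ω, f ω ^ 2 ∂Q) / √R ≤ 42 * R / √R := by gcongr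
    linarith
  have hleave : ∀ i, ∫ ω, |ζ i ω| * |η i ω| * |H ω - η i ω| ∂Q
      ≤ (∫ ω, |ζ i ω| * |η i ω| ∂Q) * (44 * √R) := by
    intro i
    have hi := indepFun_sum_erase (fun j => (hζ j).prodMk (hη j)) hind i
    have e : (fun ω => H ω - η i ω)
        = (fun z : ℝ × ℝ => z.2) ∘ fun ω => ∑ j ∈ Finset.univ.erase i, (ζ j ω, η j ω) := by
      ext ω
      simp only [hH, Function.comp_apply, Prod.snd_sum]
      rw [← Finset.add_sum_erase _ _ (Finset.mem_univ i)]
      ring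
    have hi2 : IndepFun (fun ω => |ζ i ω| * |η i ω|) (fun ω => |H ω - η i ω|) Q := by
      have := hi.comp (φ := fun z : ℝ × ℝ => |z.1| * |z.2|) (ψ := fun z : ℝ × ℝ => |z.2|)
        (by fun_prop) (by fun_prop)
      have e2 : (fun ω => |H ω - η i ω|) = (fun z : ℝ × ℝ => |z.2|) ∘
          fun ω => ∑ j ∈ Finset.univ.erase i, (ζ j ω, η j ω) := by
        ext ω
        exact congrArg abs (congrFun e ω)
      rw [e2]
      exact this
    rw [hi2.integral_fun_mul_eq_mul_integral (by fun_prop) (by fun_prop)]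
    refine mul_le_mul_of_nonneg_left ?_ (integral_nonneg fun ω => by positivity)
    have a1 := absle hHm bH eH2
    have a2 := absle (hη i) (bη i) ((Finset.single_le_sum (f := fun i => ∫ ω, η i ω ^ 2 ∂Q)
      (fun j _ => integral_nonneg fun ω => sq_nonneg _) (Finset.mem_univ i)).trans vη)
    have a3 := integral_mono (iH.sub (iη i)).abs (iH.abs.add (iη i).abs)
      fun ω => abs_sub (H ω) (η i ω)
    simp only [Pi.add_apply] at a3
    rw [integral_add iH.abs (iη i).abs] at a3
    have a4 : ∫ ω, |H ω - η i ω| ∂Q = ∫ ω, |(H - η i) ω| ∂Q := rfl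
    rw [a4]
    linarith
  set k := x ^ 2 / (s * t ^ 4) with hk
  have hk0 : 0 ≤ k := by positivity
  set cost : ι → Ω → ℝ := fun i ω => |ζ i ω| *
    (|-defect x t s m κ (H ω) - -defect x t s m κ (H ω - η i ω)| + |(0 : ℝ) - 0|) with hcost
  have hcm : ∀ i, Measurable (cost i) := fun i => by
    have h1 := (measurable_defect x t s m κ).comp hHm
    have h2 := (measurable_defect x t s m κ).comp (hHm.sub (hη i))
    exact (hζ i).abs.mul ((h1.neg.sub h2.neg).abs.add measurable_const)
  have hcle : ∀ i ω, cost i ω ≤ k * (2 * (|ζ i ω| * |η i ω| * |H ω - η i ω|)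
      + 2 * |m| * (|ζ i ω| * |η i ω|) + 4 * η i ω ^ 2) := by
    intro i ω
    have h1 := abs_defect_sub_le (x := x) (t := t) (m := m) (κ := κ) hs0 (H ω) (η i ω)
    have h2 : cost i ω = |ζ i ω| * |defect x t s m κ (H ω) - defect x t s m κ (H ω - η i ω)| := by
      simp only [hcost, sub_self, abs_zero, add_zero]
      rw [neg_sub_neg, abs_sub_comm]
    rw [h2]
    refine (mul_le_mul_of_nonneg_left h1 (abs_nonneg _)).trans ?_
    have h3 := mul_le_mul_of_nonneg_right (bζ i ω) (mul_nonneg hk0 (sq_nonneg (η i ω)))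
    rw [← hk]
    nlinarith
  have i1 : ∀ i, Integrable (fun ω => |ζ i ω| * |η i ω|) Q := fun i =>
    integrable_of_abs_le (K := 4 * 1) (by fun_prop)
      (bprod (fun ω => by rw [abs_abs]; exact bζ i ω) fun ω => by rw [abs_abs]; exact bη i ω)
  have i2 : ∀ i, Integrable (fun ω => |ζ i ω| * |η i ω| * |H ω - η i ω|) Q := fun i =>
    integrable_of_abs_le (K := 4 * 1 * (Fintype.card ι * 1 + 1)) (by fun_prop)
      (bprod (bprod (fun ω => by rw [abs_abs]; exact bζ i ω) fun ω => by rw [abs_abs]; exact bη i ω)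
        fun ω => by
          rw [abs_abs]
          exact (abs_sub _ _).trans (add_le_add (bH ω) (bη i ω)))
  have i3 : ∀ i, Integrable (fun ω => 2 * (|ζ i ω| * |η i ω| * |H ω - η i ω|)
      + 2 * |m| * (|ζ i ω| * |η i ω|)) Q := fun i =>
    ((i2 i).const_mul 2).add ((i1 i).const_mul _)
  have i4 : ∀ i, Integrable (fun ω => k * (2 * (|ζ i ω| * |η i ω| * |H ω - η i ω|)
      + 2 * |m| * (|ζ i ω| * |η i ω|) + 4 * η i ω ^ 2)) Q := fun i =>
    ((i3 i).add ((iη2 i).const_mul 4)).const_mul k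
  have hc0 : ∀ i ω, 0 ≤ cost i ω := fun i ω => by positivity
  have icost : ∀ i, Integrable (cost i) Q := fun i =>
    (i4 i).mono' (hcm i).aestronglyMeasurable (Filter.Eventually.of_forall fun ω => by
      rw [Real.norm_eq_abs, abs_of_nonneg (hc0 i ω)]
      exact hcle i ω)
  have scost : ∑ i, ∫ ω, cost i ω ∂Q ≤ k * (2 * (22 * √R * (44 * √R)) + 2 * |m| * (22 * √R)
      + 4 * (42 * R)) := by
    have h1 : ∀ i, ∫ ω, cost i ω ∂Q ≤ k * (2 * ((∫ ω, |ζ i ω| * |η i ω| ∂Q) * (44 * √R))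
        + 2 * |m| * (∫ ω, |ζ i ω| * |η i ω| ∂Q) + 4 * ∫ ω, η i ω ^ 2 ∂Q) := by
      intro i
      refine (integral_mono (icost i) (i4 i) (hcle i)).trans ?_
      rw [integral_const_mul, integral_add (i3 i) ((iη2 i).const_mul 4),
        integral_add ((i2 i).const_mul 2) ((i1 i).const_mul _), integral_const_mul,
        integral_const_mul, integral_const_mul]
      refine mul_le_mul_of_nonneg_left ?_ hk0
      linarith [hleave i]
    refine (Finset.sum_le_sum fun i _ => h1 i).trans ?_
    rw [← Finset.mul_sum, Finset.sum_add_distrib, Finset.sum_add_distrib, ← Finset.mul_sum,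
      ← Finset.sum_mul, ← Finset.mul_sum, ← Finset.mul_sum]
    gcongr
  have hE : ∫ ω, |∑ i, ζ i ω| * (0 - -defect x t s m κ (∑ i, η i ω)) ∂Q
      ≤ k * (2 * (420 * R) + 2 * m ^ 2) := by
    have i5 : Integrable (fun ω => k * (2 * (|T ω| * H ω ^ 2) + 2 * m ^ 2 * |T ω|)) Q :=
      ((iTH.const_mul 2).add (iT.abs.const_mul (2 * m ^ 2))).const_mul k
    have h1 : ∫ ω, |∑ i, ζ i ω| * (0 - -defect x t s m κ (∑ i, η i ω)) ∂Q
        ≤ ∫ ω, k * (2 * (|T ω| * H ω ^ 2) + 2 * m ^ 2 * |T ω|) ∂Q := by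
      refine integral_mono_of_nonneg (Filter.Eventually.of_forall fun ω => ?_) i5
        (Filter.Eventually.of_forall fun ω => ?_)
      · refine mul_nonneg (abs_nonneg _) ?_
        have := defect_nonneg (x := x) (t := t) (m := m) hs0 hκ (∑ i, η i ω)
        linarith
      · have := mul_le_mul_of_nonneg_left
          (defect_le_sq (x := x) (t := t) (m := m) (κ := κ) hs0 (H ω)) (abs_nonneg (T ω))
        rw [← hk] at this
        change |T ω| * (0 - -defect x t s m κ (H ω)) ≤ _
        beta_reduce
        linarith
    refine h1.trans ?_
    rw [integral_const_mul, integral_add (iTH.const_mul 2) (iT.abs.const_mul _),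
      integral_const_mul, integral_const_mul]
    refine mul_le_mul_of_nonneg_left ?_ hk0
    have := mul_le_mul_of_nonneg_left eT1 (by positivity : 0 ≤ 2 * m ^ 2)
    linarith
  set e0 : ℝ := 2 * 10 ^ 6 * (ε / t) with he0
  have he0p : 0 < e0 := by positivity
  have hv : 1 / 2 ≤ ∑ i, ∫ ω, |ζ i ω| * min e0 |ζ i ω| ∂Q := by
    have i6 : ∀ i, Integrable (fun ω => |ζ i ω| ^ 3 / (4 * e0)) Q := fun i =>
      (integrable_abs_of_abs_le (Q := Q) (hζ i) (bζ i) 3).div_const _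
    have h1 : ∀ i, ∫ ω, ζ i ω ^ 2 ∂Q - (∫ ω, |ζ i ω| ^ 3 ∂Q) / (4 * e0)
        ≤ ∫ ω, |ζ i ω| * min e0 |ζ i ω| ∂Q := by
      intro i
      rw [← integral_div, ← integral_sub (iζ2 i) (i6 i)]
      refine integral_mono ((iζ2 i).sub (i6 i)) ?_ fun ω => sq_sub_cube_le_abs_mul_min he0p _
      refine integrable_of_abs_le (K := 4 * 4) (by fun_prop)
        (bprod (fun ω => by rw [abs_abs]; exact bζ i ω) fun ω => ?_)
      rw [abs_of_nonneg (le_min he0p.le (abs_nonneg _))]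
      exact (min_le_right _ _).trans (bζ i ω)
    have h2 := Finset.sum_le_sum fun i (_ : i ∈ Finset.univ) => h1 i
    rw [Finset.sum_sub_distrib, vζ, ← Finset.sum_div] at h2
    have h3 := hQ.sum_integral_stdXi_cube_le h hl.zero_le hl.le_one
    have h4 : (∑ i, ∫ ω, |ζ i ω| ^ 3 ∂Q) / (4 * e0) ≤ 1 / 2 := by
      rw [div_le_iff₀ (by positivity)]
      refine h3.trans (le_of_eq ?_)
      rw [he0]
      ring
    linarith
  have main := randomized_concentration hζ hη hind bζ eζ vζ.le he0p hv
    (a := fun h => -defect x t s m κ h) (b := fun _ => 0) (measurable_defect x t s m κ).neg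
    measurable_const (fun h => by
      have := defect_nonneg (x := x) (t := t) (m := m) hs0 hκ h
      linarith) (K' := κ / s) (fun h => by
      have := defect_le_cap (x := x) (t := t) (m := m) (κ := κ) hs0 h
      linarith) icost
  have hfin := concentration_arith h hs (m := m) hm'
  change Q.real {ω | -defect x t s m κ (∑ i, η i ω) ≤ ∑ i, ζ i ω ∧ ∑ i, ζ i ω ≤ 0} ≤ _
  have b1 : ∀ p A B C D E : ℝ, 1 / 2 * p ≤ 2 * A + B / 2 + 2 * C → B ≤ D → C ≤ E →
      1 / 2 * p ≤ 2 * A + (D / 2 + 2 * E) := fun p A B C D E _ _ _ => by linarith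
  have main2 := b1 _ _ _ _ _ _ main hE scost
  have b2 : ∀ p w r y : ℝ, 0 ≤ r → 1 / 2 * p ≤ 2 * (2 * 10 ^ 6 * r) + w →
      w ≤ 19 * 10 ^ 8 * y → 0 ≤ y → p ≤ 10 ^ 7 * r + 4 * 10 ^ 9 * y :=
    fun p w r y _ _ _ _ => by linarith
  exact b2 _ _ _ _ (by positivity) main2 hfin (by positivity)

end Concentration

/-! ### The upper bound on the event of good pairs -/

section UpperGood

variable {Ω : Type*} [MeasurableSpace Ω] {μ Q : Measure Ω} {ι : Type*} [Fintype ι]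
  {x t ρ c R ε l : ℝ} {Z : ι → Ω → ℝ × ℝ}

/-- When `x² u²` is large, `u` is dominated by its centred part `h / t²`. -/
lemma abs_le_of_cap_lt (h : Sample μ x t ρ c R ε Z) {C m H u : ℝ}
    (hm : |m| ≤ C * (x * √R)) (hu : t ^ 2 * u = H + m) (hcap : 1 + 4 * C ^ 2 * R < x ^ 2 * u ^ 2) :
    t / 2 ≤ |H| ∧ x ^ 2 * |u| ≤ 2 * |H| := by
  have hx := h.x_pos
  have ht := h.t_pos
  have hxt := h.x_le_t
  have hsR := h.sqrt_R_pos
  have h1 : x ^ 2 * u ^ 2 = (x * |u|) ^ 2 := by rw [mul_pow, sq_abs]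
  have h2 : 1 ≤ x * |u| := by
    have : (1 : ℝ) ^ 2 ≤ (x * |u|) ^ 2 := by
      rw [← h1]
      have : 0 ≤ 4 * C ^ 2 * R := by have := h.R_pos; positivity
      linarith
    exact le_of_sq_le_sq this (by positivity)
  have h3 : 2 * C * √R ≤ x * |u| := by
    have : (2 * C * √R) ^ 2 ≤ (x * |u|) ^ 2 := by
      rw [← h1, mul_pow, mul_pow, sq √R, h.sq_sqrt_R]
      linarith
    exact le_of_sq_le_sq this (by positivity)
  have h4 : t ^ 2 * |u| ≤ |H| + |m| := by
    have := abs_add_le H m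
    rw [← hu, abs_mul, abs_of_nonneg (by positivity : 0 ≤ t ^ 2)] at this
    exact this
  have h5 : |m| ≤ t ^ 2 * |u| / 2 := by
    have a : x * (2 * C * √R) ≤ x * (x * |u|) := mul_le_mul_of_nonneg_left h3 hx.le
    have b : x * x * |u| ≤ t ^ 2 * |u| :=
      mul_le_mul_of_nonneg_right (by nlinarith) (abs_nonneg _)
    linarith
  have h6 : t ^ 2 * |u| ≤ 2 * |H| := by linarith
  constructor
  · have a : t ≤ t ^ 2 * |u| := by
      have : x * |u| ≤ t * |u| := mul_le_mul_of_nonneg_right hxt (abs_nonneg _)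
      nlinarith
    linarith
  · have : x ^ 2 * |u| ≤ t ^ 2 * |u| :=
      mul_le_mul_of_nonneg_right (pow_le_pow_left₀ hx.le hxt 2) (abs_nonneg _)
    linarith

lemma exp_neg_half_le {t : ℝ} (ht : 0 < t) : Real.exp (-(t / 2)) ≤ 2 / t := by
  rw [Real.exp_neg, inv_le_comm₀ (Real.exp_pos _) (by positivity), inv_div]
  linarith [Real.add_one_le_exp (t / 2)]

variable [IsProbabilityMeasure μ] [IsProbabilityMeasure Q]

/-- The three terms come from the main integral, from the standardized sum falling in the
random interval given by the truncated defect, and from the event of a larger defect. -/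
lemma IsTilt.upper_bound_allGood (hQ : IsTilt μ Q ρ l Z) (h : Sample μ x t ρ c R ε Z)
    (hl : IsSaddle μ x t ρ c R ε l Z) :
    μ.real (tailEvent x t c Z ∩ allGood Z)
      ≤ Real.exp (∑ i, Real.log (tiltMass μ ρ l (Z i)) - l * (x ^ 2 + 2 * c * x))
        * (mills (x + c) * (1 + 10 ^ 11 * ε)
          + Real.exp (1 + 10 ^ 10 * R) * (10 ^ 7 * (ε / t) + 4 * 10 ^ 9 * (R / t))
          + 36 / t * (Real.exp (10 ^ 4 * R) - 1)) := by
  obtain ⟨-, hs, -, -⟩ := h.tiltSd_bounds hl.zero_le hl.le_one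
  have hm' := h.abs_sum_tiltMean_snd_sq_sub_le hl.zero_le hl.le_one
  have hx := h.x_pos
  have ht := h.t_pos
  have hR := h.R_pos
  have hs0 : 0 < tiltSd μ ρ l Z := lt_of_lt_of_le (by linarith) hs
  have hl0 : 0 < l := by linarith [hl.le]
  have hE := (measurableSet_tailEvent (x := x) (t := t) (c := c) fun i => (h.law i).meas).inter
    (measurableSet_allGood fun i => (h.law i).meas)
  set b := x ^ 2 + 2 * c * x with hb
  set E := tailEvent x t c Z ∩ allGood Z with hEdef
  set κ : ℝ := 1 + 10 ^ 10 * R with hκ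
  have hκ0 : 0 ≤ κ := by positivity
  set m := ∑ i, tiltMean μ ρ l (Z i) (fun z => z.2 ^ 2) - t ^ 2 with hmdef
  set T : Ω → ℝ := fun ω => ∑ i, stdXi μ ρ l Z i (Z i ω) with hT
  set H : Ω → ℝ := fun ω => ∑ i, sqDev μ ρ l Z i (Z i ω) with hH
  have hTm : Measurable T :=
    Finset.measurable_fun_sum _ fun i _ => (measurable_stdXi i).comp (h.law i).meas
  have hHm : Measurable H :=
    Finset.measurable_fun_sum _ fun i _ => (measurable_sqDev i).comp (h.law i).meas
  have hWm : Measurable fun ω => ∑ i, xiGood ρ (Z i ω) :=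
    Finset.measurable_fun_sum _ fun i _ => (measurable_xiGood ρ).comp (h.law i).meas
  have bH : ∀ ω, |H ω| ≤ Fintype.card ι * 1 := fun ω =>
    abs_sum_le_card_mul fun i => hQ.abs_sqDev_le h i _
  set D : Set Ω := {ω | -defect x t (tiltSd μ ρ l Z) m κ (H ω) ≤ T ω ∧ T ω ≤ 0} with hD
  have hDm : MeasurableSet D :=
    (measurableSet_le ((measurable_defect _ _ _ _ _).comp hHm).neg hTm).inter
      (measurableSet_le hTm measurable_const)
  have hconc : Q.real D ≤ 10 ^ 7 * (ε / t) + 4 * 10 ^ 9 * (R / t) := hQ.concentration h hl hκ0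
  set B : Set Ω := {ω | t / 2 ≤ |H ω|} with hB
  have hBm : MeasurableSet B := measurableSet_le measurable_const hHm.abs
  have htail : ∫ ω, B.indicator (fun ω => Real.exp (2 * |H ω|)) ω ∂Q
      ≤ 36 / t * (Real.exp (10 ^ 4 * R) - 1) := by
    refine (integral_exp_abs_tail_le (fun i => (measurable_sqDev i).comp (h.law i).meas)
      (hQ.iIndepFun_comp fun i => measurable_sqDev i) (fun i ω => hQ.abs_sqDev_le h i _)
      (fun i => hQ.integral_sqDev h i) (hQ.sum_integral_sqDev_sq_le h hl.zero_le hl.le_one)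
      (a := 2) (by norm_num) (by linarith [h.one_le_t])).trans ?_
    have h3 : Real.exp (2 + 1) ≤ 21 := by
      calc Real.exp (2 + 1) = Real.exp 1 ^ 3 := by rw [← Real.exp_nat_mul]; norm_num
        _ ≤ 2.7182818286 ^ 3 := pow_le_pow_left₀ (Real.exp_pos _).le Real.exp_one_lt_d9.le 3
        _ ≤ 21 := by norm_num
    have h4 : Real.exp ((2 + 1) ^ 2 * Real.exp (2 + 1) * (42 * R)) ≤ Real.exp (10 ^ 4 * R) := by
      refine Real.exp_le_exp.2 ?_
      nlinarith
    have h5 : 1 ≤ Real.exp ((2 + 1) ^ 2 * Real.exp (2 + 1) * (42 * R)) :=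
      Real.one_le_exp (by positivity)
    have h6 := exp_neg_half_le ht
    calc _ ≤ 18 * (2 / t) * (Real.exp (10 ^ 4 * R) - 1) := by
          refine mul_le_mul (mul_le_mul_of_nonneg_left h6 (by norm_num)) (by linarith)
            (by linarith) (by positivity)
      _ = _ := by ring
  set F : Ω → ℝ := fun ω => E.indicator (fun ω => Real.exp (-(l * ∑ i, xiGood ρ (Z i ω)))) ω
    with hF
  have hreal : μ.real E = ∫ ω, F ω * ∏ i, wt ρ l (Z i ω) ∂μ := by
    rw [← integral_indicator_one hE]
    refine integral_congr_ae (Filter.Eventually.of_forall fun ω => ?_)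
    simp only [hF]
    by_cases hω : ω ∈ E
    · rw [Set.indicator_of_mem hω, Set.indicator_of_mem hω, prod_wt_of_mem hω.2, ← Real.exp_add]
      simp
    · rw [Set.indicator_of_notMem hω, Set.indicator_of_notMem hω, zero_mul]
  have i1 : Integrable (fun ω => expTail (l * tiltSd μ ρ l Z) (T ω)) Q :=
    integrable_of_abs_le ((measurable_expTail _).comp hTm) fun ω =>
      abs_expTail_le_one (by positivity) _
  have i2 : Integrable (fun ω => D.indicator (fun _ => Real.exp κ) ω) Q :=
    (integrable_const _).indicator hDm
  have i3 : Integrable (fun ω => B.indicator (fun ω => Real.exp (2 * |H ω|)) ω) Q := by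
    refine Integrable.indicator ?_ hBm
    refine integrable_of_abs_le (K := Real.exp (2 * (Fintype.card ι * 1))) (by fun_prop) fun ω => ?_
    rw [abs_of_pos (Real.exp_pos _)]
    exact Real.exp_le_exp.2 (by linarith [bH ω])
  have hpt : ∀ ω, F ω ≤ Real.exp (-(l * b)) * (expTail (l * tiltSd μ ρ l Z) (T ω)
      + D.indicator (fun _ => Real.exp κ) ω + B.indicator (fun ω => Real.exp (2 * |H ω|)) ω) := by
    intro ω
    have n1 := expTail_nonneg (l * tiltSd μ ρ l Z) (T ω)
    have n2 : 0 ≤ D.indicator (fun _ => Real.exp κ) ω :=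
      Set.indicator_nonneg (fun _ _ => (Real.exp_pos _).le) _
    have n3 : 0 ≤ B.indicator (fun ω => Real.exp (2 * |H ω|)) ω :=
      Set.indicator_nonneg (fun _ _ => (Real.exp_pos _).le) _
    by_cases hω : ω ∈ E
    swap
    · simp only [hF]
      rw [Set.indicator_of_notMem hω]
      positivity
    simp only [hF]
    rw [Set.indicator_of_mem hω]
    have hW : tiltSd μ ρ l Z * T ω = ∑ i, xiGood ρ (Z i ω) - b := sum_stdXi hl hs0.ne' ω
    have e : Real.exp (-(l * ∑ i, xiGood ρ (Z i ω)))
        = Real.exp (-(l * b)) * Real.exp (-(l * (tiltSd μ ρ l Z * T ω))) := by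
      rw [← Real.exp_add, hW]
      ring_nf
    rw [e]
    refine mul_le_mul_of_nonneg_left ?_ (Real.exp_pos _).le
    rcases le_or_gt 0 (T ω) with hpos | hneg
    · rw [expTail_of_nonneg hpos, show -(l * (tiltSd μ ρ l Z * T ω))
        = -(l * tiltSd μ ρ l Z) * T ω by ring]
      linarith
    -- the square of the norm of the second components is `t² (1 + u)`
    have hEi := (mem_tailEvent_iff h.rho_pos h.rho_mul hω.2).1 hω.1
    set q := √(∑ i, (Z i ω).2 ^ 2) with hq
    have hq2 : q ^ 2 = t ^ 2 + (H ω + m) := by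
      rw [hq, Real.sq_sqrt (Finset.sum_nonneg fun i _ => sq_nonneg _)]
      simp only [hH, hmdef, sqDev, Finset.sum_sub_distrib]
      have : ∑ i, sqGood (Z i ω) = ∑ i, (Z i ω).2 ^ 2 :=
        Finset.sum_congr rfl fun i _ => sqGood_of_mem (hω.2 i)
      rw [this]
      ring
    set u := (H ω + m) / t ^ 2 with hu
    have hut : t ^ 2 * u = H ω + m := by
      rw [hu]
      field_simp
    obtain ⟨d1, d2⟩ := defect_le (ρ := ρ) (x := x) (u := u) ht h.rho_mul (Real.sqrt_nonneg _)
      (show q ^ 2 = _ by rw [hq2, ← hut]; ring)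
    have hneg2 : -(x - ρ * q) ^ 2 ≤ tiltSd μ ρ l Z * T ω := by linarith
    rcases le_or_gt (x ^ 2 * u ^ 2) κ with hc | hc
    · have hmem : ω ∈ D := by
        refine ⟨?_, hneg.le⟩
        unfold defect
        rw [← hu, min_eq_left hc, neg_le, ← neg_le, ← neg_div, div_le_iff₀ hs0]
        linarith
      rw [Set.indicator_of_mem hmem]
      have : Real.exp (-(l * (tiltSd μ ρ l Z * T ω))) ≤ Real.exp κ := by
        refine Real.exp_le_exp.2 ?_
        have h1 : l * -(tiltSd μ ρ l Z * T ω) ≤ 1 * κ :=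
          mul_le_mul hl.le_one (by linarith) (by nlinarith) zero_le_one
        linarith
      linarith
    · have hC : 1 + 4 * (4 * 10 ^ 4) ^ 2 * R < x ^ 2 * u ^ 2 := by
        refine lt_of_le_of_lt ?_ hc
        rw [hκ]
        nlinarith
      obtain ⟨t1, t2⟩ := abs_le_of_cap_lt h hm' hut hC
      have hmem : ω ∈ B := t1
      rw [Set.indicator_of_mem hmem]
      have : Real.exp (-(l * (tiltSd μ ρ l Z * T ω))) ≤ Real.exp (2 * |H ω|) := by
        refine Real.exp_le_exp.2 ?_
        have h1 : l * -(tiltSd μ ρ l Z * T ω) ≤ 1 * (2 * |H ω|) :=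
          mul_le_mul hl.le_one (by linarith) (by nlinarith) zero_le_one
        linarith
      linarith
  have i12 : Integrable (fun ω => expTail (l * tiltSd μ ρ l Z) (T ω)
      + D.indicator (fun _ => Real.exp κ) ω) Q := i1.add i2
  have hFint : ∫ ω, F ω ∂Q ≤ Real.exp (-(l * b)) * (mills (x + c) * (1 + 10 ^ 11 * ε)
      + Real.exp κ * (10 ^ 7 * (ε / t) + 4 * 10 ^ 9 * (R / t))
      + 36 / t * (Real.exp (10 ^ 4 * R) - 1)) := by
    have h1 := integral_mono_of_nonneg (Filter.Eventually.of_forall fun ω =>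
      Set.indicator_nonneg (fun _ _ => (Real.exp_pos _).le) ω)
      ((i12.add i3).const_mul (Real.exp (-(l * b)))) (Filter.Eventually.of_forall hpt)
    refine h1.trans ?_
    rw [integral_const_mul]
    refine mul_le_mul_of_nonneg_left ?_ (Real.exp_pos _).le
    simp only [Pi.add_apply]
    rw [integral_add i12 i3, integral_add i1 i2, integral_indicator_const _ hDm, smul_eq_mul,
      mul_comm (Q.real D)]
    have h2 := (abs_le.1 (hQ.abs_integral_expTail_sub_le h hl)).2
    have h3 := mul_le_mul_of_nonneg_left hconc (Real.exp_pos κ).le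
    linarith
  rw [hreal, hQ.change, sub_eq_add_neg, Real.exp_add, mul_assoc]
  exact mul_le_mul_of_nonneg_left hFint (Real.exp_pos _).le

end UpperGood

/-! ### Large pairs: the deterministic inequality and the weights -/

section BadPointwise

/-- A quadratic form inequality behind the treatment of large pairs; `n` is the normalized total
exponent of the large pairs, `r` the value of `V` and `1 + u` the contribution of the good pairs
to `V²`. -/
lemma quadratic_nonneg {r u n : ℝ} (hr : 1 ≤ r) (hn0 : 0 ≤ n) (hn : n ≤ 78 / 100) :
    0 ≤ (r - 1) * (r - 1 - u) + r * n * (8 / 5 - r) + 2 * r * u ^ 2 ∧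
    0 ≤ (r - 1) * (r - 1 - u) + r * n * (8 / 5 - r) + 2 * r * |u| := by
  have base : 0 ≤ 7 / 8 * (r - 1) ^ 2 + r * n * (8 / 5 - r) := by
    rcases le_or_gt r (8 / 5) with h | h
    · have : 0 ≤ r * n * (8 / 5 - r) := mul_nonneg (by positivity) (by linarith)
      nlinarith [sq_nonneg (r - 1)]
    · have : r * (78 / 100) * (8 / 5 - r) ≤ r * n * (8 / 5 - r) := by
        have h2 : n * (r * (r - 8 / 5)) ≤ 78 / 100 * (r * (r - 8 / 5)) :=
          mul_le_mul_of_nonneg_right hn (mul_nonneg (by linarith) (by linarith))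
        nlinarith
      nlinarith [sq_nonneg (r - 53 / 20)]
  constructor
  · have h1 : 0 ≤ 2 * r * u ^ 2 - (r - 1) * u + (r - 1) ^ 2 / 8 := by
      have : 2 * u ^ 2 ≤ 2 * r * u ^ 2 := by nlinarith [sq_nonneg u]
      nlinarith [sq_nonneg (4 * u - (r - 1))]
    nlinarith
  · have h1 : (r - 1) * u ≤ (r - 1) * |u| := mul_le_mul_of_nonneg_left (le_abs_self u) (by linarith)
    have h2 : (r - 1) * |u| ≤ 2 * r * |u| := by nlinarith [abs_nonneg u]
    nlinarith [sq_nonneg (r - 1)]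

/-- The deterministic inequality on the event `S ≥ x V + c`: the good pairs have an exponent close
to the required one, up to the exponents `N` of the large pairs and their number `J`. -/
lemma exponent_le_of_tail {x c l Sg Sb u v N J : ℝ} (hx : 0 < x) (hl0 : 39 / 100 ≤ l)
    (hl1 : l ≤ 61 / 100) (hu : -1 ≤ u) (hv : 0 ≤ v) (hN0 : 0 ≤ N) (hN : N ≤ 78 / 100 * x ^ 2)
    (hJ : 0 ≤ J) (hE : x * √(1 + u + v) + c ≤ Sg + Sb)
    (hsplit : ∀ a, 0 < a → a ≤ x → Sb ≤ N / (2 * a) + a * v / 2 + J / (8 * x)) :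
    l * (x ^ 2 + 2 * c * x) - 2 * (x ^ 2 * u ^ 2) ≤
      l * (2 * x * Sg - x ^ 2 * (1 + u)) + (98 / 100 * N + J) ∧
    l * (x ^ 2 + 2 * c * x) - 2 * (x ^ 2 * |u|) ≤
      l * (2 * x * Sg - x ^ 2 * (1 + u)) + (98 / 100 * N + J) := by
  set r := √(1 + u + v) with hr
  have hr2 : r ^ 2 = 1 + u + v := Real.sq_sqrt (by linarith)
  have hr0 : 0 ≤ r := Real.sqrt_nonneg _
  obtain ⟨n, rfl⟩ : ∃ n, N = n * x ^ 2 := ⟨N / x ^ 2, by field_simp⟩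
  have hx2 : 0 < x ^ 2 := by positivity
  have hn0 : 0 ≤ n := nonneg_of_mul_nonneg_left hN0 hx2
  have hn : n ≤ 78 / 100 := le_of_mul_le_mul_right hN hx2
  -- it suffices to treat the terms without `l`
  have red : ∀ g, 0 ≤ g → x ^ 2 * (1 - 2 * g) + 2 * c * x ≤
      2 * x * Sg - x ^ 2 * (1 + u) + 8 / 5 * (n * x ^ 2) + J / 4 →
      l * (x ^ 2 + 2 * c * x) - 2 * (x ^ 2 * g) ≤
      l * (2 * x * Sg - x ^ 2 * (1 + u)) + (98 / 100 * (n * x ^ 2) + J) := by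
    intro g hg hle
    have h1 := mul_le_mul_of_nonneg_left hle (by linarith : 0 ≤ l)
    have h2 : l * (8 / 5 * (n * x ^ 2)) ≤ 98 / 100 * (n * x ^ 2) := by nlinarith
    have h3 : l * (J / 4) ≤ J := by nlinarith
    have h4 : l * (2 * (x ^ 2 * g)) ≤ 2 * (x ^ 2 * g) :=
      mul_le_of_le_one_left (by positivity) (by linarith)
    linarith
  rcases le_or_gt 1 r with h1 | h1
  · have hr0' : 0 < r := by linarith
    have hs := hsplit (x / r) (by positivity) (div_le_self hx.le h1)
    have e1 : n * x ^ 2 / (2 * (x / r)) = n * x * r / 2 := by field_simp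
    have e2 : J / (8 * x) * (2 * x) = J / 4 := by field_simp; ring
    rw [e1] at hs
    have hs2 : 2 * x * Sb ≤ n * x ^ 2 * r + x ^ 2 * (v / r) + J / 4 := by
      have := mul_le_mul_of_nonneg_left hs (by linarith : 0 ≤ 2 * x)
      have e3 : 2 * x * (n * x * r / 2 + x / r * v / 2 + J / (8 * x))
          = n * x ^ 2 * r + x ^ 2 * (v / r) + J / (8 * x) * (2 * x) := by
        field_simp
      rw [e3, e2] at this
      exact this
    have hE2 := mul_le_mul_of_nonneg_left hE (by linarith : 0 ≤ 2 * x)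
    have key : ∀ g, 0 ≤ (r - 1) * (r - 1 - u) + r * n * (8 / 5 - r) + 2 * r * g →
        x ^ 2 * (1 - 2 * g) + 2 * c * x ≤
      2 * x * Sg - x ^ 2 * (1 + u) + 8 / 5 * (n * x ^ 2) + J / 4 := by
      intro g hg
      have e4 : ((r - 1) * (r - 1 - u) + r * n * (8 / 5 - r) + 2 * r * g) / r
          = 2 * r - n * r - v / r - (1 + u) - 1 + 8 / 5 * n + 2 * g := by
        have : v = r ^ 2 - 1 - u := by linarith
        rw [this]
        field_simp
        ring
      have h5 : 0 ≤ x ^ 2 * (2 * r - n * r - v / r - (1 + u) - 1 + 8 / 5 * n + 2 * g) := by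
        rw [← e4]
        positivity
      nlinarith
    obtain ⟨q1, q2⟩ := quadratic_nonneg (u := u) h1 hn0 hn
    exact ⟨red _ (sq_nonneg _) (key _ q1), red _ (abs_nonneg _) (key _ q2)⟩
  · have hs := hsplit x hx le_rfl
    have e1 : n * x ^ 2 / (2 * x) = n * x / 2 := by field_simp
    have e2 : J / (8 * x) * (2 * x) = J / 4 := by field_simp; ring
    rw [e1] at hs
    have hs2 : 2 * x * Sb ≤ n * x ^ 2 + x ^ 2 * v + J / 4 := by
      have := mul_le_mul_of_nonneg_left hs (by linarith : 0 ≤ 2 * x)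
      nlinarith
    have hE2 := mul_le_mul_of_nonneg_left hE (by linarith : 0 ≤ 2 * x)
    have key : ∀ g, (1 - r) ^ 2 ≤ g → x ^ 2 * (1 - 2 * g) + 2 * c * x ≤
      2 * x * Sg - x ^ 2 * (1 + u) + 8 / 5 * (n * x ^ 2) + J / 4 := by
      intro g hg
      have h0 : 0 ≤ g := (sq_nonneg _).trans hg
      have h5 : 0 ≤ x ^ 2 * (2 * g - (1 - r) ^ 2 + 3 / 5 * n) :=
        mul_nonneg hx2.le (by linarith)
      have hv2 : v = r ^ 2 - 1 - u := by linarith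
      rw [hv2] at hs2
      nlinarith
    have hru : 1 - r ≤ |u| := by
      have : 1 - r ≤ 1 - r ^ 2 := by nlinarith
      linarith [neg_le_abs u]
    refine ⟨red _ (sq_nonneg _) (key _ ?_), red _ (abs_nonneg _) (key _ ?_)⟩
    · rw [← sq_abs u]
      exact pow_le_pow_left₀ (by linarith) hru 2
    · nlinarith

end BadPointwise

section BadWeight

variable {Ω : Type*} [MeasurableSpace Ω] {μ : Measure Ω} {ι : Type*} [Fintype ι]
  {x t ρ c R ε l : ℝ} {Z : ι → Ω → ℝ × ℝ} {nu : ι → ℝ × ℝ → ℝ}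

/-- The properties of the exponents `ν i` used for large pairs, in terms of the scaled pair. -/
structure LargeExponent (μ : Measure Ω) (x t ρ R : ℝ) (Z : ι → Ω → ℝ × ℝ) (nu : ι → ℝ × ℝ → ℝ) :
    Prop where
  meas : ∀ i, Measurable (nu i)
  le_linear : ∀ i z, nu i z ≤ 2 * ρ * z.1
  split : ∀ i z a, 0 < a → a ≤ x →
    z.1 / t ≤ max (nu i z) 0 / (2 * a) + a * (z.2 / t) ^ 2 / 2 + 1 / (8 * x)
  int : ∀ i, Integrable (fun ω => {z : ℝ × ℝ | 1 < |z.1|}.indicator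
    (fun z => Real.exp (nu i z)) (Z i ω)) μ
  sum_le : ∑ i, ∫ ω, dd (Z i ω) ∂μ + ∑ i, ∫ ω, {z : ℝ × ℝ | 1 < |z.1|}.indicator
    (fun z => Real.exp (nu i z)) (Z i ω) ∂μ ≤ R

/-- The exponent `(49 / 50) ν⁺ + 1` of the weight of a large pair. -/
noncomputable def badExp (nu : ι → ℝ × ℝ → ℝ) (i : ι) (z : ℝ × ℝ) : ℝ :=
  98 / 100 * max (nu i z) 0 + 1

/-- The weight `exp ((49 / 50) ν⁺ + 1)` on the complement of the good set. -/
noncomputable def badWt (nu : ι → ℝ × ℝ → ℝ) (i : ι) (z : ℝ × ℝ) : ℝ :=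
  goodᶜ.indicator (fun z => Real.exp (badExp nu i z)) z

/-- The mass of the weight of a large pair. -/
noncomputable def badMass (μ : Measure Ω) (Z : ι → Ω → ℝ × ℝ) (nu : ι → ℝ × ℝ → ℝ) (i : ι) : ℝ :=
  ∫ ω, badWt nu i (Z i ω) ∂μ

lemma badWt_of_mem {ι : Type*} {nu : ι → ℝ × ℝ → ℝ} {i : ι} {z : ℝ × ℝ} (hz : z ∈ good) :
    badWt nu i z = 0 :=
  Set.indicator_of_notMem (Set.notMem_compl_iff.2 hz) _

lemma badWt_of_notMem {ι : Type*} {nu : ι → ℝ × ℝ → ℝ} {i : ι} {z : ℝ × ℝ} (hz : z ∉ good) :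
    badWt nu i z = Real.exp (badExp nu i z) := Set.indicator_of_mem (show z ∈ goodᶜ from hz) _

lemma badWt_nonneg {ι : Type*} (nu : ι → ℝ × ℝ → ℝ) (i : ι) (z : ℝ × ℝ) : 0 ≤ badWt nu i z :=
  Set.indicator_nonneg (fun _ _ => (Real.exp_pos _).le) _

lemma badMass_nonneg {ι : Type*} (Z : ι → Ω → ℝ × ℝ) (nu : ι → ℝ × ℝ → ℝ) (i : ι) :
    0 ≤ badMass μ Z nu i := integral_nonneg fun _ => badWt_nonneg _ _ _

namespace LargeExponent

lemma measurable_badExp (hN : LargeExponent μ x t ρ R Z nu) (i : ι) :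
    Measurable (badExp nu i) := by
  have := hN.meas i
  unfold badExp
  fun_prop

lemma measurable_badWt (hN : LargeExponent μ x t ρ R Z nu) (i : ι) : Measurable (badWt nu i) :=
  ((hN.measurable_badExp i).exp).indicator measurableSet_good.compl

lemma badWt_le (hN : LargeExponent μ x t ρ R Z nu) (hρ0 : 0 ≤ ρ) (hρ : ρ ≤ 1) (i : ι)
    (z : ℝ × ℝ) :
    badWt nu i z ≤ 21 * dd z
      + 3 * {z : ℝ × ℝ | 1 < |z.1|}.indicator (fun z => Real.exp (nu i z)) z := by
  have hind : 0 ≤ {z : ℝ × ℝ | 1 < |z.1|}.indicator (fun z => Real.exp (nu i z)) z :=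
    Set.indicator_nonneg (fun _ _ => (Real.exp_pos _).le) _
  have h3 : Real.exp 3 ≤ 21 := by
    calc Real.exp 3 = Real.exp 1 ^ 3 := by rw [← Real.exp_nat_mul]; norm_num
      _ ≤ 2.7182818286 ^ 3 := pow_le_pow_left₀ (Real.exp_pos _).le Real.exp_one_lt_d9.le 3
      _ ≤ 21 := by norm_num
  have hd := dd_nonneg z
  by_cases hz : z ∈ good
  · rw [badWt_of_mem hz]
    positivity
  have hd1 := (bounds_of_notMem_good hz).1
  rw [badWt_of_notMem hz]
  unfold badExp
  by_cases h1 : 1 < |z.1|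
  · rw [Set.indicator_of_mem (by exact h1)]
    have he : Real.exp 1 ≤ 3 := by linarith [Real.exp_one_lt_d9]
    rcases le_total (nu i z) 0 with h0 | h0
    · rw [max_eq_right h0, mul_zero, zero_add]
      have := Real.exp_pos (nu i z)
      linarith
    · rw [max_eq_left h0, Real.exp_add]
      have h4 : Real.exp (98 / 100 * nu i z) ≤ Real.exp (nu i z) :=
        Real.exp_le_exp.2 (by linarith)
      have := mul_le_mul h4 he (Real.exp_pos _).le (Real.exp_pos _).le
      linarith
  · have hn : max (nu i z) 0 ≤ 2 := by
      refine max_le ((hN.le_linear i z).trans ?_) (by norm_num)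
      have : z.1 ≤ 1 := (le_abs_self _).trans (not_lt.1 h1)
      nlinarith
    have h4 : Real.exp (98 / 100 * max (nu i z) 0 + 1) ≤ Real.exp 3 :=
      Real.exp_le_exp.2 (by linarith)
    linarith

variable [IsProbabilityMeasure μ]

lemma int_badWt (hN : LargeExponent μ x t ρ R Z nu) (h : Sample μ x t ρ c R ε Z) (i : ι) :
    Integrable (fun ω => badWt nu i (Z i ω)) μ ∧
      badMass μ Z nu i ≤ 21 * ∫ ω, dd (Z i ω) ∂μ + 3 * ∫ ω, {z : ℝ × ℝ | 1 < |z.1|}.indicator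
        (fun z => Real.exp (nu i z)) (Z i ω) ∂μ := by
  have i1 := ((h.law i).int_dd.const_mul 21)
  have i2 := ((hN.int i).const_mul 3)
  have hi : Integrable (fun ω => badWt nu i (Z i ω)) μ :=
    (i1.add i2).mono' ((hN.measurable_badWt i).comp (h.law i).meas).aestronglyMeasurable
      (Filter.Eventually.of_forall fun ω => by
        rw [Real.norm_eq_abs, abs_of_nonneg (badWt_nonneg _ _ _)]
        exact hN.badWt_le h.rho_pos.le h.rho_le i _)
  refine ⟨hi, ?_⟩
  have := integral_mono hi (i1.add i2) fun ω => hN.badWt_le h.rho_pos.le h.rho_le i (Z i ω)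
  simp only [Pi.add_apply] at this
  rwa [integral_add i1 i2, integral_const_mul, integral_const_mul] at this

lemma sum_badMass_le (hN : LargeExponent μ x t ρ R Z nu) (h : Sample μ x t ρ c R ε Z) :
    ∑ i, badMass μ Z nu i ≤ 21 * R := by
  have h1 := Finset.sum_le_sum fun i (_ : i ∈ Finset.univ) => (hN.int_badWt h i).2
  rw [Finset.sum_add_distrib, ← Finset.mul_sum, ← Finset.mul_sum] at h1
  have h2 : 0 ≤ ∑ i, ∫ ω, {z : ℝ × ℝ | 1 < |z.1|}.indicator
      (fun z => Real.exp (nu i z)) (Z i ω) ∂μ := Finset.sum_nonneg fun i _ =>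
    integral_nonneg fun ω => Set.indicator_nonneg (fun _ _ => (Real.exp_pos _).le) _
  linarith [hN.sum_le]

end LargeExponent
end BadWeight

/-! ### The tilted measure with a large pair -/

section Mixed

variable {Ω : Type*} [MeasurableSpace Ω] {μ Q Q' : Measure Ω} {ι : Type*} [Fintype ι]
  {x t ρ c R ε l : ℝ} {Z : ι → Ω → ℝ × ℝ} {nu : ι → ℝ × ℝ → ℝ} {i₀ : ι} {w : ι → ℝ}

open Classical in
/-- The weight which forces the pair `i₀` to be large and allows the other pairs to be either good
or large. -/
noncomputable def mixWt (ρ l : ℝ) (nu : ι → ℝ × ℝ → ℝ) (i₀ j : ι) (z : ℝ × ℝ) : ℝ :=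
  (if j = i₀ then 0 else wt ρ l z) + badWt nu j z

/-- The exponent of a large pair, extended by zero to the good set. -/
noncomputable def badPart (nu : ι → ℝ × ℝ → ℝ) (i : ι) (z : ℝ × ℝ) : ℝ :=
  goodᶜ.indicator (badExp nu i) z

lemma badPart_of_mem {ι : Type*} {nu : ι → ℝ × ℝ → ℝ} {i : ι} {z : ℝ × ℝ} (hz : z ∈ good) :
    badPart nu i z = 0 :=
  Set.indicator_of_notMem (Set.notMem_compl_iff.2 hz) _

lemma badPart_of_notMem {ι : Type*} {nu : ι → ℝ × ℝ → ℝ} {i : ι} {z : ℝ × ℝ} (hz : z ∉ good) :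
    badPart nu i z = badExp nu i z := Set.indicator_of_mem (show z ∈ goodᶜ from hz) _

/-- Once the pair `i₀` is large, every factor of the product reduces to a single exponential. -/
lemma prod_mixWt_of_notMem {Ω ι : Type*} [Fintype ι] {Z : ι → Ω → ℝ × ℝ} {nu : ι → ℝ × ℝ → ℝ}
    {i₀ : ι} {ω : Ω} (hω : Z i₀ ω ∉ good) :
    ∏ j, mixWt ρ l nu i₀ j (Z j ω)
      = Real.exp (l * ∑ j, xiGood ρ (Z j ω) + ∑ j, badPart nu j (Z j ω)) := by
  rw [Finset.mul_sum, ← Finset.sum_add_distrib, Real.exp_sum]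
  refine Finset.prod_congr rfl fun j _ => ?_
  unfold mixWt
  by_cases hj : Z j ω ∈ good
  · have hne : j ≠ i₀ := fun e => hω (e ▸ hj)
    rw [if_neg hne, wt_of_mem hj, badWt_of_mem hj, badPart_of_mem hj, xiGood_of_mem hj, add_zero,
      add_zero]
  · rw [wt_of_notMem hj, badWt_of_notMem hj, badPart_of_notMem hj, xiGood_of_notMem hj, mul_zero,
      ite_self, zero_add, zero_add]

/-- `Q'` is the product tilt of `μ` by the weights `mixWt`; `w j` is the `Q'`-probability that the
pair `j` is good. -/
structure IsMixedTilt (μ Q' : Measure Ω) (ρ l R : ℝ) (Z : ι → Ω → ℝ × ℝ) (nu : ι → ℝ × ℝ → ℝ)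
    (i₀ : ι) (w : ι → ℝ) : Prop where
  ind : iIndepFun Z Q'
  nonneg : ∀ j, 0 ≤ w j
  le_one : ∀ j, w j ≤ 1
  one_sub_le : ∀ j, j ≠ i₀ → 1 - w j ≤ 2 * badMass μ Z nu j
  integral_comp : ∀ j (F : ℝ × ℝ → ℝ), Measurable F → (∀ z, z ∉ good → F z = 0) →
    ∫ ω, F (Z j ω) ∂Q' = w j * tiltMean μ ρ l (Z j) F
  change_le : ∀ F : Ω → ℝ, 0 ≤ F → ∫ ω, F ω * ∏ j, mixWt ρ l nu i₀ j (Z j ω) ∂μ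
    ≤ 2 * badMass μ Z nu i₀
      * Real.exp (∑ j, Real.log (tiltMass μ ρ l (Z j)) + 42 * R) * ∫ ω, F ω ∂Q'

/-- The total mass of the mixed weights is at most `2 e^{42 R}` times the mass of the large pair `i₀`
times that of the pure tilt. -/
lemma LargeExponent.exists_isMixedTilt [IsProbabilityMeasure μ]
    (hN : LargeExponent μ x t ρ R Z nu) (h : Sample μ x t ρ c R ε Z) (hl0 : 0 ≤ l) (hl1 : l ≤ 1)
    (hpos : 0 < badMass μ Z nu i₀) :
    ∃ (Q' : Measure Ω) (w : ι → ℝ), IsProbabilityMeasure Q' ∧ IsMixedTilt μ Q' ρ l R Z nu i₀ w := by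
  classical
  have hM : ∀ j, 1 / 2 ≤ tiltMass μ ρ l (Z j) := fun j => (h.law j).half_le_tiltMass hl0 hl1
  have hD : ∀ j, 0 ≤ badMass μ Z nu j := fun j => badMass_nonneg Z nu j
  have hg : ∀ j, ∫ ω, mixWt ρ l nu i₀ j (Z j ω) ∂μ
      = (if j = i₀ then 0 else tiltMass μ ρ l (Z j)) + badMass μ Z nu j := by
    intro j
    have i1 := ((h.law j).int_wt hl0 hl1).1
    have i2 := (hN.int_badWt h j).1
    unfold mixWt
    split_ifs
    · simp only [zero_add]
      rfl
    · rw [integral_add i1 i2]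
      rfl
  set g : ι → ℝ := fun j => (if j = i₀ then 0 else tiltMass μ ρ l (Z j)) + badMass μ Z nu j with hgd
  have hg0 : ∀ j, 0 < g j := fun j => by
    simp only [hgd]
    split_ifs with e
    · rw [zero_add, e]
      exact hpos
    · linarith [hM j, hD j]
  obtain ⟨Q', hQ', hi, hm, hc⟩ := exists_product_tilt (fun i => (h.law i).meas) h.ind
    (G := mixWt ρ l nu i₀)
    (fun j => by
      have h1 := hN.measurable_badWt j
      have h2 := measurable_wt ρ l
      unfold mixWt
      split_ifs <;> fun_prop)
    (fun j z => by
      unfold mixWt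
      have := badWt_nonneg nu j z
      have := wt_nonneg ρ l z
      split_ifs <;> positivity)
    (fun j => by
      rw [hg j]
      exact hg0 j)
  refine ⟨Q', fun j => (if j = i₀ then 0 else tiltMass μ ρ l (Z j)) / g j, hQ', hi, fun j => ?_,
    fun j => ?_, fun j hj => ?_, fun j F hF hF0 => ?_, fun F hF => ?_⟩
  · refine div_nonneg ?_ (hg0 j).le
    split_ifs <;> linarith [hM j]
  · rw [div_le_one (hg0 j)]
    simp only [hgd]
    linarith [hD j]
  · have hgj := hg0 j
    simp only [hgd, if_neg hj] at hgj ⊢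
    rw [one_sub_div hgj.ne', div_le_iff₀ hgj]
    nlinarith [hM j, hD j]
  · rw [hm j F hF, hg j]
    have e : ∀ z, F z * mixWt ρ l nu i₀ j z = (if j = i₀ then 0 else 1) * (F z * wt ρ l z) := by
      intro z
      unfold mixWt
      by_cases hz : z ∈ good
      · rw [badWt_of_mem hz]
        split_ifs <;> ring
      · rw [hF0 z hz]
        ring
    simp only [e]
    rw [integral_const_mul]
    have hMj := hM j
    unfold tiltMean
    change _ / g j = _
    have := hg0 j
    split_ifs
    · simp
    · field_simp
  · rw [hc F]
    refine mul_le_mul_of_nonneg_right ?_ (integral_nonneg hF)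
    simp only [hg]
    have hfac : ∀ j, g j ≤ (if j = i₀ then 2 * badMass μ Z nu i₀ else 1)
        * (tiltMass μ ρ l (Z j) * Real.exp (2 * badMass μ Z nu j)) := by
      intro j
      have h1 := Real.add_one_le_exp (2 * badMass μ Z nu j)
      have h2 := mul_le_mul_of_nonneg_left h1 (by linarith [hM j] : 0 ≤ tiltMass μ ρ l (Z j))
      have h3 := mul_le_mul_of_nonneg_right (hM j) (hD j)
      simp only [hgd]
      split_ifs with e
      · subst e
        rw [zero_add]
        have h0 := mul_nonneg (by linarith [hM j] : 0 ≤ tiltMass μ ρ l (Z j)) (hD j)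
        have h5 : 1 / 2 ≤ tiltMass μ ρ l (Z j) * Real.exp (2 * badMass μ Z nu j) := by
          linarith [hM j]
        have h4 := mul_le_mul_of_nonneg_left h5 (hD j)
        linarith
      · rw [one_mul]
        linarith
    refine (Finset.prod_le_prod (fun j _ => (hg0 j).le) fun j _ => hfac j).trans ?_
    rw [Finset.prod_mul_distrib, Finset.prod_mul_distrib, Finset.prod_ite_eq']
    rw [if_pos (Finset.mem_univ _)]
    refine mul_le_mul_of_nonneg_left ?_ (by linarith)
    have e : ∏ j, tiltMass μ ρ l (Z j) = ∏ j, Real.exp (Real.log (tiltMass μ ρ l (Z j))) :=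
      Finset.prod_congr rfl fun j _ => (Real.exp_log (by linarith [hM j])).symm
    rw [e, ← Real.exp_sum, ← Real.exp_sum, ← Real.exp_add, ← Finset.mul_sum]
    exact Real.exp_le_exp.2 (by linarith [hN.sum_badMass_le h])

/-- The standardized exponent of a good pair, extended by zero. -/
noncomputable def goodStd (μ : Measure Ω) (ρ l : ℝ) (Z : ι → Ω → ℝ × ℝ) (i : ι) (z : ℝ × ℝ) : ℝ :=
  good.indicator (stdXi μ ρ l Z i) z

lemma measurable_goodStd (i : ι) : Measurable (goodStd μ ρ l Z i) :=
  (measurable_stdXi i).indicator measurableSet_good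

lemma goodStd_of_mem {i : ι} {z : ℝ × ℝ} (hz : z ∈ good) :
    goodStd μ ρ l Z i z = stdXi μ ρ l Z i z := Set.indicator_of_mem hz _

lemma goodStd_of_notMem {i : ι} {z : ℝ × ℝ} (hz : z ∉ good) : goodStd μ ρ l Z i z = 0 :=
  Set.indicator_of_notMem hz _

/-- The exponent of a large pair, relative to the tilted mean of `ξ`. -/
noncomputable def badDev (μ : Measure Ω) (ρ l : ℝ) (Z : ι → Ω → ℝ × ℝ) (nu : ι → ℝ × ℝ → ℝ) (i : ι)
    (z : ℝ × ℝ) : ℝ :=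
  goodᶜ.indicator (fun z => badExp nu i z - l * tiltMean μ ρ l (Z i) (xi ρ)) z

lemma LargeExponent.measurable_badDev (hN : LargeExponent μ x t ρ R Z nu) (i : ι) :
    Measurable (badDev μ ρ l Z nu i) :=
  ((hN.measurable_badExp i).sub_const _).indicator measurableSet_good.compl

lemma goodStd_mul_badDev (i : ι) (z : ℝ × ℝ) :
    goodStd μ ρ l Z i z = 0 ∨ badDev μ ρ l Z nu i z = 0 := by
  by_cases hz : z ∈ good
  · exact Or.inr (Set.indicator_of_notMem (Set.notMem_compl_iff.2 hz) _)
  · exact Or.inl (goodStd_of_notMem hz)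

/-- The total exponent in terms of independent summands of which, for each pair, one vanishes. -/
lemma sum_goodStd_add_sum_badDev (hl : IsSaddle μ x t ρ c R ε l Z) (hs : tiltSd μ ρ l Z ≠ 0)
    (ω : Ω) :
    l * tiltSd μ ρ l Z * ∑ i, goodStd μ ρ l Z i (Z i ω) + ∑ i, badDev μ ρ l Z nu i (Z i ω)
      = l * ∑ i, xiGood ρ (Z i ω) + ∑ i, badPart nu i (Z i ω) - l * (x ^ 2 + 2 * c * x) := by
  rw [← hl.mean, Finset.mul_sum, Finset.mul_sum, Finset.mul_sum, ← Finset.sum_add_distrib,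
    ← Finset.sum_add_distrib, ← Finset.sum_sub_distrib]
  refine Finset.sum_congr rfl fun i _ => ?_
  by_cases hz : Z i ω ∈ good
  · rw [goodStd_of_mem hz, badPart_of_mem hz, badDev,
      Set.indicator_of_notMem (Set.notMem_compl_iff.2 hz), stdXi]
    field_simp
    ring
  · rw [goodStd_of_notMem hz, badPart_of_notMem hz, xiGood_of_notMem hz, badDev,
      Set.indicator_of_mem (show Z i ω ∈ goodᶜ from hz)]
    ring

/-- The centred summand of `∑ Y² 1_good` under the tilted measure with a large pair. -/
noncomputable def mixSqDev (μ : Measure Ω) (ρ l : ℝ) (Z : ι → Ω → ℝ × ℝ) (w : ι → ℝ) (i : ι)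
    (z : ℝ × ℝ) : ℝ :=
  sqGood z - w i * tiltMean μ ρ l (Z i) (fun z => z.2 ^ 2)

lemma measurable_mixSqDev {ι : Type*} {Z : ι → Ω → ℝ × ℝ} {w : ι → ℝ} (i : ι) : Measurable (mixSqDev μ ρ l Z w i) :=
  measurable_sqGood.sub_const _

namespace IsMixedTilt

lemma iIndepFun_comp (hM : IsMixedTilt μ Q' ρ l R Z nu i₀ w) {E : Type*} [MeasurableSpace E]
    {F : ι → ℝ × ℝ → E} (hF : ∀ i, Measurable (F i)) : iIndepFun (fun i ω => F i (Z i ω)) Q' :=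
  hM.ind.comp F hF

/-- Integrals of functions supported on the good set are those under the product tilt, up to the
probability of the good set. -/
lemma integral_eq (hM : IsMixedTilt μ Q' ρ l R Z nu i₀ w) (hQ : IsTilt μ Q ρ l Z) (i : ι)
    {F F' : ℝ × ℝ → ℝ} (hF : Measurable F) (hF' : Measurable F') (h0 : ∀ z, z ∉ good → F z = 0)
    (he : ∀ z ∈ good, F z = F' z) :
    ∫ ω, F (Z i ω) ∂Q' = w i * ∫ ω, F' (Z i ω) ∂Q := by
  rw [hM.integral_comp i F hF h0, hQ.integral_comp i F' hF', tiltMean_congr he]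

lemma integral_sqGood (hM : IsMixedTilt μ Q' ρ l R Z nu i₀ w) (i : ι) :
    ∫ ω, sqGood (Z i ω) ∂Q' = w i * tiltMean μ ρ l (Z i) (fun z => z.2 ^ 2) := by
  rw [hM.integral_comp i _ measurable_sqGood fun z hz => sqGood_of_notMem hz]
  rw [tiltMean_congr fun z hz => sqGood_of_mem hz]

lemma integral_mixSqDev [IsProbabilityMeasure Q'] (hM : IsMixedTilt μ Q' ρ l R Z nu i₀ w) (h : Sample μ x t ρ c R ε Z)
    (i : ι) : ∫ ω, mixSqDev μ ρ l Z w i (Z i ω) ∂Q' = 0 := by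
  have hm : Measurable fun ω => sqGood (Z i ω) := measurable_sqGood.comp (h.law i).meas
  have hi := integrable_of_abs_le (Q := Q') hm fun ω => abs_sqGood_le_one (Z i ω)
  unfold mixSqDev
  rw [integral_sub hi (integrable_const _), hM.integral_sqGood]
  simp

end IsMixedTilt

variable [IsProbabilityMeasure Q]

lemma IsTilt.tiltMean_snd_sq_mem (hQ : IsTilt μ Q ρ l Z) (h : Sample μ x t ρ c R ε Z) (i : ι) :
    0 ≤ tiltMean μ ρ l (Z i) (fun z => z.2 ^ 2) ∧ tiltMean μ ρ l (Z i) (fun z => z.2 ^ 2) ≤ 1 ∧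
      tiltMean μ ρ l (Z i) (fun z => z.2 ^ 2) ^ 2 ≤ tiltMean μ ρ l (Z i) (fun z => z.2 ^ 4) := by
  have hm : Measurable fun ω => sqGood (Z i ω) := measurable_sqGood.comp (h.law i).meas
  have hi := integrable_of_abs_le (Q := Q) hm fun ω => abs_sqGood_le_one (Z i ω)
  have hi2 := integrable_sq_of_abs_le (Q := Q) hm fun ω => abs_sqGood_le_one (Z i ω)
  have h0 : 0 ≤ ∫ ω, sqGood (Z i ω) ∂Q := integral_nonneg fun ω => sqGood_nonneg _
  have h1 : ∫ ω, sqGood (Z i ω) ∂Q ≤ 1 := by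
    have := integral_mono hi (integrable_const 1) fun ω => sqGood_le_one (Z i ω)
    simpa using this
  have e4 : ∫ ω, sqGood (Z i ω) ^ 2 ∂Q = tiltMean μ ρ l (Z i) (fun z => z.2 ^ 4) := by
    rw [hQ.integral_comp i (fun z => sqGood z ^ 2) (measurable_sqGood.pow_const 2)]
    refine tiltMean_congr fun z hz => ?_
    rw [sqGood_of_mem hz]
    ring
  have e2 := hQ.integral_sqGood (μ := μ) i
  set v := ∫ ω, sqGood (Z i ω) ∂Q with hv
  have h2 : 0 ≤ ∫ ω, (sqGood (Z i ω) ^ 2 - 2 * v * sqGood (Z i ω) + v ^ 2) ∂Q :=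
    integral_nonneg fun ω => by
      have : sqGood (Z i ω) ^ 2 - 2 * v * sqGood (Z i ω) + v ^ 2 = (sqGood (Z i ω) - v) ^ 2 := by
        ring
      rw [Pi.zero_apply, this]
      positivity
  have i3 : Integrable (fun ω => sqGood (Z i ω) ^ 2 - 2 * v * sqGood (Z i ω)) Q :=
    hi2.sub (hi.const_mul _)
  rw [integral_add i3 (integrable_const _), integral_sub hi2 (hi.const_mul _), integral_const_mul,
    e4, ← hv] at h2
  simp only [integral_const, probReal_univ, smul_eq_mul, one_mul] at h2
  rw [← e2]
  exact ⟨h0, h1, by nlinarith⟩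

namespace IsMixedTilt

lemma abs_mixSqDev_le (hM : IsMixedTilt μ Q' ρ l R Z nu i₀ w) (hQ : IsTilt μ Q ρ l Z)
    (h : Sample μ x t ρ c R ε Z) (i : ι) (z : ℝ × ℝ) : |mixSqDev μ ρ l Z w i z| ≤ 1 := by
  obtain ⟨v0, v1, -⟩ := hQ.tiltMean_snd_sq_mem h i
  have h1 := mul_nonneg (hM.nonneg i) v0
  have h2 := mul_le_one₀ (hM.le_one i) v0 v1
  have := sqGood_nonneg z
  have := sqGood_le_one z
  unfold mixSqDev
  rw [abs_le]
  constructor <;> linarith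

lemma sum_integral_mixSqDev_sq_le [IsProbabilityMeasure μ] [IsProbabilityMeasure Q']
    (hM : IsMixedTilt μ Q' ρ l R Z nu i₀ w) (hQ : IsTilt μ Q ρ l Z) (h : Sample μ x t ρ c R ε Z)
    (hl0 : 0 ≤ l) (hl1 : l ≤ 1) :
    ∑ i, ∫ ω, mixSqDev μ ρ l Z w i (Z i ω) ^ 2 ∂Q' ≤ 42 * R := by
  refine (Finset.sum_le_sum fun i _ => ?_).trans (h.sum_tiltMean_snd_fourth_le hl0 hl1)
  have hm : Measurable fun ω => sqGood (Z i ω) := measurable_sqGood.comp (h.law i).meas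
  have hi := integrable_of_abs_le (Q := Q') hm fun ω => abs_sqGood_le_one (Z i ω)
  have hi2 := integrable_sq_of_abs_le (Q := Q') hm fun ω => abs_sqGood_le_one (Z i ω)
  set v := w i * tiltMean μ ρ l (Z i) (fun z => z.2 ^ 2) with hv
  have e : ∀ ω, mixSqDev μ ρ l Z w i (Z i ω) ^ 2
      = sqGood (Z i ω) ^ 2 - 2 * v * sqGood (Z i ω) + v ^ 2 := fun ω => by
    unfold mixSqDev
    rw [← hv]
    ring
  have e4 : ∫ ω, sqGood (Z i ω) ^ 2 ∂Q' = w i * tiltMean μ ρ l (Z i) (fun z => z.2 ^ 4) := by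
    rw [hM.integral_comp i (fun z => sqGood z ^ 2) (measurable_sqGood.pow_const 2) fun z hz => by
      rw [sqGood_of_notMem hz]; ring]
    congr 1
    refine tiltMean_congr fun z hz => ?_
    rw [sqGood_of_mem hz]
    ring
  have i3 : Integrable (fun ω => sqGood (Z i ω) ^ 2 - 2 * v * sqGood (Z i ω)) Q' :=
    hi2.sub (hi.const_mul _)
  simp only [e]
  rw [integral_add i3 (integrable_const _), integral_sub hi2 (hi.const_mul _), integral_const_mul,
    hM.integral_sqGood, e4, ← hv]
  simp only [integral_const, probReal_univ, smul_eq_mul, one_mul]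
  have h4 : 0 ≤ tiltMean μ ρ l (Z i) (fun z => z.2 ^ 4) :=
    (sq_nonneg _).trans (hQ.tiltMean_snd_sq_mem h i).2.2
  have := mul_le_of_le_one_left h4 (hM.le_one i)
  nlinarith [sq_nonneg v]

/-- Excluding `i₀` and the large pairs changes the mean of `∑ Y²` by little. -/
lemma abs_sum_sub_le [IsProbabilityMeasure μ] (hM : IsMixedTilt μ Q' ρ l R Z nu i₀ w)
    (hQ : IsTilt μ Q ρ l Z) (h : Sample μ x t ρ c R ε Z) (hN : LargeExponent μ x t ρ R Z nu)
    (hx : 1 ≤ x) (hl0 : 0 ≤ l) (hl1 : l ≤ 1) :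
    |∑ i, w i * tiltMean μ ρ l (Z i) (fun z => z.2 ^ 2) - t ^ 2| ≤ 5 * 10 ^ 4 * (x * √R) := by
  classical
  have h1 := h.abs_sum_tiltMean_snd_sq_sub_le hl0 hl1
  set v : ι → ℝ := fun i => tiltMean μ ρ l (Z i) (fun z => z.2 ^ 2) with hv
  have hR := h.R_pos
  have hsR := h.sqrt_R_pos
  have hvi : v i₀ ≤ 7 * √R := by
    refine le_of_sq_le_sq ?_ (by positivity)
    have a := (hQ.tiltMean_snd_sq_mem h i₀).2.2
    have b := h.sum_tiltMean_snd_fourth_le hl0 hl1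
    have d := Finset.single_le_sum (f := fun i => tiltMean μ ρ l (Z i) (fun z => z.2 ^ 4))
      (fun j _ => (sq_nonneg _).trans (hQ.tiltMean_snd_sq_mem h j).2.2) (Finset.mem_univ i₀)
    have e : (7 * √R) ^ 2 = 49 * R := by
      rw [mul_pow, sq √R, h.sq_sqrt_R]
      norm_num
    rw [e]
    linarith
  have h2 : ∑ i, (1 - w i) * v i ≤ ∑ i, (2 * badMass μ Z nu i + if i = i₀ then 7 * √R else 0) := by
    refine Finset.sum_le_sum fun i _ => ?_
    obtain ⟨v0, v1, -⟩ := hQ.tiltMean_snd_sq_mem h i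
    have hD : 0 ≤ badMass μ Z nu i := badMass_nonneg Z nu i
    split_ifs with e
    · subst e
      have : (1 - w i) * v i ≤ v i := mul_le_of_le_one_left v0 (by linarith [hM.nonneg i])
      linarith
    · have a := hM.one_sub_le i e
      have b : (1 - w i) * v i ≤ 1 - w i := mul_le_of_le_one_right (by linarith [hM.le_one i]) v1
      linarith
  rw [Finset.sum_add_distrib, ← Finset.mul_sum, Finset.sum_ite_eq', if_pos (Finset.mem_univ _)] at h2
  have h3 := hN.sum_badMass_le h
  have h4 : 0 ≤ ∑ i, (1 - w i) * v i := Finset.sum_nonneg fun i _ =>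
    mul_nonneg (by linarith [hM.le_one i]) (hQ.tiltMean_snd_sq_mem h i).1
  have e : ∑ i, w i * v i - t ^ 2 = (∑ i, v i - t ^ 2) - ∑ i, (1 - w i) * v i := by
    simp only [sub_mul, one_mul, Finset.sum_sub_distrib]
    ring
  have h5 := h.R_le_mul_sqrt
  have h6 : √R ≤ x * √R := le_mul_of_one_le_left hsR.le hx
  rw [e]
  refine (abs_sub _ _).trans ?_
  rw [abs_of_nonneg h4]
  linarith

end IsMixedTilt
end Mixed

/-! ### The contribution of the large pairs -/

section LargePointwise

variable {Ω : Type*} [MeasurableSpace Ω] {μ : Measure Ω} {ι : Type*} [Fintype ι]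
  {x t ρ c R ε l u : ℝ} {Z : ι → Ω → ℝ × ℝ} {nu : ι → ℝ × ℝ → ℝ}

/-- The positive part of `ν` on the large pairs. -/
noncomputable def badNu (nu : ι → ℝ × ℝ → ℝ) (i : ι) (z : ℝ × ℝ) : ℝ :=
  goodᶜ.indicator (fun z => max (nu i z) 0) z

lemma badNu_nonneg {ι : Type*} (nu : ι → ℝ × ℝ → ℝ) (i : ι) (z : ℝ × ℝ) : 0 ≤ badNu nu i z :=
  Set.indicator_nonneg (fun _ _ => le_max_right _ _) _

lemma badPart_eq {ι : Type*} (nu : ι → ℝ × ℝ → ℝ) (i : ι) (z : ℝ × ℝ) :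
    badPart nu i z = 98 / 100 * badNu nu i z + goodᶜ.indicator 1 z := by
  unfold badPart badNu badExp
  by_cases hz : z ∈ goodᶜ
  · simp [hz]
  · simp [hz]

/-- On the tail event, if the total exponent of the large pairs is moderate, the exponent of the
good and large pairs together is close to the required one. -/
lemma exponent_le (h : Sample μ x t ρ c R ε Z) (hN : LargeExponent μ x t ρ R Z nu)
    (hl0 : 39 / 100 ≤ l) (hl1 : l ≤ 61 / 100) {ω : Ω} (hE : ω ∈ tailEvent x t c Z)
    (hcap : ∑ i, badNu nu i (Z i ω) ≤ 78 / 100 * x ^ 2)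
    (hu : t ^ 2 * (1 + u) = ∑ i, sqGood (Z i ω)) :
    l * (x ^ 2 + 2 * c * x) - 2 * (x ^ 2 * u ^ 2)
      ≤ l * ∑ i, xiGood ρ (Z i ω) + ∑ i, badPart nu i (Z i ω) ∧
    l * (x ^ 2 + 2 * c * x) - 2 * (x ^ 2 * |u|)
      ≤ l * ∑ i, xiGood ρ (Z i ω) + ∑ i, badPart nu i (Z i ω) := by
  have hx := h.x_pos
  have ht := h.t_pos
  set A : ℝ := ∑ i, good.indicator (fun z : ℝ × ℝ => z.1) (Z i ω) with hA
  set B : ℝ := ∑ i, goodᶜ.indicator (fun z : ℝ × ℝ => z.1) (Z i ω) with hB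
  set C : ℝ := ∑ i, goodᶜ.indicator (fun z : ℝ × ℝ => z.2 ^ 2) (Z i ω) with hC
  set J : ℝ := ∑ i, goodᶜ.indicator (1 : ℝ × ℝ → ℝ) (Z i ω) with hJ
  have hAB : A + B = ∑ i, (Z i ω).1 := by
    rw [hA, hB, ← Finset.sum_add_distrib]
    exact Finset.sum_congr rfl fun i _ =>
      congrFun (Set.indicator_self_add_compl good fun z : ℝ × ℝ => z.1) (Z i ω)
  have hsq : t ^ 2 * (1 + u) + C = ∑ i, (Z i ω).2 ^ 2 := by
    rw [hu, hC, ← Finset.sum_add_distrib]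
    exact Finset.sum_congr rfl fun i _ =>
      congrFun (Set.indicator_self_add_compl good fun z : ℝ × ℝ => z.2 ^ 2) (Z i ω)
  have hC0 : 0 ≤ C := Finset.sum_nonneg fun i _ => Set.indicator_nonneg (fun _ _ => sq_nonneg _) _
  have hJ0 : 0 ≤ J := Finset.sum_nonneg fun i _ => Set.indicator_nonneg (fun _ _ => zero_le_one) _
  have hN0 : 0 ≤ ∑ i, badNu nu i (Z i ω) := Finset.sum_nonneg fun i _ => badNu_nonneg _ _ _
  have hu1 : -1 ≤ u := by
    have h0 : 0 ≤ ∑ i, sqGood (Z i ω) := Finset.sum_nonneg fun i _ => sqGood_nonneg _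
    rw [← hu] at h0
    linarith [nonneg_of_mul_nonneg_right h0 (by positivity : 0 < t ^ 2)]
  have hE' : x * √(1 + u + C / t ^ 2) + c ≤ A / t + B / t := by
    have e : √(∑ i, (Z i ω).2 ^ 2) = t * √(1 + u + C / t ^ 2) := by
      rw [← hsq, show t ^ 2 * (1 + u) + C = t ^ 2 * (1 + u + C / t ^ 2) by field_simp,
        Real.sqrt_mul (sq_nonneg t), Real.sqrt_sq ht.le]
    have h1 : x * √(∑ i, (Z i ω).2 ^ 2) + c * t ≤ ∑ i, (Z i ω).1 := hE
    rw [e, ← hAB] at h1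
    rw [← add_div, le_div_iff₀ ht]
    linarith
  have hsplit : ∀ a, 0 < a → a ≤ x → B / t ≤ (∑ i, badNu nu i (Z i ω)) / (2 * a)
      + a * (C / t ^ 2) / 2 + J / (8 * x) := by
    intro a ha hax
    rw [hB, hC, hJ, Finset.sum_div, Finset.sum_div, Finset.sum_div, Finset.sum_div, Finset.mul_sum,
      Finset.sum_div, ← Finset.sum_add_distrib, ← Finset.sum_add_distrib]
    refine Finset.sum_le_sum fun i _ => ?_
    unfold badNu
    by_cases hz : Z i ω ∈ goodᶜ
    · simp only [Set.indicator_of_mem hz, Pi.one_apply]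
      have := hN.split i (Z i ω) a ha hax
      rwa [div_pow] at this
    · simp [Set.indicator_of_notMem hz]
  have hxi : ∑ i, xiGood ρ (Z i ω) = 2 * x * (A / t) - x ^ 2 * (1 + u) := by
    have e1 : ∑ i, xiGood ρ (Z i ω) = 2 * ρ * A - ρ ^ 2 * (t ^ 2 * (1 + u)) := by
      rw [hu, hA, Finset.mul_sum, Finset.mul_sum, ← Finset.sum_sub_distrib]
      refine Finset.sum_congr rfl fun i _ => ?_
      by_cases hz : Z i ω ∈ good
      · rw [xiGood_of_mem hz, sqGood_of_mem hz, Set.indicator_of_mem hz]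
        rfl
      · rw [xiGood_of_notMem hz, sqGood_of_notMem hz, Set.indicator_of_notMem hz]
        ring
    rw [e1, ← h.rho_mul]
    field_simp
  have hbp : ∑ i, badPart nu i (Z i ω) = 98 / 100 * ∑ i, badNu nu i (Z i ω) + J := by
    rw [hJ, Finset.mul_sum, ← Finset.sum_add_distrib]
    exact Finset.sum_congr rfl fun i _ => badPart_eq nu i _
  rw [hxi, hbp]
  exact exponent_le_of_tail hx hl0 hl1 hu1 (div_nonneg hC0 (sq_nonneg t)) hN0 hcap hJ0 hE' hsplit

end LargePointwise

section Large

variable {Ω : Type*} [MeasurableSpace Ω] {μ Q Q' : Measure Ω} {ι : Type*} [Fintype ι]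
  {x t ρ c R ε l : ℝ} {Z : ι → Ω → ℝ × ℝ} {nu : ι → ℝ × ℝ → ℝ} {i₀ : ι} {w : ι → ℝ}
  [IsProbabilityMeasure μ] [IsProbabilityMeasure Q]

lemma sq_le_add_cube (z : ℝ) : z ^ 2 ≤ 1 / 100 + 10 * |z| ^ 3 := by
  have h0 := abs_nonneg z
  rw [← sq_abs]
  rcases le_total |z| (1 / 10) with h | h
  · nlinarith [pow_nonneg h0 3]
  · nlinarith [mul_le_mul_of_nonneg_left h (sq_nonneg |z|)]

/-- The moments of the standardized good summands under the tilted measure with a large pair. -/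
lemma IsMixedTilt.goodStd_moments (hM : IsMixedTilt μ Q' ρ l R Z nu i₀ w) (hQ : IsTilt μ Q ρ l Z)
    (h : Sample μ x t ρ c R ε Z) (hN : LargeExponent μ x t ρ R Z nu) (hx : 1 ≤ x) (hl0 : 0 ≤ l)
    (hl1 : l ≤ 1) :
    (∀ i, ∫ ω, goodStd μ ρ l Z i (Z i ω) ∂Q' = 0) ∧
      ∑ i, ∫ ω, goodStd μ ρ l Z i (Z i ω) ^ 2 ∂Q' ≤ 1 ∧
      1 / 2 ≤ ∑ i, ∫ ω, goodStd μ ρ l Z i (Z i ω) ^ 2 ∂Q' ∧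
      ∑ i, ∫ ω, |goodStd μ ρ l Z i (Z i ω)| ^ 3 ∂Q' ≤ 4 * 10 ^ 6 * (ε / t) := by
  classical
  have ht := h.t_pos
  have ht1 := h.one_le_t
  have hR := h.R_pos
  have m1 : ∀ i, Measurable (goodStd μ ρ l Z i) := fun i => measurable_goodStd i
  have m2 : ∀ i, Measurable (stdXi μ ρ l Z i) := fun i => measurable_stdXi i
  have e2 : ∀ i, ∫ ω, goodStd μ ρ l Z i (Z i ω) ^ 2 ∂Q'
      = w i * ∫ ω, stdXi μ ρ l Z i (Z i ω) ^ 2 ∂Q := fun i =>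
    hM.integral_eq hQ i (F := fun z => goodStd μ ρ l Z i z ^ 2)
      (F' := fun z => stdXi μ ρ l Z i z ^ 2) ((m1 i).pow_const 2) ((m2 i).pow_const 2)
      (fun z hz => by rw [goodStd_of_notMem hz]; ring) fun z hz => by rw [goodStd_of_mem hz]
  have e3 : ∀ i, ∫ ω, |goodStd μ ρ l Z i (Z i ω)| ^ 3 ∂Q'
      = w i * ∫ ω, |stdXi μ ρ l Z i (Z i ω)| ^ 3 ∂Q := fun i =>
    hM.integral_eq hQ i (F := fun z => |goodStd μ ρ l Z i z| ^ 3)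
      (F' := fun z => |stdXi μ ρ l Z i z| ^ 3) ((m1 i).abs.pow_const 3) ((m2 i).abs.pow_const 3)
      (fun z hz => by rw [goodStd_of_notMem hz]; simp) fun z hz => by rw [goodStd_of_mem hz]
  have s2 := hQ.sum_integral_stdXi_sq h hl0 hl1
  have s3 := hQ.sum_integral_stdXi_cube_le h hl0 hl1
  have b : ∀ i ω, |stdXi μ ρ l Z i (Z i ω)| ≤ 4 / t := fun i ω => hQ.abs_stdXi_le h hl0 hl1 i _
  have hm : ∀ i, Measurable fun ω => stdXi μ ρ l Z i (Z i ω) := fun i => (m2 i).comp (h.law i).meas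
  have i2 := fun i => integrable_sq_of_abs_le (Q := Q) (hm i) (b i)
  have i3 := fun i => integrable_abs_of_abs_le (Q := Q) (hm i) (b i) 3
  have p2 : ∀ i, 0 ≤ ∫ ω, stdXi μ ρ l Z i (Z i ω) ^ 2 ∂Q := fun i =>
    integral_nonneg fun ω => sq_nonneg _
  have p3 : ∀ i, 0 ≤ ∫ ω, |stdXi μ ρ l Z i (Z i ω)| ^ 3 ∂Q := fun i =>
    integral_nonneg fun ω => by positivity
  have q2 : ∀ i, ∫ ω, stdXi μ ρ l Z i (Z i ω) ^ 2 ∂Q ≤ (4 / t) ^ 2 := fun i => by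
    have := integral_mono (i2 i) (integrable_const ((4 / t) ^ 2)) fun ω => by
      have := pow_le_pow_left₀ (abs_nonneg _) (b i ω) 2
      rwa [sq_abs] at this
    simpa using this
  have q0 : ∫ ω, stdXi μ ρ l Z i₀ (Z i₀ ω) ^ 2 ∂Q ≤ 1 / 4 := by
    have h1 := integral_mono (i2 i₀) ((integrable_const (1 / 100 : ℝ)).add ((i3 i₀).const_mul 10))
      fun ω => sq_le_add_cube _
    simp only [Pi.add_apply] at h1
    rw [integral_add (integrable_const _) ((i3 i₀).const_mul 10), integral_const_mul] at h1
    simp only [integral_const, probReal_univ, smul_eq_mul, one_mul] at h1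
    have h2 := (Finset.single_le_sum (fun i _ => p3 i) (Finset.mem_univ i₀)).trans s3
    have h3 : ε / t ≤ 10⁻¹ ^ 30 := (div_le_self h.eps_nonneg ht1).trans h.eps_le
    norm_num at h3
    linarith
  refine ⟨fun i => ?_, ?_, ?_, ?_⟩
  · rw [hM.integral_eq hQ i (m1 i) (m2 i) (fun z hz => goodStd_of_notMem hz) fun z hz =>
      goodStd_of_mem hz, hQ.integral_stdXi h i, mul_zero]
  · rw [← s2]
    exact Finset.sum_le_sum fun i _ => by
      rw [e2]
      exact mul_le_of_le_one_left (p2 i) (hM.le_one i)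
  · have h1 : ∑ i, (1 - w i) * ∫ ω, stdXi μ ρ l Z i (Z i ω) ^ 2 ∂Q
        ≤ ∑ i, (2 * (4 / t) ^ 2 * badMass μ Z nu i + if i = i₀ then 1 / 4 else 0) := by
      refine Finset.sum_le_sum fun i _ => ?_
      have hD : 0 ≤ badMass μ Z nu i := badMass_nonneg Z nu i
      split_ifs with e
      · subst e
        have := mul_le_of_le_one_left (p2 i) (by linarith [hM.nonneg i] : 1 - w i ≤ 1)
        have h5 : 0 ≤ 2 * (4 / t) ^ 2 * badMass μ Z nu i := by positivity
        linarith
      · have := mul_le_mul (hM.one_sub_le i e) (q2 i) (p2 i) (by linarith)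
        linarith
    rw [Finset.sum_add_distrib, ← Finset.mul_sum, Finset.sum_ite_eq',
      if_pos (Finset.mem_univ _)] at h1
    have h2 := hN.sum_badMass_le h
    have h3 : ∑ i, ∫ ω, goodStd μ ρ l Z i (Z i ω) ^ 2 ∂Q'
        = ∑ i, ∫ ω, stdXi μ ρ l Z i (Z i ω) ^ 2 ∂Q - ∑ i, (1 - w i) * ∫ ω, stdXi μ ρ l Z i (Z i ω) ^ 2 ∂Q := by
      rw [← Finset.sum_sub_distrib]
      exact Finset.sum_congr rfl fun i _ => by rw [e2]; ring
    have h4 : 2 * (4 / t) ^ 2 * ∑ i, badMass μ Z nu i ≤ 1 / 4 := by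
      have h5 : R ≤ 10⁻¹ ^ 30 * t ^ 2 := h.R_le.trans
        (mul_le_mul_of_nonneg_left (pow_le_pow_left₀ (by linarith) h.x_le_t 2) (by norm_num))
      have h6 := mul_le_mul_of_nonneg_left (h2.trans (mul_le_mul_of_nonneg_left h5
        (by norm_num : (0 : ℝ) ≤ 21))) (by positivity : 0 ≤ 2 * (4 / t) ^ 2)
      have e : 2 * (4 / t) ^ 2 * (21 * (10⁻¹ ^ 30 * t ^ 2)) = 672 * 10⁻¹ ^ 30 := by
        field_simp
        norm_num
      rw [e] at h6
      norm_num at h6 ⊢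
      linarith
    rw [h3, s2]
    linarith
  · refine le_trans (Finset.sum_le_sum fun i _ => ?_) s3
    rw [e3]
    exact mul_le_of_le_one_left (p3 i) (hM.le_one i)

/-- The total exponent of the good and large pairs does not concentrate on unit intervals. -/
lemma IsMixedTilt.concentration [IsProbabilityMeasure Q'] (hM : IsMixedTilt μ Q' ρ l R Z nu i₀ w) (hQ : IsTilt μ Q ρ l Z)
    (h : Sample μ x t ρ c R ε Z) (hN : LargeExponent μ x t ρ R Z nu) (hx : 1 ≤ x)
    (hl : IsSaddle μ x t ρ c R ε l Z) (r : ℝ) :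
    Q'.real {ω | r ≤ l * tiltSd μ ρ l Z * ∑ i, goodStd μ ρ l Z i (Z i ω)
        + ∑ i, badDev μ ρ l Z nu i (Z i ω) ∧
      l * tiltSd μ ρ l Z * ∑ i, goodStd μ ρ l Z i (Z i ω)
        + ∑ i, badDev μ ρ l Z nu i (Z i ω) ≤ r + 1} ≤ 4 / x := by
  obtain ⟨-, hs, -, -⟩ := h.tiltSd_bounds hl.zero_le hl.le_one
  obtain ⟨m0, m1, m2, m3⟩ := hM.goodStd_moments hQ h hN hx hl.zero_le hl.le_one
  have ht := h.t_pos
  have ht1 := h.one_le_t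
  have hε := h.eps_pos
  set y := l * tiltSd μ ρ l Z with hy
  have hyx : 7 / 10 * x ≤ y := by nlinarith [hl.le]
  have hy0 : 0 < y := by linarith
  set ζ : ι → Ω → ℝ := fun i ω => goodStd μ ρ l Z i (Z i ω) with hζdef
  set η : ι → Ω → ℝ := fun i ω => badDev μ ρ l Z nu i (Z i ω) with hηdef
  have hζ : ∀ i, Measurable (ζ i) := fun i => (measurable_goodStd i).comp (h.law i).meas
  have hη : ∀ i, Measurable (η i) := fun i => (hN.measurable_badDev i).comp (h.law i).meas
  have bζ : ∀ i ω, |ζ i ω| ≤ 4 := fun i ω => by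
    simp only [hζdef]
    by_cases hz : Z i ω ∈ good
    · rw [goodStd_of_mem hz]
      exact (hQ.abs_stdXi_le h hl.zero_le hl.le_one i _).trans (div_le_self (by norm_num) ht1)
    · rw [goodStd_of_notMem hz, abs_zero]
      norm_num
  have hind : iIndepFun (fun i ω => (ζ i ω, η i ω)) Q' :=
    hM.iIndepFun_comp fun i => (measurable_goodStd i).prodMk (hN.measurable_badDev i)
  have hindζ : iIndepFun ζ Q' := hM.iIndepFun_comp fun i => measurable_goodStd i
  have iζ2 := fun i => integrable_sq_of_abs_le (Q := Q') (hζ i) (bζ i)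
  have hTm : Measurable fun ω => ∑ i, ζ i ω := Finset.measurable_fun_sum _ fun i _ => hζ i
  have bT : ∀ ω, |∑ i, ζ i ω| ≤ Fintype.card ι * 4 := fun ω => abs_sum_le_card_mul fun i => bζ i ω
  have eT2 : ∫ ω, (∑ i, ζ i ω) ^ 2 ∂Q' ≤ 1 := by
    rw [integral_sum_sq hζ bζ hindζ m0]
    exact m1
  have eT1 : ∫ ω, |∑ i, ζ i ω| ∂Q' ≤ 1 := integral_abs_le_one hTm bT eT2
  set e0 : ℝ := 4 * 10 ^ 6 * (ε / t) with he0
  have he0p : 0 < e0 := by positivity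
  have hv : 1 / 4 ≤ ∑ i, ∫ ω, |ζ i ω| * min e0 |ζ i ω| ∂Q' := by
    have i6 : ∀ i, Integrable (fun ω => |ζ i ω| ^ 3 / (4 * e0)) Q' := fun i =>
      (integrable_abs_of_abs_le (Q := Q') (hζ i) (bζ i) 3).div_const _
    have h1 : ∀ i, ∫ ω, ζ i ω ^ 2 ∂Q' - (∫ ω, |ζ i ω| ^ 3 ∂Q') / (4 * e0)
        ≤ ∫ ω, |ζ i ω| * min e0 |ζ i ω| ∂Q' := by
      intro i
      rw [← integral_div, ← integral_sub (iζ2 i) (i6 i)]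
      refine integral_mono ((iζ2 i).sub (i6 i)) ?_ fun ω => sq_sub_cube_le_abs_mul_min he0p _
      refine integrable_of_abs_le (K := 4 * 4) (by fun_prop) fun ω => ?_
      rw [abs_mul, abs_abs, abs_of_nonneg (le_min he0p.le (abs_nonneg _))]
      exact mul_le_mul (bζ i ω) ((min_le_right _ _).trans (bζ i ω))
        (le_min he0p.le (abs_nonneg _)) (by norm_num)
    have h2 := Finset.sum_le_sum fun i (_ : i ∈ Finset.univ) => h1 i
    rw [Finset.sum_sub_distrib, ← Finset.sum_div] at h2
    have h4 : (∑ i, ∫ ω, |ζ i ω| ^ 3 ∂Q') / (4 * e0) ≤ 1 / 4 := by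
      rw [div_le_iff₀ (by positivity)]
      linarith
    linarith
  -- for each pair one of the two components vanishes, so the randomness of the ends is free
  have hcost : ∀ (f : ℝ → ℝ) (i : ι) (ω : Ω), |ζ i ω| *
      |f (∑ j, η j ω) - f (∑ j, η j ω - η i ω)| = 0 := fun f i ω => by
    rcases goodStd_mul_badDev (μ := μ) (ρ := ρ) (l := l) (Z := Z) (nu := nu) i (Z i ω) with e | e
    · simp only [hζdef]
      rw [e, abs_zero, zero_mul]
    · simp only [hηdef]
      rw [e, sub_zero, sub_self, abs_zero, mul_zero]
  have hcost2 : ∀ (f g : ℝ → ℝ) (i : ι), (fun ω => |ζ i ω| * (|f (∑ j, η j ω)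
      - f (∑ j, η j ω - η i ω)| + |g (∑ j, η j ω) - g (∑ j, η j ω - η i ω)|)) = fun _ => 0 :=
    fun f g i => by
      ext ω
      rw [mul_add, hcost f, hcost g, add_zero]
  have main := randomized_concentration hζ hη hind bζ m0 m1 he0p hv
    (a := fun h => (r - h) / y) (b := fun h => (r + 1 - h) / y) (by fun_prop) (by fun_prop)
    (fun h => div_le_div_of_nonneg_right (by linarith) hy0.le) (K' := 1 / y)
    (fun h => by rw [← sub_div]; exact le_of_eq (by ring)) (fun i => by
      rw [hcost2 (fun h => (r - h) / y) (fun h => (r + 1 - h) / y) i]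
      exact integrable_const _)
  simp only [hcost2 (fun h => (r - h) / y) (fun h => (r + 1 - h) / y), integral_const, smul_zero,
    Finset.sum_const_zero, mul_zero, add_zero] at main
  have hlen : ∀ h : ℝ, (r + 1 - h) / y - (r - h) / y = 1 / y := fun h => by
    rw [← sub_div]
    ring
  simp only [hlen] at main
  rw [integral_mul_const] at main
  have hset : {ω | r ≤ y * ∑ i, ζ i ω + ∑ i, η i ω ∧ y * ∑ i, ζ i ω + ∑ i, η i ω ≤ r + 1}
      = {ω | (r - ∑ j, η j ω) / y ≤ ∑ i, ζ i ω ∧ ∑ i, ζ i ω ≤ (r + 1 - ∑ j, η j ω) / y} := by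
    ext ω
    simp only [Set.mem_ofPred_eq]
    rw [div_le_iff₀ hy0, le_div_iff₀ hy0]
    constructor <;> rintro ⟨a, b⟩ <;> constructor <;> linarith
  change Q'.real {ω | r ≤ y * ∑ i, ζ i ω + ∑ i, η i ω ∧ y * ∑ i, ζ i ω + ∑ i, η i ω ≤ r + 1} ≤ _
  rw [hset]
  have h1 : (∫ ω, |∑ i, ζ i ω| ∂Q') * (1 / y) ≤ 1 * (1 / (7 / 10 * x)) :=
    mul_le_mul eT1 (one_div_le_one_div_of_le (by linarith) hyx) (by positivity) zero_le_one
  have h2 : e0 ≤ 1 / (50 * x) := by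
    rw [he0, le_div_iff₀ (by linarith)]
    have h3 : ε / t * x ≤ ε := by
      rw [div_mul_eq_mul_div, div_le_iff₀ ht]
      exact mul_le_mul_of_nonneg_left h.x_le_t hε.le
    have := h.eps_le
    norm_num at this
    linarith
  have e1 : 1 / (50 * x) = 1 / 50 * (1 / x) := by field_simp
  have e2 : 1 / (7 / 10 * x) = 10 / 7 * (1 / x) := by field_simp
  have e3 : 4 / x = 4 * (1 / x) := by ring
  have h0 : 0 < 1 / x := by positivity
  rw [e1] at h2
  rw [e2] at h1
  rw [e3]
  linarith

end Large

section LargeBound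

variable {Ω : Type*} [MeasurableSpace Ω] {μ Q Q' : Measure Ω} {ι : Type*} [Fintype ι]
  {x t ρ c R ε l : ℝ} {Z : ι → Ω → ℝ × ℝ} {nu : ι → ℝ × ℝ → ℝ} {i₀ : ι} {w : ι → ℝ}

lemma LargeExponent.measurable_badNu (hN : LargeExponent μ x t ρ R Z nu) (i : ι) :
    Measurable (badNu nu i) :=
  ((hN.meas i).max measurable_const).indicator measurableSet_good.compl

/-- The event that the large pairs have a moderate total exponent. -/
def moderate (x : ℝ) (Z : ι → Ω → ℝ × ℝ) (nu : ι → ℝ × ℝ → ℝ) : Set Ω :=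
  {ω | ∑ i, badNu nu i (Z i ω) ≤ 78 / 100 * x ^ 2}

lemma LargeExponent.measurableSet_moderate (hN : LargeExponent μ x t ρ R Z nu)
    (h : Sample μ x t ρ c R ε Z) : MeasurableSet (moderate x Z nu) :=
  measurableSet_le (Finset.measurable_fun_sum _ fun i _ =>
    (hN.measurable_badNu i).comp (h.law i).meas) measurable_const

variable [IsProbabilityMeasure μ] [IsProbabilityMeasure Q]

lemma Sample.measureReal_notMem_good_le (h : Sample μ x t ρ c R ε Z) (i : ι) :
    μ.real {ω | Z i ω ∉ good} ≤ ∫ ω, dd (Z i ω) ∂μ := by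
  have hm : MeasurableSet {ω | Z i ω ∉ good} := ((h.law i).meas measurableSet_good).compl
  rw [← integral_indicator_one hm]
  refine integral_mono_of_nonneg (Filter.Eventually.of_forall fun ω =>
    Set.indicator_nonneg (fun _ _ => zero_le_one) _) (h.law i).int_dd
    (Filter.Eventually.of_forall fun ω => ?_)
  beta_reduce
  by_cases hz : Z i ω ∈ good
  · rw [Set.indicator_of_notMem (show ω ∉ {ω | Z i ω ∉ good} from not_not.2 hz)]
    exact dd_nonneg _
  · rw [Set.indicator_of_mem (show ω ∈ {ω | Z i ω ∉ good} from hz)]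
    exact (bounds_of_notMem_good hz).1

lemma LargeExponent.measureReal_notMem_good_le (hN : LargeExponent μ x t ρ R Z nu)
    (h : Sample μ x t ρ c R ε Z) (i : ι) : μ.real {ω | Z i ω ∉ good} ≤ badMass μ Z nu i := by
  have hm : MeasurableSet {ω | Z i ω ∉ good} := ((h.law i).meas measurableSet_good).compl
  rw [← integral_indicator_one hm]
  refine integral_mono_of_nonneg (Filter.Eventually.of_forall fun ω =>
    Set.indicator_nonneg (fun _ _ => zero_le_one) _) (hN.int_badWt h i).1
    (Filter.Eventually.of_forall fun ω => ?_)
  beta_reduce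
  by_cases hz : Z i ω ∈ good
  · rw [Set.indicator_of_notMem (show ω ∉ {ω | Z i ω ∉ good} from not_not.2 hz)]
    exact badWt_nonneg _ _ _
  · rw [Set.indicator_of_mem (show ω ∈ {ω | Z i ω ∉ good} from hz), badWt_of_notMem hz]
    refine Real.one_le_exp ?_
    unfold badExp
    have := le_max_right (nu i (Z i ω)) 0
    linarith

lemma exp_five_le : Real.exp (4 + 1) ≤ 149 := by
  calc Real.exp (4 + 1) = Real.exp 1 ^ 5 := by rw [← Real.exp_nat_mul]; norm_num
    _ ≤ 2.7182818286 ^ 5 := pow_le_pow_left₀ (Real.exp_pos _).le Real.exp_one_lt_d9.le 5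
    _ ≤ 149 := by norm_num

lemma large_arith {R t : ℝ} (hR : 0 < R) (ht : 0 < t) :
    Real.exp (2 * (1 + 10 ^ 10 * R)) * (16 / t)
      + 36 / t * (Real.exp (2 * 10 ^ 5 * R) - 1) ≤ 200 / t * Real.exp (10 ^ 11 * R) := by
  have e2 : Real.exp 2 ≤ 8 := by
    calc Real.exp 2 = Real.exp 1 ^ 2 := by rw [← Real.exp_nat_mul]; norm_num
      _ ≤ 2.7182818286 ^ 2 := pow_le_pow_left₀ (Real.exp_pos _).le Real.exp_one_lt_d9.le 2
      _ ≤ 8 := by norm_num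
  have h1 : Real.exp (2 * (1 + 10 ^ 10 * R)) ≤ 8 * Real.exp (10 ^ 11 * R) := by
    rw [show 2 * (1 + 10 ^ 10 * R) = 2 + 2 * 10 ^ 10 * R by ring, Real.exp_add]
    exact mul_le_mul e2 (Real.exp_le_exp.2 (by linarith)) (Real.exp_pos _).le (by norm_num)
  have h2 : Real.exp (2 * 10 ^ 5 * R) - 1 ≤ Real.exp (10 ^ 11 * R) := by
    have : Real.exp (2 * 10 ^ 5 * R) ≤ Real.exp (10 ^ 11 * R) :=
      Real.exp_le_exp.2 (by linarith)
    linarith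
  have h3 := mul_le_mul_of_nonneg_right h1 (by positivity : 0 ≤ 16 / t)
  have h4 := mul_le_mul_of_nonneg_left h2 (by positivity : 0 ≤ 36 / t)
  have e : 8 * Real.exp (10 ^ 11 * R) * (16 / t) + 36 / t * Real.exp (10 ^ 11 * R)
      = 164 / t * Real.exp (10 ^ 11 * R) := by ring
  have h5 : 164 / t * Real.exp (10 ^ 11 * R) ≤ 200 / t * Real.exp (10 ^ 11 * R) := by
    gcongr
    norm_num
  linarith

set_option maxHeartbeats 400000 in
/-- The tail event with a given large pair and a moderate total exponent of the large pairs. -/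
lemma IsMixedTilt.measureReal_le [IsProbabilityMeasure Q']
    (hM : IsMixedTilt μ Q' ρ l R Z nu i₀ w) (hQ : IsTilt μ Q ρ l Z)
    (h : Sample μ x t ρ c R ε Z) (hN : LargeExponent μ x t ρ R Z nu) (hx1 : 1 ≤ x)
    (hl : IsSaddle μ x t ρ c R ε l Z) :
    μ.real (tailEvent x t c Z ∩ moderate x Z nu ∩ {ω | Z i₀ ω ∉ good})
      ≤ 2 * badMass μ Z nu i₀ * Real.exp (∑ i, Real.log (tiltMass μ ρ l (Z i)) + 42 * R)
        * (Real.exp (-(l * (x ^ 2 + 2 * c * x))) * (200 / t * Real.exp (10 ^ 11 * R))) := by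
  obtain ⟨-, hs, -, -⟩ := h.tiltSd_bounds hl.zero_le hl.le_one
  have hm' := hM.abs_sum_sub_le hQ h hN hx1 hl.zero_le hl.le_one
  have hx := h.x_pos
  have ht := h.t_pos
  have hR := h.R_pos
  have hs0 : 0 < tiltSd μ ρ l Z := lt_of_lt_of_le (by linarith) hs
  have hE := ((measurableSet_tailEvent (x := x) (t := t) (c := c) fun i => (h.law i).meas).inter
    (hN.measurableSet_moderate h)).inter ((h.law i₀).meas measurableSet_good).compl
  set b := x ^ 2 + 2 * c * x with hb
  change MeasurableSet (tailEvent x t c Z ∩ moderate x Z nu ∩ {ω | Z i₀ ω ∉ good}) at hE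
  set E := tailEvent x t c Z ∩ moderate x Z nu ∩ {ω | Z i₀ ω ∉ good} with hEdef
  set κ : ℝ := 1 + 10 ^ 10 * R with hκ
  have hκ0 : 0 ≤ κ := by positivity
  set m := ∑ i, w i * tiltMean μ ρ l (Z i) (fun z => z.2 ^ 2) - t ^ 2 with hmdef
  set Y : Ω → ℝ := fun ω => l * tiltSd μ ρ l Z * ∑ i, goodStd μ ρ l Z i (Z i ω)
    + ∑ i, badDev μ ρ l Z nu i (Z i ω) with hY
  set H : Ω → ℝ := fun ω => ∑ i, mixSqDev μ ρ l Z w i (Z i ω) with hH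
  have hYm : Measurable Y :=
    ((Finset.measurable_fun_sum _ fun i _ =>
      (measurable_goodStd i).comp (h.law i).meas).const_mul _).add
      (Finset.measurable_fun_sum _ fun i _ => (hN.measurable_badDev i).comp (h.law i).meas)
  have hHm : Measurable H :=
    Finset.measurable_fun_sum _ fun i _ => (measurable_mixSqDev i).comp (h.law i).meas
  have bH : ∀ ω, |H ω| ≤ Fintype.card ι * 1 := fun ω =>
    abs_sum_le_card_mul fun i => hM.abs_mixSqDev_le hQ h i _
  set B : Set Ω := {ω | t / 2 ≤ |H ω|} with hB
  have hBm : MeasurableSet B := measurableSet_le measurable_const hHm.abs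
  have htail : ∫ ω, B.indicator (fun ω => Real.exp (4 * |H ω|)) ω ∂Q'
      ≤ 36 / t * (Real.exp (2 * 10 ^ 5 * R) - 1) := by
    refine (integral_exp_abs_tail_le (fun i => (measurable_mixSqDev i).comp (h.law i).meas)
      (hM.iIndepFun_comp fun i => measurable_mixSqDev i) (fun i ω => hM.abs_mixSqDev_le hQ h i _)
      (fun i => hM.integral_mixSqDev h i)
      (hM.sum_integral_mixSqDev_sq_le hQ h hl.zero_le hl.le_one)
      (a := 4) (by norm_num) (by linarith [h.one_le_t])).trans ?_
    have h4 : Real.exp ((4 + 1) ^ 2 * Real.exp (4 + 1) * (42 * R)) ≤ Real.exp (2 * 10 ^ 5 * R) := by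
      refine Real.exp_le_exp.2 ?_
      nlinarith [exp_five_le]
    have h5 : 1 ≤ Real.exp ((4 + 1) ^ 2 * Real.exp (4 + 1) * (42 * R)) :=
      Real.one_le_exp (by positivity)
    have h6 := exp_neg_half_le ht
    calc _ ≤ 18 * (2 / t) * (Real.exp (2 * 10 ^ 5 * R) - 1) := by
          refine mul_le_mul (mul_le_mul_of_nonneg_left h6 (by norm_num)) (by linarith)
            (by linarith) (by positivity)
      _ = _ := by ring
  have hconc : ∫ ω, expTail 1 (Y ω + 2 * κ) ∂Q' ≤ 16 / t := by
    refine (integral_expTail_le_of_unit_intervals (hYm.add_const _) (p := 4 / x)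
      fun k => ?_).trans ?_
    · have := hM.concentration hQ h hN hx1 hl (k - 2 * κ)
      refine le_trans (le_of_eq ?_) this
      congr 1
      ext ω
      simp only [Set.mem_ofPred_eq, hY]
      constructor <;> rintro ⟨a, b⟩ <;> constructor <;> linarith
    · rw [← mul_div_assoc, div_le_div_iff₀ hx ht, h.t_eq]
      linarith
  set F : Ω → ℝ := fun ω => E.indicator
    (fun ω => Real.exp (-(l * ∑ i, xiGood ρ (Z i ω) + ∑ i, badPart nu i (Z i ω)))) ω with hF
  have hreal : μ.real E = ∫ ω, F ω * ∏ i, mixWt ρ l nu i₀ i (Z i ω) ∂μ := by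
    rw [← integral_indicator_one hE]
    refine integral_congr_ae (Filter.Eventually.of_forall fun ω => ?_)
    simp only [hF]
    by_cases hω : ω ∈ E
    · rw [Set.indicator_of_mem hω, Set.indicator_of_mem hω, prod_mixWt_of_notMem hω.2,
        ← Real.exp_add]
      simp
    · rw [Set.indicator_of_notMem hω, Set.indicator_of_notMem hω, zero_mul]
  have i1 : Integrable (fun ω => expTail 1 (Y ω + 2 * κ)) Q' :=
    integrable_of_abs_le ((measurable_expTail _).comp (hYm.add_const _)) fun ω =>
      abs_expTail_le_one zero_le_one _
  have i3 : Integrable (fun ω => B.indicator (fun ω => Real.exp (4 * |H ω|)) ω) Q' := by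
    refine Integrable.indicator ?_ hBm
    refine integrable_of_abs_le (K := Real.exp (4 * (Fintype.card ι * 1))) (by fun_prop) fun ω => ?_
    rw [abs_of_pos (Real.exp_pos _)]
    exact Real.exp_le_exp.2 (by linarith [bH ω])
  have hpt : ∀ ω, F ω ≤ Real.exp (-(l * b)) * (Real.exp (2 * κ) * expTail 1 (Y ω + 2 * κ)
      + B.indicator (fun ω => Real.exp (4 * |H ω|)) ω) := by
    intro ω
    have n1 := mul_nonneg (Real.exp_pos (2 * κ)).le (expTail_nonneg 1 (Y ω + 2 * κ))
    have n3 : 0 ≤ B.indicator (fun ω => Real.exp (4 * |H ω|)) ω :=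
      Set.indicator_nonneg (fun _ _ => (Real.exp_pos _).le) _
    by_cases hω : ω ∈ E
    swap
    · simp only [hF]
      rw [Set.indicator_of_notMem hω]
      positivity
    simp only [hF]
    rw [Set.indicator_of_mem hω]
    have hW : Y ω = l * ∑ i, xiGood ρ (Z i ω) + ∑ i, badPart nu i (Z i ω) - l * b :=
      sum_goodStd_add_sum_badDev hl hs0.ne' ω
    have e : Real.exp (-(l * ∑ i, xiGood ρ (Z i ω) + ∑ i, badPart nu i (Z i ω)))
        = Real.exp (-(l * b)) * Real.exp (-Y ω) := by
      rw [← Real.exp_add, hW]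
      ring_nf
    rw [e]
    refine mul_le_mul_of_nonneg_left ?_ (Real.exp_pos _).le
    set u := (H ω + m) / t ^ 2 with hu
    have hut : t ^ 2 * u = H ω + m := by
      rw [hu]
      field_simp
    have husq : t ^ 2 * (1 + u) = ∑ i, sqGood (Z i ω) := by
      rw [mul_add, hut]
      simp only [hH, hmdef, mixSqDev, Finset.sum_sub_distrib]
      ring
    obtain ⟨d1, d2⟩ := exponent_le h hN hl.le hl.ge hω.1.1 hω.1.2 husq
    rcases le_or_gt (x ^ 2 * u ^ 2) κ with hc | hc
    · have : Real.exp (-Y ω) = Real.exp (2 * κ) * expTail 1 (Y ω + 2 * κ) := by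
        rw [expTail_of_nonneg (by linarith), ← Real.exp_add]
        ring_nf
      linarith
    · have hC : 1 + 4 * (5 * 10 ^ 4) ^ 2 * R < x ^ 2 * u ^ 2 := by
        refine lt_of_le_of_lt (le_of_eq ?_) hc
        rw [hκ]
        norm_num
      obtain ⟨t1, t2⟩ := abs_le_of_cap_lt h hm' hut hC
      have hmem : ω ∈ B := t1
      rw [Set.indicator_of_mem hmem]
      have : Real.exp (-Y ω) ≤ Real.exp (4 * |H ω|) := Real.exp_le_exp.2 (by linarith)
      linarith
  have hFint : ∫ ω, F ω ∂Q' ≤ Real.exp (-(l * b)) * (200 / t * Real.exp (10 ^ 11 * R)) := by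
    have h1 := integral_mono_of_nonneg (Filter.Eventually.of_forall fun ω =>
      Set.indicator_nonneg (fun _ _ => (Real.exp_pos _).le) ω)
      (((i1.const_mul (Real.exp (2 * κ))).add i3).const_mul (Real.exp (-(l * b))))
      (Filter.Eventually.of_forall hpt)
    refine h1.trans ?_
    rw [integral_const_mul]
    refine mul_le_mul_of_nonneg_left ?_ (Real.exp_pos _).le
    simp only [Pi.add_apply]
    rw [integral_add (i1.const_mul _) i3, integral_const_mul]
    have h3 := mul_le_mul_of_nonneg_left hconc (Real.exp_pos (2 * κ)).le
    have h4 := large_arith hR ht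
    rw [← hκ] at h4
    linarith
  rw [hreal]
  refine (hM.change_le F fun ω => Set.indicator_nonneg (fun _ _ => (Real.exp_pos _).le) _).trans ?_
  refine mul_le_mul_of_nonneg_left hFint ?_
  have : 0 ≤ badMass μ Z nu i₀ := badMass_nonneg Z nu i₀
  positivity

/-- The tail event with some large pair and a moderate total exponent of the large pairs. -/
lemma LargeExponent.measureReal_moderate_le (hN : LargeExponent μ x t ρ R Z nu)
    (hQ : IsTilt μ Q ρ l Z) (h : Sample μ x t ρ c R ε Z) (hx1 : 1 ≤ x)
    (hl : IsSaddle μ x t ρ c R ε l Z) :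
    μ.real (tailEvent x t c Z ∩ moderate x Z nu ∩ (allGood Z)ᶜ)
      ≤ Real.exp (∑ i, Real.log (tiltMass μ ρ l (Z i)) - l * (x ^ 2 + 2 * c * x))
        * (8400 * (R / t) * Real.exp (2 * 10 ^ 11 * R)) := by
  have ht := h.t_pos
  have hR := h.R_pos
  set K := ∑ i, Real.log (tiltMass μ ρ l (Z i)) with hK
  set b := x ^ 2 + 2 * c * x with hb
  have hD : ∀ i, 0 ≤ badMass μ Z nu i := fun i => badMass_nonneg Z nu i
  have hi : ∀ i, μ.real (tailEvent x t c Z ∩ moderate x Z nu ∩ {ω | Z i ω ∉ good})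
      ≤ badMass μ Z nu i * (2 * Real.exp (K + 42 * R) *
        (Real.exp (-(l * b)) * (200 / t * Real.exp (10 ^ 11 * R)))) := by
    intro i
    rcases (hD i).eq_or_lt with h0 | h0
    · rw [← h0, zero_mul]
      refine (measureReal_mono Set.inter_subset_right).trans ?_
      rw [h0]
      exact hN.measureReal_notMem_good_le h i
    · obtain ⟨Q', w, hQ', hM⟩ := hN.exists_isMixedTilt h hl.zero_le hl.le_one h0
      refine (hM.measureReal_le hQ h hN hx1 hl).trans (le_of_eq ?_)
      ring
  have hcover : tailEvent x t c Z ∩ moderate x Z nu ∩ (allGood Z)ᶜ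
      ⊆ ⋃ i ∈ Finset.univ, tailEvent x t c Z ∩ moderate x Z nu ∩ {ω | Z i ω ∉ good} := by
    rintro ω ⟨h1, h2⟩
    have : ∃ i, Z i ω ∉ good := by
      by_contra hc
      push Not at hc
      exact h2 hc
    obtain ⟨i, hi⟩ := this
    simp only [Set.mem_iUnion]
    exact ⟨i, Finset.mem_univ i, h1, hi⟩
  refine (measureReal_mono hcover (measure_ne_top _ _)).trans ?_
  refine (measureReal_biUnion_finset_le _ _).trans ?_
  refine (Finset.sum_le_sum fun i _ => hi i).trans ?_
  rw [← Finset.sum_mul]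
  refine (mul_le_mul_of_nonneg_right (hN.sum_badMass_le h) (by positivity)).trans ?_
  have e : 21 * R * (2 * Real.exp (K + 42 * R) *
      (Real.exp (-(l * b)) * (200 / t * Real.exp (10 ^ 11 * R))))
      = Real.exp (K - l * b) * (8400 * (R / t) * Real.exp (42 * R + 10 ^ 11 * R)) := by
    rw [sub_eq_add_neg, Real.exp_add, Real.exp_add, Real.exp_add]
    ring
  rw [e]
  have : Real.exp (42 * R + 10 ^ 11 * R) ≤ Real.exp (2 * 10 ^ 11 * R) :=
    Real.exp_le_exp.2 (by linarith)
  gcongr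

/-- Exponential Markov inequality for the total exponent of the large pairs. -/
lemma LargeExponent.measureReal_compl_moderate_le (hN : LargeExponent μ x t ρ R Z nu)
    (h : Sample μ x t ρ c R ε Z) :
    μ.real (moderate x Z nu)ᶜ ≤ Real.exp (-(76 / 100 * x ^ 2)) * (21 * R * Real.exp (21 * R)) := by
  have hD : ∀ i, 0 ≤ badMass μ Z nu i := fun i => badMass_nonneg Z nu i
  have hm := (hN.measurableSet_moderate h).compl
  have hprod : ∫ ω, ∏ i, (1 + badWt nu i (Z i ω)) ∂μ = ∏ i, (1 + badMass μ Z nu i) := by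
    rw [h.ind.integral_fun_prod_comp (f := fun i z => 1 + badWt nu i z)
      (fun i => (h.law i).meas.aemeasurable)
      (fun i => ((hN.measurable_badWt i).const_add 1).aestronglyMeasurable)]
    refine Finset.prod_congr rfl fun i _ => ?_
    rw [integral_add (integrable_const _) (hN.int_badWt h i).1]
    simp [badMass]
  have hint : Integrable (fun ω => ∏ i, (1 + badWt nu i (Z i ω))) μ := by
    by_contra hcon
    rw [integral_undef hcon] at hprod
    have : 0 < ∏ i, (1 + badMass μ Z nu i) := Finset.prod_pos fun i _ => by linarith [hD i]
    exact this.ne hprod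
  have hpt : ∀ ω, (moderate x Z nu)ᶜ.indicator (1 : Ω → ℝ) ω
      ≤ Real.exp (-(76 / 100 * x ^ 2)) * (∏ i, (1 + badWt nu i (Z i ω)) - 1) := by
    intro ω
    have hnn := fun i => badWt_nonneg nu i (Z i ω)
    have h1 : 1 ≤ ∏ i, (1 + badWt nu i (Z i ω)) := Finset.one_le_prod fun i _ => by
      linarith [hnn i]
    by_cases hω : ω ∈ moderate x Z nu
    · rw [Set.indicator_of_notMem (Set.notMem_compl_iff.2 hω)]
      exact mul_nonneg (Real.exp_pos _).le (by linarith)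
    rw [Set.indicator_of_mem (show ω ∈ (moderate x Z nu)ᶜ from hω), Pi.one_apply]
    have hlt : 78 / 100 * x ^ 2 < ∑ i, badNu nu i (Z i ω) := not_le.1 hω
    have hpart : 76 / 100 * x ^ 2 ≤ ∑ i, badPart nu i (Z i ω) := by
      have : 98 / 100 * ∑ i, badNu nu i (Z i ω) ≤ ∑ i, badPart nu i (Z i ω) := by
        rw [Finset.mul_sum]
        refine Finset.sum_le_sum fun i _ => ?_
        rw [badPart_eq]
        have : 0 ≤ goodᶜ.indicator (1 : ℝ × ℝ → ℝ) (Z i ω) :=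
          Set.indicator_nonneg (fun _ _ => zero_le_one) _
        linarith
      nlinarith [sq_nonneg x]
    have hbad : ∃ i, Z i ω ∉ good := by
      by_contra hc
      push Not at hc
      have : ∑ i, badPart nu i (Z i ω) = 0 := Finset.sum_eq_zero fun i _ => badPart_of_mem (hc i)
      have := h.x_pos
      nlinarith
    obtain ⟨i, hi⟩ := hbad
    -- the factors are at least `1`, and at a large pair the factor exceeds its exponential by `1`
    have h2 : ∏ i, Real.exp (badPart nu i (Z i ω)) + ∏ _i : ι, (1 : ℝ)
        ≤ ∏ i, (1 + badWt nu i (Z i ω)) := by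
      refine Finset.prod_add_prod_le (Finset.mem_univ i) ?_ (fun j _ _ => ?_) (fun j _ _ => ?_)
        (fun j _ => (Real.exp_pos _).le) fun j _ => zero_le_one
      · rw [badPart_of_notMem hi, badWt_of_notMem hi, add_comm]
      · by_cases hj : Z j ω ∈ good
        · rw [badPart_of_mem hj, Real.exp_zero]
          linarith [hnn j]
        · rw [badPart_of_notMem hj, badWt_of_notMem hj]
          linarith
      · linarith [hnn j]
    rw [← Real.exp_sum, Finset.prod_const_one] at h2
    have h3 : Real.exp (76 / 100 * x ^ 2) ≤ ∏ i, (1 + badWt nu i (Z i ω)) - 1 := by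
      have := Real.exp_le_exp.2 hpart
      linarith
    calc (1 : ℝ) = Real.exp (-(76 / 100 * x ^ 2)) * Real.exp (76 / 100 * x ^ 2) := by
          rw [← Real.exp_add]
          simp
      _ ≤ _ := mul_le_mul_of_nonneg_left h3 (Real.exp_pos _).le
  rw [← integral_indicator_one hm]
  refine (integral_mono ((integrable_const (1 : ℝ)).indicator hm)
    ((hint.sub (integrable_const _)).const_mul _) hpt).trans ?_
  rw [integral_const_mul]
  refine mul_le_mul_of_nonneg_left ?_ (Real.exp_pos _).le
  simp only [Pi.sub_apply]
  rw [integral_sub hint (integrable_const _), hprod]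
  simp only [integral_const, probReal_univ, smul_eq_mul, one_mul]
  have h1 : ∏ i, (1 + badMass μ Z nu i) ≤ Real.exp (21 * R) := by
    refine (Finset.prod_le_prod (fun i _ => by linarith [hD i]) fun i _ => by
      linarith [Real.add_one_le_exp (badMass μ Z nu i)]).trans
      (?_ : ∏ i, Real.exp (badMass μ Z nu i) ≤ _)
    rw [← Real.exp_sum]
    exact Real.exp_le_exp.2 (hN.sum_badMass_le h)
  have h2 : Real.exp (21 * R) * (1 - 21 * R) ≤ 1 := by
    have := Real.add_one_le_exp (-(21 * R))
    calc _ ≤ Real.exp (21 * R) * Real.exp (-(21 * R)) :=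
          mul_le_mul_of_nonneg_left (by linarith) (Real.exp_pos _).le
      _ = 1 := by rw [← Real.exp_add]; simp
  linarith

end LargeBound

/-! ### The two-sided bound -/

section TwoSided

variable {Ω : Type*} [MeasurableSpace Ω] {μ Q : Measure Ω} {ι : Type*} [Fintype ι]
  {x t ρ c R ε l : ℝ} {Z : ι → Ω → ℝ × ℝ} {nu : ι → ℝ × ℝ → ℝ}
  [IsProbabilityMeasure μ]

/-- The main term is not smaller than a Gaussian bound with a margin. -/
lemma Sample.exponent_ge (h : Sample μ x t ρ c R ε Z) (hl : IsSaddle μ x t ρ c R ε l Z) :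
    -(721 / 1000 * x ^ 2) - 3 * 10 ^ 12 * R
      ≤ ∑ i, Real.log (tiltMass μ ρ l (Z i)) - l * (x ^ 2 + 2 * c * x) := by
  have h1 := (abs_le.1 (h.abs_exponent_sub_le hl.le hl.ge hl.near)).1
  obtain ⟨g1, g2, -⟩ := h.gamma_mem
  have h2 := (abs_le.1 (h.abs_skew_le (by linarith : 0 ≤ (1 + c / x) / 2) (by linarith))).1
  have h3 := mul_le_mul_of_nonneg_left h.sqrt_R_le h.x_pos.le
  have h4 : (x + c) ^ 2 ≤ (6 / 5 * x) ^ 2 := by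
    obtain ⟨c1, c2⟩ := abs_le.1 h.abs_c_le
    exact pow_le_pow_left₀ (by linarith [h.x_pos]) (by linarith) 2
  norm_num at h3
  nlinarith [sq_nonneg x]

lemma Sample.measureReal_compl_allGood_le (h : Sample μ x t ρ c R ε Z) :
    μ.real (allGood Z)ᶜ ≤ R := by
  have hcover : (allGood Z)ᶜ ⊆ ⋃ i ∈ Finset.univ, {ω | Z i ω ∉ good} := by
    intro ω h2
    have : ∃ i, Z i ω ∉ good := by
      by_contra hc
      push Not at hc
      exact h2 hc
    obtain ⟨i, hi⟩ := this
    simp only [Set.mem_iUnion]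
    exact ⟨i, Finset.mem_univ i, hi⟩
  exact (measureReal_mono hcover (measure_ne_top _ _)).trans
    ((measureReal_biUnion_finset_le _ _).trans
      ((Finset.sum_le_sum fun i _ => h.measureReal_notMem_good_le i).trans h.sum_dd))

/-- The tail event with some large pair. -/
lemma LargeExponent.measureReal_compl_allGood_le [IsProbabilityMeasure Q]
    (hN : LargeExponent μ x t ρ R Z nu) (hQ : IsTilt μ Q ρ l Z) (h : Sample μ x t ρ c R ε Z)
    (hl : IsSaddle μ x t ρ c R ε l Z) :
    μ.real (tailEvent x t c Z ∩ (allGood Z)ᶜ)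
      ≤ Real.exp (∑ i, Real.log (tiltMass μ ρ l (Z i)) - l * (x ^ 2 + 2 * c * x))
        * (2 * 10 ^ 4 * (R / t) * Real.exp (4 * 10 ^ 12 * R)) := by
  have hK := h.exponent_ge hl
  have hx := h.x_pos
  have ht := h.t_pos
  have hR := h.R_pos
  set k := ∑ i, Real.log (tiltMass μ ρ l (Z i)) - l * (x ^ 2 + 2 * c * x) with hk
  have hRt : 0 < R / t := by positivity
  rcases le_or_gt 1 x with hx1 | hx1
  · have h1 := hN.measureReal_moderate_le hQ h hx1 hl
    have h2 := hN.measureReal_compl_moderate_le h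
    have hsub : tailEvent x t c Z ∩ (allGood Z)ᶜ
        ⊆ (tailEvent x t c Z ∩ moderate x Z nu ∩ (allGood Z)ᶜ) ∪ (moderate x Z nu)ᶜ := by
      rintro ω ⟨a, b⟩
      by_cases hm : ω ∈ moderate x Z nu
      · exact Or.inl ⟨⟨a, hm⟩, b⟩
      · exact Or.inr hm
    have h3 := (measureReal_mono hsub (measure_ne_top μ _)).trans (measureReal_union_le _ _)
    have h4 : Real.exp (-(39 / 1000 * x ^ 2)) ≤ 100 / t := by
      rw [Real.exp_neg, inv_le_comm₀ (Real.exp_pos _) (by positivity), inv_div,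
        div_le_iff₀ (by norm_num), h.t_eq]
      nlinarith [Real.add_one_le_exp (39 / 1000 * x ^ 2)]
    have h5 : Real.exp (-(76 / 100 * x ^ 2))
        ≤ Real.exp k * Real.exp (3 * 10 ^ 12 * R) * (100 / t) := by
      refine le_trans ?_ (mul_le_mul_of_nonneg_left h4 (by positivity))
      rw [← Real.exp_add, ← Real.exp_add]
      exact Real.exp_le_exp.2 (by linarith)
    have h6 := mul_le_mul_of_nonneg_right h5
      (by positivity : 0 ≤ 21 * R * Real.exp (21 * R))
    have e6 : Real.exp k * Real.exp (3 * 10 ^ 12 * R) * (100 / t) * (21 * R * Real.exp (21 * R))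
        = Real.exp k * (2100 * (R / t) * Real.exp (3 * 10 ^ 12 * R + 21 * R)) := by
      rw [Real.exp_add]
      ring
    rw [e6] at h6
    have h7 : Real.exp (3 * 10 ^ 12 * R + 21 * R) ≤ Real.exp (4 * 10 ^ 12 * R) :=
      Real.exp_le_exp.2 (by linarith)
    have h8 : Real.exp (2 * 10 ^ 11 * R) ≤ Real.exp (4 * 10 ^ 12 * R) :=
      Real.exp_le_exp.2 (by linarith)
    have h9 : 8400 * (R / t) * Real.exp (2 * 10 ^ 11 * R)
        + 2100 * (R / t) * Real.exp (3 * 10 ^ 12 * R + 21 * R)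
        ≤ 2 * 10 ^ 4 * (R / t) * Real.exp (4 * 10 ^ 12 * R) := by
      have a1 := mul_le_mul_of_nonneg_left h8 hRt.le
      have a2 := mul_le_mul_of_nonneg_left h7 hRt.le
      have a3 := mul_pos hRt (Real.exp_pos (4 * 10 ^ 12 * R))
      linarith
    have h10 := mul_le_mul_of_nonneg_left h9 (Real.exp_pos k).le
    linarith
  · refine (measureReal_mono Set.inter_subset_right).trans
      (h.measureReal_compl_allGood_le.trans ?_)
    have h1 : Real.exp (-1) ≤ Real.exp k * Real.exp (4 * 10 ^ 12 * R) := by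
      rw [← Real.exp_add]
      refine Real.exp_le_exp.2 ?_
      nlinarith
    have h2 : 1 / 3 ≤ Real.exp (-1) := by
      rw [Real.exp_neg, one_div]
      exact inv_anti₀ (Real.exp_pos _) (by linarith [Real.exp_one_lt_d9])
    have h3 : R ≤ 2 * (R / t) := by
      rw [← mul_div_assoc, le_div_iff₀ ht, h.t_eq]
      nlinarith
    have h4 := mul_le_mul_of_nonneg_left (h2.trans h1) (by positivity : 0 ≤ 2 * 10 ^ 4 * (R / t))
    linarith

lemma exp_sub_one_le (a : ℝ) : Real.exp a - 1 ≤ a * Real.exp a := by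
  have h := mul_le_mul_of_nonneg_left (Real.add_one_le_exp (-a)) (Real.exp_pos a).le
  rw [← Real.exp_add, add_neg_cancel, Real.exp_zero] at h
  linarith

lemma upper_arith {m t R ε : ℝ} (hR : 0 < R) (hε : 0 < ε) (hm : 0 < m)
    (hmt : 1 / t ≤ 24 * m) :
    m * (1 + 10 ^ 11 * ε)
      + Real.exp (1 + 10 ^ 10 * R) * (10 ^ 7 * (ε / t) + 4 * 10 ^ 9 * (R / t))
      + 36 / t * (Real.exp (10 ^ 4 * R) - 1) + 2 * 10 ^ 4 * (R / t) * Real.exp (4 * 10 ^ 12 * R)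
      ≤ m * (Real.exp (5 * 10 ^ 12 * R) * (1 + 10 ^ 12 * ε)) := by
  set E := Real.exp (4 * 10 ^ 12 * R) with hE
  have hE1 : 1 ≤ E := Real.one_le_exp (by positivity)
  have hεt : ε / t ≤ 24 * (m * ε) := by
    have := mul_le_mul_of_nonneg_left hmt hε.le
    rw [mul_one_div] at this
    linarith
  have hRt : R / t ≤ 24 * (m * R) := by
    have := mul_le_mul_of_nonneg_left hmt hR.le
    rw [mul_one_div] at this
    linarith
  have e1 : Real.exp (1 + 10 ^ 10 * R) ≤ 3 * E := by
    rw [Real.exp_add]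
    exact mul_le_mul (by linarith [Real.exp_one_lt_d9]) (Real.exp_le_exp.2 (by linarith))
      (Real.exp_pos _).le (by norm_num)
  have e2 : Real.exp (10 ^ 4 * R) - 1 ≤ 10 ^ 4 * R * E :=
    (exp_sub_one_le _).trans (mul_le_mul_of_nonneg_left (Real.exp_le_exp.2 (by linarith))
      (by positivity))
  have h1 : Real.exp (1 + 10 ^ 10 * R) * (10 ^ 7 * (ε / t) + 4 * 10 ^ 9 * (R / t))
      ≤ 3 * E * (10 ^ 7 * (24 * (m * ε)) + 4 * 10 ^ 9 * (24 * (m * R))) :=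
    (mul_le_mul_of_nonneg_left (by linarith) (Real.exp_pos _).le).trans
      (mul_le_mul_of_nonneg_right e1 (by positivity))
  have h2 : 36 / t * (Real.exp (10 ^ 4 * R) - 1) ≤ 36 * (24 * m) * (10 ^ 4 * R * E) := by
    have a0 : 0 ≤ Real.exp (10 ^ 4 * R) - 1 := by
      linarith [Real.one_le_exp (by positivity : 0 ≤ 10 ^ 4 * R)]
    have a1 : 36 / t = 36 * (1 / t) := by ring
    rw [a1]
    exact mul_le_mul (by linarith) e2 a0 (by positivity)
  have h3 : 2 * 10 ^ 4 * (R / t) * E ≤ 2 * 10 ^ 4 * (24 * (m * R)) * E := by gcongr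
  have h4 : E * (1 + 10 ^ 12 * R) ≤ Real.exp (5 * 10 ^ 12 * R) := by
    have e : 5 * 10 ^ 12 * R = 4 * 10 ^ 12 * R + 10 ^ 12 * R := by ring
    rw [e, Real.exp_add]
    exact mul_le_mul_of_nonneg_left (by linarith [Real.add_one_le_exp (10 ^ 12 * R)])
      (by positivity)
  have h5 : m * (E * (1 + 10 ^ 12 * R) * (1 + 10 ^ 12 * ε))
      ≤ m * (Real.exp (5 * 10 ^ 12 * R) * (1 + 10 ^ 12 * ε)) := by gcongr
  refine le_trans ?_ h5
  have p1 : 0 ≤ m * (E * (R * ε)) := by positivity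
  have p2 : 0 ≤ m * (E * ε) := by positivity
  have p3 : 0 ≤ m * (E * R) := by positivity
  have p4 : 0 ≤ m * (E - 1) := mul_nonneg hm.le (by linarith)
  have p5 : 0 ≤ m * ε * (E - 1) := mul_nonneg (by positivity) (by linarith)
  linarith

/-- The tail probability is within the required factors of the Gaussian tail times the skewness
correction. -/
theorem Sample.tail_bounds (h : Sample μ x t ρ c R ε Z) (hN : LargeExponent μ x t ρ R Z nu) :
    (1 - Phi (x + c)) * Real.exp (skew μ ρ ((1 + c / x) / 2) Z)
        * (Real.exp (-(10 ^ 13 * R)) * (1 - 10 ^ 13 * ε)) ≤ μ.real (tailEvent x t c Z) ∧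
      μ.real (tailEvent x t c Z) ≤ (1 - Phi (x + c)) * Real.exp (skew μ ρ ((1 + c / x) / 2) Z)
        * (Real.exp (10 ^ 13 * R) * (1 + 10 ^ 13 * ε)) := by
  obtain ⟨l, l1, l2, l3, l4, l5⟩ := h.exists_saddle
  have hl : IsSaddle μ x t ρ c R ε l Z := ⟨l1, l2, l3, l4, l5⟩
  obtain ⟨Q, hQp, hQ⟩ := h.exists_isTilt hl.zero_le hl.le_one
  have hx := h.x_pos
  have ht := h.t_pos
  have hR := h.R_pos
  have hε := h.eps_pos
  have hlow := hQ.lower_bound h hl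
  have hup := hQ.upper_bound_allGood h hl
  have hup2 := hN.measureReal_compl_allGood_le hQ h hl
  have hexp := abs_le.1 (h.abs_exponent_sub_le hl.le hl.ge hl.near)
  have hint := (abs_le.1 (hQ.abs_integral_expTail_sub_le h hl)).1
  obtain ⟨c1, c2⟩ := abs_le.1 h.abs_c_le
  have hm : 0 < mills (x + c) := mills_pos (by linarith)
  have hmt : 1 / t ≤ 24 * mills (x + c) := by
    have h1 : 1 / (24 * t) ≤ mills (x + c) := by
      refine le_trans ?_ (le_mills (by linarith))
      rw [div_le_div_iff₀ (by positivity) (by linarith)]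
      linarith [h.t_eq]
    have e : 1 / t = 24 * (1 / (24 * t)) := by field_simp
    linarith
  have harith := upper_arith hR hε hm hmt
  rw [one_sub_Phi_eq]
  set m := mills (x + c) with hmdef
  set k := ∑ i, Real.log (tiltMass μ ρ l (Z i)) - l * (x ^ 2 + 2 * c * x) with hk
  set σ := skew μ ρ ((1 + c / x) / 2) Z with hσ
  have hG : ∀ a : ℝ, Real.exp (-(x + c) ^ 2 / 2) * m * Real.exp σ * (Real.exp a)
      = m * Real.exp (-(x + c) ^ 2 / 2 + σ + a) := fun a => by
    rw [Real.exp_add, Real.exp_add]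
    ring
  constructor
  · have h1 : Real.exp k * (m * (1 - 10 ^ 11 * ε)) ≤ μ.real (tailEvent x t c Z) :=
      (mul_le_mul_of_nonneg_left (by linarith) (Real.exp_pos k).le).trans hlow
    refine le_trans ?_ h1
    rw [← mul_assoc, hG]
    have h2 : Real.exp (-(x + c) ^ 2 / 2 + σ + -(10 ^ 13 * R)) ≤ Real.exp k :=
      Real.exp_le_exp.2 (by linarith [hexp.1])
    have h3 : 0 ≤ 1 - 10 ^ 11 * ε := by
      have := h.eps_le
      norm_num at this
      linarith
    have h4 := mul_le_mul_of_nonneg_right h2 (mul_nonneg hm.le h3)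
    have h5 := mul_nonneg (mul_nonneg hm.le (Real.exp_pos (-(x + c) ^ 2 / 2 + σ
      + -(10 ^ 13 * R))).le) hε.le
    linarith
  · have hsplit : μ.real (tailEvent x t c Z) ≤ μ.real (tailEvent x t c Z ∩ allGood Z)
        + μ.real (tailEvent x t c Z ∩ (allGood Z)ᶜ) := by
      refine (measureReal_mono ?_ (measure_ne_top μ _)).trans (measureReal_union_le _ _)
      rw [Set.inter_union_compl]
    have h1 := mul_le_mul_of_nonneg_left harith (Real.exp_pos k).le
    have h2 : μ.real (tailEvent x t c Z)
        ≤ Real.exp k * (m * (Real.exp (5 * 10 ^ 12 * R) * (1 + 10 ^ 12 * ε))) := by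
      refine (hsplit.trans (add_le_add hup hup2)).trans (le_trans (le_of_eq ?_) h1)
      ring
    refine h2.trans ?_
    rw [← mul_assoc (Real.exp (-(x + c) ^ 2 / 2) * m * Real.exp σ), hG]
    have h3 : Real.exp k * Real.exp (5 * 10 ^ 12 * R)
        ≤ Real.exp (-(x + c) ^ 2 / 2 + σ + 10 ^ 13 * R) := by
      rw [← Real.exp_add]
      exact Real.exp_le_exp.2 (by linarith [hexp.2])
    have h4 := mul_le_mul_of_nonneg_right h3 (by positivity : 0 ≤ m * (1 + 10 ^ 12 * ε))
    have h5 : m * Real.exp (-(x + c) ^ 2 / 2 + σ + 10 ^ 13 * R) * (1 + 10 ^ 12 * ε)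
        ≤ m * Real.exp (-(x + c) ^ 2 / 2 + σ + 10 ^ 13 * R) * (1 + 10 ^ 13 * ε) := by
      refine mul_le_mul_of_nonneg_left (by linarith) (by positivity)
    linarith

/-- A two-sided bound with the factors `exp (A R)` and `1 + A ε` yields an exact representation. -/
lemma exists_factors {p G A : ℝ} (hG : 0 < G) (hR : 0 < R) (hε : 0 < ε) (hA : 0 < A)
    (hlow : G * (Real.exp (-(A * R)) * (1 - A * ε)) ≤ p)
    (hup : p ≤ G * (Real.exp (A * R) * (1 + A * ε))) :
    ∃ O₁ O₂ : ℝ, |O₁| ≤ A ∧ |O₂| ≤ A ∧ p = G * Real.exp (O₁ * R) * (1 + O₂ * ε) := by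
  obtain ⟨r, rfl⟩ : ∃ r, p = G * r := ⟨p / G, by field_simp⟩
  have hlow' := le_of_mul_le_mul_left hlow hG
  have hup' := le_of_mul_le_mul_left hup hG
  have hAR : 0 < A * R := by positivity
  have key : ∀ E : ℝ, 0 < E → E * (1 - A * ε) ≤ r → r ≤ E * (1 + A * ε) →
      |(r / E - 1) / ε| ≤ A ∧ r = E * (1 + (r / E - 1) / ε * ε) := fun E hE h1 h2 => by
    constructor
    · rw [abs_div, abs_of_pos hε, div_le_iff₀ hε, abs_le]
      have a1 : 1 - A * ε ≤ r / E := by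
        rw [le_div_iff₀ hE]
        linarith
      have a2 : r / E ≤ 1 + A * ε := by
        rw [div_le_iff₀ hE]
        linarith
      constructor <;> linarith
    · field_simp
      ring
  rcases le_or_gt r (Real.exp (-(A * R))) with h1 | h1
  · obtain ⟨k1, k2⟩ := key _ (Real.exp_pos _) hlow' (h1.trans
      (le_mul_of_one_le_right (Real.exp_pos _).le (by nlinarith)))
    refine ⟨-A, _, by rw [abs_neg, abs_of_pos hA], k1, ?_⟩
    rw [neg_mul, mul_assoc, ← k2]
  rcases le_or_gt (Real.exp (A * R)) r with h2 | h2
  · obtain ⟨k1, k2⟩ := key _ (Real.exp_pos _) ((mul_le_of_le_one_right (Real.exp_pos _).le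
      (by nlinarith)).trans h2) hup'
    refine ⟨A, _, by rw [abs_of_pos hA], k1, ?_⟩
    rw [mul_assoc, ← k2]
  · have hr : 0 < r := (Real.exp_pos _).trans h1
    refine ⟨Real.log r / R, 0, ?_, by simpa using hA.le, ?_⟩
    · rw [abs_div, abs_of_pos hR, div_le_iff₀ hR, abs_le]
      exact ⟨(Real.le_log_iff_exp_le hr).2 h1.le, (Real.log_le_iff_le_exp hr).2 h2.le⟩
    · rw [div_mul_cancel₀ _ hR.ne', Real.exp_log hr]
      ring

end TwoSided

/-! ### From the moment conditions to the scaled pairs -/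

section Scaling

lemma third_moment_sq_le {y s : ℝ} (hy : 0 ≤ y) (hs : 0 < s) :
    y ^ 2 ≤ s ^ 2 / 3 + 2 / 3 * (y ^ 3 / s) := by
  have h : 0 ≤ (y - s) ^ 2 * (2 * y + s) / (3 * s) := by positivity
  have e : (y - s) ^ 2 * (2 * y + s) / (3 * s) = s ^ 2 / 3 + 2 / 3 * (y ^ 3 / s) - y ^ 2 := by
    field_simp
    ring
  linarith

lemma tiltExponent_le (c₀ x m a b : ℝ) : tiltExponent c₀ x m a b ≤ 2 * x * a := by
  unfold tiltExponent
  split_ifs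
  · exact le_rfl
  · exact min_le_right _ _

/-- The exponent dominates the first component up to a quadratic term in the second one. -/
lemma le_tiltExponent {c₀ x m a b r : ℝ} (hx : 0 < x) (hm : 0 ≤ c₀ * m)
    (hxm : x ^ 2 * (c₀ * m) ≤ 1 / 4) (hr : 0 < r) (hrx : r ≤ x) :
    a ≤ max (tiltExponent c₀ x m a b) 0 / (2 * r) + r * b ^ 2 / 2 + 1 / (8 * x) := by
  have h0 : 0 ≤ r * b ^ 2 / 2 := by positivity
  have h1 : 0 ≤ 1 / (8 * x) := by positivity
  have h2 : 0 ≤ max (tiltExponent c₀ x m a b) 0 / (2 * r) :=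
    div_nonneg (le_max_right _ _) (by positivity)
  rcases le_or_gt a 0 with ha | ha
  · linarith
  have hlin : tiltExponent c₀ x m a b = 2 * x * a →
      a ≤ max (tiltExponent c₀ x m a b) 0 / (2 * r) + r * b ^ 2 / 2 + 1 / (8 * x) := by
    intro e
    have : a ≤ max (tiltExponent c₀ x m a b) 0 / (2 * r) := by
      rw [le_div_iff₀ (by positivity), e]
      refine le_trans ?_ (le_max_left _ _)
      nlinarith
    linarith
  by_cases hD : b ^ 2 + c₀ * m = 0
  · exact hlin (if_pos hD)
  rcases le_total (2 * x * a) (a ^ 2 / (b ^ 2 + c₀ * m)) with hle | hle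
  · exact hlin (by rw [tiltExponent, if_neg hD, min_eq_right hle])
  · have e : tiltExponent c₀ x m a b = a ^ 2 / (b ^ 2 + c₀ * m) := by
      rw [tiltExponent, if_neg hD, min_eq_left hle]
    set D := b ^ 2 + c₀ * m with hDdef
    have hD0 : 0 < D := lt_of_le_of_ne (by positivity) (Ne.symm hD)
    have h3 : a ≤ a ^ 2 / D / (2 * r) + r * D / 2 := by
      have h4 : 0 ≤ (a - r * D) ^ 2 / (2 * r * D) := by positivity
      have e4 : (a - r * D) ^ 2 / (2 * r * D) = a ^ 2 / D / (2 * r) + r * D / 2 - a := by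
        field_simp
        ring
      linarith
    have h5 : a ^ 2 / D / (2 * r) ≤ max (tiltExponent c₀ x m a b) 0 / (2 * r) := by
      rw [e]
      exact div_le_div_of_nonneg_right (le_max_left _ _) (by positivity)
    have h6 : r * (c₀ * m) / 2 ≤ 1 / (8 * x) := by
      rw [le_div_iff₀ (by positivity)]
      have := mul_le_mul_of_nonneg_right hrx (mul_nonneg hm hx.le)
      nlinarith
    have h7 : r * D / 2 = r * b ^ 2 / 2 + r * (c₀ * m) / 2 := by
      rw [hDdef]
      ring
    linarith

variable {Ω : Type*} [MeasurableSpace Ω] {μ : Measure Ω}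

lemma measurable_tiltExponent (c₀ x m t : ℝ) :
    Measurable fun z : ℝ × ℝ => tiltExponent c₀ x m (z.1 / t) (z.2 / t) := by
  unfold tiltExponent
  refine Measurable.ite ?_ (by fun_prop) (by fun_prop)
  exact (measurableSet_singleton (0 : ℝ)).preimage (f := fun z : ℝ × ℝ => (z.2 / t) ^ 2 + c₀ * m)
    (by fun_prop)

/-- The integral of the truncated power is the sum of the truncated moments. -/
lemma integral_trunc_mul {t : ℝ} (ht : 0 ≤ t) {f : Ω → ℝ} (hf : Measurable f)
    (hint : Integrable (fun ω => |f ω| ^ 3) μ) :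
    Integrable (fun ω => trunc (t * f ω)) μ ∧
    ∫ ω, trunc (t * f ω) ∂μ = t ^ 3 * ∫ ω in {ω | 1 < |t * f ω|}, |f ω| ^ 3 ∂μ
      + t ^ 4 * ∫ ω in {ω | |t * f ω| ≤ 1}, |f ω| ^ 4 ∂μ := by
  have hm1 : MeasurableSet {ω | 1 < |t * f ω|} := measurableSet_lt (by fun_prop) (by fun_prop)
  have hm2 : MeasurableSet {ω | |t * f ω| ≤ 1} := measurableSet_le (by fun_prop) (by fun_prop)
  have hi : Integrable (fun ω => trunc (t * f ω)) μ := by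
    refine (hint.const_mul (t ^ 3)).mono'
      (measurable_trunc.comp (hf.const_mul t)).aestronglyMeasurable
      (Filter.Eventually.of_forall fun ω => ?_)
    rw [Real.norm_eq_abs, abs_of_nonneg (trunc_nonneg _)]
    refine (trunc_le_cube _).trans (le_of_eq ?_)
    rw [abs_mul, abs_of_nonneg ht, mul_pow]
  refine ⟨hi, ?_⟩
  have hc : {ω | |t * f ω| ≤ 1}ᶜ = {ω | 1 < |t * f ω|} := by
    ext ω
    simp only [Set.mem_compl_iff, Set.mem_ofPred_eq, not_le]
  rw [← integral_add_compl hm2 hi, hc, ← integral_const_mul, ← integral_const_mul, add_comm]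
  congr 1
  · refine setIntegral_congr_fun hm1 fun ω hω => ?_
    have h1 : 1 < |t * f ω| := hω
    rw [show trunc (t * f ω) = |t * f ω| ^ 3 from if_neg (not_le.2 h1), abs_mul, abs_of_nonneg ht,
      mul_pow]
  · refine setIntegral_congr_fun hm2 fun ω hω => ?_
    have h1 : |t * f ω| ≤ 1 := hω
    rw [show trunc (t * f ω) = (t * f ω) ^ 4 from if_pos h1, mul_pow,
      (by decide : Even 4).pow_abs]

/-- The pair `(X, Y)` scaled by `t`. -/
def scaled {Ω : Type*} (t : ℝ) (X Y : Ω → ℝ) (ω : Ω) : ℝ × ℝ := (t * X ω, t * Y ω)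

variable {x t : ℝ} {X Y : Ω → ℝ}

lemma integral_dd_scaled (hx : 0 < x) (hX : Measurable X) (hY : Measurable Y)
    (iX : Integrable (fun ω => |X ω| ^ 3) μ) (iY : Integrable (fun ω => |Y ω| ^ 3) μ) :
    ∫ ω, dd (scaled (1 + x) X Y ω) ∂μ = deltaTerm μ x X Y := by
  obtain ⟨a1, a2⟩ := integral_trunc_mul (by linarith : 0 ≤ 1 + x) hX iX
  obtain ⟨b1, b2⟩ := integral_trunc_mul (by linarith : 0 ≤ 1 + x) hY iY
  unfold dd scaled deltaTerm
  rw [integral_add a1 b1, a2, b2]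
  ring

lemma cube_scaled {Ω : Type*} {X Y : Ω → ℝ} (ht : 0 ≤ t) (ω : Ω) :
    cube (scaled t X Y ω) = t ^ 3 * (|X ω| ^ 3 + |Y ω| ^ 3) := by
  simp only [cube, scaled, abs_mul, abs_of_nonneg ht, mul_pow]
  ring

lemma integral_cube_scaled (ht : 0 ≤ t) (iX : Integrable (fun ω => |X ω| ^ 3) μ)
    (iY : Integrable (fun ω => |Y ω| ^ 3) μ) :
    ∫ ω, cube (scaled t X Y ω) ∂μ = t ^ 3 * thirdMoment μ X Y := by
  simp only [cube_scaled ht]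
  rw [integral_const_mul, integral_add iX iY, thirdMoment]

lemma indicator_exp_scaled (c₀ : ℝ) (hx : 0 < x) (ω : Ω) :
    {z : ℝ × ℝ | 1 < |z.1|}.indicator (fun z => Real.exp (tiltExponent c₀ x (∫ ω', Y ω' ^ 2 ∂μ)
        (z.1 / (1 + x)) (z.2 / (1 + x)))) (scaled (1 + x) X Y ω)
      = {ω | 1 < |(1 + x) * X ω|}.indicator (expTilt μ c₀ x X Y) ω := by
  have h1 : 1 + x ≠ 0 := by positivity
  by_cases h : 1 < |(1 + x) * X ω|
  · rw [Set.indicator_of_mem (show scaled (1 + x) X Y ω ∈ {z : ℝ × ℝ | 1 < |z.1|} from h),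
      Set.indicator_of_mem (show ω ∈ {ω | 1 < |(1 + x) * X ω|} from h)]
    simp only [scaled, expTilt, mul_div_cancel_left₀ _ h1]
  · rw [Set.indicator_of_notMem (show scaled (1 + x) X Y ω ∉ {z : ℝ × ℝ | 1 < |z.1|} from h),
      Set.indicator_of_notMem (show ω ∉ {ω | 1 < |(1 + x) * X ω|} from h)]

lemma thirdMoment_nonneg (μ : Measure Ω) (X Y : Ω → ℝ) : 0 ≤ thirdMoment μ X Y :=
  add_nonneg (integral_nonneg fun _ => by positivity) (integral_nonneg fun _ => by positivity)

variable [IsProbabilityMeasure μ]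

lemma integral_snd_sq_le {s : ℝ} (hs : 0 < s) (iY : Integrable (fun ω => |Y ω| ^ 3) μ)
    (h : thirdMoment μ X Y ≤ s ^ 3) :
    ∫ ω, Y ω ^ 2 ∂μ ≤ s ^ 2 := by
  have i1 : Integrable (fun ω => s ^ 2 / 3 + 2 / 3 * (|Y ω| ^ 3 / s)) μ :=
    (integrable_const _).add ((iY.div_const s).const_mul _)
  have h1 : ∫ ω, Y ω ^ 2 ∂μ ≤ ∫ ω, (s ^ 2 / 3 + 2 / 3 * (|Y ω| ^ 3 / s)) ∂μ := by
    refine integral_mono_of_nonneg (Filter.Eventually.of_forall fun ω => sq_nonneg _) i1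
      (Filter.Eventually.of_forall fun ω => ?_)
    beta_reduce
    rw [← sq_abs]
    exact third_moment_sq_le (abs_nonneg _) hs
  rw [integral_add (integrable_const _) ((iY.div_const s).const_mul _), integral_const_mul] at h1
  simp only [integral_div, integral_const, probReal_univ, smul_eq_mul, one_mul] at h1
  have h2 : 0 ≤ ∫ ω, |X ω| ^ 3 ∂μ := integral_nonneg fun _ => by positivity
  have h3 : (∫ ω, |Y ω| ^ 3 ∂μ) / s ≤ s ^ 2 := by
    rw [div_le_iff₀ hs]
    unfold thirdMoment at h
    linarith
  linarith

/-- The scaled pair satisfies the moment conditions if `s` bounds the cube root of the third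
moment. -/
lemma pairLaw_scaled {s : ℝ} (hx : 0 < x) (hX : Measurable X) (hY : Measurable Y)
    (iX : Integrable (fun ω => |X ω| ^ 3) μ) (iY : Integrable (fun ω => |Y ω| ^ 3) μ)
    (h0 : ∫ ω, X ω ∂μ = 0) (hs : 0 < s) (h : thirdMoment μ X Y ≤ s ^ 3) (hxs : x * s ≤ 1 / 4)
    (hsmall : thirdMoment μ X Y ≤ 1 / 100) :
    PairLaw μ (x / (1 + x)) (scaled (1 + x) X Y) := by
  have ht : 0 < 1 + x := by linarith
  have h3 := thirdMoment_nonneg μ X Y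
  refine ⟨(hX.const_mul _).prodMk (hY.const_mul _), ?_, ?_, ?_, ?_, by positivity, ?_⟩
  · simp only [cube_scaled ht.le]
    exact (iX.add iY).const_mul _
  · simp only [scaled]
    rw [integral_const_mul, h0, mul_zero]
  · rw [integral_cube_scaled ht.le iX iY]
    have a1 : (1 + x) ^ 3 ≤ 4 * (1 + x ^ 3) := by
      nlinarith [mul_nonneg (by linarith : 0 ≤ 1 + x) (sq_nonneg (x - 1))]
    have a2 : x ^ 3 * thirdMoment μ X Y ≤ (1 / 4) ^ 3 := by
      calc _ ≤ x ^ 3 * s ^ 3 := by gcongr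
        _ = (x * s) ^ 3 := by ring
        _ ≤ _ := pow_le_pow_left₀ (by positivity) hxs 3
    have a3 := mul_le_mul_of_nonneg_right a1 h3
    norm_num at a2
    linarith
  · simp only [scaled, mul_pow]
    rw [integral_const_mul]
    have a1 := integral_snd_sq_le hs iY h
    have a2 : x ^ 2 * ∫ ω, Y ω ^ 2 ∂μ ≤ (1 / 4) ^ 2 := by
      calc _ ≤ x ^ 2 * s ^ 2 := by gcongr
        _ = (x * s) ^ 2 := by ring
        _ ≤ _ := pow_le_pow_left₀ (by positivity) hxs 2
    have e : (x / (1 + x)) ^ 2 * ((1 + x) ^ 2 * ∫ ω, Y ω ^ 2 ∂μ) = x ^ 2 * ∫ ω, Y ω ^ 2 ∂μ := by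
      field_simp
    rw [e]
    norm_num at a2
    linarith
  · rw [div_le_one ht]
    linarith

end Scaling

section Family

variable {Ω : Type*} [MeasurableSpace Ω] {μ : Measure Ω} {n : ℕ}
  {X Y : Fin n → Ω → ℝ} {c₀ x c : ℝ}

lemma rTerm_nonneg (μ : Measure Ω) (c₀ x : ℝ) (X Y : Ω → ℝ) : 0 ≤ rTerm μ c₀ x X Y :=
  integral_nonneg fun _ => (Real.exp_pos _).le

/-- The number `s` is the cube root of the largest third moment. The two bounds are the two halves of
the range condition on `x`. -/
lemma exists_thirdMoment_bound (hx : 0 < x) (hc₀ : 0 ≤ c₀) (hpos : 0 < L3 μ X Y)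
    (hrange : x ≤ rangeConst c₀ / (⨆ i, thirdMoment μ (X i) (Y i)) ^ (1 / 3 : ℝ)) :
    ∃ s : ℝ, 0 < s ∧ (∀ i, thirdMoment μ (X i) (Y i) ≤ s ^ 3) ∧ x * s ≤ 1 / 4 ∧
      (x * s) ^ 2 * c₀ ≤ 1 / 4 := by
  set m := ⨆ i, thirdMoment μ (X i) (Y i) with hm
  have hle : ∀ i, thirdMoment μ (X i) (Y i) ≤ m := fun i =>
    le_ciSup (f := fun i => thirdMoment μ (X i) (Y i)) (Set.finite_range _).bddAbove i
  have hm0 : 0 < m := by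
    obtain ⟨i, -, hi⟩ := Finset.exists_lt_of_sum_lt (s := Finset.univ) (f := fun _ : Fin n => (0 : ℝ))
      (g := fun i => thirdMoment μ (X i) (Y i)) (by simpa [L3] using hpos)
    exact hi.trans_le (hle i)
  set s := m ^ (1 / 3 : ℝ) with hs
  have hs0 : 0 < s := Real.rpow_pos_of_pos hm0 _
  have hs3 : s ^ 3 = m := by
    rw [hs, ← Real.rpow_natCast, ← Real.rpow_mul hm0.le]
    norm_num
  rw [le_div_iff₀ hs0] at hrange
  refine ⟨s, hs0, fun i => by rw [hs3]; exact hle i, ?_, ?_⟩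
  · refine hrange.trans ?_
    unfold rangeConst
    split_ifs
    · exact le_rfl
    · exact min_le_left _ _
  · by_cases h : c₀ = 0
    · rw [h, mul_zero]
      norm_num
    · have hc : 0 < c₀ := lt_of_le_of_ne hc₀ (Ne.symm h)
      have h1 : x * s ≤ 1 / (2 * √c₀) := by
        refine hrange.trans ?_
        rw [rangeConst, if_neg h]
        exact min_le_right _ _
      have h2 := mul_le_mul_of_nonneg_right (pow_le_pow_left₀ (by positivity) h1 2) hc.le
      refine h2.trans (le_of_eq ?_)
      rw [div_pow, mul_pow, Real.sq_sqrt hc.le]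
      field_simp
      norm_num

lemma exp_skew_scaled (hx : 0 < x) :
    Real.exp (skew μ (x / (1 + x)) ((1 + c / x) / 2) fun i => scaled (1 + x) (X i) (Y i))
      = skewCorrection μ c x X Y := by
  have ht : 1 + x ≠ 0 := by positivity
  have e1 : ∀ i, ∫ ω, (scaled (1 + x) (X i) (Y i) ω).1 ^ 3 ∂μ
      = (1 + x) ^ 3 * ∫ ω, X i ω ^ 3 ∂μ := fun i => by
    simp only [scaled, mul_pow]
    rw [integral_const_mul]
  have e2 : ∀ i, ∫ ω, (scaled (1 + x) (X i) (Y i) ω).1 * (scaled (1 + x) (X i) (Y i) ω).2 ^ 2 ∂μ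
      = (1 + x) ^ 3 * ∫ ω, X i ω * Y i ω ^ 2 ∂μ := fun i => by
    rw [← integral_const_mul]
    refine integral_congr_ae (Filter.Eventually.of_forall fun ω => ?_)
    simp only [scaled]
    ring
  unfold skew skewCorrection
  simp only [e1, e2, ← Finset.mul_sum]
  congr 1
  field_simp

lemma tailEvent_scaled {Ω : Type*} {X Y : Fin n → Ω → ℝ} (hx : 0 < x) :
    tailEvent x (1 + x) c (fun i => scaled (1 + x) (X i) (Y i)) = {ω | x * V Y ω + c ≤ S X ω} := by
  have ht : 0 < 1 + x := by linarith
  ext ω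
  simp only [tailEvent, Set.mem_ofPred_eq, scaled, mul_pow, ← Finset.mul_sum, S, V]
  rw [Real.sqrt_mul (sq_nonneg _), Real.sqrt_sq ht.le]
  have e : x * ((1 + x) * √(∑ i, Y i ω ^ 2)) + c * (1 + x)
      = (1 + x) * (x * √(∑ i, Y i ω ^ 2) + c) := by ring
  rw [e]
  exact mul_le_mul_iff_right₀ ht

variable [IsProbabilityMeasure μ]

lemma L3_pos (iX : ∀ i, Integrable (fun ω => |X i ω| ^ 3) μ)
    (sX : ∑ i, ∫ ω, X i ω ^ 2 ∂μ = 1) : 0 < L3 μ X Y := by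
  obtain ⟨i, -, hi⟩ := Finset.exists_lt_of_sum_lt (s := Finset.univ)
    (f := fun _ : Fin n => (0 : ℝ)) (g := fun i => ∫ ω, X i ω ^ 2 ∂μ) (by simp [sX])
  beta_reduce at hi
  set a := ∫ ω, X i ω ^ 2 ∂μ with ha
  have hs : 0 < √(a / 2) := Real.sqrt_pos.2 (by positivity)
  have h1 : 0 < thirdMoment μ (X i) (Y i) := by
    by_contra hcon
    have h2 : thirdMoment μ (Y i) (X i) ≤ √(a / 2) ^ 3 := by
      have e : thirdMoment μ (Y i) (X i) = thirdMoment μ (X i) (Y i) := add_comm _ _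
      rw [e]
      exact (not_lt.1 hcon).trans (by positivity)
    have h3 := integral_snd_sq_le hs (iX i) h2
    rw [Real.sq_sqrt (by positivity), ← ha] at h3
    linarith
  exact h1.trans_le (Finset.single_le_sum (f := fun i => thirdMoment μ (X i) (Y i))
    (fun j _ => thirdMoment_nonneg μ _ _) (Finset.mem_univ i))

/-- The scaled pairs satisfy the assumptions of the two-sided bound. -/
lemma sample_scaled (hX : ∀ i, Measurable (X i)) (hY : ∀ i, Measurable (Y i))
    (hind : iIndepFun (fun i ω => (X i ω, Y i ω)) μ)
    (iX : ∀ i, Integrable (fun ω => |X i ω| ^ 3) μ) (iY : ∀ i, Integrable (fun ω => |Y i ω| ^ 3) μ)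
    (h0 : ∀ i, ∫ ω, X i ω ∂μ = 0) (sX : ∑ i, ∫ ω, X i ω ^ 2 ∂μ = 1)
    (sY : ∑ i, ∫ ω, Y i ω ^ 2 ∂μ = 1) (hx : 0 < x) (hc : |c| ≤ x / 5)
    (hL : (1 + x) * L3 μ X Y ≤ 10⁻¹ ^ 30) (hR : x⁻¹ ^ 2 * Rx μ c₀ x X Y ≤ 10⁻¹ ^ 30)
    {s : ℝ} (hs : 0 < s) (hmax : ∀ i, thirdMoment μ (X i) (Y i) ≤ s ^ 3) (hxs : x * s ≤ 1 / 4) :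
    Sample μ x (1 + x) (x / (1 + x)) c (Rx μ c₀ x X Y) ((1 + x) * L3 μ X Y)
      fun i => scaled (1 + x) (X i) (Y i) := by
  have ht : 0 < 1 + x := by linarith
  have h3 : ∀ i, 0 ≤ thirdMoment μ (X i) (Y i) := fun i => thirdMoment_nonneg μ _ _
  have hle : ∀ i, thirdMoment μ (X i) (Y i) ≤ L3 μ X Y := fun i =>
    Finset.single_le_sum (f := fun i => thirdMoment μ (X i) (Y i)) (fun j _ => h3 j)
      (Finset.mem_univ i)
  have hL0 : 0 ≤ L3 μ X Y := Finset.sum_nonneg fun i _ => h3 i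
  have hlaw : ∀ i, PairLaw μ (x / (1 + x)) (scaled (1 + x) (X i) (Y i)) := fun i => by
    refine pairLaw_scaled hx (hX i) (hY i) (iX i) (iY i) (h0 i) hs (hmax i) hxs ((hle i).trans ?_)
    norm_num at hL
    nlinarith
  have hdd : ∑ i, ∫ ω, dd (scaled (1 + x) (X i) (Y i) ω) ∂μ = ∑ i, deltaTerm μ x (X i) (Y i) :=
    Finset.sum_congr rfl fun i _ => integral_dd_scaled hx (hX i) (hY i) (iX i) (iY i)
  have hr : 0 ≤ ∑ i, rTerm μ c₀ x (X i) (Y i) := Finset.sum_nonneg fun i _ => rTerm_nonneg _ _ _ _ _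
  have hddR : ∑ i, ∫ ω, dd (scaled (1 + x) (X i) (Y i) ω) ∂μ ≤ Rx μ c₀ x X Y := by
    rw [hdd, Rx]
    linarith
  have hcube : ∑ i, ∫ ω, cube (scaled (1 + x) (X i) (Y i) ω) ∂μ = (1 + x) ^ 3 * L3 μ X Y := by
    rw [L3, Finset.mul_sum]
    exact Finset.sum_congr rfl fun i _ => integral_cube_scaled ht.le (iX i) (iY i)
  -- some first component does not vanish, which makes the error terms positive
  have hddpos : 0 < ∑ i, ∫ ω, dd (scaled (1 + x) (X i) (Y i) ω) ∂μ := by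
    obtain ⟨i, -, hi⟩ := Finset.exists_lt_of_sum_lt (s := Finset.univ)
      (f := fun _ : Fin n => (0 : ℝ)) (g := fun i => ∫ ω, X i ω ^ 2 ∂μ) (by simp [sX])
    have h1 := (hlaw i).fst_sq_sq_le
    have h2 : ∫ ω, (scaled (1 + x) (X i) (Y i) ω).1 ^ 2 ∂μ = (1 + x) ^ 2 * ∫ ω, X i ω ^ 2 ∂μ := by
      simp only [scaled, mul_pow]
      rw [integral_const_mul]
    rw [h2] at h1
    have h4 : 0 < ((1 + x) ^ 2 * ∫ ω, X i ω ^ 2 ∂μ) ^ 2 := by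
      beta_reduce at hi
      positivity
    have h5 : 0 < ∫ ω, dd (scaled (1 + x) (X i) (Y i) ω) ∂μ := by linarith
    exact h5.trans_le (Finset.single_le_sum
      (f := fun i => ∫ ω, dd (scaled (1 + x) (X i) (Y i) ω) ∂μ)
      (fun j _ => integral_dd_nonneg) (Finset.mem_univ i))
  have hLpos := L3_pos (Y := Y) iX sX
  refine ⟨hlaw, ?_, hx, rfl, div_mul_cancel₀ _ ht.ne', hc, ?_, ?_, hddpos.trans_le hddR, hddR, ?_,
    ?_, by positivity, hL⟩
  · exact hind.comp (fun _ z => ((1 + x) * z.1, (1 + x) * z.2)) fun _ => by fun_prop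
  · simp only [scaled, mul_pow]
    simp only [integral_const_mul]
    rw [← Finset.mul_sum, sX, mul_one]
  · simp only [scaled, mul_pow]
    simp only [integral_const_mul]
    rw [← Finset.mul_sum, sY, mul_one]
  · have h1 := mul_le_mul_of_nonneg_right hR (sq_nonneg x)
    have e : x⁻¹ ^ 2 * Rx μ c₀ x X Y * x ^ 2 = Rx μ c₀ x X Y := by field_simp
    rwa [e] at h1
  · rw [hcube]
    exact le_of_eq (by ring)

/-- By the range condition on `x`, the term `c₀ E Y²` in the denominator of `ν` is negligible:
`x² c₀ E Y² ≤ 1 / 4`. -/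
lemma largeExponent_scaled (hX : ∀ i, Measurable (X i)) (hY : ∀ i, Measurable (Y i))
    (iX : ∀ i, Integrable (fun ω => |X i ω| ^ 3) μ) (iY : ∀ i, Integrable (fun ω => |Y i ω| ^ 3) μ)
    (hc₀ : 0 ≤ c₀) (hx : 0 < x) (hint : ∀ i, Integrable (expTilt μ c₀ x (X i) (Y i)) μ)
    {s : ℝ} (hs : 0 < s) (hmax : ∀ i, thirdMoment μ (X i) (Y i) ≤ s ^ 3)
    (hxs : (x * s) ^ 2 * c₀ ≤ 1 / 4) :
    LargeExponent μ x (1 + x) (x / (1 + x)) (Rx μ c₀ x X Y)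
      (fun i => scaled (1 + x) (X i) (Y i))
      (fun i z => tiltExponent c₀ x (∫ ω, Y i ω ^ 2 ∂μ) (z.1 / (1 + x)) (z.2 / (1 + x))) := by
  have ht : 0 < 1 + x := by linarith
  have hm : ∀ i, MeasurableSet {ω | 1 < |(1 + x) * X i ω|} := fun i => by
    have := hX i
    exact measurableSet_lt (by fun_prop) (by fun_prop)
  refine ⟨fun i => measurable_tiltExponent _ _ _ _, fun i z => ?_, fun i z a ha hax => ?_,
    fun i => ?_, le_of_eq ?_⟩
  · refine (tiltExponent_le _ _ _ _ _).trans (le_of_eq ?_)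
    ring
  · have h2 : 0 ≤ ∫ ω, Y i ω ^ 2 ∂μ := integral_nonneg fun _ => sq_nonneg _
    refine le_tiltExponent hx (mul_nonneg hc₀ h2) ?_ ha hax
    have h1 := mul_le_mul_of_nonneg_left (integral_snd_sq_le hs (iY i) (hmax i))
      (by positivity : 0 ≤ x ^ 2 * c₀)
    linarith
  · simp only [indicator_exp_scaled c₀ hx]
    exact (hint i).indicator (hm i)
  · rw [Rx]
    congr 1
    · exact Finset.sum_congr rfl fun i _ => integral_dd_scaled hx (hX i) (hY i) (iX i) (iY i)
    · refine Finset.sum_congr rfl fun i _ => ?_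
      simp only [indicator_exp_scaled c₀ hx]
      rw [integral_indicator (hm i), rTerm]

end Family

end SelfNorm

theorem theorem2p1 :
    ∃ c₁ A : ℝ, 0 < c₁ ∧ c₁ ≤ 1 / 4 ∧ 0 < A ∧
      ∀ (Ω : Type*) [MeasurableSpace Ω] (μ : Measure Ω) [IsProbabilityMeasure μ]
        (n : ℕ) (X Y : Fin n → Ω → ℝ),
        (∀ i, Measurable (X i)) → (∀ i, Measurable (Y i)) →
        iIndepFun (fun i ω => (X i ω, Y i ω)) μ →
        (∀ i, Integrable (fun ω => |X i ω| ^ 3) μ) →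
        (∀ i, Integrable (fun ω => |Y i ω| ^ 3) μ) →
        (∀ i, ∫ ω, X i ω ∂μ = 0) →
        ∑ i, ∫ ω, X i ω ^ 2 ∂μ = 1 →
        ∑ i, ∫ ω, Y i ω ^ 2 ∂μ = 1 →
        ∀ c₀ x c : ℝ, 0 ≤ c₀ → 0 < x → |c| ≤ x / 5 →
          (∀ i, Integrable (SelfNorm.expTilt μ c₀ x (X i) (Y i)) μ) →
          (1 + x) * SelfNorm.L3 μ X Y ≤ c₁ →
          x⁻¹ ^ 2 * SelfNorm.Rx μ c₀ x X Y ≤ c₁ →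
          x ≤ SelfNorm.rangeConst c₀ /
            (⨆ i, SelfNorm.thirdMoment μ (X i) (Y i)) ^ (1 / 3 : ℝ) →
          (⨆ i, SelfNorm.rTerm μ c₀ x (X i) (Y i)) ≤ c₁ →
          ∃ O₁ O₂ : ℝ, |O₁| ≤ A ∧ |O₂| ≤ A ∧
            μ.real {ω | x * SelfNorm.V Y ω + c ≤ SelfNorm.S X ω} =
              (1 - SelfNorm.Phi (x + c)) * SelfNorm.skewCorrection μ c x X Y
                * Real.exp (O₁ * SelfNorm.Rx μ c₀ x X Y)
                * (1 + O₂ * ((1 + x) * SelfNorm.L3 μ X Y)) := by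
  refine ⟨10⁻¹ ^ 30, 10 ^ 13, by norm_num, by norm_num, by norm_num, ?_⟩
  intro Ω _ μ _ n X Y hX hY hind iX iY h0 sX sY c₀ x c hc₀ hx hc hint hL hR hrange _
  have hpos : 0 < SelfNorm.L3 μ X Y := SelfNorm.L3_pos iX sX
  obtain ⟨s, hs, hmax, hxs, hxs'⟩ := SelfNorm.exists_thirdMoment_bound hx hc₀ hpos hrange
  have h := SelfNorm.sample_scaled hX hY hind iX iY h0 sX sY hx hc hL hR hs hmax hxs
  have hN := SelfNorm.largeExponent_scaled hX hY iX iY hc₀ hx hint hs hmax hxs'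
  have hb := h.tail_bounds hN
  rw [SelfNorm.exp_skew_scaled hx, SelfNorm.tailEvent_scaled hx] at hb
  have hG : 0 < (1 - SelfNorm.Phi (x + c)) * SelfNorm.skewCorrection μ c x X Y := by
    have h1 : 0 ≤ x + c := by linarith [(abs_le.1 hc).1]
    rw [SelfNorm.one_sub_Phi_eq]
    exact mul_pos (mul_pos (Real.exp_pos _) (SelfNorm.mills_pos h1)) (Real.exp_pos _)
  exact SelfNorm.exists_factors hG h.R_pos h.eps_pos (by norm_num) hb.1 hb.2
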